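/- **Setting.** Let $\mathcal E$ be a category with finite limits (with chosen finite products) such that the forgetful functor $U:\mathrm{Cat}(\mathcal E)\to\mathrm{Graph}(\mathcal E)$ from internal categories to internal graphs has a left adjoint $\mathrm{fc}$ (free internal category). Write $T$ also for the induced monad $U\,\mathrm{fc}$ on $\mathrm{Graph}(\mathcal E)$, with unit $\eta$ and multiplication $\mu$. Let $V$ be an internal monoidal category in $\mathcal E$, with object of objects $V_0$, object of arrows $V_1$, tensor product $\otimes$ and unit $I$. **Iterated tensor products.** Regard $V_0$ as the graph $1\leftleftarrows V_0$ with one vertex and with $V_0$ as object of edges; an edge of $TV_0$ is a list of objects of $V$. Fix a choice of iterated tensor products in $V$: a graph morphism $\otimes_0:TV_0\to V_0$ with $\otimes_0(v)=v$ on lists with one entry and $\otimes_0()=I$ on the empty list, with isomorphisms $\otimes_0 l\otimes\otimes_0 m\cong\otimes_0(l\circ m)$ for lists $l,m$ (everything internally in $\mathcal E$, where $l\circ m$ is composition in $\mathrm{fc}(V_0)$), coherent with the associator and the unitors of $V$. If $V$ is strict, one such choice is the functor from $\mathrm{fc}(V_0)$ to the one-object category $(V_0,\otimes,I)$ that extends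 the identity, with identities as isomorphisms. **$T$-multicategories.** For a monad $T$ on a category with pullbacks, a $T$-multicategory $C$ is a diagram $TC_0\xleftarrow{s}C_1\xrightarrow{t}C_0$ with a composition $C_1\times_{TC_0}TC_1\to C_1$ and identities $C_0\to C_1$, satisfying the usual source and target conditions, unit laws and associativity law. A functor $C\to D$ is a pair $C_0\to D_0$, $C_1\to D_1$ that preserves source, target, composition and identities. A $T$-algebra $a:TA\to A$ gives the $T$-multicategory $TA\xleftarrow{1}TA\xrightarrow{a}A$ with composition induced by $\mu$ and with identities $\eta$. From now on $T$ is the monad of the setting. * *The $T$-multicategory $MV$.* Its graph of objects is $V_0$. Its graph of arrows has one vertex, and its edges are the pairs $(l,f)$ of a list $l$ of objects of $V$ and an arrow $f:\otimes_0l\to v$ of $V$, with source $l$ and target $v$. The identity of $v$ is $((v),\mathrm{id}_v)$. The composite of $(l,f)$ with a list $((l_1,f_1),\dots,(l_n,f_n))$ whose list of targets is $l$ is the concatenation of $l_1,\dots,l_n$ together with the composite of $f$ and $f_1\otimes\dots\otimes f_n:\otimes_0(l_1\cdots l_n)\to\otimes_0 l$. * *The $T$-multicategory $\mathrm{Ind}^+(X)$.*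 For an object $X$ of $\mathcal E$, the indiscrete internal category $\mathrm{Ind}(X)$ has $X\times X$ as object of arrows; like every internal category it is a $T$-algebra, and $\mathrm{Ind}^+(X)$ is the corresponding $T$-multicategory $T\,\mathrm{Ind}(X)\leftarrow T\,\mathrm{Ind}(X)\to\mathrm{Ind}(X)$. **$\mathrm{MCat}_{\mathrm{Id}}^{MV}$.** An $MV$-enriched $\mathrm{Id}$-multicategory consists of an object $X$ of $\mathcal E$ and a functor $\mathfrak X=(\mathfrak X_0,\mathfrak X_1):\mathrm{Ind}^+(X)\to MV$ of $T$-multicategories. A functor $\mathfrak X\to\mathfrak Y$ consists of $F_0:X\to Y$ in $\mathcal E$ and a graph morphism $F_1:\mathrm{Ind}(X)\to (MV)_1$ with $$F_1(x_0,x_1):\mathfrak X_0(x_0,x_1)\to\mathfrak Y_0(F_0x_0,F_0x_1)$$ (an arrow of $MV$ whose source is a list with one entry) such that, for every path in $\mathrm{Ind}(X)$ through $x_0,\dots,x_n$ with $n\ge0$, the composite of the arrow $\mathfrak Y_1(F_0x_0,\dots,F_0x_n)$ with the list of the $F_1(x_{i-1},x_i)$ equals the composite of $F_1(x_0,x_n)$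 with the arrow $\mathfrak X_1(x_0,\dots,x_n)$, as generalized elements. **$\mathrm{SCat}_{\mathcal E}^{\mathrm{Ext}V}$.** The externalization $\mathrm{Ext}(V)$ is the indexed monoidal category over $\mathcal E$ whose fibre over $W$ has as objects the arrows $W\to V_0$ and as morphisms $x\to y$ the arrows $W\to V_1$ with source $x$ and target $y$, with composition and tensor product computed in $V$, and with reindexing given by precomposition. For an indexed monoidal category $\mathcal W$ over $\mathcal E$, a small $\mathcal W$-category consists of an object $X$ of $\mathcal E$, an object $\hom$ of $\mathcal W^{X\times X}$, a morphism $I\to\hom(x,x)$ in $\mathcal W^{X}$ and a morphism $\hom(x_1,x_2)\otimes\hom(x_0,x_1)\to\hom(x_0,x_2)$ in $\mathcal W^{X\times X\times X}$ (where $\hom(x_i,x_j)$ denotes the reindexing of $\hom$ along the evident map), satisfying the unit and associativity laws. A functor of small $\mathcal W$-categories consists of an arrow $F:X\to Y$ of $\mathcal E$ and a morphism $\hom_X\to(F\times F)^*\hom_Y$ of $\mathcal W^{X\times X}$ compatible with units and compositions. **Statement.** For every $\mathcal E$, $\mathrm{fc}\dashv U$, $V$ and choice of iterated tensor products as above, the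 category $\mathrm{MCat}_{\mathrm{Id}}^{MV}$ of $MV$-enriched $\mathrm{Id}$-multicategories and their functors is equivalent to the category $\mathrm{SCat}_{\mathcal E}^{\mathrm{Ext}V}$ of small $\mathrm{Ext}(V)$-categories and their functors. -/

import Mathlib

open CategoryTheory Category Limits MonoidalCategory CartesianMonoidalCategory

universe v u w' w

set_option linter.unusedSectionVars false

attribute [local simp] pullback.lift_fst pullback.lift_snd pullback.lift_fst_assoc
  pullback.lift_snd_assoc

/-! ### Internal graphs and internal categories -/

/-- An internal graph `edge ⇉ vert` in a category. -/
structure IntGraph (E : Type u) [Category.{v} E] where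
  vert : E
  edge : E
  src : edge ⟶ vert
  tgt : edge ⟶ vert

namespace IntGraph

variable {E : Type u} [Category.{v} E]

/-- Morphisms of internal graphs. -/
@[ext]
structure Hom (G H : IntGraph E) where
  v : G.vert ⟶ H.vert
  e : G.edge ⟶ H.edge
  src_comm : e ≫ H.src = G.src ≫ v
  tgt_comm : e ≫ H.tgt = G.tgt ≫ v

attribute [simp] Hom.src_comm Hom.tgt_comm

/-- The category `Graph(E)`. -/
instance : Category (IntGraph E) where
  Hom := Hom
  id G := ⟨𝟙 _, 𝟙 _, by simp, by simp⟩
  comp f g := ⟨f.v ≫ g.v, f.e ≫ g.e, by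
    rw [assoc, g.src_comm, ← assoc, f.src_comm, assoc], by
    rw [assoc, g.tgt_comm, ← assoc, f.tgt_comm, assoc]⟩
  id_comp f := by ext <;> simp
  comp_id f := by ext <;> simp
  assoc f g h := by ext <;> simp

@[ext]
theorem hom_ext {G H : IntGraph E} {f g : G ⟶ H} (hv : f.v = g.v) (he : f.e = g.e) : f = g :=
  Hom.ext hv he

@[simp] theorem id_v (G : IntGraph E) : Hom.v (𝟙 G) = 𝟙 G.vert := rfl
@[simp] theorem id_e (G : IntGraph E) : Hom.e (𝟙 G) = 𝟙 G.edge := rfl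
@[simp] theorem comp_v {G H K : IntGraph E} (f : G ⟶ H) (g : H ⟶ K) :
    (f ≫ g).v = f.v ≫ g.v := rfl
@[simp] theorem comp_e {G H K : IntGraph E} (f : G ⟶ H) (g : H ⟶ K) :
    (f ≫ g).e = f.e ≫ g.e := rfl

section

variable [HasPullbacks E] {G H K : IntGraph E}

/-- The pullback of internal graphs, computed on vertices and on edges. -/
noncomputable def pb (f : G ⟶ K) (g : H ⟶ K) : IntGraph E where
  vert := pullback f.v g.v
  edge := pullback f.e g.e
  src := pullback.map f.e g.e f.v g.v G.src H.src K.src f.src_comm g.src_comm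
  tgt := pullback.map f.e g.e f.v g.v G.tgt H.tgt K.tgt f.tgt_comm g.tgt_comm

/-- First projection of the pullback of graphs. -/
noncomputable def pbFst (f : G ⟶ K) (g : H ⟶ K) : pb f g ⟶ G where
  v := pullback.fst _ _
  e := pullback.fst _ _
  src_comm := by simp [pb, pullback.map]
  tgt_comm := by simp [pb, pullback.map]

/-- Second projection of the pullback of graphs. -/
noncomputable def pbSnd (f : G ⟶ K) (g : H ⟶ K) : pb f g ⟶ H where
  v := pullback.snd _ _
  e := pullback.snd _ _
  src_comm := by simp [pb, pullback.map]
  tgt_comm := by simp [pb, pullback.map]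

theorem pb_condition (f : G ⟶ K) (g : H ⟶ K) : pbFst f g ≫ f = pbSnd f g ≫ g := by
  ext
  · exact pullback.condition
  · exact pullback.condition

/-- The map into a pullback of graphs induced by its universal property. -/
noncomputable def pbLift {f : G ⟶ K} {g : H ⟶ K} {W : IntGraph E} (a : W ⟶ G) (b : W ⟶ H)
    (h : a ≫ f = b ≫ g) : W ⟶ pb f g where
  v := pullback.lift a.v b.v (congrArg Hom.v h)
  e := pullback.lift a.e b.e (congrArg Hom.e h)
  src_comm := by
    apply pullback.hom_ext <;> simp [pb, pullback.map]
  tgt_comm := by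
    apply pullback.hom_ext <;> simp [pb, pullback.map]

@[simp]
theorem pbLift_fst {f : G ⟶ K} {g : H ⟶ K} {W : IntGraph E} (a : W ⟶ G) (b : W ⟶ H)
    (h : a ≫ f = b ≫ g) : pbLift a b h ≫ pbFst f g = a := by
  ext
  · exact pullback.lift_fst _ _ _
  · exact pullback.lift_fst _ _ _

@[simp]
theorem pbLift_snd {f : G ⟶ K} {g : H ⟶ K} {W : IntGraph E} (a : W ⟶ G) (b : W ⟶ H)
    (h : a ≫ f = b ≫ g) : pbLift a b h ≫ pbSnd f g = b := by
  ext
  · exact pullback.lift_snd _ _ _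
  · exact pullback.lift_snd _ _ _

theorem pb_hom_ext {f : G ⟶ K} {g : H ⟶ K} {W : IntGraph E} {a b : W ⟶ pb f g}
    (h₁ : a ≫ pbFst f g = b ≫ pbFst f g) (h₂ : a ≫ pbSnd f g = b ≫ pbSnd f g) : a = b := by
  ext
  · exact pullback.hom_ext (congrArg Hom.v h₁) (congrArg Hom.v h₂)
  · exact pullback.hom_ext (congrArg Hom.e h₁) (congrArg Hom.e h₂)

instance : HasPullbacks (IntGraph E) := by
  have : ∀ {X Y Z : IntGraph E} {f : X ⟶ Z} {g : Y ⟶ Z}, HasLimit (cospan f g) :=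
    fun {_ _ _ f g} => ⟨⟨⟨PullbackCone.mk (pbFst f g) (pbSnd f g) (pb_condition f g),
      PullbackCone.IsLimit.mk _ (fun s => pbLift s.fst s.snd s.condition)
        (fun s => pbLift_fst _ _ _) (fun s => pbLift_snd _ _ _)
        (fun s m h₁ h₂ => pb_hom_ext (by simpa using h₁) (by simpa using h₂))⟩⟩⟩
  exact hasPullbacks_of_hasLimit_cospan _

end

end IntGraph

/-- An internal category in `E`. Composition is defined on the pullback of `src` and `tgt`, whose
generalized elements are the pairs `(g, f)` such that `g ∘ f` makes sense. The axioms are stated in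
the internal language, that is, for generalized elements. -/
structure IntCat (E : Type u) [Category.{v} E] [HasPullbacks E] extends IntGraph E where
  ident : vert ⟶ edge
  comp : pullback src tgt ⟶ edge
  ident_src : ident ≫ src = 𝟙 vert
  ident_tgt : ident ≫ tgt = 𝟙 vert
  comp_src : comp ≫ src = pullback.snd src tgt ≫ src
  comp_tgt : comp ≫ tgt = pullback.fst src tgt ≫ tgt
  ident_comp : ∀ {W : E} (f : W ⟶ edge) (h : (f ≫ tgt ≫ ident) ≫ src = f ≫ tgt),
    pullback.lift (f ≫ tgt ≫ ident) f h ≫ comp = f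
  comp_ident : ∀ {W : E} (f : W ⟶ edge) (h : f ≫ src = (f ≫ src ≫ ident) ≫ tgt),
    pullback.lift f (f ≫ src ≫ ident) h ≫ comp = f
  comp_assoc : ∀ {W : E} (k g f : W ⟶ edge) (hkg : k ≫ src = g ≫ tgt) (hgf : g ≫ src = f ≫ tgt)
    (h₁ : (pullback.lift k g hkg ≫ comp) ≫ src = f ≫ tgt)
    (h₂ : k ≫ src = (pullback.lift g f hgf ≫ comp) ≫ tgt),
    pullback.lift (pullback.lift k g hkg ≫ comp) f h₁ ≫ comp =
      pullback.lift k (pullback.lift g f hgf ≫ comp) h₂ ≫ comp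

namespace IntCat

variable {E : Type u} [Category.{v} E] [HasPullbacks E]

attribute [simp] ident_src ident_tgt

/-- Composition `g ∘ f` of generalized arrows of an internal category. -/
noncomputable def compAt (A : IntCat E) {W : E} (g f : W ⟶ A.edge) (h : g ≫ A.src = f ≫ A.tgt) :
    W ⟶ A.edge := pullback.lift g f h ≫ A.comp

section

variable (A : IntCat E) {W W' : E}

@[simp]
theorem compAt_src (g f : W ⟶ A.edge) (h : g ≫ A.src = f ≫ A.tgt) :
    A.compAt g f h ≫ A.src = f ≫ A.src := by simp [compAt, A.comp_src]

@[simp]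
theorem compAt_tgt (g f : W ⟶ A.edge) (h : g ≫ A.src = f ≫ A.tgt) :
    A.compAt g f h ≫ A.tgt = g ≫ A.tgt := by simp [compAt, A.comp_tgt]

theorem pre_compAt (r : W' ⟶ W) (g f : W ⟶ A.edge) (h : g ≫ A.src = f ≫ A.tgt) :
    r ≫ A.compAt g f h = A.compAt (r ≫ g) (r ≫ f) (by simp [h]) := by
  rw [compAt, compAt, ← assoc]
  congr 1
  apply pullback.hom_ext <;> simp

theorem compAt_congr {g g' f f' : W ⟶ A.edge} (hg : g = g') (hf : f = f')
    (h : g ≫ A.src = f ≫ A.tgt) :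
    A.compAt g f h = A.compAt g' f' (by rw [← hg, ← hf, h]) := by subst hg hf; rfl

theorem compAt_ident_left (f : W ⟶ A.edge) :
    A.compAt (f ≫ A.tgt ≫ A.ident) f (by simp) = f := A.ident_comp f _

theorem compAt_ident_right (f : W ⟶ A.edge) :
    A.compAt f (f ≫ A.src ≫ A.ident) (by simp) = f := A.comp_ident f _

theorem compAt_assoc (k g f : W ⟶ A.edge) (hkg : k ≫ A.src = g ≫ A.tgt)
    (hgf : g ≫ A.src = f ≫ A.tgt) :
    A.compAt (A.compAt k g hkg) f (by simp [hgf]) = A.compAt k (A.compAt g f hgf) (by simp [hkg]) :=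
  A.comp_assoc k g f hkg hgf _ _

end

/-- Internal functors. -/
@[ext]
structure Functor (A B : IntCat E) extends IntGraph.Hom A.toIntGraph B.toIntGraph where
  map_ident : A.ident ≫ e = v ≫ B.ident
  map_comp : ∀ {W : E} (g f : W ⟶ A.edge) (h : g ≫ A.src = f ≫ A.tgt)
    (h' : (g ≫ e) ≫ B.src = (f ≫ e) ≫ B.tgt), A.compAt g f h ≫ e = B.compAt (g ≫ e) (f ≫ e) h'

/-- The category `Cat(E)` of internal categories and internal functors. -/
instance : Category (IntCat E) where
  Hom := Functor
  id A :=
    { toHom := 𝟙 A.toIntGraph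
      map_ident := by simp
      map_comp := fun g f h h' => by simp }
  comp {A B C} F G :=
    { toHom := (show A.toIntGraph ⟶ B.toIntGraph from F.toHom) ≫
        (show B.toIntGraph ⟶ C.toIntGraph from G.toHom)
      map_ident := by
        simp only [IntGraph.comp_v, IntGraph.comp_e]
        rw [← assoc, F.map_ident, assoc, G.map_ident, assoc]
      map_comp := fun g f h h' => by
        have h1 : (g ≫ F.e) ≫ B.src = (f ≫ F.e) ≫ B.tgt := by
          rw [assoc, assoc, F.src_comm, F.tgt_comm, ← assoc, h, assoc]
        simp only [IntGraph.comp_e]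
        rw [← assoc, F.map_comp g f h h1, G.map_comp]
        · exact C.compAt_congr (assoc _ _ _) (assoc _ _ _) _
        · rw [assoc _ G.e, assoc _ G.e, G.src_comm, G.tgt_comm, ← assoc, h1, assoc] }
  id_comp F := by apply Functor.ext <;> simp
  comp_id F := by apply Functor.ext <;> simp
  assoc F G H := by apply Functor.ext <;> simp

variable (E) in
/-- The forgetful functor `U : Cat(E) ⥤ Graph(E)`. -/
def forget : IntCat E ⥤ IntGraph E where
  obj A := A.toIntGraph
  map F := Functor.toHom F

theorem hom_ext {A B : IntCat E} {F G : A ⟶ B} (h : (forget E).map F = (forget E).map G) :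
    F = G :=
  Functor.ext (congrArg IntGraph.Hom.v h) (congrArg IntGraph.Hom.e h)

end IntCat

/-! ### Families of objects and arrows of an internal category -/

/-- A `W`-indexed family of objects of an internal category `A`, that is, an arrow `W ⟶ A₀`. -/
@[ext]
structure Fam {E : Type u} [Category.{v} E] [HasPullbacks E] (A : IntCat E) (W : E) where
  val : W ⟶ A.vert

namespace Fam

variable {E : Type u} [Category.{v} E] [HasPullbacks E] {A : IntCat E} {W W' : E}

/-- A `W`-indexed family of arrows of `A` with given families of sources and targets. -/
@[ext]
structure Hom (x y : Fam A W) where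
  val : W ⟶ A.edge
  src_eq : val ≫ A.src = x.val
  tgt_eq : val ≫ A.tgt = y.val

attribute [simp] Hom.src_eq Hom.tgt_eq

/-- The category of `W`-indexed families of objects and arrows of `A`, which is the fibre over `W`
of the externalization of `A`. -/
noncomputable instance : Category (Fam A W) where
  Hom := Hom
  id x := ⟨x.val ≫ A.ident, by simp, by simp⟩
  comp f g := ⟨A.compAt g.val f.val (by simp), by simp, by simp⟩
  id_comp f := by
    apply Hom.ext
    have := A.compAt_ident_right f.val
    simpa [← assoc] using this
  comp_id f := by
    apply Hom.ext
    have := A.compAt_ident_left f.val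
    simpa [← assoc] using this
  assoc f g h := by
    apply Hom.ext
    exact (A.compAt_assoc _ _ _ _ _).symm

@[ext]
theorem hom_ext {x y : Fam A W} {f g : x ⟶ y} (h : f.val = g.val) : f = g := Hom.ext h

theorem id_val (x : Fam A W) : Hom.val (𝟙 x) = x.val ≫ A.ident := rfl

theorem comp_val {x y z : Fam A W} (f : x ⟶ y) (g : y ⟶ z) :
    (f ≫ g).val = A.compAt g.val f.val (by simp) := rfl

/-- Equal families of objects are isomorphic, via the identity family. -/
noncomputable def eqIso {x y : Fam A W} (h : x.val = y.val) : x ≅ y where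
  hom := ⟨x.val ≫ A.ident, by simp, by simp [h]⟩
  inv := ⟨y.val ≫ A.ident, by simp, by simp [h]⟩
  hom_inv_id := by
    obtain rfl : x = y := Fam.ext h
    exact id_comp (𝟙 x)
  inv_hom_id := by
    obtain rfl : x = y := Fam.ext h
    exact id_comp (𝟙 x)

@[simp]
theorem eqIso_refl (x : Fam A W) : eqIso (rfl : x.val = x.val) = Iso.refl x := by
  ext; rfl

theorem comp_eqIso_val {x y z : Fam A W} (f : x ⟶ y) (h : y.val = z.val) :
    (f ≫ (eqIso h).hom).val = f.val := by
  obtain rfl : y = z := Fam.ext h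
  simp

theorem eqIso_comp_val {x y z : Fam A W} (h : x.val = y.val) (f : y ⟶ z) :
    ((eqIso h).hom ≫ f).val = f.val := by
  obtain rfl : x = y := Fam.ext h
  simp

theorem comp_val_congr {x y z x' y' z' : Fam A W} {f : x ⟶ y} {g : y ⟶ z} {f' : x' ⟶ y'}
    {g' : y' ⟶ z'} (hf : f.val = f'.val) (hg : g.val = g'.val) : (f ≫ g).val = (f' ≫ g').val := by
  rw [comp_val, comp_val]
  exact A.compAt_congr hg hf _

/-- Two families of arrows given by the same arrow of `E` correspond to each other under the
identity isomorphisms of their sources and targets. -/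
theorem eq_of_val_eq {x y x' y' : Fam A W} (hx : x.val = x'.val) (hy : y.val = y'.val)
    {f : x ⟶ y} {f' : x' ⟶ y'} (h : f.val = f'.val) :
    f ≫ (eqIso hy).hom = (eqIso hx).hom ≫ f' := by
  apply hom_ext
  rw [comp_eqIso_val, eqIso_comp_val, h]

/-- Reindexing of families along `r : W' ⟶ W`, that is, precomposition. -/
noncomputable def re (A : IntCat E) (r : W' ⟶ W) : Fam A W ⥤ Fam A W' where
  obj x := ⟨r ≫ x.val⟩
  map f := ⟨r ≫ f.val, by simp, by simp⟩
  map_id x := by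
    apply hom_ext
    simp [id_val]
  map_comp f g := by
    apply hom_ext
    simp [comp_val, IntCat.pre_compAt]

@[simp] theorem re_obj_val (r : W' ⟶ W) (x : Fam A W) : ((re A r).obj x).val = r ≫ x.val := rfl
@[simp] theorem re_map_val (r : W' ⟶ W) {x y : Fam A W} (f : x ⟶ y) :
    ((re A r).map f).val = r ≫ f.val := rfl

/-- Reindexing of an isomorphism of families, with prescribed source and target. -/
noncomputable def reIso (r : W' ⟶ W) {x y : Fam A W} (f : x ≅ y) {x' y' : Fam A W'}
    (hx : x'.val = r ≫ x.val) (hy : y'.val = r ≫ y.val) : x' ≅ y' where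
  hom := ⟨r ≫ f.hom.val, by simp [hx], by simp [hy]⟩
  inv := ⟨r ≫ f.inv.val, by simp [hy], by simp [hx]⟩
  hom_inv_id := by
    obtain rfl : x' = (re A r).obj x := Fam.ext hx
    obtain rfl : y' = (re A r).obj y := Fam.ext hy
    exact ((re A r).mapIso f).hom_inv_id
  inv_hom_id := by
    obtain rfl : x' = (re A r).obj x := Fam.ext hx
    obtain rfl : y' = (re A r).obj y := Fam.ext hy
    exact ((re A r).mapIso f).inv_hom_id

@[simp]
theorem reIso_hom_val (r : W' ⟶ W) {x y : Fam A W} (f : x ≅ y) {x' y' : Fam A W'}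
    (hx : x'.val = r ≫ x.val) (hy : y'.val = r ≫ y.val) :
    (reIso r f hx hy).hom.val = r ≫ f.hom.val := rfl

@[simp]
theorem reIso_inv_val (r : W' ⟶ W) {x y : Fam A W} (f : x ≅ y) {x' y' : Fam A W'}
    (hx : x'.val = r ≫ x.val) (hy : y'.val = r ≫ y.val) :
    (reIso r f hx hy).inv.val = r ≫ f.inv.val := rfl

end Fam

/-! ### Internal monoidal categories -/

/-- An internal category `V` with internal functors `V × V ⟶ V` (with components `tObj` and `tArr`)
and `1 ⟶ V` (determined by its component `unit` on objects). -/
structure IntTensorCat (E : Type u) [Category.{v} E] [CartesianMonoidalCategory E]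
    [HasPullbacks E] extends IntCat E where
  tObj : vert ⊗ vert ⟶ vert
  tArr : edge ⊗ edge ⟶ edge
  tArr_src : tArr ≫ src = (src ⊗ₘ src) ≫ tObj
  tArr_tgt : tArr ≫ tgt = (tgt ⊗ₘ tgt) ≫ tObj
  tArr_ident : (ident ⊗ₘ ident) ≫ tArr = tObj ≫ ident
  tArr_comp : ∀ {W : E} (g f g' f' : W ⟶ edge) (h : g ≫ src = f ≫ tgt) (h' : g' ≫ src = f' ≫ tgt)
    (h'' : (lift g g' ≫ tArr) ≫ src = (lift f f' ≫ tArr) ≫ tgt),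
    lift (toIntCat.compAt g f h) (toIntCat.compAt g' f' h') ≫ tArr =
      toIntCat.compAt (lift g g' ≫ tArr) (lift f f' ≫ tArr) h''
  unit : 𝟙_ E ⟶ vert

namespace IntTensorCat

variable {E : Type u} [Category.{v} E] [CartesianMonoidalCategory E] [HasPullbacks E]
  (V : IntTensorCat E) {W W' : E}

/-- The tensor product of families of objects. -/
def tO (x y : Fam V.toIntCat W) : Fam V.toIntCat W := ⟨lift x.val y.val ≫ V.tObj⟩

/-- The tensor product of families of arrows. -/
def tH {x y x' y' : Fam V.toIntCat W} (f : x ⟶ y) (g : x' ⟶ y') : V.tO x x' ⟶ V.tO y y' :=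
  ⟨lift f.val g.val ≫ V.tArr, by simp [tO, V.tArr_src], by
    simp [tO, V.tArr_tgt]⟩

/-- The constant family on the tensor unit. -/
def tI (W : E) : Fam V.toIntCat W := ⟨toUnit W ≫ V.unit⟩

@[simp] theorem tO_val (x y : Fam V.toIntCat W) : (V.tO x y).val = lift x.val y.val ≫ V.tObj := rfl
@[simp] theorem tH_val {x y x' y' : Fam V.toIntCat W} (f : x ⟶ y) (g : x' ⟶ y') :
    (V.tH f g).val = lift f.val g.val ≫ V.tArr := rfl
@[simp] theorem tI_val : (V.tI W).val = toUnit W ≫ V.unit := rfl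

theorem tH_id (x y : Fam V.toIntCat W) : V.tH (𝟙 x) (𝟙 y) = 𝟙 (V.tO x y) := by
  apply Fam.hom_ext
  simp [Fam.id_val, ← V.tArr_ident]

theorem tH_comp {x y z x' y' z' : Fam V.toIntCat W} (f : x ⟶ y) (g : y ⟶ z) (f' : x' ⟶ y')
    (g' : y' ⟶ z') : V.tH (f ≫ g) (f' ≫ g') = V.tH f f' ≫ V.tH g g' := by
  apply Fam.hom_ext
  exact V.tArr_comp _ _ _ _ _ _ _

/-- The generic family of objects, and the three projections. -/
def gen : Fam V.toIntCat V.vert := ⟨𝟙 _⟩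
/-- The first of three generic families. -/
def gen₁ : Fam V.toIntCat (V.vert ⊗ V.vert ⊗ V.vert) := ⟨fst _ _⟩
/-- The second of three generic families. -/
def gen₂ : Fam V.toIntCat (V.vert ⊗ V.vert ⊗ V.vert) := ⟨snd _ _ ≫ fst _ _⟩
/-- The third of three generic families. -/
def gen₃ : Fam V.toIntCat (V.vert ⊗ V.vert ⊗ V.vert) := ⟨snd _ _ ≫ snd _ _⟩

/-- The instance at `a, b, c` of an associator. -/
noncomputable def assocAt
    (i : V.tO (V.tO V.gen₁ V.gen₂) V.gen₃ ≅ V.tO V.gen₁ (V.tO V.gen₂ V.gen₃))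
    (a b c : Fam V.toIntCat W) : V.tO (V.tO a b) c ≅ V.tO a (V.tO b c) :=
  Fam.reIso (lift a.val (lift b.val c.val)) i
    (by simp [gen₁, gen₂, gen₃, comp_lift_assoc]) (by simp [gen₁, gen₂, gen₃, comp_lift_assoc])

/-- The instance at `a` of a left unitor. -/
noncomputable def leftAt (i : V.tO (V.tI _) V.gen ≅ V.gen) (a : Fam V.toIntCat W) :
    V.tO (V.tI W) a ≅ a :=
  Fam.reIso a.val i (by simp [gen, comp_lift_assoc]) (by simp [gen])

/-- The instance at `a` of a right unitor. -/
noncomputable def rightAt (i : V.tO V.gen (V.tI _) ≅ V.gen) (a : Fam V.toIntCat W) :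
    V.tO a (V.tI W) ≅ a :=
  Fam.reIso a.val i (by simp [gen, comp_lift_assoc]) (by simp [gen])

end IntTensorCat

/-- An internal monoidal category. The associator and the unitors are isomorphisms between the
generic families of objects, natural and coherent in the internal language. -/
structure IntMonCat (E : Type u) [Category.{v} E] [CartesianMonoidalCategory E]
    [HasPullbacks E] extends IntTensorCat E where
  assocIso : toIntTensorCat.tO (toIntTensorCat.tO toIntTensorCat.gen₁ toIntTensorCat.gen₂)
      toIntTensorCat.gen₃ ≅
    toIntTensorCat.tO toIntTensorCat.gen₁
      (toIntTensorCat.tO toIntTensorCat.gen₂ toIntTensorCat.gen₃)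
  leftIso : toIntTensorCat.tO (toIntTensorCat.tI _) toIntTensorCat.gen ≅ toIntTensorCat.gen
  rightIso : toIntTensorCat.tO toIntTensorCat.gen (toIntTensorCat.tI _) ≅ toIntTensorCat.gen
  assoc_natural : ∀ {W : E} {a b c a' b' c' : Fam toIntCat W} (f : a ⟶ a') (g : b ⟶ b')
    (h : c ⟶ c'),
    toIntTensorCat.tH (toIntTensorCat.tH f g) h ≫ (toIntTensorCat.assocAt assocIso a' b' c').hom =
      (toIntTensorCat.assocAt assocIso a b c).hom ≫ toIntTensorCat.tH f (toIntTensorCat.tH g h)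
  left_natural : ∀ {W : E} {a a' : Fam toIntCat W} (f : a ⟶ a'),
    toIntTensorCat.tH (𝟙 _) f ≫ (toIntTensorCat.leftAt leftIso a').hom =
      (toIntTensorCat.leftAt leftIso a).hom ≫ f
  right_natural : ∀ {W : E} {a a' : Fam toIntCat W} (f : a ⟶ a'),
    toIntTensorCat.tH f (𝟙 _) ≫ (toIntTensorCat.rightAt rightIso a').hom =
      (toIntTensorCat.rightAt rightIso a).hom ≫ f
  triangle : ∀ {W : E} (a b : Fam toIntCat W),
    (toIntTensorCat.assocAt assocIso a (toIntTensorCat.tI W) b).hom ≫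
        toIntTensorCat.tH (𝟙 a) (toIntTensorCat.leftAt leftIso b).hom =
      toIntTensorCat.tH (toIntTensorCat.rightAt rightIso a).hom (𝟙 b)
  pentagon : ∀ {W : E} (a b c d : Fam toIntCat W),
    toIntTensorCat.tH (toIntTensorCat.assocAt assocIso a b c).hom (𝟙 d) ≫
        (toIntTensorCat.assocAt assocIso a (toIntTensorCat.tO b c) d).hom ≫
        toIntTensorCat.tH (𝟙 a) (toIntTensorCat.assocAt assocIso b c d).hom =
      (toIntTensorCat.assocAt assocIso (toIntTensorCat.tO a b) c d).hom ≫
        (toIntTensorCat.assocAt assocIso a b (toIntTensorCat.tO c d)).hom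

namespace IntMonCat

variable {E : Type u} [Category.{v} E] [CartesianMonoidalCategory E] [HasPullbacks E]
  (V : IntMonCat E) {W W' : E}

/-- The monoidal category of `W`-indexed families of objects and arrows of an internal monoidal
category. -/
noncomputable instance famMonoidal : MonoidalCategory (Fam V.toIntCat W) where
  tensorObj := V.tO
  whiskerLeft x _ _ f := V.tH (𝟙 x) f
  whiskerRight f y := V.tH f (𝟙 y)
  tensorHom f g := V.tH f g
  tensorUnit := V.tI W
  associator := V.assocAt V.assocIso
  leftUnitor := V.leftAt V.leftIso
  rightUnitor := V.rightAt V.rightIso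
  tensorHom_def f g := by rw [← V.tH_comp]; simp
  id_tensorHom_id x y := V.tH_id x y
  tensorHom_comp_tensorHom f f' g g' := (V.tH_comp _ _ _ _).symm
  whiskerLeft_id x y := V.tH_id x y
  id_whiskerRight x y := V.tH_id x y
  associator_naturality f g h := V.assoc_natural f g h
  leftUnitor_naturality f := V.left_natural f
  rightUnitor_naturality f := V.right_natural f
  pentagon a b c d := V.pentagon a b c d
  triangle a b := V.triangle a b

theorem tensorObj_val (x y : Fam V.toIntCat W) : (x ⊗ y).val = lift x.val y.val ≫ V.tObj := rfl
theorem tensorHom_val {x y x' y' : Fam V.toIntCat W} (f : x ⟶ y) (g : x' ⟶ y') :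
    (f ⊗ₘ g).val = lift f.val g.val ≫ V.tArr := rfl
theorem whiskerLeft_val (x : Fam V.toIntCat W) {y y' : Fam V.toIntCat W} (f : y ⟶ y') :
    (x ◁ f).val = lift (x.val ≫ V.ident) f.val ≫ V.tArr := rfl
theorem whiskerRight_val {x x' : Fam V.toIntCat W} (f : x ⟶ x') (y : Fam V.toIntCat W) :
    (f ▷ y).val = lift f.val (y.val ≫ V.ident) ≫ V.tArr := rfl
theorem tensorUnit_val : (𝟙_ (Fam V.toIntCat W)).val = toUnit W ≫ V.unit := rfl
theorem associator_val (x y z : Fam V.toIntCat W) :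
    (α_ x y z).hom.val = lift x.val (lift y.val z.val) ≫ V.assocIso.hom.val := rfl
theorem leftUnitor_val (x : Fam V.toIntCat W) :
    (λ_ x).hom.val = x.val ≫ V.leftIso.hom.val := rfl
theorem rightUnitor_val (x : Fam V.toIntCat W) :
    (ρ_ x).hom.val = x.val ≫ V.rightIso.hom.val := rfl

end IntMonCat

/-! ### Indexed monoidal categories and small categories enriched in them -/

set_option linter.checkUnivs false in
/-- An indexed monoidal category over `E`, that is, a pseudofunctor from `Eᵒᵖ` to the 2-category of
monoidal categories, strong monoidal functors and monoidal natural transformations. -/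
structure IndexedMonCat (E : Type u) [Category.{v} E] where
  fib : E → Type w
  [cat : ∀ X, Category.{w'} (fib X)]
  [mon : ∀ X, MonoidalCategory (fib X)]
  re : ∀ {X Y : E}, (X ⟶ Y) → fib Y ⥤ fib X
  [reMon : ∀ {X Y : E} (f : X ⟶ Y), (re f).Monoidal]
  reId : ∀ X : E, re (𝟙 X) ≅ 𝟭 (fib X)
  reComp : ∀ {X Y Z : E} (f : X ⟶ Y) (g : Y ⟶ Z), re (f ≫ g) ≅ re g ⋙ re f
  reId_monoidal : ∀ X : E, NatTrans.IsMonoidal (reId X).hom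
  reComp_monoidal : ∀ {X Y Z : E} (f : X ⟶ Y) (g : Y ⟶ Z), NatTrans.IsMonoidal (reComp f g).hom
  re_assoc : ∀ {X Y Z K : E} (f : X ⟶ Y) (g : Y ⟶ Z) (h : Z ⟶ K) (A : fib K),
    (reComp (f ≫ g) h).hom.app A ≫ (reComp f g).hom.app ((re h).obj A) =
      eqToHom (by rw [assoc]) ≫ (reComp f (g ≫ h)).hom.app A ≫ (re f).map ((reComp g h).hom.app A)
  re_id_left : ∀ {X Y : E} (f : X ⟶ Y) (A : fib Y),
    (reComp (𝟙 X) f).hom.app A ≫ (reId X).hom.app ((re f).obj A) = eqToHom (by simp)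
  re_id_right : ∀ {X Y : E} (f : X ⟶ Y) (A : fib Y),
    (reComp f (𝟙 Y)).hom.app A ≫ (re f).map ((reId Y).hom.app A) = eqToHom (by simp)

namespace IndexedMonCat

attribute [instance] cat mon reMon

variable {E : Type u} [Category.{v} E] (𝒲 : IndexedMonCat.{v, u, w', w} E)

/-- The coherence isomorphism `r^* f^* A ≅ g^* A` for `g = f ∘ r`. -/
noncomputable def reObj {X Y Z : E} (r : X ⟶ Y) (f : Y ⟶ Z) (g : X ⟶ Z) (h : r ≫ f = g)
    (A : 𝒲.fib Z) : (𝒲.re r).obj ((𝒲.re f).obj A) ≅ (𝒲.re g).obj A :=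
  (𝒲.reComp r f).symm.app A ≪≫ eqToIso (by rw [h])

theorem reObj_natural {X Y Z : E} (r : X ⟶ Y) (f : Y ⟶ Z) (g : X ⟶ Z) (h : r ≫ f = g)
    {A B : 𝒲.fib Z} (φ : A ⟶ B) :
    (𝒲.re r).map ((𝒲.re f).map φ) ≫ (𝒲.reObj r f g h B).hom =
      (𝒲.reObj r f g h A).hom ≫ (𝒲.re g).map φ := by
  subst h
  simpa [reObj] using (𝒲.reComp r f).inv.naturality φ

theorem reObj_aux {C : Type*} [Category* C] {P Q R S T : C} (a : P ≅ Q) (b : Q ≅ R) (e : P ≅ S)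
    (c : S ≅ T) (d : T ≅ R) (h : a.hom ≫ b.hom = e.hom ≫ c.hom ≫ d.hom) :
    d.inv ≫ c.inv ≫ e.inv = b.inv ≫ a.inv := by
  have h1 : a ≪≫ b = e ≪≫ c ≪≫ d := Iso.ext h
  simpa using (congrArg Iso.inv h1).symm

theorem reObj_assoc {X Y Z K : E} (s : X ⟶ Y) (r : Y ⟶ Z) (f : Z ⟶ K) (g : Y ⟶ K)
    (t : X ⟶ Z) (k : X ⟶ K) (h₁ : r ≫ f = g) (h₂ : s ≫ g = k) (h₃ : s ≫ r = t) (h₄ : t ≫ f = k)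
    (A : 𝒲.fib K) :
    (𝒲.re s).map (𝒲.reObj r f g h₁ A).hom ≫ (𝒲.reObj s g k h₂ A).hom =
      (𝒲.reObj s r t h₃ ((𝒲.re f).obj A)).hom ≫ (𝒲.reObj t f k h₄ A).hom := by
  subst h₁ h₃ h₄
  have key := reObj_aux ((𝒲.reComp (s ≫ r) f).app A) ((𝒲.reComp s r).app ((𝒲.re f).obj A))
    (eqToIso (by rw [assoc])) ((𝒲.reComp s (r ≫ f)).app A)
    ((𝒲.re s).mapIso ((𝒲.reComp r f).app A)) (𝒲.re_assoc s r f A)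
  simpa [reObj] using key

theorem reObj_id {X Y : E} (f g : X ⟶ Y) (h : f ≫ 𝟙 Y = g) (A : 𝒲.fib Y) :
    (𝒲.re f).map ((𝒲.reId Y).inv.app A) ≫ (𝒲.reObj f (𝟙 Y) g h A).hom =
      eqToHom (by rw [← h, comp_id]; rfl) := by
  have h1 : f = g := by rw [← h, comp_id]
  subst h1
  have := 𝒲.re_id_right f A
  have h2 : (𝒲.reComp f (𝟙 Y)).hom.app A =
      eqToHom (by simp) ≫ (𝒲.re f).map ((𝒲.reId Y).inv.app A) := by
    rw [← this]
    simp [← Functor.map_comp]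
  rw [reObj]
  simp only [Iso.trans_hom, Iso.app_hom, Iso.symm_hom, eqToIso.hom]
  have h3 : (𝒲.re f).map ((𝒲.reId Y).inv.app A) =
      eqToHom (by simp) ≫ (𝒲.reComp f (𝟙 Y)).hom.app A := by
    rw [h2]; simp
  rw [h3]
  simp

end IndexedMonCat

section SmallCat

variable {E : Type u} [Category.{v} E] [CartesianMonoidalCategory E]
  (𝒲 : IndexedMonCat.{v, u, w', w} E)

namespace IndexedMonCat

/-- The family of identities `I ⟶ H(x, x)` indexed by `x : Z ⟶ X`, obtained by reindexing the
generic one. -/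
noncomputable def idAt {X : E} {H : 𝒲.fib (X ⊗ X)}
    (i : 𝟙_ (𝒲.fib X) ⟶ (𝒲.re (lift (𝟙 X) (𝟙 X))).obj H) {Z : E} (x : Z ⟶ X) :
    𝟙_ (𝒲.fib Z) ⟶ (𝒲.re (lift x x)).obj H :=
  Functor.LaxMonoidal.ε (𝒲.re x) ≫ (𝒲.re x).map i ≫
    (𝒲.reObj x (lift (𝟙 X) (𝟙 X)) (lift x x) (by simp [comp_lift]) H).hom

/-- The family of compositions `H(x₁, x₂) ⊗ H(x₀, x₁) ⟶ H(x₀, x₂)` indexed by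
`x₀, x₁, x₂ : Z ⟶ X`, obtained by reindexing the generic one. -/
noncomputable def compAt {X : E} {H : 𝒲.fib (X ⊗ X)}
    (c : (𝒲.re (snd X (X ⊗ X))).obj H ⊗
        (𝒲.re (lift (fst X (X ⊗ X)) (snd X (X ⊗ X) ≫ fst X X))).obj H ⟶
      (𝒲.re (lift (fst X (X ⊗ X)) (snd X (X ⊗ X) ≫ snd X X))).obj H)
    {Z : E} (x₀ x₁ x₂ : Z ⟶ X) :
    (𝒲.re (lift x₁ x₂)).obj H ⊗ (𝒲.re (lift x₀ x₁)).obj H ⟶ (𝒲.re (lift x₀ x₂)).obj H :=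
  ((𝒲.reObj (lift x₀ (lift x₁ x₂)) (snd X (X ⊗ X)) (lift x₁ x₂) (by simp) H).inv ⊗ₘ
    (𝒲.reObj (lift x₀ (lift x₁ x₂)) (lift (fst X (X ⊗ X)) (snd X (X ⊗ X) ≫ fst X X))
      (lift x₀ x₁) (by simp [comp_lift]) H).inv) ≫
  Functor.LaxMonoidal.μ (𝒲.re (lift x₀ (lift x₁ x₂))) _ _ ≫
  (𝒲.re (lift x₀ (lift x₁ x₂))).map c ≫
  (𝒲.reObj (lift x₀ (lift x₁ x₂)) (lift (fst X (X ⊗ X)) (snd X (X ⊗ X) ≫ snd X X))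
      (lift x₀ x₂) (by simp [comp_lift]) H).hom

end IndexedMonCat

/-- A small `𝒲`-category: an object `X` of `E`, an object `hom` of `𝒲(X × X)`, a morphism
`ident : I ⟶ hom(x, x)` of `𝒲(X)` and a morphism `comp : hom(x₁, x₂) ⊗ hom(x₀, x₁) ⟶ hom(x₀, x₂)`
of `𝒲(X × X × X)`. The unit and associativity axioms are stated in context, that is, for families
`x₀, x₁, ... : Z ⟶ X`; the case of the projections of `X × X` and `X × X × X × X` is generic. -/
structure SmallCat where
  X : E
  hom : 𝒲.fib (X ⊗ X)
  ident : 𝟙_ (𝒲.fib X) ⟶ (𝒲.re (lift (𝟙 X) (𝟙 X))).obj hom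
  comp : (𝒲.re (snd X (X ⊗ X))).obj hom ⊗
      (𝒲.re (lift (fst X (X ⊗ X)) (snd X (X ⊗ X) ≫ fst X X))).obj hom ⟶
    (𝒲.re (lift (fst X (X ⊗ X)) (snd X (X ⊗ X) ≫ snd X X))).obj hom
  ident_comp : ∀ {Z : E} (x₀ x₁ : Z ⟶ X),
    (𝒲.idAt ident x₁ ▷ (𝒲.re (lift x₀ x₁)).obj hom) ≫ 𝒲.compAt comp x₀ x₁ x₁ = (λ_ _).hom
  comp_ident : ∀ {Z : E} (x₀ x₁ : Z ⟶ X),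
    ((𝒲.re (lift x₀ x₁)).obj hom ◁ 𝒲.idAt ident x₀) ≫ 𝒲.compAt comp x₀ x₀ x₁ = (ρ_ _).hom
  comp_assoc : ∀ {Z : E} (x₀ x₁ x₂ x₃ : Z ⟶ X),
    (𝒲.compAt comp x₁ x₂ x₃ ▷ (𝒲.re (lift x₀ x₁)).obj hom) ≫ 𝒲.compAt comp x₀ x₁ x₃ =
      (α_ _ _ _).hom ≫ ((𝒲.re (lift x₂ x₃)).obj hom ◁ 𝒲.compAt comp x₀ x₁ x₂) ≫
        𝒲.compAt comp x₀ x₂ x₃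

namespace SmallCat

variable {𝒲} (A B C : SmallCat 𝒲)

/-- The object `hom(x₀, x₁)` of `𝒲(Z)`. -/
abbrev homAt {Z : E} (x₀ x₁ : Z ⟶ A.X) : 𝒲.fib Z := (𝒲.re (lift x₀ x₁)).obj A.hom

variable {A B} in
/-- The family of morphisms `A(x₀, x₁) ⟶ B(f x₀, f x₁)` obtained by reindexing the generic one. -/
noncomputable def mapAt {f : A.X ⟶ B.X} (m : A.hom ⟶ (𝒲.re (f ⊗ₘ f)).obj B.hom) {Z : E}
    {x₀ x₁ : Z ⟶ A.X} {y₀ y₁ : Z ⟶ B.X} (h₀ : x₀ ≫ f = y₀) (h₁ : x₁ ≫ f = y₁) :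
    A.homAt x₀ x₁ ⟶ B.homAt y₀ y₁ :=
  (𝒲.re (lift x₀ x₁)).map m ≫
    (𝒲.reObj (lift x₀ x₁) (f ⊗ₘ f) (lift y₀ y₁) (by simp [h₀, h₁]) B.hom).hom

/-- Functors of small `𝒲`-categories. -/
structure Hom where
  obj : A.X ⟶ B.X
  map : A.hom ⟶ (𝒲.re (obj ⊗ₘ obj)).obj B.hom
  map_ident : ∀ {Z : E} (x : Z ⟶ A.X),
    𝒲.idAt A.ident x ≫ mapAt map rfl rfl = 𝒲.idAt B.ident (x ≫ obj)
  map_comp : ∀ {Z : E} (x₀ x₁ x₂ : Z ⟶ A.X),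
    𝒲.compAt A.comp x₀ x₁ x₂ ≫ mapAt map rfl rfl =
      (mapAt map rfl rfl ⊗ₘ mapAt map rfl rfl) ≫
        𝒲.compAt B.comp (x₀ ≫ obj) (x₁ ≫ obj) (x₂ ≫ obj)

namespace Hom

variable {A B C}

theorem ext_mapAt {F G : Hom A B} (h : F.obj = G.obj)
    (hm : ∀ {Z : E} {x₀ x₁ : Z ⟶ A.X} {y₀ y₁ : Z ⟶ B.X} (h₀ : x₀ ≫ F.obj = y₀)
      (h₁ : x₁ ≫ F.obj = y₁) (h₀' : x₀ ≫ G.obj = y₀) (h₁' : x₁ ≫ G.obj = y₁),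
      mapAt F.map h₀ h₁ = mapAt G.map h₀' h₁') : F = G := by
  obtain ⟨f, m, _, _⟩ := F
  obtain ⟨g, n, _, _⟩ := G
  obtain rfl : f = g := h
  have key := hm (x₀ := fst A.X A.X) (x₁ := snd A.X A.X) rfl rfl rfl rfl
  simp only [mapAt, cancel_mono] at key
  have h1 : ∀ (t : A.X ⊗ A.X ⟶ A.X ⊗ A.X) (ht : t = 𝟙 _) (k k' : A.hom ⟶
      (𝒲.re (f ⊗ₘ f)).obj B.hom), (𝒲.re t).map k = (𝒲.re t).map k' → k = k' := by
    rintro t rfl k k' hk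
    have h2 := (𝒲.reId _).hom.naturality k
    have h3 := (𝒲.reId _).hom.naturality k'
    rw [hk, h3] at h2
    simpa using h2.symm
  obtain rfl := h1 _ lift_fst_snd _ _ key
  rfl

theorem map_ident' (F : Hom A B) {Z : E} {x : Z ⟶ A.X} {y : Z ⟶ B.X} (h : x ≫ F.obj = y) :
    𝒲.idAt A.ident x ≫ mapAt F.map h h = 𝒲.idAt B.ident y := by
  subst h
  exact F.map_ident x

theorem map_comp' (F : Hom A B) {Z : E} {x₀ x₁ x₂ : Z ⟶ A.X} {y₀ y₁ y₂ : Z ⟶ B.X}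
    (h₀ : x₀ ≫ F.obj = y₀) (h₁ : x₁ ≫ F.obj = y₁) (h₂ : x₂ ≫ F.obj = y₂) :
    𝒲.compAt A.comp x₀ x₁ x₂ ≫ mapAt F.map h₀ h₂ =
      (mapAt F.map h₁ h₂ ⊗ₘ mapAt F.map h₀ h₁) ≫ 𝒲.compAt B.comp y₀ y₁ y₂ := by
  subst h₀ h₁ h₂
  exact F.map_comp x₀ x₁ x₂

theorem mapAt_comp {f : A.X ⟶ B.X} {g : B.X ⟶ C.X} (m : A.hom ⟶ (𝒲.re (f ⊗ₘ f)).obj B.hom)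
    (n : B.hom ⟶ (𝒲.re (g ⊗ₘ g)).obj C.hom) (hh) {Z : E} {x₀ x₁ : Z ⟶ A.X} {y₀ y₁ : Z ⟶ B.X}
    {z₀ z₁ : Z ⟶ C.X} (h₀ : x₀ ≫ f = y₀) (h₁ : x₁ ≫ f = y₁) (k₀ : y₀ ≫ g = z₀) (k₁ : y₁ ≫ g = z₁)
    (l₀ : x₀ ≫ f ≫ g = z₀) (l₁ : x₁ ≫ f ≫ g = z₁) :
    mapAt (m ≫ (𝒲.re (f ⊗ₘ f)).map n ≫
      (𝒲.reObj (f ⊗ₘ f) (g ⊗ₘ g) ((f ≫ g) ⊗ₘ (f ≫ g)) hh C.hom).hom) l₀ l₁ =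
      mapAt m h₀ h₁ ≫ mapAt n k₀ k₁ := by
  simp only [mapAt, Functor.map_comp, assoc]
  rw [𝒲.reObj_assoc (t := lift y₀ y₁) (h₃ := by simp [h₀, h₁]) (h₄ := by simp [k₀, k₁])]
  rw [← assoc ((𝒲.re _).map ((𝒲.re _).map n)), 𝒲.reObj_natural, assoc]

theorem mapAt_id (m : A.hom ⟶ (𝒲.re (𝟙 A.X ⊗ₘ 𝟙 A.X)).obj A.hom)
    (hm : m = (𝒲.reId _).inv.app A.hom ≫ eqToHom (by simp))
    {Z : E} {x₀ x₁ y₀ y₁ : Z ⟶ A.X} (h₀ : x₀ ≫ 𝟙 _ = y₀) (h₁ : x₁ ≫ 𝟙 _ = y₁) :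
    mapAt m h₀ h₁ = eqToHom (by rw [← h₀, ← h₁, comp_id, comp_id]) := by
  have key : ∀ (t : A.X ⊗ A.X ⟶ A.X ⊗ A.X) (ht : 𝟙 _ = t) (h : lift x₀ x₁ ≫ t = lift y₀ y₁),
      (𝒲.re (lift x₀ x₁)).map ((𝒲.reId _).inv.app A.hom ≫ eqToHom (by simp [← ht])) ≫
        (𝒲.reObj (lift x₀ x₁) t (lift y₀ y₁) h A.hom).hom =
        eqToHom (by rw [← h₀, ← h₁, comp_id, comp_id]; rfl) := by
    rintro t rfl h
    simpa using 𝒲.reObj_id (lift x₀ x₁) (lift y₀ y₁) h A.hom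
  rw [mapAt, hm]
  exact key _ (by simp) _

/-- Composition of functors of small `𝒲`-categories. -/
@[simps]
noncomputable def comp (F : Hom A B) (G : Hom B C) : Hom A C where
  obj := F.obj ≫ G.obj
  map := F.map ≫ (𝒲.re (F.obj ⊗ₘ F.obj)).map G.map ≫
    (𝒲.reObj (F.obj ⊗ₘ F.obj) (G.obj ⊗ₘ G.obj) ((F.obj ≫ G.obj) ⊗ₘ (F.obj ≫ G.obj))
      (by simp) C.hom).hom
  map_ident x := by
    rw [mapAt_comp _ _ _ rfl rfl (assoc _ _ _) (assoc _ _ _), ← assoc (𝒲.idAt _ _), F.map_ident, G.map_ident']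
  map_comp x₀ x₁ x₂ := by
    rw [mapAt_comp _ _ _ rfl rfl (assoc _ _ _) (assoc _ _ _),
      mapAt_comp _ _ _ rfl rfl (assoc _ _ _) (assoc _ _ _),
      mapAt_comp _ _ _ rfl rfl (assoc _ _ _) (assoc _ _ _), ← assoc (𝒲.compAt _ _ _ _),
      F.map_comp, assoc (_ ⊗ₘ _),
      G.map_comp' (assoc _ _ _) (assoc _ _ _) (assoc _ _ _), ← assoc (_ ⊗ₘ _), tensorHom_comp_tensorHom]

variable (A) in
/-- The identity functor of a small `𝒲`-category. -/
@[simps]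
noncomputable def id : Hom A A where
  obj := 𝟙 A.X
  map := (𝒲.reId _).inv.app A.hom ≫ eqToHom (by simp)
  map_ident x := by
    rw [mapAt_id _ rfl]
    have : ∀ (y : _ ⟶ A.X) (h : x = y), 𝒲.idAt A.ident x ≫ eqToHom (by rw [h]) =
        𝒲.idAt A.ident y := by rintro y rfl; simp
    exact this _ (by simp)
  map_comp x₀ x₁ x₂ := by
    rw [mapAt_id _ rfl, mapAt_id _ rfl, mapAt_id _ rfl]
    have : ∀ (y₀ y₁ y₂ : _ ⟶ A.X) (h₀ : x₀ = y₀) (h₁ : x₁ = y₁) (h₂ : x₂ = y₂),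
        𝒲.compAt A.comp x₀ x₁ x₂ ≫ eqToHom (by rw [h₀, h₂]) =
          (eqToHom (by rw [h₁, h₂]) ⊗ₘ eqToHom (by rw [h₀, h₁])) ≫ 𝒲.compAt A.comp y₀ y₁ y₂ := by
      rintro _ _ _ rfl rfl rfl; simp
    exact this _ _ _ (by simp) (by simp) (by simp)

end Hom

/-- The category of small `𝒲`-categories and their functors. -/
noncomputable instance : Category (SmallCat 𝒲) where
  Hom := Hom
  id := Hom.id
  comp := Hom.comp
  id_comp {A B} F := by
    refine Hom.ext_mapAt (id_comp _) fun {Z x₀ x₁ y₀ y₁} h₀ h₁ h₀' h₁' => ?_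
    exact (Hom.mapAt_comp _ _ _ (comp_id x₀) (comp_id x₁) h₀' h₁' h₀ h₁).trans
      ((congrArg (· ≫ _) (Hom.mapAt_id _ rfl _ _)).trans (by simp))
  comp_id {A B} F := by
    refine Hom.ext_mapAt (comp_id _) fun {Z x₀ x₁ y₀ y₁} h₀ h₁ h₀' h₁' => ?_
    exact (Hom.mapAt_comp _ _ _ h₀' h₁' (comp_id y₀) (comp_id y₁) h₀ h₁).trans
      ((congrArg (_ ≫ ·) (Hom.mapAt_id _ rfl _ _)).trans (by simp))
  assoc {A B C D} F G K := by
    refine Hom.ext_mapAt (assoc _ _ _) fun {Z x₀ x₁ y₀ y₁} h₀ h₁ h₀' h₁' => ?_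
    refine (Hom.mapAt_comp _ _ _ (y₀ := x₀ ≫ F.obj ≫ G.obj) (y₁ := x₁ ≫ F.obj ≫ G.obj)
      rfl rfl (by rw [← h₀]; simp [Hom.comp]) (by rw [← h₁]; simp [Hom.comp]) h₀ h₁).trans ?_
    refine Eq.trans ?_ (Hom.mapAt_comp _ _ _ (y₀ := x₀ ≫ F.obj) (y₁ := x₁ ≫ F.obj)
      rfl rfl (by rw [← h₀]; simp [Hom.comp]) (by rw [← h₁]; simp [Hom.comp]) h₀' h₁').symm
    have e1 := Hom.mapAt_comp F.map G.map (by simp) (x₀ := x₀) (x₁ := x₁) rfl rfl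
      (assoc _ _ _) (assoc _ _ _) rfl rfl
    have e2 := Hom.mapAt_comp G.map K.map (by simp) (x₀ := x₀ ≫ F.obj) (x₁ := x₁ ≫ F.obj)
      (y₀ := x₀ ≫ F.obj ≫ G.obj) (y₁ := x₁ ≫ F.obj ≫ G.obj) (z₀ := y₀) (z₁ := y₁)
      (assoc _ _ _) (assoc _ _ _) (by rw [← h₀]; simp [Hom.comp]) (by rw [← h₁]; simp [Hom.comp])
      (by rw [← h₀]; simp [Hom.comp]) (by rw [← h₁]; simp [Hom.comp])
    exact ((congrArg (· ≫ _) e1).trans (assoc _ _ _)).trans (congrArg (_ ≫ ·) e2.symm)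

end SmallCat

end SmallCat

/-! ### The externalization of an internal monoidal category -/

namespace IntMonCat

variable {E : Type u} [Category.{v} E] [CartesianMonoidalCategory E] [HasPullbacks E]
  (V : IntMonCat E) {W W' : E}

theorem eqIso_trans {x y z : Fam V.toIntCat W} (h : x.val = y.val) (h' : y.val = z.val) :
    (Fam.eqIso h).hom ≫ (Fam.eqIso h').hom = (Fam.eqIso (h.trans h')).hom := by
  obtain rfl : x = y := Fam.ext h
  simp

theorem tensor_val_congr {x y x' y' : Fam V.toIntCat W} (h : x.val = y.val)
    (h' : x'.val = y'.val) : (x ⊗ x').val = (y ⊗ y').val := by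
  rw [tensorObj_val, tensorObj_val, h, h']

theorem eqIso_tensor {x y x' y' : Fam V.toIntCat W} (h : x.val = y.val) (h' : x'.val = y'.val) :
    (Fam.eqIso h).hom ⊗ₘ (Fam.eqIso h').hom = (Fam.eqIso (V.tensor_val_congr h h')).hom := by
  obtain rfl : x = y := Fam.ext h
  obtain rfl : x' = y' := Fam.ext h'
  simp

theorem eqIso_whiskerRight {x y : Fam V.toIntCat W} (h : x.val = y.val) (z : Fam V.toIntCat W) :
    (Fam.eqIso h).hom ▷ z = (Fam.eqIso (V.tensor_val_congr h (rfl : z.val = z.val))).hom := by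
  obtain rfl : x = y := Fam.ext h
  simp

theorem whiskerLeft_eqIso {x y : Fam V.toIntCat W} (z : Fam V.toIntCat W) (h : x.val = y.val) :
    z ◁ (Fam.eqIso h).hom = (Fam.eqIso (V.tensor_val_congr (rfl : z.val = z.val) h)).hom := by
  obtain rfl : x = y := Fam.ext h
  simp

theorem re_val_congr (r : W' ⟶ W) {x y : Fam V.toIntCat W} (h : x.val = y.val) :
    ((Fam.re V.toIntCat r).obj x).val = ((Fam.re V.toIntCat r).obj y).val := by
  rw [Fam.re_obj_val, Fam.re_obj_val, h]

theorem re_eqIso (r : W' ⟶ W) {x y : Fam V.toIntCat W} (h : x.val = y.val) :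
    (Fam.re V.toIntCat r).map (Fam.eqIso h).hom = (Fam.eqIso (V.re_val_congr r h)).hom := by
  obtain rfl : x = y := Fam.ext h
  simp

theorem eqToHom_eq {x y : Fam V.toIntCat W} (h : x = y) :
    eqToHom h = (Fam.eqIso (congrArg Fam.val h)).hom := by
  subst h
  simp

theorem re_unit_val (r : W' ⟶ W) : (𝟙_ (Fam V.toIntCat W')).val =
    ((Fam.re V.toIntCat r).obj (𝟙_ (Fam V.toIntCat W))).val := by
  simp [tensorUnit_val]

theorem re_tensor_val (r : W' ⟶ W) (x y : Fam V.toIntCat W) :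
    ((Fam.re V.toIntCat r).obj x ⊗ (Fam.re V.toIntCat r).obj y).val =
      ((Fam.re V.toIntCat r).obj (x ⊗ y)).val := by
  simp [tensorObj_val, comp_lift_assoc]

theorem re_id_val (x : Fam V.toIntCat W) :
    ((Fam.re V.toIntCat (𝟙 W)).obj x).val = x.val := by simp

theorem re_comp_val {W'' : E} (r : W'' ⟶ W') (s : W' ⟶ W) (x : Fam V.toIntCat W) :
    ((Fam.re V.toIntCat (r ≫ s)).obj x).val =
      ((Fam.re V.toIntCat r).obj ((Fam.re V.toIntCat s).obj x)).val := by simp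

/-- Reindexing of families preserves tensor products and units on the nose. -/
noncomputable def reCore (r : W' ⟶ W) : (Fam.re V.toIntCat r).CoreMonoidal where
  εIso := Fam.eqIso (V.re_unit_val r)
  μIso x y := Fam.eqIso (V.re_tensor_val r x y)
  μIso_hom_natural_left f x := by
    refine (Fam.eq_of_val_eq _ _ ?_)
    simp [whiskerRight_val, comp_lift_assoc]
  μIso_hom_natural_right x f := by
    refine (Fam.eq_of_val_eq _ _ ?_)
    simp [whiskerLeft_val, comp_lift_assoc]
  associativity x y z := by
    apply Fam.hom_ext
    rw [eqIso_whiskerRight, whiskerLeft_eqIso, Fam.eqIso_comp_val, Fam.eqIso_comp_val,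
      ← assoc (α_ _ _ _).hom, Fam.comp_eqIso_val, Fam.comp_eqIso_val]
    simp [associator_val, comp_lift_assoc]
  left_unitality x := by
    apply Fam.hom_ext
    rw [eqIso_whiskerRight, Fam.eqIso_comp_val, Fam.eqIso_comp_val]
    simp [leftUnitor_val]
  right_unitality x := by
    apply Fam.hom_ext
    rw [whiskerLeft_eqIso, Fam.eqIso_comp_val, Fam.eqIso_comp_val]
    simp [rightUnitor_val]

noncomputable instance (r : W' ⟶ W) : (Fam.re V.toIntCat r).Monoidal := (V.reCore r).toMonoidal

theorem re_ε (r : W' ⟶ W) : Functor.LaxMonoidal.ε (Fam.re V.toIntCat r) =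
    (Fam.eqIso (V.re_unit_val r)).hom := rfl

theorem re_μ (r : W' ⟶ W) (x y : Fam V.toIntCat W) :
    Functor.LaxMonoidal.μ (Fam.re V.toIntCat r) x y =
      (Fam.eqIso (V.re_tensor_val r x y)).hom := rfl

/-- The externalization `Ext(V)` of an internal monoidal category `V`, as an indexed monoidal
category: the fibre over `W` consists of the `W`-indexed families of objects and arrows of `V`. -/
noncomputable def Ext : IndexedMonCat.{v, u, v, v} E where
  fib W := Fam V.toIntCat W
  re r := Fam.re V.toIntCat r
  reId X := NatIso.ofComponents (fun x => Fam.eqIso (V.re_id_val x)) (fun f =>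
    Fam.eq_of_val_eq _ _ (by simp))
  reComp f g := NatIso.ofComponents (fun x => Fam.eqIso (V.re_comp_val f g x)) (fun f =>
    Fam.eq_of_val_eq _ _ (by simp))
  reId_monoidal X :=
    { unit := (V.eqIso_trans (V.re_unit_val _) (V.re_id_val _)).trans (by simp [Functor.LaxMonoidal.ε])
      tensor := fun x y => (V.eqIso_trans (V.re_tensor_val _ x y) (V.re_id_val (x ⊗ y))).trans (by
        simp only [NatIso.ofComponents_hom_app]
        rw [eqIso_tensor]
        simp [Functor.LaxMonoidal.μ]) }
  reComp_monoidal f g :=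
    { unit := (V.eqIso_trans (V.re_unit_val (f ≫ g)) (V.re_comp_val f g _)).trans (by
        rw [Functor.LaxMonoidal.comp_ε, re_ε, re_ε, re_eqIso, eqIso_trans])
      tensor := fun x y => (V.eqIso_trans (V.re_tensor_val (f ≫ g) x y) (V.re_comp_val f g (x ⊗ y))).trans (by
        simp only [NatIso.ofComponents_hom_app]
        rw [Functor.LaxMonoidal.comp_μ, re_μ, re_μ, re_eqIso, eqIso_tensor, eqIso_trans,
          eqIso_trans]) }
  re_assoc f g h x := by
    simp only [NatIso.ofComponents_hom_app]
    rw [re_eqIso, eqToHom_eq, eqIso_trans, eqIso_trans, eqIso_trans]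
  re_id_left f x := by
    simp only [NatIso.ofComponents_hom_app]
    rw [eqToHom_eq, eqIso_trans]
  re_id_right f x := by
    simp only [NatIso.ofComponents_hom_app]
    rw [re_eqIso, eqToHom_eq, eqIso_trans]

end IntMonCat

/-! ### Generalized multicategories -/

/-- A `T`-multicategory, for a monad `T`: a `T`-graph `T C₀ ⟵ C₁ ⟶ C₀` with a composition
`C₁ ×_{T C₀} T C₁ ⟶ C₁` and identities `C₀ ⟶ C₁`. The unit and associativity axioms are stated for
generalized elements; in the associativity axiom `t` is an element of `T (C₁ ×_{T C₀} T C₁)`. -/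
structure GenMulticat {C : Type u} [Category.{v} C] [HasPullbacks C] (T : Monad C) where
  C₀ : C
  C₁ : C
  src : C₁ ⟶ T.obj C₀
  tgt : C₁ ⟶ C₀
  comp : pullback src (T.map tgt) ⟶ C₁
  ident : C₀ ⟶ C₁
  comp_src : comp ≫ src = pullback.snd src (T.map tgt) ≫ T.map src ≫ T.μ.app C₀
  comp_tgt : comp ≫ tgt = pullback.fst src (T.map tgt) ≫ tgt
  ident_src : ident ≫ src = T.η.app C₀
  ident_tgt : ident ≫ tgt = 𝟙 C₀
  ident_comp : ∀ {W : C} (c : W ⟶ C₁) (h : (c ≫ tgt ≫ ident) ≫ src = (c ≫ T.η.app C₁) ≫ T.map tgt),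
    pullback.lift (c ≫ tgt ≫ ident) (c ≫ T.η.app C₁) h ≫ comp = c
  comp_ident : ∀ {W : C} (c : W ⟶ C₁) (h : c ≫ src = (c ≫ src ≫ T.map ident) ≫ T.map tgt),
    pullback.lift c (c ≫ src ≫ T.map ident) h ≫ comp = c
  comp_assoc : ∀ {W : C} (c : W ⟶ C₁) (t : W ⟶ T.obj (pullback src (T.map tgt)))
    (h₁ : c ≫ src = (t ≫ T.map (pullback.fst src (T.map tgt))) ≫ T.map tgt)
    (h₂ : c ≫ src = (t ≫ T.map comp) ≫ T.map tgt)
    (h₃ : (pullback.lift c (t ≫ T.map (pullback.fst src (T.map tgt))) h₁ ≫ comp) ≫ src =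
      (t ≫ T.map (pullback.snd src (T.map tgt)) ≫ T.μ.app C₁) ≫ T.map tgt),
    pullback.lift c (t ≫ T.map comp) h₂ ≫ comp =
      pullback.lift (pullback.lift c (t ≫ T.map (pullback.fst src (T.map tgt))) h₁ ≫ comp)
        (t ≫ T.map (pullback.snd src (T.map tgt)) ≫ T.μ.app C₁) h₃ ≫ comp

namespace GenMulticat

variable {C : Type u} [Category.{v} C] [HasPullbacks C] {T : Monad C}

section

variable (D : GenMulticat T) {W W' : C}

/-- Composition of generalized elements. -/
noncomputable def compAt (c : W ⟶ D.C₁) (d : W ⟶ T.obj D.C₁) (h : c ≫ D.src = d ≫ T.map D.tgt) :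
    W ⟶ D.C₁ := pullback.lift c d h ≫ D.comp

theorem compAt_src (c : W ⟶ D.C₁) (d : W ⟶ T.obj D.C₁) (h : c ≫ D.src = d ≫ T.map D.tgt) :
    D.compAt c d h ≫ D.src = d ≫ T.map D.src ≫ T.μ.app D.C₀ := by
  simp [compAt, D.comp_src]

theorem compAt_tgt (c : W ⟶ D.C₁) (d : W ⟶ T.obj D.C₁) (h : c ≫ D.src = d ≫ T.map D.tgt) :
    D.compAt c d h ≫ D.tgt = c ≫ D.tgt := by
  simp [compAt, D.comp_tgt]

theorem pre_compAt (r : W' ⟶ W) (c : W ⟶ D.C₁) (d : W ⟶ T.obj D.C₁)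
    (h : c ≫ D.src = d ≫ T.map D.tgt) :
    r ≫ D.compAt c d h = D.compAt (r ≫ c) (r ≫ d) (by simp [h]) := by
  rw [compAt, compAt, ← assoc]
  congr 1
  apply pullback.hom_ext <;> simp

theorem compAt_congr {c c' : W ⟶ D.C₁} {d d' : W ⟶ T.obj D.C₁} (hc : c = c') (hd : d = d')
    (h : c ≫ D.src = d ≫ T.map D.tgt) :
    D.compAt c d h = D.compAt c' d' (by rw [← hc, ← hd, h]) := by subst hc hd; rfl

/-- Associativity of the composition, where `a` and `b` are the two components of an element of
`T (C₁ ×_{T C₀} T C₁)` that is the image under `T` of a family of composable pairs. -/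
theorem compAt_assoc {Z : C} (c : W ⟶ D.C₁) (t : W ⟶ T.obj Z) (p : Z ⟶ D.C₁)
    (q : Z ⟶ T.obj D.C₁) (h : p ≫ D.src = q ≫ T.map D.tgt)
    (h₁ : c ≫ D.src = (t ≫ T.map p) ≫ T.map D.tgt)
    (h₂ : c ≫ D.src = (t ≫ T.map (D.compAt p q h)) ≫ T.map D.tgt)
    (h₃ : D.compAt c (t ≫ T.map p) h₁ ≫ D.src = (t ≫ T.map q ≫ T.μ.app D.C₁) ≫ T.map D.tgt) :
    D.compAt c (t ≫ T.map (D.compAt p q h)) h₂ =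
      D.compAt (D.compAt c (t ≫ T.map p) h₁) (t ≫ T.map q ≫ T.μ.app D.C₁) h₃ := by
  have e₀ : t ≫ T.map (D.compAt p q h) = (t ≫ T.map (pullback.lift p q h)) ≫ T.map D.comp := by
    simp [compAt]
  have e₁ : t ≫ T.map p = (t ≫ T.map (pullback.lift p q h)) ≫
      T.map (pullback.fst D.src (T.map D.tgt)) := by
    rw [assoc, ← T.map_comp, pullback.lift_fst]
  have e₂ : t ≫ T.map q ≫ T.μ.app D.C₁ = (t ≫ T.map (pullback.lift p q h)) ≫
      T.map (pullback.snd D.src (T.map D.tgt)) ≫ T.μ.app D.C₁ := by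
    rw [assoc, ← assoc (T.map _), ← T.map_comp, pullback.lift_snd]
  rw [D.compAt_congr rfl e₀, D.compAt_congr (D.compAt_congr rfl e₁ h₁) e₂]
  exact D.comp_assoc _ _ _ _ _

theorem unary_composable {c d : W ⟶ D.C₁} {r : W ⟶ D.C₀} (hc : c ≫ D.src = r ≫ T.η.app D.C₀)
    (hd : d ≫ D.tgt = r) : c ≫ D.src = (d ≫ T.η.app D.C₁) ≫ T.map D.tgt := by
  have n := T.η.naturality D.tgt
  simp only [Functor.id_map] at n
  rw [hc, assoc, ← n, ← assoc, hd]

theorem compAt_unary_src (c d : W ⟶ D.C₁) (h : c ≫ D.src = (d ≫ T.η.app D.C₁) ≫ T.map D.tgt) :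
    D.compAt c (d ≫ T.η.app D.C₁) h ≫ D.src = d ≫ D.src := by
  have n := T.η.naturality D.src
  simp only [Functor.id_map] at n
  rw [compAt_src, assoc, ← assoc (T.η.app _), ← n, assoc]
  exact congrArg (d ≫ ·) ((congrArg (D.src ≫ ·) (T.left_unit _)).trans (comp_id _))

/-- Unary composition is associative. -/
theorem compAt_assoc_unary (c d : W ⟶ D.C₁) (e : W ⟶ T.obj D.C₁)
    (h₁ : c ≫ D.src = (d ≫ T.η.app D.C₁) ≫ T.map D.tgt) (h : d ≫ D.src = e ≫ T.map D.tgt)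
    (h₂ : c ≫ D.src = (D.compAt d e h ≫ T.η.app D.C₁) ≫ T.map D.tgt)
    (h₃ : D.compAt c (d ≫ T.η.app D.C₁) h₁ ≫ D.src = e ≫ T.map D.tgt) :
    D.compAt c (D.compAt d e h ≫ T.η.app D.C₁) h₂ =
      D.compAt (D.compAt c (d ≫ T.η.app D.C₁) h₁) e h₃ := by
  have n : ∀ {Y : C} (k : W ⟶ Y), k ≫ T.η.app Y = T.η.app W ≫ T.map k :=
    fun k => T.η.naturality k
  have e₂ : e = T.η.app W ≫ T.map e ≫ T.μ.app D.C₁ := by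
    rw [← assoc, ← n, assoc, T.left_unit]
    exact (comp_id e).symm
  have k₁ : c ≫ D.src = (T.η.app W ≫ T.map d) ≫ T.map D.tgt := by rw [← n]; exact h₁
  have k₂ : c ≫ D.src = (T.η.app W ≫ T.map (D.compAt d e h)) ≫ T.map D.tgt := by rw [← n]; exact h₂
  have k₃ : D.compAt c (T.η.app W ≫ T.map d) k₁ ≫ D.src =
      (T.η.app W ≫ T.map e ≫ T.μ.app D.C₁) ≫ T.map D.tgt := by
    rw [← e₂, ← D.compAt_congr rfl (n d) h₁]; exact h₃
  rw [D.compAt_congr rfl (n _), D.compAt_congr (D.compAt_congr rfl (n d) h₁) e₂]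
  exact D.compAt_assoc c (T.η.app W) d e h k₁ k₂ k₃

end

/-- Functors of `T`-multicategories. -/
structure Hom (D D' : GenMulticat T) where
  f₀ : D.C₀ ⟶ D'.C₀
  f₁ : D.C₁ ⟶ D'.C₁
  src_comm : f₁ ≫ D'.src = D.src ≫ T.map f₀
  tgt_comm : f₁ ≫ D'.tgt = D.tgt ≫ f₀
  map_ident : D.ident ≫ f₁ = f₀ ≫ D'.ident
  map_comp : ∀ {W : C} (c : W ⟶ D.C₁) (d : W ⟶ T.obj D.C₁) (h : c ≫ D.src = d ≫ T.map D.tgt)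
    (h' : (c ≫ f₁) ≫ D'.src = (d ≫ T.map f₁) ≫ T.map D'.tgt),
    D.compAt c d h ≫ f₁ = D'.compAt (c ≫ f₁) (d ≫ T.map f₁) h'

/-- The `T`-multicategory associated with a `T`-algebra `a : T A ⟶ A`, whose underlying `T`-graph is
`T A ⟵ T A ⟶ A`, with components the identity and `a`. -/
noncomputable def ofAlgebra (A : T.Algebra) : GenMulticat T where
  C₀ := A.A
  C₁ := T.obj A.A
  src := 𝟙 _
  tgt := A.a
  comp := pullback.snd _ _ ≫ T.μ.app A.A
  ident := T.η.app A.A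
  comp_src := by simp
  comp_tgt := by
    rw [assoc, A.assoc, ← assoc, ← pullback.condition, comp_id]
  ident_src := by simp
  ident_tgt := A.unit
  ident_comp c h := by simp
  comp_ident c h := by simp
  comp_assoc c t h₁ h₂ h₃ := by
    simp [T.assoc]

end GenMulticat

/-! ### Indiscrete categories and enriched multicategories -/

section Enriched

variable {E : Type u} [Category.{v} E] [CartesianMonoidalCategory E] [HasPullbacks E]

/-- The indiscrete internal category `Ind(X)` on an object `X`, with `X × X` as object of arrows. -/
@[simps! vert edge src tgt ident]
noncomputable def IntCat.ind (X : E) : IntCat E where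
  vert := X
  edge := X ⊗ X
  src := fst X X
  tgt := snd X X
  ident := lift (𝟙 X) (𝟙 X)
  comp := lift (pullback.snd (fst X X) (snd X X) ≫ fst X X)
    (pullback.fst (fst X X) (snd X X) ≫ snd X X)
  ident_src := by simp
  ident_tgt := by simp
  comp_src := by simp
  comp_tgt := by simp
  ident_comp f h := by
    apply CartesianMonoidalCategory.hom_ext <;> simp
  comp_ident f h := by
    apply CartesianMonoidalCategory.hom_ext <;> simp
  comp_assoc k g f hkg hgf h₁ h₂ := by
    apply CartesianMonoidalCategory.hom_ext <;> simp

theorem IntCat.indMap_ident {X Y : E} (f : X ⟶ Y) :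
    lift (𝟙 X) (𝟙 X) ≫ (f ⊗ₘ f) = f ≫ lift (𝟙 Y) (𝟙 Y) := by simp

theorem IntCat.indMap_fst {X Y W : E} (f : X ⟶ Y) (g : W ⟶ X ⊗ X) :
    (g ≫ (f ⊗ₘ f)) ≫ fst Y Y = (g ≫ fst X X) ≫ f := by simp

theorem IntCat.indMap_snd {X Y W : E} (f : X ⟶ Y) (g : W ⟶ X ⊗ X) :
    (g ≫ (f ⊗ₘ f)) ≫ snd Y Y = (g ≫ snd X X) ≫ f := by simp

/-- The internal functor `Ind(X) ⟶ Ind(Y)` induced by `X ⟶ Y`. -/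
noncomputable def IntCat.indMap {X Y : E} (f : X ⟶ Y) : IntCat.ind X ⟶ IntCat.ind Y where
  v := f
  e := f ⊗ₘ f
  src_comm := tensorHom_fst f f
  tgt_comm := tensorHom_snd f f
  map_ident := IntCat.indMap_ident f
  map_comp g k h h' := by
    have h1 := (IntCat.ind X).compAt_src g k h
    have h2 := (IntCat.ind X).compAt_tgt g k h
    have h3 := (IntCat.ind Y).compAt_src _ _ h'
    have h4 := (IntCat.ind Y).compAt_tgt _ _ h'
    refine CartesianMonoidalCategory.hom_ext _ _ ?_ ?_
    · refine Eq.trans ?_ h3.symm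
      exact (IntCat.indMap_fst f _).trans ((congrArg (· ≫ f) h1).trans (IntCat.indMap_fst f k).symm)
    · refine Eq.trans ?_ h4.symm
      exact (IntCat.indMap_snd f _).trans ((congrArg (· ≫ f) h2).trans (IntCat.indMap_snd f g).symm)

theorem IntCat.indMap_id (X : E) : IntCat.indMap (𝟙 X) = 𝟙 (IntCat.ind X) := by
  apply IntCat.hom_ext
  apply IntGraph.hom_ext
  · rfl
  · exact id_tensorHom_id X X

theorem IntCat.indMap_comp {X Y Z : E} (f : X ⟶ Y) (g : Y ⟶ Z) :
    IntCat.indMap (f ≫ g) = IntCat.indMap f ≫ IntCat.indMap g := by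
  apply IntCat.hom_ext
  apply IntGraph.hom_ext
  · rfl
  · exact (tensorHom_comp_tensorHom f f g g).symm

variable {Fr : IntGraph E ⥤ IntCat E} (adj : Fr ⊣ IntCat.forget E)

/-- The algebra for the free category monad given by the indiscrete category on `X`, with structure
map the image under the forgetful functor of the counit. -/
noncomputable def indAlgebra (X : E) : adj.toMonad.Algebra :=
  (Monad.comparison adj).obj (IntCat.ind X)

/-- The morphism of algebras `Ind(X) ⟶ Ind(Y)` induced by `X ⟶ Y`. -/
noncomputable def indAlgebraMap {X Y : E} (f : X ⟶ Y) : indAlgebra adj X ⟶ indAlgebra adj Y :=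
  (Monad.comparison adj).map (IntCat.indMap f)

theorem indAlgebraMap_id (X : E) : (indAlgebraMap adj (𝟙 X)).f = 𝟙 (indAlgebra adj X).A := by
  rw [indAlgebraMap, IntCat.indMap_id, CategoryTheory.Functor.map_id]
  rfl

theorem indAlgebraMap_comp {X Y Z : E} (f : X ⟶ Y) (g : Y ⟶ Z) :
    (indAlgebraMap adj (f ≫ g)).f = (indAlgebraMap adj f).f ≫ (indAlgebraMap adj g).f := by
  rw [indAlgebraMap, IntCat.indMap_comp, CategoryTheory.Functor.map_comp]
  rfl

/-- The multicategory `Ind⁺(X)` of lists of composable arrows of `Ind(X)`. -/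
noncomputable def indMulticat (X : E) : GenMulticat adj.toMonad :=
  GenMulticat.ofAlgebra (indAlgebra adj X)

variable {adj}

/-- A `D`-enriched multicategory for the identity monad on `E`: an object `X` of `E` with a functor
of multicategories `Ind⁺(X) ⟶ D`. -/
structure EnrichedMulticat (D : GenMulticat adj.toMonad) where
  X : E
  map : GenMulticat.Hom (indMulticat adj X) D

namespace EnrichedMulticat

variable {D : GenMulticat adj.toMonad} (A B K L : EnrichedMulticat D)

/-- The underlying morphism of graphs from `Ind(X)`. -/
noncomputable def m₀ : (indAlgebra adj A.X).A ⟶ D.C₀ := A.map.f₀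

/-- The component on the objects of arrows, whose domain is the graph of lists. -/
noncomputable def m₁ : adj.toMonad.obj (indAlgebra adj A.X).A ⟶ D.C₁ := A.map.f₁

theorem m₁_src : A.m₁ ≫ D.src = adj.toMonad.map A.m₀ := A.map.src_comm.trans (id_comp _)

theorem m₁_tgt : A.m₁ ≫ D.tgt = (indAlgebra adj A.X).a ≫ A.m₀ := A.map.tgt_comm

variable {A B} in
theorem left_composable {f : A.X ⟶ B.X} {φ : (indAlgebra adj A.X).A ⟶ D.C₁}
    (ht : φ ≫ D.tgt = (indAlgebraMap adj f).f ≫ B.m₀) :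
    (adj.toMonad.map (indAlgebraMap adj f).f ≫ B.m₁) ≫ D.src =
      adj.toMonad.map φ ≫ adj.toMonad.map D.tgt := by
  rw [assoc, B.m₁_src, ← adj.toMonad.map_comp, ← adj.toMonad.map_comp, ht]

variable {A} in
theorem right_composable {φ : (indAlgebra adj A.X).A ⟶ D.C₁}
    (hs : φ ≫ D.src = A.m₀ ≫ adj.toMonad.η.app D.C₀) :
    ((indAlgebra adj A.X).a ≫ φ) ≫ D.src =
      (A.m₁ ≫ adj.toMonad.η.app D.C₁) ≫ adj.toMonad.map D.tgt := by
  have := adj.toMonad.η.naturality D.tgt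
  simp only [Functor.id_map] at this
  rw [assoc, hs, assoc, ← this, ← assoc, ← assoc, m₁_tgt]

/-- A functor of enriched multicategories: `f₀ : X ⟶ Y` with a transformation from
`Ind⁺(X) ⟶ D` to the composite of `Ind⁺(f₀)` and `Ind⁺(Y) ⟶ D`. -/
@[ext]
structure Hom where
  f₀ : A.X ⟶ B.X
  f₁ : (indAlgebra adj A.X).A ⟶ D.C₁
  src_eq : f₁ ≫ D.src = A.m₀ ≫ adj.toMonad.η.app D.C₀
  tgt_eq : f₁ ≫ D.tgt = (indAlgebraMap adj f₀).f ≫ B.m₀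
  natural :
    D.compAt (adj.toMonad.map (indAlgebraMap adj f₀).f ≫ B.m₁) (adj.toMonad.map f₁)
        (left_composable tgt_eq) =
      D.compAt ((indAlgebra adj A.X).a ≫ f₁) (A.m₁ ≫ adj.toMonad.η.app D.C₁)
        (right_composable src_eq)

namespace Hom

variable {A B K L}

theorem comp_composable (F : Hom A B) (G : Hom B K) :
    ((indAlgebraMap adj F.f₀).f ≫ G.f₁) ≫ D.src =
      (F.f₁ ≫ adj.toMonad.η.app D.C₁) ≫ adj.toMonad.map D.tgt := by
  have := adj.toMonad.η.naturality D.tgt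
  simp only [Functor.id_map] at this
  rw [assoc, G.src_eq, assoc, ← this, ← assoc, ← assoc, F.tgt_eq]

/-- The arrow component of a composite functor. -/
noncomputable def comp₁ (F : Hom A B) (G : Hom B K) : (indAlgebra adj A.X).A ⟶ D.C₁ :=
  D.compAt ((indAlgebraMap adj F.f₀).f ≫ G.f₁) (F.f₁ ≫ adj.toMonad.η.app D.C₁)
    (comp_composable F G)

variable (A) in
/-- The identity functor. -/
@[simps]
noncomputable def id : Hom A A where
  f₀ := 𝟙 A.X
  f₁ := A.m₀ ≫ D.ident
  src_eq := by rw [assoc, D.ident_src]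
  tgt_eq := by
    rw [assoc, D.ident_tgt, indAlgebraMap_id]
    exact (comp_id _).trans (id_comp _).symm
  natural := by
    have e₁ : adj.toMonad.map (indAlgebraMap adj (𝟙 A.X)).f ≫ A.m₁ = A.m₁ := by
      rw [indAlgebraMap_id, CategoryTheory.Functor.map_id, id_comp]
    have e₂ : adj.toMonad.map (A.m₀ ≫ D.ident) = A.m₁ ≫ D.src ≫ adj.toMonad.map D.ident := by
      rw [← assoc, A.m₁_src, adj.toMonad.map_comp]
    have e₃ : (indAlgebra adj A.X).a ≫ A.m₀ ≫ D.ident = A.m₁ ≫ D.tgt ≫ D.ident := by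
      rw [← assoc, ← assoc, m₁_tgt]
    rw [D.compAt_congr e₁ e₂, D.compAt_congr e₃ rfl]
    exact (D.comp_ident _ _).trans (D.ident_comp _ _).symm

/-- Composition of functors. -/
@[simps]
noncomputable def comp (F : Hom A B) (G : Hom B K) : Hom A K where
  f₀ := F.f₀ ≫ G.f₀
  f₁ := comp₁ F G
  src_eq := by
    have h1 := adj.toMonad.η.naturality D.src
    have h2 := adj.toMonad.left_unit D.C₀
    simp only [Functor.id_map] at h1
    rw [comp₁, D.compAt_src, assoc, ← assoc (adj.toMonad.η.app _), ← h1, assoc, ← assoc, F.src_eq,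
      assoc]
    exact congrArg (A.m₀ ≫ ·) ((congrArg (adj.toMonad.η.app D.C₀ ≫ ·) h2).trans (comp_id _))
  tgt_eq := by
    rw [comp₁, D.compAt_tgt, assoc, G.tgt_eq, indAlgebraMap_comp, assoc]
  natural := by
    let P := (indAlgebra adj A.X).a ≫ (indAlgebraMap adj F.f₀).f ≫ G.f₁
    let Q := adj.toMonad.map (indAlgebraMap adj F.f₀).f ≫ B.m₁
    let R := (indAlgebra adj A.X).a ≫ (indAlgebraMap adj F.f₀).f ≫ B.m₀
    have hP : P ≫ D.src = R ≫ adj.toMonad.η.app D.C₀ := by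
      simp only [P, R, assoc, G.src_eq]
    have ha : adj.toMonad.map (indAlgebraMap adj F.f₀).f ≫ (indAlgebra adj B.X).a =
        (indAlgebra adj A.X).a ≫ (indAlgebraMap adj F.f₀).f := (indAlgebraMap adj F.f₀).h
    have hQ : Q ≫ D.tgt = R := by
      simp only [Q, R]
      rw [assoc, m₁_tgt, ← assoc, ha, assoc]
    have hF : ((indAlgebra adj A.X).a ≫ F.f₁) ≫ D.tgt = R := by
      simp only [R]
      rw [assoc, F.tgt_eq]
    have e₀ : adj.toMonad.map (indAlgebraMap adj (F.f₀ ≫ G.f₀)).f ≫ K.m₁ =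
        adj.toMonad.map (indAlgebraMap adj F.f₀).f ≫
          adj.toMonad.map (indAlgebraMap adj G.f₀).f ≫ K.m₁ := by
      rw [indAlgebraMap_comp, adj.toMonad.map_comp, assoc]
    have k₁ : (adj.toMonad.map (indAlgebraMap adj F.f₀).f ≫
        adj.toMonad.map (indAlgebraMap adj G.f₀).f ≫ K.m₁) ≫ D.src =
        (𝟙 _ ≫ adj.toMonad.map ((indAlgebraMap adj F.f₀).f ≫ G.f₁)) ≫ adj.toMonad.map D.tgt := by
      rw [id_comp, adj.toMonad.map_comp, assoc, assoc, assoc]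
      exact congrArg (adj.toMonad.map (indAlgebraMap adj F.f₀).f ≫ ·)
        ((assoc _ _ _).symm.trans (left_composable G.tgt_eq))
    have k₂ := left_composable F.tgt_eq
    have e₁ : 𝟙 _ ≫ adj.toMonad.map (F.f₁ ≫ adj.toMonad.η.app D.C₁) ≫ adj.toMonad.μ.app D.C₁ =
        adj.toMonad.map F.f₁ := by
      rw [id_comp, adj.toMonad.map_comp, assoc, adj.toMonad.right_unit]
      exact comp_id _
    have e₂ : D.compAt (adj.toMonad.map (indAlgebraMap adj F.f₀).f ≫
        adj.toMonad.map (indAlgebraMap adj G.f₀).f ≫ K.m₁)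
        (𝟙 _ ≫ adj.toMonad.map ((indAlgebraMap adj F.f₀).f ≫ G.f₁)) k₁ =
        D.compAt P (Q ≫ adj.toMonad.η.app D.C₁) (D.unary_composable hP hQ) := by
      have a₁ : 𝟙 _ ≫ adj.toMonad.map ((indAlgebraMap adj F.f₀).f ≫ G.f₁) =
          adj.toMonad.map (indAlgebraMap adj F.f₀).f ≫ adj.toMonad.map G.f₁ := by
        rw [id_comp, adj.toMonad.map_comp]
      have a₂ : adj.toMonad.map (indAlgebraMap adj F.f₀).f ≫ (indAlgebra adj B.X).a ≫ G.f₁ = P := by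
        simp only [P]
        rw [← assoc, ha, assoc]
      rw [D.compAt_congr rfl a₁, ← D.pre_compAt _ _ _ (left_composable G.tgt_eq), G.natural,
        D.pre_compAt, D.compAt_congr a₂ (assoc _ _ _).symm]
    have e₃ : D.compAt Q (adj.toMonad.map F.f₁) k₂ =
        D.compAt ((indAlgebra adj A.X).a ≫ F.f₁) (A.m₁ ≫ adj.toMonad.η.app D.C₁)
          (right_composable F.src_eq) := F.natural
    have e₄ : (indAlgebra adj A.X).a ≫ comp₁ F G =
        D.compAt P (((indAlgebra adj A.X).a ≫ F.f₁) ≫ adj.toMonad.η.app D.C₁)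
          (D.unary_composable hP hF) := by
      rw [comp₁, D.pre_compAt]
      exact D.compAt_congr rfl (assoc _ _ _).symm _
    have k₃ : D.compAt P (Q ≫ adj.toMonad.η.app D.C₁) (D.unary_composable hP hQ) ≫ D.src =
        adj.toMonad.map F.f₁ ≫ adj.toMonad.map D.tgt := by
      rw [D.compAt_unary_src]
      exact k₂
    have k₄ : D.compAt P (((indAlgebra adj A.X).a ≫ F.f₁) ≫ adj.toMonad.η.app D.C₁)
        (D.unary_composable hP hF) ≫ D.src =
          (A.m₁ ≫ adj.toMonad.η.app D.C₁) ≫ adj.toMonad.map D.tgt := by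
      rw [D.compAt_unary_src]
      exact right_composable F.src_eq
    have k₅ : D.compAt (adj.toMonad.map (indAlgebraMap adj F.f₀).f ≫
        adj.toMonad.map (indAlgebraMap adj G.f₀).f ≫ K.m₁)
        (𝟙 _ ≫ adj.toMonad.map ((indAlgebraMap adj F.f₀).f ≫ G.f₁)) k₁ ≫ D.src =
        (𝟙 _ ≫ adj.toMonad.map (F.f₁ ≫ adj.toMonad.η.app D.C₁) ≫ adj.toMonad.μ.app D.C₁) ≫
          adj.toMonad.map D.tgt := by
      rw [e₁, e₂]
      exact k₃
    rw [D.compAt_congr e₀ (id_comp _).symm, D.compAt_congr e₄ rfl]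
    refine (D.compAt_assoc _ (𝟙 _) _ _ (comp_composable F G) k₁ _ k₅).trans ?_
    rw [D.compAt_congr e₂ e₁]
    refine (D.compAt_assoc_unary P Q _ _ k₂ (D.unary_composable hP
      ((D.compAt_tgt _ _ _).trans hQ)) k₃).symm.trans ?_
    rw [D.compAt_congr rfl (congrArg (· ≫ adj.toMonad.η.app D.C₁) e₃)]
    exact D.compAt_assoc_unary P _ _ _ (right_composable F.src_eq) _ k₄

end Hom

/-- The category of `D`-enriched multicategories for the identity monad, and their functors. -/
noncomputable instance : Category (EnrichedMulticat D) where
  Hom := Hom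
  id := Hom.id
  comp := Hom.comp
  id_comp {A B} F := by
    refine Hom.ext (id_comp _) ?_
    have e₁ : (indAlgebraMap adj (𝟙 A.X)).f ≫ F.f₁ = F.f₁ := by
      rw [indAlgebraMap_id, id_comp]
    have n := adj.toMonad.η.naturality D.ident
    simp only [Functor.id_map] at n
    have e₂ : (A.m₀ ≫ D.ident) ≫ adj.toMonad.η.app D.C₁ =
        F.f₁ ≫ D.src ≫ adj.toMonad.map D.ident := by
      rw [assoc, n, ← assoc, ← assoc, F.src_eq]
    exact (D.compAt_congr e₁ e₂ _).trans (D.comp_ident _ _)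
  comp_id {A B} F := by
    refine Hom.ext (comp_id _) ?_
    have e₁ : (indAlgebraMap adj F.f₀).f ≫ B.m₀ ≫ D.ident = F.f₁ ≫ D.tgt ≫ D.ident := by
      rw [← assoc, ← F.tgt_eq, assoc]
    exact (D.compAt_congr e₁ rfl _).trans (D.ident_comp _ _)
  assoc {A B K L} F G H := by
    refine Hom.ext (assoc _ _ _) ?_
    have e₁ : (indAlgebraMap adj (F.f₀ ≫ G.f₀)).f ≫ H.f₁ =
        (indAlgebraMap adj F.f₀).f ≫ (indAlgebraMap adj G.f₀).f ≫ H.f₁ := by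
      rw [indAlgebraMap_comp, assoc]
    have e₂ : (indAlgebraMap adj F.f₀).f ≫ Hom.comp₁ G H =
        D.compAt ((indAlgebraMap adj F.f₀).f ≫ (indAlgebraMap adj G.f₀).f ≫ H.f₁)
          (((indAlgebraMap adj F.f₀).f ≫ G.f₁) ≫ adj.toMonad.η.app D.C₁)
          (D.unary_composable (r := (indAlgebraMap adj F.f₀).f ≫ (indAlgebraMap adj G.f₀).f ≫ K.m₀)
            (by simp only [assoc, H.src_eq]) (by rw [assoc, G.tgt_eq])) := by
      rw [Hom.comp₁, D.pre_compAt]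
      exact D.compAt_congr rfl (assoc _ _ _).symm _
    refine (D.compAt_congr e₁ rfl _).trans ?_
    refine Eq.trans ?_ (D.compAt_congr e₂ rfl _).symm
    exact D.compAt_assoc_unary _ _ _ _ (Hom.comp_composable F G) _
      ((D.compAt_unary_src _ _ _).trans (Hom.comp_composable F G))

end EnrichedMulticat

end Enriched

/-! ### Iterated tensor products -/

section Iterated

variable {E : Type u} [Category.{v} E] [CartesianMonoidalCategory E]

/-- The graph `1 ⇇ X` with one vertex and with `X` as object of edges. -/
abbrev bouquet (X : E) : IntGraph E where
  vert := 𝟙_ E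
  edge := X
  src := toUnit X
  tgt := toUnit X

/-- A morphism to the graph `1 ⇇ X` amounts to a morphism to `X` from the object of edges. -/
@[simps]
def bouquetLift {X : E} {G : IntGraph E} (f : G.edge ⟶ X) : G ⟶ bouquet X where
  v := toUnit _
  e := f
  src_comm := toUnit_unique _ _
  tgt_comm := toUnit_unique _ _

theorem bouquet_hom_ext {X : E} {G : IntGraph E} {f g : G ⟶ bouquet X} (h : f.e = g.e) : f = g :=
  IntGraph.hom_ext (toUnit_unique _ _) h

/-- The morphism of graphs `(1 ⇇ X) ⟶ (1 ⇇ Y)` induced by `X ⟶ Y`. -/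
abbrev bouquetMap {X Y : E} (f : X ⟶ Y) : bouquet X ⟶ bouquet Y := bouquetLift f

variable [HasPullbacks E] (V : IntMonCat E) {A : IntCat E} {W W' : E}

namespace IntMonCat

/-- The family of objects `⊗ l` of `V`, for a family `l` of arrows of `A`. -/
def tenAt (ten : A.toIntGraph ⟶ bouquet V.vert) (l : W ⟶ A.edge) : Fam V.toIntCat W := ⟨l ≫ ten.e⟩

theorem tenAt_val (ten : A.toIntGraph ⟶ bouquet V.vert) (l : W ⟶ A.edge) :
    (V.tenAt ten l).val = l ≫ ten.e := rfl

/-- The isomorphism `⊗ l ⊗ ⊗ m ≅ ⊗ n` for a family of composable arrows `l`, `m` of `A` with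
composite `n`, obtained by reindexing the generic one. -/
noncomputable def mulAt (ten : A.toIntGraph ⟶ bouquet V.vert)
    (mul : V.tenAt ten (pullback.fst A.src A.tgt) ⊗ V.tenAt ten (pullback.snd A.src A.tgt) ≅
      V.tenAt ten A.comp) (l m n : W ⟶ A.edge) (h : l ≫ A.src = m ≫ A.tgt)
    (hn : A.compAt l m h = n) : V.tenAt ten l ⊗ V.tenAt ten m ≅ V.tenAt ten n :=
  Fam.reIso (pullback.lift l m h) mul
    (by
      rw [tensorObj_val, tensorObj_val, tenAt_val, tenAt_val, comp_lift_assoc, tenAt_val,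
        tenAt_val, ← assoc, pullback.lift_fst, ← assoc, pullback.lift_snd])
    (by rw [tenAt_val, tenAt_val, ← hn, IntCat.compAt, assoc])

end IntMonCat

/-- A choice of iterated tensor products in `V` of lists of objects of `V`, where the lists of
objects of `V` are the arrows of a category `A` under the graph `1 ⇇ V₀` (in the applications, the
free category on this graph). It consists of a morphism of graphs `ten`, that sends the list with
one entry `v` to `v` and the empty list to the unit of `V`, with coherent isomorphisms
`⊗ l ⊗ ⊗ m ≅ ⊗ (l ∘ m)`. The coherence axioms are stated for generalized elements. -/
structure IteratedTensor (A : IntCat E) (η : bouquet V.vert ⟶ A.toIntGraph) where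
  ten : A.toIntGraph ⟶ bouquet V.vert
  ten_single : η ≫ ten = 𝟙 _
  ten_ident : A.ident ≫ ten.e = toUnit _ ≫ V.unit
  mul : V.tenAt ten (pullback.fst A.src A.tgt) ⊗ V.tenAt ten (pullback.snd A.src A.tgt) ≅
    V.tenAt ten A.comp
  mul_assoc : ∀ {W : E} (l m n lm mn lmn : W ⟶ A.edge) (h₁ : l ≫ A.src = m ≫ A.tgt)
    (h₂ : m ≫ A.src = n ≫ A.tgt) (h₃ : lm ≫ A.src = n ≫ A.tgt) (h₄ : l ≫ A.src = mn ≫ A.tgt)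
    (e₁ : A.compAt l m h₁ = lm) (e₂ : A.compAt m n h₂ = mn) (e₃ : A.compAt lm n h₃ = lmn)
    (e₄ : A.compAt l mn h₄ = lmn),
    ((V.mulAt ten mul l m lm h₁ e₁).hom ▷ V.tenAt ten n) ≫ (V.mulAt ten mul lm n lmn h₃ e₃).hom =
      (α_ _ _ _).hom ≫ (V.tenAt ten l ◁ (V.mulAt ten mul m n mn h₂ e₂).hom) ≫
        (V.mulAt ten mul l mn lmn h₄ e₄).hom
  ident_mul : ∀ {W : E} (i l : W ⟶ A.edge) (h : i ≫ A.src = l ≫ A.tgt) (e : A.compAt i l h = l)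
    (hi : (𝟙_ (Fam V.toIntCat W)).val = (V.tenAt ten i).val), i = l ≫ A.tgt ≫ A.ident →
    ((Fam.eqIso hi).hom ▷ V.tenAt ten l) ≫ (V.mulAt ten mul i l l h e).hom = (λ_ _).hom
  mul_ident : ∀ {W : E} (l i : W ⟶ A.edge) (h : l ≫ A.src = i ≫ A.tgt) (e : A.compAt l i h = l)
    (hi : (𝟙_ (Fam V.toIntCat W)).val = (V.tenAt ten i).val), i = l ≫ A.src ≫ A.ident →
    (V.tenAt ten l ◁ (Fam.eqIso hi).hom) ≫ (V.mulAt ten mul l i l h e).hom = (ρ_ _).hom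

namespace IteratedTensor

variable {V} {η : bouquet V.vert ⟶ A.toIntGraph} (I : IteratedTensor V A η)

/-- The family of objects `⊗ l`. -/
abbrev at' (l : W ⟶ A.edge) : Fam V.toIntCat W := V.tenAt I.ten l

/-- The isomorphism `⊗ l ⊗ ⊗ m ≅ ⊗ n` for `n` the composite of `l` and `m`. -/
noncomputable abbrev mulAt (l m n : W ⟶ A.edge) (h : l ≫ A.src = m ≫ A.tgt)
    (hn : A.compAt l m h = n) : I.at' l ⊗ I.at' m ≅ I.at' n := V.mulAt I.ten I.mul l m n h hn

theorem mulAt_val (l m n : W ⟶ A.edge) (h : l ≫ A.src = m ≫ A.tgt) (hn : A.compAt l m h = n) :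
    (I.mulAt l m n h hn).hom.val = pullback.lift l m h ≫ I.mul.hom.val := rfl

theorem mulAt_inv_val (l m n : W ⟶ A.edge) (h : l ≫ A.src = m ≫ A.tgt)
    (hn : A.compAt l m h = n) :
    (I.mulAt l m n h hn).inv.val = pullback.lift l m h ≫ I.mul.inv.val := rfl

/-- The tensor product of two families of arrows between iterated tensor products. -/
noncomputable def mulHom {l m n l' m' n' : W ⟶ A.edge} (h : l ≫ A.src = m ≫ A.tgt)
    (hn : A.compAt l m h = n) (h' : l' ≫ A.src = m' ≫ A.tgt) (hn' : A.compAt l' m' h' = n')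
    (f : I.at' l ⟶ I.at' l') (g : I.at' m ⟶ I.at' m') : I.at' n ⟶ I.at' n' :=
  (I.mulAt l m n h hn).inv ≫ (f ⊗ₘ g) ≫ (I.mulAt l' m' n' h' hn').hom

theorem mulHom_id {l m n : W ⟶ A.edge} (h : l ≫ A.src = m ≫ A.tgt) (hn : A.compAt l m h = n) :
    I.mulHom h hn h hn (𝟙 _) (𝟙 _) = 𝟙 _ := by
  simp [mulHom]

theorem mulHom_comp {l m n l' m' n' l'' m'' n'' : W ⟶ A.edge} (h : l ≫ A.src = m ≫ A.tgt)
    (hn : A.compAt l m h = n) (h' : l' ≫ A.src = m' ≫ A.tgt) (hn' : A.compAt l' m' h' = n')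
    (h'' : l'' ≫ A.src = m'' ≫ A.tgt) (hn'' : A.compAt l'' m'' h'' = n'')
    (f : I.at' l ⟶ I.at' l') (g : I.at' m ⟶ I.at' m') (f' : I.at' l' ⟶ I.at' l'')
    (g' : I.at' m' ⟶ I.at' m'') :
    I.mulHom h hn h'' hn'' (f ≫ f') (g ≫ g') =
      I.mulHom h hn h' hn' f g ≫ I.mulHom h' hn' h'' hn'' f' g' := by
  simp only [mulHom, assoc, Iso.hom_inv_id_assoc]
  rw [← tensorHom_comp_tensorHom_assoc]

theorem mulHom_val_congr {l m n l' m' n' k p q k' p' q' : W ⟶ A.edge} (h : l ≫ A.src = m ≫ A.tgt)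
    (hn : A.compAt l m h = n) (h' : l' ≫ A.src = m' ≫ A.tgt) (hn' : A.compAt l' m' h' = n')
    (t : k ≫ A.src = p ≫ A.tgt)
    (tn : A.compAt k p t = q) (t' : k' ≫ A.src = p' ≫ A.tgt) (tn' : A.compAt k' p' t' = q')
    {f : I.at' l ⟶ I.at' l'} {g : I.at' m ⟶ I.at' m'} {f' : I.at' k ⟶ I.at' k'}
    {g' : I.at' p ⟶ I.at' p'} (hl : l = k) (hl' : l' = k') (hm : m = p) (hm' : m' = p')
    (hf : f.val = f'.val) (hg : g.val = g'.val) :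
    (I.mulHom h hn h' hn' f g).val = (I.mulHom t tn t' tn' f' g').val := by
  subst hl hl' hm hm' hn hn' tn tn'
  obtain rfl := Fam.hom_ext hf
  obtain rfl := Fam.hom_ext hg
  rfl

theorem mulHom_re (r : W' ⟶ W) {l m n l' m' n' : W ⟶ A.edge} (h : l ≫ A.src = m ≫ A.tgt)
    (hn : A.compAt l m h = n) (h' : l' ≫ A.src = m' ≫ A.tgt) (hn' : A.compAt l' m' h' = n')
    {k p q k' p' q' : W' ⟶ A.edge} (t : k ≫ A.src = p ≫ A.tgt)
    (tn : A.compAt k p t = q) (t' : k' ≫ A.src = p' ≫ A.tgt) (tn' : A.compAt k' p' t' = q')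
    (f : I.at' l ⟶ I.at' l') (g : I.at' m ⟶ I.at' m') (f' : I.at' k ⟶ I.at' k')
    (g' : I.at' p ⟶ I.at' p') (hl : r ≫ l = k) (hl' : r ≫ l' = k') (hm : r ≫ m = p)
    (hm' : r ≫ m' = p') (hf : r ≫ f.val = f'.val) (hg : r ≫ g.val = g'.val) :
    r ≫ (I.mulHom h hn h' hn' f g).val = (I.mulHom t tn t' tn' f' g').val := by
  rw [← Fam.re_map_val, mulHom, mulHom, Functor.map_comp, Functor.map_comp]
  have key : ∀ {a b : W ⟶ A.edge} {a' b' : W' ⟶ A.edge} (h : a ≫ A.src = b ≫ A.tgt)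
      (h' : a' ≫ A.src = b' ≫ A.tgt), r ≫ a = a' → r ≫ b = b' →
      r ≫ pullback.lift a b h = pullback.lift a' b' h' := by
    intro a b a' b' h h' ha hb
    apply pullback.hom_ext <;> simp [ha, hb]
  refine Fam.comp_val_congr ?_ (Fam.comp_val_congr ?_ ?_)
  · rw [Fam.re_map_val, mulAt_inv_val, mulAt_inv_val, ← assoc, key h t hl hm]
  · rw [Fam.re_map_val, IntMonCat.tensorHom_val, IntMonCat.tensorHom_val, comp_lift_assoc, hf, hg]
  · rw [Fam.re_map_val, mulAt_val, mulAt_val, ← assoc, key h' t' hl' hm']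

theorem mon_aux₀ {C : Type*} [Category* C] [MonoidalCategory C] {x y z p q r : C}
    {a : x ⊗ y ≅ p} {b : p ⊗ z ≅ r} {c : y ⊗ z ≅ q} {d : x ⊗ q ≅ r}
    (h : (a.hom ▷ z) ≫ b.hom = (α_ x y z).hom ≫ (x ◁ c.hom) ≫ d.hom) :
    b.inv ≫ (a.inv ▷ z) = d.inv ≫ (x ◁ c.inv) ≫ (α_ x y z).inv := by
  have : whiskerRightIso a z ≪≫ b = α_ x y z ≪≫ whiskerLeftIso x c ≪≫ d := Iso.ext h
  simpa using congrArg Iso.inv this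

theorem mon_aux₁ {C : Type*} [Category* C] [MonoidalCategory C] {x y p x' y' p' z z' : C}
    (a : p ⟶ x ⊗ y) (f : x ⟶ x') (g : y ⟶ y') (b : x' ⊗ y' ⟶ p') (k : z ⟶ z') :
    ((a ≫ (f ⊗ₘ g) ≫ b) ⊗ₘ k) = (a ▷ z) ≫ ((f ⊗ₘ g) ⊗ₘ k) ≫ (b ▷ z') := by
  rw [← tensorHom_id, ← tensorHom_id, tensorHom_comp_tensorHom, tensorHom_comp_tensorHom, id_comp,
    comp_id]

theorem mon_aux₂ {C : Type*} [Category* C] [MonoidalCategory C] {x y p x' y' p' z z' : C}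
    (a : p ⟶ x ⊗ y) (f : x ⟶ x') (g : y ⟶ y') (b : x' ⊗ y' ⟶ p') (k : z ⟶ z') :
    (k ⊗ₘ (a ≫ (f ⊗ₘ g) ≫ b)) = (z ◁ a) ≫ (k ⊗ₘ (f ⊗ₘ g)) ≫ (z' ◁ b) := by
  rw [← id_tensorHom, ← id_tensorHom, tensorHom_comp_tensorHom, tensorHom_comp_tensorHom, id_comp,
    comp_id]

theorem mulHom_assoc {l m n lm mn lmn l' m' n' lm' mn' lmn' : W ⟶ A.edge}
    (h₁ : l ≫ A.src = m ≫ A.tgt)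
    (h₂ : m ≫ A.src = n ≫ A.tgt) (h₃ : lm ≫ A.src = n ≫ A.tgt) (h₄ : l ≫ A.src = mn ≫ A.tgt)
    (e₁ : A.compAt l m h₁ = lm) (e₂ : A.compAt m n h₂ = mn) (e₃ : A.compAt lm n h₃ = lmn)
    (e₄ : A.compAt l mn h₄ = lmn) (h₁' : l' ≫ A.src = m' ≫ A.tgt)
    (h₂' : m' ≫ A.src = n' ≫ A.tgt) (h₃' : lm' ≫ A.src = n' ≫ A.tgt)
    (h₄' : l' ≫ A.src = mn' ≫ A.tgt)
    (e₁' : A.compAt l' m' h₁' = lm') (e₂' : A.compAt m' n' h₂' = mn')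
    (e₃' : A.compAt lm' n' h₃' = lmn') (e₄' : A.compAt l' mn' h₄' = lmn')
    (f : I.at' l ⟶ I.at' l') (g : I.at' m ⟶ I.at' m') (k : I.at' n ⟶ I.at' n') :
    I.mulHom h₃ e₃ h₃' e₃' (I.mulHom h₁ e₁ h₁' e₁' f g) k =
      I.mulHom h₄ e₄ h₄' e₄' f (I.mulHom h₂ e₂ h₂' e₂' g k) := by
  have a := I.mul_assoc l m n lm mn lmn h₁ h₂ h₃ h₄ e₁ e₂ e₃ e₄
  have a' := I.mul_assoc l' m' n' lm' mn' lmn' h₁' h₂' h₃' h₄' e₁' e₂' e₃' e₄'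
  have b : (I.mulAt lm n lmn h₃ e₃).inv ≫ ((I.mulAt l m lm h₁ e₁).inv ▷ I.at' n) =
      (I.mulAt l mn lmn h₄ e₄).inv ≫ (I.at' l ◁ (I.mulAt m n mn h₂ e₂).inv) ≫ (α_ _ _ _).inv := by
    exact mon_aux₀ a
  have c₁ : (I.mulHom h₁ e₁ h₁' e₁' f g ⊗ₘ k) = ((I.mulAt l m lm h₁ e₁).inv ▷ I.at' n) ≫
      ((f ⊗ₘ g) ⊗ₘ k) ≫ ((I.mulAt l' m' lm' h₁' e₁').hom ▷ I.at' n') := by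
    exact mon_aux₁ _ _ _ _ _
  have c₂ : (f ⊗ₘ I.mulHom h₂ e₂ h₂' e₂' g k) = (I.at' l ◁ (I.mulAt m n mn h₂ e₂).inv) ≫
      (f ⊗ₘ (g ⊗ₘ k)) ≫ (I.at' l' ◁ (I.mulAt m' n' mn' h₂' e₂').hom) := by
    exact mon_aux₂ _ _ _ _ _
  rw [mulHom, c₁, mulHom, c₂]
  simp only [assoc]
  rw [a', reassoc_of% b, associator_naturality_assoc]
  simp

theorem unit_val (p : W ⟶ A.vert) :
    (𝟙_ (Fam V.toIntCat W)).val = (V.tenAt I.ten (p ≫ A.ident)).val := by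
  rw [IntMonCat.tenAt_val, assoc, I.ten_ident, IntMonCat.tensorUnit_val, ← assoc,
    toUnit_unique (p ≫ toUnit _) (toUnit W)]

theorem eqIso_unit_comp {i i' : W ⟶ A.edge} (hk : (𝟙_ (Fam V.toIntCat W)).val = (I.at' i).val)
    (hk' : (𝟙_ (Fam V.toIntCat W)).val = (I.at' i').val) (j : I.at' i ⟶ I.at' i')
    (hj : j.val = toUnit W ≫ V.unit ≫ V.ident) :
    (Fam.eqIso hk).hom ≫ j = (Fam.eqIso hk').hom := by
  apply Fam.hom_ext
  rw [Fam.eqIso_comp_val, hj]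
  exact (assoc _ _ _).symm

theorem mon_aux₃ {C : Type*} [Category* C] [MonoidalCategory C] {x y i i' : C}
    {a : i ⊗ x ≅ x} {b : i' ⊗ y ≅ y} {e : 𝟙_ C ≅ i} {e' : 𝟙_ C ≅ i'}
    (ha : (e.hom ▷ x) ≫ a.hom = (λ_ x).hom) (hb : (e'.hom ▷ y) ≫ b.hom = (λ_ y).hom) (f : x ⟶ y)
    (j : i ⟶ i') (hj : e.hom ≫ j = e'.hom) : a.inv ≫ (j ⊗ₘ f) ≫ b.hom = f := by
  rw [Iso.inv_comp_eq, ← cancel_epi (e.hom ▷ x), reassoc_of% ha, MonoidalCategory.tensorHom_def,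
    assoc, ← comp_whiskerRight_assoc, hj, ← whisker_exchange_assoc, hb, leftUnitor_naturality]

theorem mon_aux₄ {C : Type*} [Category* C] [MonoidalCategory C] {x y i i' : C}
    {a : x ⊗ i ≅ x} {b : y ⊗ i' ≅ y} {e : 𝟙_ C ≅ i} {e' : 𝟙_ C ≅ i'}
    (ha : (x ◁ e.hom) ≫ a.hom = (ρ_ x).hom) (hb : (y ◁ e'.hom) ≫ b.hom = (ρ_ y).hom) (f : x ⟶ y)
    (j : i ⟶ i') (hj : e.hom ≫ j = e'.hom) : a.inv ≫ (f ⊗ₘ j) ≫ b.hom = f := by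
  rw [Iso.inv_comp_eq, ← cancel_epi (x ◁ e.hom), reassoc_of% ha, MonoidalCategory.tensorHom_def',
    assoc, ← whiskerLeft_comp_assoc, hj, whisker_exchange_assoc, hb, rightUnitor_naturality]

theorem mulHom_ident_left {i l i' l' : W ⟶ A.edge} (h : i ≫ A.src = l ≫ A.tgt)
    (e : A.compAt i l h = l) (h' : i' ≫ A.src = l' ≫ A.tgt) (e' : A.compAt i' l' h' = l')
    (hi : i = l ≫ A.tgt ≫ A.ident) (hi' : i' = l' ≫ A.tgt ≫ A.ident)
    (f : I.at' l ⟶ I.at' l') (j : I.at' i ⟶ I.at' i') (hj : j.val = toUnit W ≫ V.unit ≫ V.ident) :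
    I.mulHom h e h' e' j f = f := by
  have hk : (𝟙_ (Fam V.toIntCat W)).val = (V.tenAt I.ten i).val := by
    rw [hi, ← assoc]; exact I.unit_val _
  have hk' : (𝟙_ (Fam V.toIntCat W)).val = (V.tenAt I.ten i').val := by
    rw [hi', ← assoc]; exact I.unit_val _
  exact mon_aux₃ (I.ident_mul i l h e hk hi) (I.ident_mul i' l' h' e' hk' hi') f j
    (I.eqIso_unit_comp hk hk' j hj)

theorem mulHom_ident_right {i l i' l' : W ⟶ A.edge} (h : l ≫ A.src = i ≫ A.tgt)
    (e : A.compAt l i h = l) (h' : l' ≫ A.src = i' ≫ A.tgt) (e' : A.compAt l' i' h' = l')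
    (hi : i = l ≫ A.src ≫ A.ident) (hi' : i' = l' ≫ A.src ≫ A.ident)
    (f : I.at' l ⟶ I.at' l') (j : I.at' i ⟶ I.at' i') (hj : j.val = toUnit W ≫ V.unit ≫ V.ident) :
    I.mulHom h e h' e' f j = f := by
  have hk : (𝟙_ (Fam V.toIntCat W)).val = (V.tenAt I.ten i).val := by
    rw [hi, ← assoc]; exact I.unit_val _
  have hk' : (𝟙_ (Fam V.toIntCat W)).val = (V.tenAt I.ten i').val := by
    rw [hi', ← assoc]; exact I.unit_val _
  exact mon_aux₄ (I.mul_ident l i h e hk hi) (I.mul_ident l' i' h' e' hk' hi') f j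
    (I.eqIso_unit_comp hk hk' j hj)

end IteratedTensor

end Iterated

/-! ### The multicategory induced by an internal monoidal category -/

section Induced

variable {E : Type u} [Category.{v} E] [CartesianMonoidalCategory E] [HasPullbacks E]
  {V : IntMonCat E} {A : IntCat E} {W W' : E}

namespace IteratedTensor

variable {η : bouquet V.vert ⟶ A.toIntGraph} (I : IteratedTensor V A η)

/-- The graph with one vertex whose edges are the pairs of a list `l` of objects of `V` and an arrow
`⊗ l ⟶ v` of `V`. -/
noncomputable def ops : IntGraph E := IntGraph.pb I.ten (bouquetMap V.src)

/-- The list of inputs. -/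
noncomputable def opsSrc : I.ops ⟶ A.toIntGraph := IntGraph.pbFst _ _

/-- The underlying arrow of `V`. -/
noncomputable def opsArr : I.ops.edge ⟶ V.edge := (IntGraph.pbSnd I.ten (bouquetMap V.src)).e

/-- The output. -/
noncomputable def opsTgt : I.ops ⟶ bouquet V.vert := bouquetLift (I.opsArr ≫ V.tgt)

theorem opsArr_src : I.opsArr ≫ V.src = I.opsSrc.e ≫ I.ten.e :=
  (congrArg IntGraph.Hom.e (IntGraph.pb_condition I.ten (bouquetMap V.src))).symm

/-- The morphism of graphs given by a list of objects and an arrow of `V`. -/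
noncomputable def opsLift {G : IntGraph E} (l : G ⟶ A.toIntGraph) (f : G.edge ⟶ V.edge)
    (h : l.e ≫ I.ten.e = f ≫ V.src) : G ⟶ I.ops :=
  IntGraph.pbLift l (bouquetLift f) (bouquet_hom_ext h)

theorem opsLift_src {G : IntGraph E} (l : G ⟶ A.toIntGraph) (f : G.edge ⟶ V.edge)
    (h : l.e ≫ I.ten.e = f ≫ V.src) : I.opsLift l f h ≫ I.opsSrc = l := IntGraph.pbLift_fst _ _ _

theorem opsLift_arr {G : IntGraph E} (l : G ⟶ A.toIntGraph) (f : G.edge ⟶ V.edge)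
    (h : l.e ≫ I.ten.e = f ≫ V.src) : (I.opsLift l f h).e ≫ I.opsArr = f :=
  congrArg IntGraph.Hom.e (IntGraph.pbLift_snd l (bouquetLift f) (bouquet_hom_ext h))

theorem ops_hom_ext {G : IntGraph E} {a b : G ⟶ I.ops} (h : a ≫ I.opsSrc = b ≫ I.opsSrc)
    (h' : a.e ≫ I.opsArr = b.e ≫ I.opsArr) : a = b :=
  IntGraph.pb_hom_ext h (bouquet_hom_ext h')

/-- The underlying graph of the category of lists of objects of `V`, whose edges are the triples of
lists `l`, `m` and an arrow `⊗ l ⟶ ⊗ m` of `V`. -/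
noncomputable def stGraph : IntGraph E := IntGraph.pb I.opsTgt I.ten

/-- The list that is the domain. -/
noncomputable def stDom : I.stGraph ⟶ A.toIntGraph := IntGraph.pbFst _ _ ≫ I.opsSrc

/-- The list that is the codomain. -/
noncomputable def stCod : I.stGraph ⟶ A.toIntGraph := IntGraph.pbSnd _ _

/-- The underlying arrow of `V`. -/
noncomputable def stArr : I.stGraph.edge ⟶ V.edge := (IntGraph.pbFst I.opsTgt I.ten).e ≫ I.opsArr

theorem stArr_src : I.stArr ≫ V.src = I.stDom.e ≫ I.ten.e := by
  exact (assoc _ _ _).trans ((congrArg (_ ≫ ·) I.opsArr_src).trans (assoc _ _ _).symm)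

theorem stArr_tgt : I.stArr ≫ V.tgt = I.stCod.e ≫ I.ten.e :=
  (assoc _ _ _).trans (congrArg IntGraph.Hom.e (IntGraph.pb_condition I.opsTgt I.ten))

theorem st_vert_ext {a b : W ⟶ I.stGraph.vert} (h : a ≫ I.stDom.v = b ≫ I.stDom.v)
    (h' : a ≫ I.stCod.v = b ≫ I.stCod.v) : a = b := by
  refine pullback.hom_ext ?_ h'
  refine pullback.hom_ext ?_ (toUnit_unique _ _)
  exact (assoc _ _ _).trans (h.trans (assoc _ _ _).symm)

theorem st_edge_ext {a b : W ⟶ I.stGraph.edge} (h : a ≫ I.stDom.e = b ≫ I.stDom.e)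
    (h' : a ≫ I.stCod.e = b ≫ I.stCod.e) (h'' : a ≫ I.stArr = b ≫ I.stArr) : a = b := by
  refine pullback.hom_ext ?_ h'
  refine pullback.hom_ext ?_ ?_
  · exact (assoc _ _ _).trans (h.trans (assoc _ _ _).symm)
  · exact (assoc _ _ _).trans (h''.trans (assoc _ _ _).symm)

/-- The family of edges given by families of lists `l`, `m` and of arrows `⊗ l ⟶ ⊗ m`. -/
noncomputable def stMk (l m : W ⟶ A.edge) (f : I.at' l ⟶ I.at' m) : W ⟶ I.stGraph.edge :=
  pullback.lift (f := I.opsTgt.e) (g := I.ten.e)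
    (pullback.lift (f := I.ten.e) (g := V.src) l f.val f.src_eq.symm) m
    (((assoc _ _ _).symm.trans (congrArg (· ≫ V.tgt) (pullback.lift_snd _ _ _))).trans f.tgt_eq)

theorem stMk_dom (l m : W ⟶ A.edge) (f : I.at' l ⟶ I.at' m) : I.stMk l m f ≫ I.stDom.e = l :=
  ((assoc _ _ _).symm.trans (congrArg (· ≫ _) (pullback.lift_fst _ _ _))).trans
    (pullback.lift_fst _ _ _)

theorem stMk_cod (l m : W ⟶ A.edge) (f : I.at' l ⟶ I.at' m) : I.stMk l m f ≫ I.stCod.e = m :=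
  pullback.lift_snd _ _ _

theorem stMk_arr (l m : W ⟶ A.edge) (f : I.at' l ⟶ I.at' m) : I.stMk l m f ≫ I.stArr = f.val :=
  ((assoc _ _ _).symm.trans (congrArg (· ≫ _) (pullback.lift_fst _ _ _))).trans
    (pullback.lift_snd _ _ _)

/-- The family of arrows `⊗ l ⟶ ⊗ m` underlying a family of edges. -/
noncomputable def stHom (a : W ⟶ I.stGraph.edge) :
    I.at' (a ≫ I.stDom.e) ⟶ I.at' (a ≫ I.stCod.e) :=
  ⟨a ≫ I.stArr, by rw [assoc, stArr_src, IntMonCat.tenAt_val, assoc],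
    by rw [assoc, stArr_tgt, IntMonCat.tenAt_val, assoc]⟩

theorem stHom_val (a : W ⟶ I.stGraph.edge) : (I.stHom a).val = a ≫ I.stArr := rfl

theorem st_dom_composable {a b : W ⟶ I.stGraph.edge} (h : a ≫ I.stGraph.src = b ≫ I.stGraph.tgt) :
    (a ≫ I.stDom.e) ≫ A.src = (b ≫ I.stDom.e) ≫ A.tgt := by
  rw [assoc, assoc, I.stDom.src_comm, I.stDom.tgt_comm, ← assoc, h, assoc]

theorem st_cod_composable {a b : W ⟶ I.stGraph.edge} (h : a ≫ I.stGraph.src = b ≫ I.stGraph.tgt) :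
    (a ≫ I.stCod.e) ≫ A.src = (b ≫ I.stCod.e) ≫ A.tgt := by
  rw [assoc, assoc, I.stCod.src_comm, I.stCod.tgt_comm, ← assoc, h, assoc]

/-- The composite of two families of edges, which is their tensor product. -/
noncomputable def stComp (a b : W ⟶ I.stGraph.edge) (h : a ≫ I.stGraph.src = b ≫ I.stGraph.tgt) :
    W ⟶ I.stGraph.edge :=
  I.stMk (A.compAt _ _ (I.st_dom_composable h)) (A.compAt _ _ (I.st_cod_composable h))
    (I.mulHom (I.st_dom_composable h) rfl (I.st_cod_composable h) rfl (I.stHom a) (I.stHom b))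

theorem pre_stComp (r : W' ⟶ W) (a b : W ⟶ I.stGraph.edge)
    (h : a ≫ I.stGraph.src = b ≫ I.stGraph.tgt)
    (h' : (r ≫ a) ≫ I.stGraph.src = (r ≫ b) ≫ I.stGraph.tgt) :
    r ≫ I.stComp a b h = I.stComp (r ≫ a) (r ≫ b) h' := by
  apply st_edge_ext
  · rw [assoc, stComp, stMk_dom, A.pre_compAt, stComp, stMk_dom]
    exact A.compAt_congr (assoc _ _ _).symm (assoc _ _ _).symm _
  · rw [assoc, stComp, stMk_cod, A.pre_compAt, stComp, stMk_cod]
    exact A.compAt_congr (assoc _ _ _).symm (assoc _ _ _).symm _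
  · rw [assoc, stComp, stMk_arr, stComp, stMk_arr]
    exact I.mulHom_re r _ _ _ _ _ _ _ _ _ _ _ _ (assoc _ _ _).symm (assoc _ _ _).symm
      (assoc _ _ _).symm (assoc _ _ _).symm (assoc _ _ _).symm (assoc _ _ _).symm

theorem stComp_congr {a b a' b' : W ⟶ I.stGraph.edge} (ha : a = a') (hb : b = b')
    (h : a ≫ I.stGraph.src = b ≫ I.stGraph.tgt) (h' : a' ≫ I.stGraph.src = b' ≫ I.stGraph.tgt) :
    I.stComp a b h = I.stComp a' b' h' := by
  subst ha hb; rfl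

theorem stMk_src_eq {l m : W ⟶ A.edge} (f : I.at' l ⟶ I.at' m) (a : W ⟶ I.stGraph.vert)
    (hl : l ≫ A.src = a ≫ I.stDom.v) (hm : m ≫ A.src = a ≫ I.stCod.v) :
    I.stMk l m f ≫ I.stGraph.src = a := by
  apply st_vert_ext
  · rw [assoc, ← I.stDom.src_comm, ← assoc, stMk_dom, hl]
  · rw [assoc, ← I.stCod.src_comm, ← assoc, stMk_cod, hm]

theorem stMk_tgt_eq {l m : W ⟶ A.edge} (f : I.at' l ⟶ I.at' m) (a : W ⟶ I.stGraph.vert)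
    (hl : l ≫ A.tgt = a ≫ I.stDom.v) (hm : m ≫ A.tgt = a ≫ I.stCod.v) :
    I.stMk l m f ≫ I.stGraph.tgt = a := by
  apply st_vert_ext
  · rw [assoc, ← I.stDom.tgt_comm, ← assoc, stMk_dom, hl]
  · rw [assoc, ← I.stCod.tgt_comm, ← assoc, stMk_cod, hm]

/-- The identity of the tensor unit, as a family of arrows between tensor products of lists that are
identities of `A`. -/
noncomputable def unitHom (p q : W ⟶ A.vert) : I.at' (p ≫ A.ident) ⟶ I.at' (q ≫ A.ident) :=
  ⟨toUnit W ≫ V.unit ≫ V.ident, by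
    rw [← I.unit_val, IntMonCat.tensorUnit_val, assoc, assoc, V.ident_src, comp_id], by
    rw [← I.unit_val, IntMonCat.tensorUnit_val, assoc, assoc, V.ident_tgt, comp_id]⟩

/-- The family of identity edges. -/
noncomputable def stIdent : I.stGraph.vert ⟶ I.stGraph.edge :=
  I.stMk (I.stDom.v ≫ A.ident) (I.stCod.v ≫ A.ident) (I.unitHom _ _)

theorem stComp_dom (a b : W ⟶ I.stGraph.edge) (h : a ≫ I.stGraph.src = b ≫ I.stGraph.tgt) :
    I.stComp a b h ≫ I.stDom.e = A.compAt _ _ (I.st_dom_composable h) := I.stMk_dom _ _ _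

theorem stComp_cod (a b : W ⟶ I.stGraph.edge) (h : a ≫ I.stGraph.src = b ≫ I.stGraph.tgt) :
    I.stComp a b h ≫ I.stCod.e = A.compAt _ _ (I.st_cod_composable h) := I.stMk_cod _ _ _

theorem stComp_arr (a b : W ⟶ I.stGraph.edge) (h : a ≫ I.stGraph.src = b ≫ I.stGraph.tgt) :
    I.stComp a b h ≫ I.stArr = (I.mulHom (I.st_dom_composable h) rfl (I.st_cod_composable h) rfl
      (I.stHom a) (I.stHom b)).val := I.stMk_arr _ _ _

theorem stIdent_dom (a : W ⟶ I.stGraph.vert) :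
    (a ≫ I.stIdent) ≫ I.stDom.e = (a ≫ I.stDom.v) ≫ A.ident := by
  rw [assoc, stIdent, stMk_dom, assoc]

theorem stIdent_cod (a : W ⟶ I.stGraph.vert) :
    (a ≫ I.stIdent) ≫ I.stCod.e = (a ≫ I.stCod.v) ≫ A.ident := by
  rw [assoc, stIdent, stMk_cod, assoc]

theorem stIdent_arr (a : W ⟶ I.stGraph.vert) :
    (a ≫ I.stIdent) ≫ I.stArr = toUnit W ≫ V.unit ≫ V.ident := by
  rw [assoc, stIdent, stMk_arr, unitHom, ← assoc, toUnit_unique (a ≫ toUnit _) (toUnit W)]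

theorem lift_stComp (a b : W ⟶ I.stGraph.edge) (h : a ≫ I.stGraph.src = b ≫ I.stGraph.tgt) :
    pullback.lift a b h ≫ I.stComp (pullback.fst I.stGraph.src I.stGraph.tgt)
      (pullback.snd I.stGraph.src I.stGraph.tgt) pullback.condition = I.stComp a b h := by
  rw [I.pre_stComp _ _ _ _ (by rw [pullback.lift_fst, pullback.lift_snd, h])]
  exact I.stComp_congr (pullback.lift_fst _ _ _) (pullback.lift_snd _ _ _) _ _

theorem stComp_ident_left (a b : W ⟶ I.stGraph.edge) (hb : b = a ≫ I.stGraph.tgt ≫ I.stIdent)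
    (h : b ≫ I.stGraph.src = a ≫ I.stGraph.tgt) : I.stComp b a h = a := by
  have h₁ : b ≫ I.stDom.e = (a ≫ I.stDom.e) ≫ A.tgt ≫ A.ident := by
    rw [hb, ← assoc, stIdent_dom, assoc a, ← I.stDom.tgt_comm]
    simp only [assoc]
  have h₂ : b ≫ I.stCod.e = (a ≫ I.stCod.e) ≫ A.tgt ≫ A.ident := by
    rw [hb, ← assoc, stIdent_cod, assoc a, ← I.stCod.tgt_comm]
    simp only [assoc]
  have k₁ : A.compAt _ _ (I.st_dom_composable h) = a ≫ I.stDom.e :=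
    (A.compAt_congr h₁ rfl _).trans (A.compAt_ident_left _)
  have k₂ : A.compAt _ _ (I.st_cod_composable h) = a ≫ I.stCod.e :=
    (A.compAt_congr h₂ rfl _).trans (A.compAt_ident_left _)
  apply st_edge_ext
  · rw [stComp_dom, k₁]
  · rw [stComp_cod, k₂]
  · rw [stComp_arr]
    refine (I.mulHom_val_congr (I.st_dom_composable h) rfl (I.st_cod_composable h) rfl
      (I.st_dom_composable h) k₁ (I.st_cod_composable h) k₂ rfl rfl rfl rfl rfl rfl).trans ?_
    refine congrArg Fam.Hom.val (I.mulHom_ident_left _ k₁ _ k₂ h₁ h₂ (I.stHom a) (I.stHom b) ?_)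
    rw [stHom_val, hb, ← assoc, stIdent_arr]

theorem stComp_ident_right (a b : W ⟶ I.stGraph.edge) (hb : b = a ≫ I.stGraph.src ≫ I.stIdent)
    (h : a ≫ I.stGraph.src = b ≫ I.stGraph.tgt) : I.stComp a b h = a := by
  have h₁ : b ≫ I.stDom.e = (a ≫ I.stDom.e) ≫ A.src ≫ A.ident := by
    rw [hb, ← assoc, stIdent_dom, assoc a, ← I.stDom.src_comm]
    simp only [assoc]
  have h₂ : b ≫ I.stCod.e = (a ≫ I.stCod.e) ≫ A.src ≫ A.ident := by
    rw [hb, ← assoc, stIdent_cod, assoc a, ← I.stCod.src_comm]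
    simp only [assoc]
  have k₁ : A.compAt _ _ (I.st_dom_composable h) = a ≫ I.stDom.e :=
    (A.compAt_congr rfl h₁ _).trans (A.compAt_ident_right _)
  have k₂ : A.compAt _ _ (I.st_cod_composable h) = a ≫ I.stCod.e :=
    (A.compAt_congr rfl h₂ _).trans (A.compAt_ident_right _)
  apply st_edge_ext
  · rw [stComp_dom, k₁]
  · rw [stComp_cod, k₂]
  · rw [stComp_arr]
    refine (I.mulHom_val_congr (I.st_dom_composable h) rfl (I.st_cod_composable h) rfl
      (I.st_dom_composable h) k₁ (I.st_cod_composable h) k₂ rfl rfl rfl rfl rfl rfl).trans ?_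
    refine congrArg Fam.Hom.val (I.mulHom_ident_right _ k₁ _ k₂ h₁ h₂ (I.stHom a) (I.stHom b) ?_)
    rw [stHom_val, hb, ← assoc, stIdent_arr]

theorem stComp_assoc (a b c : W ⟶ I.stGraph.edge) (h : a ≫ I.stGraph.src = b ≫ I.stGraph.tgt)
    (h' : b ≫ I.stGraph.src = c ≫ I.stGraph.tgt)
    (k : I.stComp a b h ≫ I.stGraph.src = c ≫ I.stGraph.tgt)
    (k' : a ≫ I.stGraph.src = I.stComp b c h' ≫ I.stGraph.tgt) :
    I.stComp (I.stComp a b h) c k = I.stComp a (I.stComp b c h') k' := by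
  have e₁ := I.stComp_dom a b h
  have e₂ := I.stComp_dom b c h'
  have e₁' := I.stComp_cod a b h
  have e₂' := I.stComp_cod b c h'
  have e₃ : A.compAt _ _ (I.st_dom_composable k) = A.compAt _ _ (I.st_dom_composable k') :=
    ((A.compAt_congr e₁ rfl _).trans (A.compAt_assoc _ _ _ (I.st_dom_composable h)
      (I.st_dom_composable h'))).trans (A.compAt_congr rfl e₂ _).symm
  have e₃' : A.compAt _ _ (I.st_cod_composable k) = A.compAt _ _ (I.st_cod_composable k') :=
    ((A.compAt_congr e₁' rfl _).trans (A.compAt_assoc _ _ _ (I.st_cod_composable h)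
      (I.st_cod_composable h'))).trans (A.compAt_congr rfl e₂' _).symm
  apply st_edge_ext
  · exact (I.stComp_dom _ _ _).trans (e₃.trans (I.stComp_dom _ _ _).symm)
  · exact (I.stComp_cod _ _ _).trans (e₃'.trans (I.stComp_cod _ _ _).symm)
  · rw [stComp_arr, stComp_arr]
    have key := congrArg Fam.Hom.val (I.mulHom_assoc (I.st_dom_composable h)
      (I.st_dom_composable h') (I.st_dom_composable k) (I.st_dom_composable k') e₁.symm e₂.symm e₃
      rfl (I.st_cod_composable h) (I.st_cod_composable h') (I.st_cod_composable k)
      (I.st_cod_composable k') e₁'.symm e₂'.symm e₃' rfl (I.stHom a) (I.stHom b) (I.stHom c))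
    refine Eq.trans ?_ (key.trans ?_)
    · exact I.mulHom_val_congr _ rfl _ rfl _ _ _ _ rfl rfl rfl rfl
        ((I.stComp_arr a b h).trans (I.mulHom_val_congr _ rfl _ rfl _ _ _ _ rfl rfl rfl rfl rfl rfl))
        rfl
    · exact (I.mulHom_val_congr _ rfl _ rfl _ _ _ _ rfl rfl rfl rfl rfl
        ((I.stComp_arr b c h').trans (I.mulHom_val_congr _ rfl _ rfl _ _ _ _ rfl rfl rfl rfl rfl
          rfl))).symm

end IteratedTensor

end Induced

section Multicategory

variable {E : Type u} [Category.{v} E] [CartesianMonoidalCategory E] [HasPullbacks E]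
  {V : IntMonCat E} {A : IntCat E} {W W' : E}

namespace IteratedTensor

variable {η : bouquet V.vert ⟶ A.toIntGraph} (I : IteratedTensor V A η)

/-- The internal category of lists of objects of `V`: its arrows are the triples of lists `l`, `m`
and an arrow `⊗ l ⟶ ⊗ m` of `V`, and its composition is induced by the composition of lists and by
the tensor product of arrows of `V`. -/
noncomputable def stCat : IntCat E where
  toIntGraph := I.stGraph
  ident := I.stIdent
  comp := I.stComp (pullback.fst _ _) (pullback.snd _ _) pullback.condition
  ident_src := I.stMk_src_eq _ _ (by rw [assoc, A.ident_src, comp_id, id_comp])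
    (by rw [assoc, A.ident_src, comp_id, id_comp])
  ident_tgt := I.stMk_tgt_eq _ _ (by rw [assoc, A.ident_tgt, comp_id, id_comp])
    (by rw [assoc, A.ident_tgt, comp_id, id_comp])
  comp_src := I.stMk_src_eq _ _
    (by rw [A.compAt_src, assoc, assoc, I.stDom.src_comm])
    (by rw [A.compAt_src, assoc, assoc, I.stCod.src_comm])
  comp_tgt := I.stMk_tgt_eq _ _
    (by rw [A.compAt_tgt, assoc, assoc, I.stDom.tgt_comm])
    (by rw [A.compAt_tgt, assoc, assoc, I.stCod.tgt_comm])
  ident_comp f h := by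
    rw [lift_stComp]
    exact I.stComp_ident_left _ _ rfl h
  comp_ident f h := by
    rw [lift_stComp]
    exact I.stComp_ident_right _ _ rfl h
  comp_assoc k g f hkg hgf h₁ h₂ := by
    have e₁ := I.lift_stComp k g hkg
    have e₂ := I.lift_stComp g f hgf
    refine (I.lift_stComp _ _ h₁).trans (Eq.trans ?_ (I.lift_stComp _ _ h₂).symm)
    refine (I.stComp_congr e₁ rfl h₁ (by rw [← e₁, h₁])).trans (Eq.trans ?_
      (I.stComp_congr rfl e₂ h₂ (by rw [← e₂, h₂])).symm)
    exact I.stComp_assoc _ _ _ _ _ _ _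

theorem stCat_compAt (a b : W ⟶ I.stGraph.edge) (h : a ≫ I.stGraph.src = b ≫ I.stGraph.tgt) :
    I.stCat.compAt a b h = I.stComp a b h := I.lift_stComp a b h

/-- The internal functor that sends an arrow of the category of lists to its domain. -/
noncomputable def stDomFunctor : I.stCat ⟶ A where
  toHom := I.stDom
  map_ident := I.stMk_dom _ _ _
  map_comp g f h _ := (congrArg (· ≫ _) (I.stCat_compAt g f h)).trans (I.stComp_dom g f h)

/-- The internal functor that sends an arrow of the category of lists to its codomain. -/
noncomputable def stCodFunctor : I.stCat ⟶ A where
  toHom := I.stCod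
  map_ident := I.stMk_cod _ _ _
  map_comp g f h _ := (congrArg (· ≫ _) (I.stCat_compAt g f h)).trans (I.stComp_cod g f h)

/-- The morphism to the graph of lists given by two morphisms to `A` and a family of arrows. -/
noncomputable def stLift {G : IntGraph E} (l m : G ⟶ A.toIntGraph) (f : G.edge ⟶ V.edge)
    (h : l.e ≫ I.ten.e = f ≫ V.src) (h' : f ≫ V.tgt = m.e ≫ I.ten.e) : G ⟶ I.stGraph :=
  IntGraph.pbLift (I.opsLift l f h) m (bouquet_hom_ext
    ((assoc _ _ _).symm.trans ((congrArg (· ≫ V.tgt) (I.opsLift_arr l f h)).trans h')))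

section

variable {G : IntGraph E} (l m : G ⟶ A.toIntGraph) (f : G.edge ⟶ V.edge)
    (h : l.e ≫ I.ten.e = f ≫ V.src) (h' : f ≫ V.tgt = m.e ≫ I.ten.e)

theorem stLift_dom : I.stLift l m f h h' ≫ I.stDom = l :=
  ((assoc _ _ _).symm.trans (congrArg (· ≫ _) (IntGraph.pbLift_fst _ _ _))).trans
    (I.opsLift_src _ _ _)

theorem stLift_cod : I.stLift l m f h h' ≫ I.stCod = m := IntGraph.pbLift_snd _ _ _

theorem stLift_arr : (I.stLift l m f h h').e ≫ I.stArr = f :=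
  ((assoc _ _ _).symm.trans (congrArg (· ≫ _)
    (congrArg IntGraph.Hom.e (IntGraph.pbLift_fst _ _ _)))).trans (I.opsLift_arr _ _ _)

end

theorem st_hom_ext {G : IntGraph E} {a b : G ⟶ I.stGraph} (h : a ≫ I.stDom = b ≫ I.stDom)
    (h' : a ≫ I.stCod = b ≫ I.stCod) (h'' : a.e ≫ I.stArr = b.e ≫ I.stArr) : a = b :=
  IntGraph.hom_ext
    (I.st_vert_ext (congrArg IntGraph.Hom.v h) (congrArg IntGraph.Hom.v h'))
    (I.st_edge_ext (congrArg IntGraph.Hom.e h) (congrArg IntGraph.Hom.e h') h'')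

/-- Internal functors to the category of lists. -/
noncomputable def stFunctor {B : IntCat E} (φ : B.toIntGraph ⟶ I.stGraph) (l m : B ⟶ A)
    (hl : φ ≫ I.stDom = l.toHom) (hm : φ ≫ I.stCod = m.toHom)
    (hi : B.ident ≫ φ.e ≫ I.stArr = toUnit _ ≫ V.unit ≫ V.ident)
    (hc : ∀ {W : E} (g f : W ⟶ B.edge) (h : g ≫ B.src = f ≫ B.tgt)
      (h' : (g ≫ φ.e) ≫ I.stGraph.src = (f ≫ φ.e) ≫ I.stGraph.tgt),
      B.compAt g f h ≫ φ.e ≫ I.stArr = I.stComp (g ≫ φ.e) (f ≫ φ.e) h' ≫ I.stArr) :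
    B ⟶ I.stCat where
  toHom := φ
  map_ident := by
    have hle := congrArg IntGraph.Hom.e hl
    have hme := congrArg IntGraph.Hom.e hm
    have hlv := congrArg IntGraph.Hom.v hl
    have hmv := congrArg IntGraph.Hom.v hm
    refine I.st_edge_ext ?_ ?_ ?_
    · refine Eq.trans ?_ (I.stIdent_dom φ.v).symm
      refine ((assoc _ _ _).trans (congrArg (_ ≫ ·) hle)).trans (l.map_ident.trans ?_)
      exact congrArg (· ≫ _) hlv.symm
    · refine Eq.trans ?_ (I.stIdent_cod φ.v).symm
      refine ((assoc _ _ _).trans (congrArg (_ ≫ ·) hme)).trans (m.map_ident.trans ?_)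
      exact congrArg (· ≫ _) hmv.symm
    · exact (assoc _ _ _).trans (hi.trans (I.stIdent_arr φ.v).symm)
  map_comp g f h h' := by
    have hle : φ.e ≫ I.stDom.e = l.e := congrArg IntGraph.Hom.e hl
    have hme : φ.e ≫ I.stCod.e = m.e := congrArg IntGraph.Hom.e hm
    have conv : ∀ (n : B ⟶ A), (g ≫ n.e) ≫ A.src = (f ≫ n.e) ≫ A.tgt := by
      intro n
      rw [assoc, assoc, n.src_comm, n.tgt_comm, ← assoc, h, assoc]
    refine Eq.trans ?_ (I.stCat_compAt _ _ h').symm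
    refine I.st_edge_ext ?_ ?_ ?_
    · refine Eq.trans ?_ (I.stComp_dom _ _ h').symm
      refine ((assoc _ _ _).trans (congrArg (_ ≫ ·) hle)).trans
        ((l.map_comp g f h (conv l)).trans (A.compAt_congr ?_ ?_ _))
      · exact (congrArg (g ≫ ·) hle.symm).trans (assoc _ _ _).symm
      · exact (congrArg (f ≫ ·) hle.symm).trans (assoc _ _ _).symm
    · refine Eq.trans ?_ (I.stComp_cod _ _ h').symm
      refine ((assoc _ _ _).trans (congrArg (_ ≫ ·) hme)).trans
        ((m.map_comp g f h (conv m)).trans (A.compAt_congr ?_ ?_ _))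
      · exact (congrArg (g ≫ ·) hme.symm).trans (assoc _ _ _).symm
      · exact (congrArg (f ≫ ·) hme.symm).trans (assoc _ _ _).symm
    · exact (assoc _ _ _).trans (hc g f h h')

/-- The morphism of graphs that sends a list `l` to the identity of `⊗ l`. -/
noncomputable def stId : A.toIntGraph ⟶ I.stGraph :=
  I.stLift (𝟙 _) (𝟙 _) (I.ten.e ≫ V.ident)
    (by rw [assoc, V.ident_src, comp_id, IntGraph.id_e, id_comp])
    (by rw [assoc, V.ident_tgt, comp_id, IntGraph.id_e, id_comp])

theorem stId_dom : I.stId ≫ I.stDom = 𝟙 _ := I.stLift_dom _ _ _ _ _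

theorem stId_cod : I.stId ≫ I.stCod = 𝟙 _ := I.stLift_cod _ _ _ _ _

theorem stId_arr : I.stId.e ≫ I.stArr = I.ten.e ≫ V.ident := I.stLift_arr _ _ _ _ _

/-- The internal functor that sends a list `l` to the identity of `⊗ l`. -/
noncomputable def stIdFunctor : A ⟶ I.stCat :=
  I.stFunctor I.stId (𝟙 A) (𝟙 A) I.stId_dom I.stId_cod
    (by rw [stId_arr, ← assoc, I.ten_ident, assoc])
    (fun g f h h' => by
      have hd := congrArg IntGraph.Hom.e I.stId_dom
      have hc := congrArg IntGraph.Hom.e I.stId_cod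
      simp only [IntGraph.comp_e, IntGraph.id_e] at hd hc
      have k : ∀ {W : E} (x : W ⟶ A.edge), (x ≫ I.stId.e) ≫ I.stDom.e = x := by
        intro W x
        rw [assoc, hd, comp_id]
      have k' : ∀ {W : E} (x : W ⟶ A.edge), (x ≫ I.stId.e) ≫ I.stCod.e = x := by
        intro W x
        rw [assoc, hc, comp_id]
      have kf : ∀ {W : E} (x : W ⟶ A.edge),
          (x ≫ I.stId.e) ≫ I.stArr = (x ≫ I.ten.e) ≫ V.ident := by
        intro W x
        rw [assoc, stId_arr, assoc]
      rw [stId_arr, stComp_arr]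
      refine Eq.trans ?_ ((congrArg Fam.Hom.val (I.mulHom_id h rfl)).symm.trans
        (I.mulHom_val_congr _ _ _ _ _ _ _ _ (k g).symm (k' g).symm (k f).symm (k' f).symm
          (kf g).symm (kf f).symm))
      exact (assoc _ _ _).symm)

/-- Two families of edges of the graph of lists such that the domain of the first is the codomain of
the second compose, by composition in `V`. -/
noncomputable def stVert {G : IntGraph E} (φ ψ : G ⟶ I.stGraph) (h : φ ≫ I.stDom = ψ ≫ I.stCod) :
    G ⟶ I.stGraph :=
  I.stLift (ψ ≫ I.stDom) (φ ≫ I.stCod) (V.compAt (φ.e ≫ I.stArr) (ψ.e ≫ I.stArr) (by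
      have he : φ.e ≫ I.stDom.e = ψ.e ≫ I.stCod.e := congrArg IntGraph.Hom.e h
      rw [assoc, assoc, stArr_src, stArr_tgt, ← assoc, ← assoc, he]))
    (by rw [V.compAt_src, assoc, stArr_src, IntGraph.comp_e, assoc])
    (by rw [V.compAt_tgt, assoc, stArr_tgt, IntGraph.comp_e, assoc])

theorem stVert_dom {G : IntGraph E} (φ ψ : G ⟶ I.stGraph) (h : φ ≫ I.stDom = ψ ≫ I.stCod) :
    I.stVert φ ψ h ≫ I.stDom = ψ ≫ I.stDom := I.stLift_dom _ _ _ _ _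

theorem stVert_cod {G : IntGraph E} (φ ψ : G ⟶ I.stGraph) (h : φ ≫ I.stDom = ψ ≫ I.stCod) :
    I.stVert φ ψ h ≫ I.stCod = φ ≫ I.stCod := I.stLift_cod _ _ _ _ _

theorem stVert_composable {G : IntGraph E} {φ ψ : G ⟶ I.stGraph}
    (h : φ ≫ I.stDom = ψ ≫ I.stCod) :
    (φ.e ≫ I.stArr) ≫ V.src = (ψ.e ≫ I.stArr) ≫ V.tgt := by
  have he : φ.e ≫ I.stDom.e = ψ.e ≫ I.stCod.e := congrArg IntGraph.Hom.e h
  rw [assoc, assoc, stArr_src, stArr_tgt, ← assoc, ← assoc, he]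

theorem stVert_arr {G : IntGraph E} (φ ψ : G ⟶ I.stGraph) (h : φ ≫ I.stDom = ψ ≫ I.stCod) :
    (I.stVert φ ψ h).e ≫ I.stArr =
      V.compAt (φ.e ≫ I.stArr) (ψ.e ≫ I.stArr) (I.stVert_composable h) := I.stLift_arr _ _ _ _ _

/-- The interchange law, for families of composable edges. -/
theorem st_interchange {a b a' b' c d : W ⟶ I.stGraph.edge}
    (h : a ≫ I.stGraph.src = b ≫ I.stGraph.tgt) (h' : a' ≫ I.stGraph.src = b' ≫ I.stGraph.tgt)
    (hc : c ≫ I.stGraph.src = d ≫ I.stGraph.tgt)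
    (ka : a ≫ I.stDom.e = a' ≫ I.stCod.e) (kb : b ≫ I.stDom.e = b' ≫ I.stCod.e)
    (c₁ : c ≫ I.stDom.e = a' ≫ I.stDom.e) (c₂ : c ≫ I.stCod.e = a ≫ I.stCod.e)
    (d₁ : d ≫ I.stDom.e = b' ≫ I.stDom.e) (d₂ : d ≫ I.stCod.e = b ≫ I.stCod.e)
    (qa : (a ≫ I.stArr) ≫ V.src = (a' ≫ I.stArr) ≫ V.tgt)
    (qb : (b ≫ I.stArr) ≫ V.src = (b' ≫ I.stArr) ≫ V.tgt)
    (q : (I.stComp a b h ≫ I.stArr) ≫ V.src = (I.stComp a' b' h' ≫ I.stArr) ≫ V.tgt)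
    (hca : c ≫ I.stArr = V.compAt _ _ qa) (hdb : d ≫ I.stArr = V.compAt _ _ qb) :
    V.compAt (I.stComp a b h ≫ I.stArr) (I.stComp a' b' h' ≫ I.stArr) q =
      I.stComp c d hc ≫ I.stArr := by
  let f : I.at' (a' ≫ I.stCod.e) ⟶ I.at' (a ≫ I.stCod.e) :=
    ⟨a ≫ I.stArr, (I.stHom a).src_eq.trans (congrArg (· ≫ I.ten.e) ka), (I.stHom a).tgt_eq⟩
  let g : I.at' (b' ≫ I.stCod.e) ⟶ I.at' (b ≫ I.stCod.e) :=
    ⟨b ≫ I.stArr, (I.stHom b).src_eq.trans (congrArg (· ≫ I.ten.e) kb), (I.stHom b).tgt_eq⟩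
  have e₁ : I.stComp a b h ≫ I.stArr = (I.mulHom (I.st_cod_composable h') rfl
      (I.st_cod_composable h) rfl f g).val :=
    (I.stComp_arr a b h).trans (I.mulHom_val_congr _ _ _ _ _ _ _ _ ka rfl kb rfl rfl rfl)
  have e₂ := I.stComp_arr a' b' h'
  refine (V.compAt_congr e₁ e₂ q).trans ?_
  refine Eq.trans ?_ (I.stComp_arr c d hc).symm
  have key := congrArg Fam.Hom.val (I.mulHom_comp (I.st_dom_composable h') rfl
    (I.st_cod_composable h') rfl (I.st_cod_composable h) rfl (I.stHom a') (I.stHom b') f g)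
  refine Eq.trans ?_ (key.symm.trans ?_)
  · rfl
  · exact I.mulHom_val_congr _ _ _ _ _ _ _ _ c₁.symm c₂.symm d₁.symm d₂.symm hca.symm hdb.symm

/-- The morphism of graphs underlying an internal functor to the category of lists. -/
noncomputable def stMap {B : IntCat E} (F : B ⟶ I.stCat) : B.toIntGraph ⟶ I.stGraph := (IntCat.forget E).map F

theorem stMap_ident {B : IntCat E} (F : B ⟶ I.stCat) :
    B.ident ≫ (I.stMap F).e ≫ I.stArr = toUnit _ ≫ V.unit ≫ V.ident :=
  (assoc _ _ _).symm.trans ((congrArg (· ≫ I.stArr) F.map_ident).trans (I.stIdent_arr F.v))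

theorem stMap_comp {B : IntCat E} (F : B ⟶ I.stCat) (g f : W ⟶ B.edge)
    (h : g ≫ B.src = f ≫ B.tgt)
    (h' : (g ≫ (I.stMap F).e) ≫ I.stGraph.src = (f ≫ (I.stMap F).e) ≫ I.stGraph.tgt) :
    B.compAt g f h ≫ (I.stMap F).e ≫ I.stArr = I.stComp _ _ h' ≫ I.stArr :=
  (assoc _ _ _).symm.trans ((congrArg (· ≫ I.stArr) (F.map_comp g f h h')).trans
    (congrArg (· ≫ I.stArr) (I.stCat_compAt _ _ _)))

theorem map_composable {B : IntCat E} {G : IntGraph E} (φ : B.toIntGraph ⟶ G) (g f : W ⟶ B.edge)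
    (h : g ≫ B.src = f ≫ B.tgt) : (g ≫ φ.e) ≫ G.src = (f ≫ φ.e) ≫ G.tgt := by
  rw [assoc, assoc, φ.src_comm, φ.tgt_comm, ← assoc, h, assoc]

/-- The vertical composite of internal functors to the category of lists. -/
noncomputable def stVertFunctor {B : IntCat E} (F G : B ⟶ I.stCat)
    (h₀ : I.stMap F ≫ I.stDom = I.stMap G ≫ I.stCod) : B ⟶ I.stCat :=
  I.stFunctor (I.stVert (I.stMap F) (I.stMap G) h₀)
    (G ≫ I.stDomFunctor) (F ≫ I.stCodFunctor) (I.stVert_dom _ _ _) (I.stVert_cod _ _ _)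
    (by
      rw [stVert_arr, V.pre_compAt, V.compAt_congr (I.stMap_ident F) (I.stMap_ident G)]
      have := V.compAt_ident_left (toUnit B.vert ≫ V.unit ≫ V.ident)
      refine (V.compAt_congr ?_ rfl _).trans this
      rw [assoc, assoc, ← assoc V.ident, V.ident_tgt, id_comp])
    (fun g f k k' => by
      have hF := map_composable (I.stMap F) g f k
      have hG := map_composable (I.stMap G) g f k
      have he := congrArg IntGraph.Hom.e h₀
      have hd := congrArg IntGraph.Hom.e (I.stVert_dom _ _ h₀)
      have hc := congrArg IntGraph.Hom.e (I.stVert_cod _ _ h₀)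
      have ha := I.stVert_arr _ _ h₀
      simp only [IntGraph.comp_e] at he hd hc
      rw [stVert_arr, V.pre_compAt, V.compAt_congr (I.stMap_comp F g f k hF)
        (I.stMap_comp G g f k hG)]
      have q : ∀ {Y : E} (x : Y ⟶ B.edge), ((x ≫ (I.stMap F).e) ≫ I.stArr) ≫ V.src =
          ((x ≫ (I.stMap G).e) ≫ I.stArr) ≫ V.tgt := by
        intro Y x
        have := I.stVert_composable h₀
        simp only [assoc] at this ⊢
        rw [this]
      refine I.st_interchange hF hG k' ?_ ?_ ?_ ?_ ?_ ?_ (q g) (q f) _ ?_ ?_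
      · rw [assoc, assoc, he]
      · rw [assoc, assoc, he]
      · rw [assoc, assoc, hd]
      · rw [assoc, assoc, hc]
      · rw [assoc, assoc, hd]
      · rw [assoc, assoc, hc]
      · rw [assoc, ha, V.pre_compAt]
        exact V.compAt_congr (assoc _ _ _).symm (assoc _ _ _).symm _
      · rw [assoc, ha, V.pre_compAt]
        exact V.compAt_congr (assoc _ _ _).symm (assoc _ _ _).symm _)

theorem stMap_stIdFunctor_dom : I.stMap I.stIdFunctor ≫ I.stDom = 𝟙 _ := I.stId_dom

theorem stMap_stIdFunctor_cod : I.stMap I.stIdFunctor ≫ I.stCod = 𝟙 _ := I.stId_cod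

theorem stMap_stIdFunctor_arr : (I.stMap I.stIdFunctor).e ≫ I.stArr = I.ten.e ≫ V.ident :=
  I.stId_arr

theorem stMap_stVertFunctor {B : IntCat E} (F G : B ⟶ I.stCat)
    (h₀ : I.stMap F ≫ I.stDom = I.stMap G ≫ I.stCod) :
    I.stMap (I.stVertFunctor F G h₀) = I.stVert (I.stMap F) (I.stMap G) h₀ := rfl

end IteratedTensor

/-! #### The multicategory -/

section

variable {Fr : IntGraph E ⥤ IntCat E} (adj : Fr ⊣ IntCat.forget E)

/-- Internal functors out of a free category are determined by their restriction along the unit. -/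
theorem free_ext {G : IntGraph E} {B : IntCat E} {F F' : Fr.obj G ⟶ B}
    (h : adj.unit.app G ≫ (IntCat.forget E).map F = adj.unit.app G ≫ (IntCat.forget E).map F') :
    F = F' := by
  apply (adj.homEquiv G B).injective
  rw [adj.homEquiv_unit, adj.homEquiv_unit, h]

end

section

variable {Fr : IntGraph E ⥤ IntCat E} (adj : Fr ⊣ IntCat.forget E)

variable (V) in
/-- The free category on the graph `1 ⇇ V₀`, whose arrows are the lists of objects of `V`. -/
def listCat (_ : Fr ⊣ IntCat.forget E) : IntCat E := Fr.obj (bouquet V.vert)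

variable (V) in
/-- The insertion of objects of `V` as lists with one entry. -/
def single : bouquet V.vert ⟶ (listCat V adj).toIntGraph := adj.unit.app (bouquet V.vert)

end

namespace IteratedTensor

variable {Fr : IntGraph E ⥤ IntCat E} {adj : Fr ⊣ IntCat.forget E}
  (I : IteratedTensor V (listCat V adj) (single V adj))

theorem single_ten : (single V adj).e ≫ I.ten.e = 𝟙 _ := congrArg IntGraph.Hom.e I.ten_single

/-- The morphism of graphs that sends `f : ⊗ l ⟶ v` to itself, seen as an arrow `⊗ l ⟶ ⊗ (v)`. -/
noncomputable def stGen : I.ops ⟶ I.stGraph :=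
  I.stLift I.opsSrc (I.opsTgt ≫ single V adj) I.opsArr I.opsArr_src.symm (by
    rw [IntGraph.comp_e, assoc, single_ten, comp_id]
    rfl)

/-- The internal functor from the free category that sends a list `f₁, ..., fₙ`, with
`fᵢ : ⊗ lᵢ ⟶ vᵢ`, to the arrow `f₁ ⊗ ... ⊗ fₙ : ⊗ (l₁ ⋯ lₙ) ⟶ ⊗ (v₁, ..., vₙ)`. -/
noncomputable def tenArrow : Fr.obj I.ops ⟶ I.stCat :=
  (adj.homEquiv I.ops I.stCat).symm I.stGen

theorem unit_tenArrow : adj.unit.app I.ops ≫ I.stMap I.tenArrow = I.stGen := by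
  have := (adj.homEquiv I.ops I.stCat).apply_symm_apply I.stGen
  rwa [adj.homEquiv_unit] at this

end IteratedTensor

end Multicategory

section Multicategory

variable {E : Type u} [Category.{v} E] [CartesianMonoidalCategory E] [HasPullbacks E]
  {V : IntMonCat E}

namespace IteratedTensor

variable {Fr : IntGraph E ⥤ IntCat E} {adj : Fr ⊣ IntCat.forget E}
  (I : IteratedTensor V (listCat V adj) (single V adj))
  {W W' : IntGraph E}

/-- The morphism of graphs underlying `tenArrow`. -/
noncomputable def ten₁ : adj.toMonad.obj I.ops ⟶ I.stGraph := I.stMap I.tenArrow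

theorem unit_ten₁ : adj.toMonad.η.app I.ops ≫ I.ten₁ = I.stGen := I.unit_tenArrow

theorem ten₁_cod : I.ten₁ ≫ I.stCod = adj.toMonad.map I.opsTgt := by
  have : I.tenArrow ≫ I.stCodFunctor = Fr.map I.opsTgt := by
    apply free_ext adj
    exact ((assoc _ _ _).symm.trans (congrArg (· ≫ I.stCod) I.unit_tenArrow)).trans
      ((I.stLift_cod _ _ _ _ _).trans (adj.unit.naturality I.opsTgt))
  exact congrArg (IntCat.forget E).map this

theorem ten₁_dom : I.ten₁ ≫ I.stDom = adj.toMonad.map I.opsSrc ≫ adj.toMonad.μ.app _ := by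
  have : I.tenArrow ≫ I.stDomFunctor = Fr.map I.opsSrc ≫ adj.counit.app _ := by
    apply free_ext adj
    refine ((assoc _ _ _).symm.trans (congrArg (· ≫ I.stDom) I.unit_tenArrow)).trans
      ((I.stLift_dom _ _ _ _ _).trans ?_)
    refine Eq.trans ?_ ((assoc _ _ _).trans (congrArg (adj.unit.app _ ≫ ·)
      ((IntCat.forget E).map_comp _ _).symm))
    refine Eq.trans ?_ (congrArg (· ≫ _) (adj.unit.naturality I.opsSrc))
    refine Eq.trans ?_ (assoc _ _ _).symm
    exact ((congrArg (I.opsSrc ≫ ·) (adj.right_triangle_components _)).trans (comp_id _)).symm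
  exact congrArg (IntCat.forget E).map this

/-- The list of inputs, as a morphism to the value of the monad. -/
noncomputable def mSrc : I.ops ⟶ adj.toMonad.obj (bouquet V.vert) := I.opsSrc

/-- The iterated tensor product, as a morphism from the value of the monad. -/
def mTen : (adj.toMonad.obj (bouquet V.vert)).edge ⟶ V.vert := I.ten.e

theorem opsArr_mSrc : I.opsArr ≫ V.src = I.mSrc.e ≫ I.mTen := I.opsArr_src

theorem mops_ext {a b : W ⟶ I.ops} (h : a ≫ I.mSrc = b ≫ I.mSrc)
    (h' : a.e ≫ I.opsArr = b.e ≫ I.opsArr) : a = b := I.ops_hom_ext h h'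

/-- The arrows `f₁ ⊗ ... ⊗ fₙ` of `V` for lists of operations. -/
noncomputable def tenArr : (adj.toMonad.obj I.ops).edge ⟶ V.edge := I.ten₁.e ≫ I.stArr

theorem tenArr_src : I.tenArr ≫ V.src =
    (adj.toMonad.map I.mSrc ≫ adj.toMonad.μ.app (bouquet V.vert)).e ≫ I.mTen :=
  (assoc _ _ _).trans ((congrArg (I.ten₁.e ≫ ·) I.stArr_src).trans ((assoc _ _ _).symm.trans
    (congrArg (· ≫ I.ten.e) (congrArg IntGraph.Hom.e I.ten₁_dom))))

theorem tenArr_tgt : I.tenArr ≫ V.tgt = (adj.toMonad.map I.opsTgt).e ≫ I.mTen :=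
  (assoc _ _ _).trans ((congrArg (I.ten₁.e ≫ ·) I.stArr_tgt).trans ((assoc _ _ _).symm.trans
    (congrArg (· ≫ I.ten.e) (congrArg IntGraph.Hom.e I.ten₁_cod))))

theorem unit_tenArr : (adj.toMonad.η.app I.ops).e ≫ I.tenArr = I.opsArr :=
  (assoc _ _ _).symm.trans ((congrArg (· ≫ I.stArr) (congrArg IntGraph.Hom.e I.unit_ten₁)).trans
    (I.stLift_arr _ _ _ _ _))

/-- The identity operations. -/
noncomputable def opsIdent : bouquet V.vert ⟶ I.ops :=
  I.opsLift (single V adj) V.ident (I.single_ten.trans V.ident_src.symm)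

theorem opsIdent_src : I.opsIdent ≫ I.opsSrc = single V adj := I.opsLift_src _ _ _

theorem opsIdent_arr : I.opsIdent.e ≫ I.opsArr = V.ident := I.opsLift_arr _ _ _

theorem opsIdent_tgt : I.opsIdent ≫ I.opsTgt = 𝟙 _ := bouquet_hom_ext
  ((assoc _ _ _).symm.trans ((congrArg (· ≫ V.tgt) I.opsIdent_arr).trans V.ident_tgt))

theorem map_ident_aux : I.opsIdent ≫ I.stGen = single V adj ≫ I.stMap I.stIdFunctor := by
  refine I.st_hom_ext ?_ ?_ ?_
  · rw [assoc, stGen, stLift_dom, opsIdent_src, assoc, stMap_stIdFunctor_dom, comp_id]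
  · rw [assoc, stGen, stLift_cod, ← assoc, opsIdent_tgt, id_comp, assoc, stMap_stIdFunctor_cod,
      comp_id]
  · rw [IntGraph.comp_e, assoc, stGen, stLift_arr, opsIdent_arr, IntGraph.comp_e, assoc,
      stMap_stIdFunctor_arr, ← assoc, single_ten, id_comp]

theorem map_ident_ten₁ : adj.toMonad.map I.opsIdent ≫ I.ten₁ = I.stMap I.stIdFunctor := by
  have : Fr.map I.opsIdent ≫ I.tenArrow = I.stIdFunctor := by
    apply free_ext adj
    refine Eq.trans ((congrArg (adj.unit.app _ ≫ ·) ((IntCat.forget E).map_comp _ _)).trans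
      ((assoc _ _ _).symm.trans (congrArg (· ≫ _) (adj.unit.naturality I.opsIdent).symm))) ?_
    exact ((assoc _ _ _).trans (congrArg (I.opsIdent ≫ ·) I.unit_tenArrow)).trans I.map_ident_aux
  exact congrArg (IntCat.forget E).map this

theorem map_ident_tenArr : (adj.toMonad.map I.opsIdent).e ≫ I.tenArr = I.mTen ≫ V.ident :=
  (assoc _ _ _).symm.trans ((congrArg (· ≫ I.stArr)
    (congrArg IntGraph.Hom.e I.map_ident_ten₁)).trans I.stMap_stIdFunctor_arr)

theorem opsComp_composable (c : W ⟶ I.ops) (d : W ⟶ adj.toMonad.obj I.ops)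
    (h : c ≫ I.mSrc = d ≫ adj.toMonad.map I.opsTgt) :
    (c.e ≫ I.opsArr) ≫ V.src = (d.e ≫ I.tenArr) ≫ V.tgt := by
  have h₁ := congrArg IntGraph.Hom.e h
  simp only [IntGraph.comp_e] at h₁
  rw [assoc, opsArr_mSrc, ← assoc, h₁, assoc, assoc, tenArr_tgt]

/-- The morphism of graphs given by a list of objects and an arrow of `V`. -/
noncomputable def mLift (l : W ⟶ adj.toMonad.obj (bouquet V.vert)) (f : W.edge ⟶ V.edge)
    (h : l.e ≫ I.mTen = f ≫ V.src) : W ⟶ I.ops := I.opsLift l f h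

theorem mLift_src (l : W ⟶ adj.toMonad.obj (bouquet V.vert)) (f : W.edge ⟶ V.edge)
    (h : l.e ≫ I.mTen = f ≫ V.src) : I.mLift l f h ≫ I.mSrc = l := I.opsLift_src _ _ _

theorem mLift_arr (l : W ⟶ adj.toMonad.obj (bouquet V.vert)) (f : W.edge ⟶ V.edge)
    (h : l.e ≫ I.mTen = f ≫ V.src) : (I.mLift l f h).e ≫ I.opsArr = f := I.opsLift_arr _ _ _

/-- The composite of an operation `f` with a list `f₁, ..., fₙ` of operations: the list of inputs is
the concatenation of the lists of inputs of the `fᵢ`, and the underlying arrow of `V` is the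
composite of `f` with `f₁ ⊗ ... ⊗ fₙ`. -/
noncomputable def opsComp (c : W ⟶ I.ops) (d : W ⟶ adj.toMonad.obj I.ops)
    (h : c ≫ I.mSrc = d ≫ adj.toMonad.map I.opsTgt) : W ⟶ I.ops :=
  I.mLift (d ≫ adj.toMonad.map I.mSrc ≫ adj.toMonad.μ.app (bouquet V.vert))
    (V.compAt (c.e ≫ I.opsArr) (d.e ≫ I.tenArr) (I.opsComp_composable c d h)) (by
      rw [V.compAt_src, assoc, tenArr_src, IntGraph.comp_e, assoc])

section

variable (c : W ⟶ I.ops) (d : W ⟶ adj.toMonad.obj I.ops)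
    (h : c ≫ I.mSrc = d ≫ adj.toMonad.map I.opsTgt)

theorem opsComp_src : I.opsComp c d h ≫ I.mSrc =
    d ≫ adj.toMonad.map I.mSrc ≫ adj.toMonad.μ.app (bouquet V.vert) := I.mLift_src _ _ _

theorem opsComp_arr : (I.opsComp c d h).e ≫ I.opsArr = V.compAt (c.e ≫ I.opsArr) (d.e ≫ I.tenArr)
      (I.opsComp_composable c d h) := I.mLift_arr _ _ _

theorem opsComp_tgt : I.opsComp c d h ≫ I.opsTgt = c ≫ I.opsTgt := by
  apply bouquet_hom_ext
  refine (assoc _ _ _).symm.trans ((congrArg (· ≫ V.tgt) (I.opsComp_arr c d h)).trans ?_)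
  exact (V.compAt_tgt _ _ _).trans (assoc _ _ _)

theorem pre_opsComp (r : W' ⟶ W) (h' : (r ≫ c) ≫ I.mSrc = (r ≫ d) ≫ adj.toMonad.map I.opsTgt) :
    r ≫ I.opsComp c d h = I.opsComp (r ≫ c) (r ≫ d) h' := by
  apply I.mops_ext
  · rw [assoc, opsComp_src, opsComp_src, assoc]
  · rw [IntGraph.comp_e, assoc, opsComp_arr, opsComp_arr, V.pre_compAt]
    exact V.compAt_congr (assoc _ _ _).symm (assoc _ _ _).symm _

theorem opsComp_congr {c c' : W ⟶ I.ops} {d d' : W ⟶ adj.toMonad.obj I.ops} (hc : c = c')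
    (hd : d = d') (h : c ≫ I.mSrc = d ≫ adj.toMonad.map I.opsTgt)
    (h' : c' ≫ I.mSrc = d' ≫ adj.toMonad.map I.opsTgt) :
    I.opsComp c d h = I.opsComp c' d' h' := by
  subst hc hd; rfl

theorem lift_opsComp :
    pullback.lift c d h ≫ I.opsComp (pullback.fst I.mSrc (adj.toMonad.map I.opsTgt))
      (pullback.snd I.mSrc (adj.toMonad.map I.opsTgt)) pullback.condition =
      I.opsComp c d h := by
  rw [I.pre_opsComp _ _ _ _ (by rw [pullback.lift_fst, pullback.lift_snd, h])]
  exact I.opsComp_congr (pullback.lift_fst _ _ _) (pullback.lift_snd _ _ _) _ _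

end

theorem unit_map_ten₁ {Y : IntGraph E} (k : Y ⟶ I.ops) :
    adj.toMonad.η.app Y ≫ adj.toMonad.map k ≫ I.ten₁ = k ≫ I.stGen := by
  have n := adj.toMonad.η.naturality k
  simp only [Functor.id_map] at n
  rw [← assoc, ← n, assoc, unit_ten₁]

theorem unit_map_mu_ten₁ {Y : IntGraph E} (k : Y ⟶ adj.toMonad.obj I.ops) :
    adj.toMonad.η.app Y ≫ adj.toMonad.map k ≫ adj.toMonad.μ.app I.ops ≫ I.ten₁ =
      k ≫ I.ten₁ := by
  have n := adj.toMonad.η.naturality k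
  have h := adj.toMonad.left_unit I.ops
  simp only [Functor.id_map] at n
  rw [← assoc, ← n, assoc, ← assoc (adj.toMonad.η.app _)]
  exact congrArg (k ≫ ·) ((congrArg (· ≫ I.ten₁) h).trans (id_comp _))

theorem vert_composable {Y : IntGraph E} (p : Y ⟶ I.ops) (q : Y ⟶ adj.toMonad.obj I.ops)
    (h : p ≫ I.mSrc = q ≫ adj.toMonad.map I.opsTgt) :
    (adj.toMonad.map p ≫ I.ten₁) ≫ I.stDom =
      (adj.toMonad.map q ≫ adj.toMonad.μ.app I.ops ≫ I.ten₁) ≫ I.stCod := by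
  have n := adj.toMonad.μ.naturality I.opsTgt
  have h' := congrArg adj.toMonad.map h
  rw [adj.toMonad.map_comp, adj.toMonad.map_comp] at h'
  have e₁ : (adj.toMonad.map p ≫ I.ten₁) ≫ I.stDom =
      adj.toMonad.map p ≫ adj.toMonad.map I.mSrc ≫ adj.toMonad.μ.app (bouquet V.vert) :=
    (assoc _ _ _).trans (congrArg (_ ≫ ·) I.ten₁_dom)
  have e₂ : (adj.toMonad.map q ≫ adj.toMonad.μ.app I.ops ≫ I.ten₁) ≫ I.stCod =
      adj.toMonad.map q ≫ adj.toMonad.μ.app I.ops ≫ adj.toMonad.map I.opsTgt :=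
    ((assoc _ _ _).trans (congrArg (_ ≫ ·) (assoc _ _ _))).trans
      (congrArg (fun x => adj.toMonad.map q ≫ adj.toMonad.μ.app I.ops ≫ x) I.ten₁_cod)
  refine e₁.trans (Eq.trans ?_ e₂.symm)
  rw [← assoc, h', assoc]
  exact congrArg (adj.toMonad.map q ≫ ·) n

theorem map_opsComp_ten₁ {Y : IntGraph E} (p : Y ⟶ I.ops) (q : Y ⟶ adj.toMonad.obj I.ops)
    (h : p ≫ I.mSrc = q ≫ adj.toMonad.map I.opsTgt) :
    adj.toMonad.map (I.opsComp p q h) ≫ I.ten₁ = I.stVert (adj.toMonad.map p ≫ I.ten₁)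
      (adj.toMonad.map q ≫ adj.toMonad.μ.app I.ops ≫ I.ten₁) (I.vert_composable p q h) := by
  have key : Fr.map (I.opsComp p q h) ≫ I.tenArrow = I.stVertFunctor (Fr.map p ≫ I.tenArrow)
      (Fr.map q ≫ adj.counit.app (Fr.obj I.ops) ≫ I.tenArrow) (I.vert_composable p q h) := by
    apply free_ext adj
    change adj.toMonad.η.app Y ≫ adj.toMonad.map (I.opsComp p q h) ≫ I.ten₁ =
      adj.toMonad.η.app Y ≫ I.stVert (adj.toMonad.map p ≫ I.ten₁)
        (adj.toMonad.map q ≫ adj.toMonad.μ.app I.ops ≫ I.ten₁) (I.vert_composable p q h)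
    rw [unit_map_ten₁]
    have hs : I.opsComp p q h ≫ I.opsSrc = q ≫ I.ten₁ ≫ I.stDom :=
      (I.opsComp_src p q h).trans (congrArg (q ≫ ·) I.ten₁_dom.symm)
    refine I.st_hom_ext ?_ ?_ ?_
    · have e := I.unit_map_mu_ten₁ q
      rw [assoc, assoc, stVert_dom, ← assoc (adj.toMonad.η.app _) _ I.stDom, e, assoc, stGen,
        stLift_dom, hs]
    · rw [assoc, assoc, stVert_cod, ← assoc (adj.toMonad.η.app _) _ I.stCod, unit_map_ten₁, assoc, stGen, stLift_cod,
        ← assoc, opsComp_tgt, assoc]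
    · have e₁ := congrArg IntGraph.Hom.e (I.unit_map_ten₁ p)
      have e₂ := congrArg IntGraph.Hom.e (I.unit_map_mu_ten₁ q)
      simp only [IntGraph.comp_e] at e₁ e₂
      rw [IntGraph.comp_e, IntGraph.comp_e, assoc, assoc, stVert_arr, V.pre_compAt, stGen,
        stLift_arr, opsComp_arr]
      refine V.compAt_congr ?_ ?_ _
      · rw [IntGraph.comp_e, ← assoc, e₁, assoc, stGen, stLift_arr]
      · rw [IntGraph.comp_e, IntGraph.comp_e, ← assoc, e₂, assoc, tenArr]
  exact congrArg (IntCat.forget E).map key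

theorem map_opsComp_tenArr {Y : IntGraph E} (p : Y ⟶ I.ops) (q : Y ⟶ adj.toMonad.obj I.ops)
    (h : p ≫ I.mSrc = q ≫ adj.toMonad.map I.opsTgt)
    (h' : ((adj.toMonad.map p).e ≫ I.tenArr) ≫ V.src =
      ((adj.toMonad.map q ≫ adj.toMonad.μ.app I.ops).e ≫ I.tenArr) ≫ V.tgt) :
    (adj.toMonad.map (I.opsComp p q h)).e ≫ I.tenArr = V.compAt ((adj.toMonad.map p).e ≫ I.tenArr)
      ((adj.toMonad.map q ≫ adj.toMonad.μ.app I.ops).e ≫ I.tenArr) h' := by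
  have e := congrArg (fun x => IntGraph.Hom.e x ≫ I.stArr) (I.map_opsComp_ten₁ p q h)
  refine (assoc _ _ _).symm.trans (e.trans ((I.stVert_arr _ _ _).trans (V.compAt_congr ?_ ?_ _)))
  · exact assoc _ _ _
  · refine (assoc _ _ _).trans (Eq.trans ?_ (assoc _ _ _).symm)
    exact congrArg (_ ≫ ·) (assoc _ _ _)

theorem opsComp_ident_left (c d : W ⟶ I.ops) (hd : d = c ≫ I.opsTgt ≫ I.opsIdent)
    (h : d ≫ I.mSrc = (c ≫ adj.toMonad.η.app I.ops) ≫ adj.toMonad.map I.opsTgt) :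
    I.opsComp d (c ≫ adj.toMonad.η.app I.ops) h = c := by
  have n := adj.toMonad.η.naturality I.mSrc
  have hl := adj.toMonad.left_unit (bouquet V.vert)
  simp only [Functor.id_map] at n
  apply I.mops_ext
  · rw [opsComp_src, assoc, ← assoc (adj.toMonad.η.app _), ← n, assoc]
    exact congrArg (c ≫ ·) ((congrArg (I.mSrc ≫ ·) hl).trans (comp_id _))
  · have e₁ : d.e ≫ I.opsArr = (c.e ≫ I.opsArr) ≫ V.tgt ≫ V.ident := by
      rw [hd, IntGraph.comp_e, IntGraph.comp_e, assoc, assoc, opsIdent_arr]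
      have : I.opsTgt.e = I.opsArr ≫ V.tgt := rfl
      simp only [assoc, this]
    have e₂ : (c ≫ adj.toMonad.η.app I.ops).e ≫ I.tenArr = c.e ≫ I.opsArr := by
      rw [IntGraph.comp_e, assoc, unit_tenArr]
    rw [opsComp_arr, V.compAt_congr e₁ e₂]
    exact V.compAt_ident_left _

theorem opsComp_ident_right (c : W ⟶ I.ops)
    (h : c ≫ I.mSrc = (c ≫ I.mSrc ≫ adj.toMonad.map I.opsIdent) ≫ adj.toMonad.map I.opsTgt) :
    I.opsComp c (c ≫ I.mSrc ≫ adj.toMonad.map I.opsIdent) h = c := by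
  have hr := adj.toMonad.right_unit (bouquet V.vert)
  have hi : I.opsIdent ≫ I.mSrc = adj.toMonad.η.app (bouquet V.vert) := I.opsIdent_src
  apply I.mops_ext
  · rw [opsComp_src, assoc, assoc, ← assoc (adj.toMonad.map _), ← adj.toMonad.map_comp, hi]
    exact congrArg (c ≫ ·) ((congrArg (I.mSrc ≫ ·) hr).trans (comp_id _))
  · have e : (c ≫ I.mSrc ≫ adj.toMonad.map I.opsIdent).e ≫ I.tenArr =
        (c.e ≫ I.opsArr) ≫ V.src ≫ V.ident := by
      rw [IntGraph.comp_e, IntGraph.comp_e, assoc, assoc, map_ident_tenArr, assoc,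
        ← assoc I.opsArr, opsArr_mSrc, assoc]
    rw [opsComp_arr, V.compAt_congr rfl e]
    exact V.compAt_ident_right _

theorem opsComp_assoc {Y : IntGraph E} (c : W ⟶ I.ops) (t : W ⟶ adj.toMonad.obj Y) (p : Y ⟶ I.ops)
    (q : Y ⟶ adj.toMonad.obj I.ops) (h : p ≫ I.mSrc = q ≫ adj.toMonad.map I.opsTgt)
    (h₁ : c ≫ I.mSrc = (t ≫ adj.toMonad.map p) ≫ adj.toMonad.map I.opsTgt)
    (h₂ : c ≫ I.mSrc = (t ≫ adj.toMonad.map (I.opsComp p q h)) ≫ adj.toMonad.map I.opsTgt)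
    (h₃ : I.opsComp c (t ≫ adj.toMonad.map p) h₁ ≫ I.mSrc =
      (t ≫ adj.toMonad.map q ≫ adj.toMonad.μ.app I.ops) ≫ adj.toMonad.map I.opsTgt) :
    I.opsComp c (t ≫ adj.toMonad.map (I.opsComp p q h)) h₂ =
      I.opsComp (I.opsComp c (t ≫ adj.toMonad.map p) h₁)
        (t ≫ adj.toMonad.map q ≫ adj.toMonad.μ.app I.ops) h₃ := by
  apply I.mops_ext
  · have n := adj.toMonad.μ.naturality I.mSrc
    have a := adj.toMonad.assoc (bouquet V.vert)
    rw [opsComp_src, opsComp_src, assoc, ← assoc (adj.toMonad.map _), ← adj.toMonad.map_comp,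
      opsComp_src, adj.toMonad.map_comp, adj.toMonad.map_comp]
    simp only [assoc]
    refine congrArg (fun x => t ≫ adj.toMonad.map q ≫ x) ?_
    refine (congrArg (adj.toMonad.map (adj.toMonad.map I.mSrc) ≫ ·) a).trans ?_
    exact (assoc _ _ _).symm.trans ((congrArg (· ≫ _) n).trans (assoc _ _ _))
  · have k₁ := I.opsComp_composable c _ h₁
    have k₂ := I.opsComp_composable _ _ h₃
    have k₃ : (((t ≫ adj.toMonad.map p).e) ≫ I.tenArr) ≫ V.src =
        ((t ≫ adj.toMonad.map q ≫ adj.toMonad.μ.app I.ops).e ≫ I.tenArr) ≫ V.tgt := by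
      rw [← k₂, opsComp_arr, V.compAt_src]
    have k₄ : ((adj.toMonad.map p).e ≫ I.tenArr) ≫ V.src =
        ((adj.toMonad.map q ≫ adj.toMonad.μ.app I.ops).e ≫ I.tenArr) ≫ V.tgt := by
      have e := congrArg IntGraph.Hom.e (I.vert_composable p q h)
      simp only [IntGraph.comp_e] at e
      rw [IntGraph.comp_e, tenArr]
      simp only [assoc] at e ⊢
      rw [stArr_src, stArr_tgt, reassoc_of% e]
    have e : (t ≫ adj.toMonad.map (I.opsComp p q h)).e ≫ I.tenArr = V.compAt _ _ k₃ := by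
      rw [IntGraph.comp_e, assoc, I.map_opsComp_tenArr p q h k₄, V.pre_compAt]
      exact V.compAt_congr (assoc _ _ _).symm (assoc _ _ _).symm _
    rw [opsComp_arr, opsComp_arr, V.compAt_congr rfl e, V.compAt_congr (I.opsComp_arr _ _ h₁) rfl]
    exact (V.compAt_assoc _ _ _ k₁ k₃).symm

/-- The multicategory for the free category monad induced by an internal monoidal category: its
operations are the arrows `⊗ l ⟶ v` of `V` with a list `l` of objects of `V`. -/
noncomputable def multicat : GenMulticat adj.toMonad where
  C₀ := bouquet V.vert
  C₁ := I.ops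
  src := I.mSrc
  tgt := I.opsTgt
  comp := I.opsComp (pullback.fst _ _) (pullback.snd _ _) pullback.condition
  ident := I.opsIdent
  comp_src := I.opsComp_src _ _ _
  comp_tgt := I.opsComp_tgt _ _ _
  ident_src := I.opsIdent_src
  ident_tgt := I.opsIdent_tgt
  ident_comp c h := by
    rw [lift_opsComp]
    exact I.opsComp_ident_left c _ rfl h
  comp_ident c h := by
    rw [lift_opsComp]
    exact I.opsComp_ident_right c h
  comp_assoc c t h₁ h₂ h₃ := by
    have e := I.lift_opsComp _ _ h₁
    rw [lift_opsComp, lift_opsComp]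
    refine (I.opsComp_assoc c t _ _ pullback.condition h₁ h₂ ?_).trans (I.opsComp_congr e.symm rfl _ h₃)
    rw [← e]
    exact h₃

end IteratedTensor

end Multicategory

/-! #### The strict case -/

section Strict

variable {E : Type u} [Category.{v} E] [CartesianMonoidalCategory E] [HasPullbacks E]

/-- An internal monoidal category is strict if its associator and unitors are identities. -/
structure IntMonCat.IsStrict (V : IntMonCat E) : Prop where
  assoc_val : V.assocIso.hom.val =
    (V.tO (V.tO V.gen₁ V.gen₂) V.gen₃).val ≫ V.ident
  left_val : V.leftIso.hom.val = (V.tO (V.tI _) V.gen).val ≫ V.ident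
  right_val : V.rightIso.hom.val = (V.tO V.gen (V.tI _)).val ≫ V.ident

namespace IntMonCat.IsStrict

variable {V : IntMonCat E} (hV : V.IsStrict) {W : E}

theorem assoc_eq (hV : V.IsStrict) (x y z : Fam V.toIntCat W) :
    (x ⊗ y ⊗ z).val = ((x ⊗ y) ⊗ z).val := by
  have h₁ : (α_ x y z).hom.val = ((x ⊗ y) ⊗ z).val ≫ V.ident := by
    rw [V.associator_val, hV.assoc_val, ← assoc]
    congr 1
    exact (V.assocAt V.assocIso x y z).hom.src_eq.symm.trans ((assoc _ _ _).trans
      (congrArg (_ ≫ ·) V.assocIso.hom.src_eq)) |>.symm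
  rw [← (α_ x y z).hom.tgt_eq, h₁, assoc, V.ident_tgt, comp_id]

theorem assoc_hom (hV : V.IsStrict) (x y z : Fam V.toIntCat W) :
    (α_ x y z).hom = (Fam.eqIso (hV.assoc_eq x y z).symm).hom := by
  apply Fam.hom_ext
  change _ = ((x ⊗ y) ⊗ z).val ≫ V.ident
  rw [V.associator_val, hV.assoc_val, ← assoc]
  congr 1
  exact (V.assocAt V.assocIso x y z).hom.src_eq.symm.trans ((assoc _ _ _).trans
    (congrArg (_ ≫ ·) V.assocIso.hom.src_eq)) |>.symm

theorem left_aux (hV : V.IsStrict) (x : Fam V.toIntCat W) :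
    (λ_ x).hom.val = (𝟙_ _ ⊗ x).val ≫ V.ident := by
  rw [V.leftUnitor_val, hV.left_val, ← assoc]
  congr 1
  exact (V.leftAt V.leftIso x).hom.src_eq.symm.trans ((assoc _ _ _).trans
    (congrArg (_ ≫ ·) V.leftIso.hom.src_eq)) |>.symm

theorem left_eq (hV : V.IsStrict) (x : Fam V.toIntCat W) : (𝟙_ _ ⊗ x).val = x.val := by
  rw [← (λ_ x).hom.tgt_eq, hV.left_aux, assoc, V.ident_tgt, comp_id]

theorem left_hom (hV : V.IsStrict) (x : Fam V.toIntCat W) :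
    (λ_ x).hom = (Fam.eqIso (hV.left_eq x)).hom := Fam.hom_ext (hV.left_aux x)

theorem right_aux (hV : V.IsStrict) (x : Fam V.toIntCat W) :
    (ρ_ x).hom.val = (x ⊗ 𝟙_ _).val ≫ V.ident := by
  rw [V.rightUnitor_val, hV.right_val, ← assoc]
  congr 1
  exact (V.rightAt V.rightIso x).hom.src_eq.symm.trans ((assoc _ _ _).trans
    (congrArg (_ ≫ ·) V.rightIso.hom.src_eq)) |>.symm

theorem right_eq (hV : V.IsStrict) (x : Fam V.toIntCat W) : (x ⊗ 𝟙_ _).val = x.val := by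
  rw [← (ρ_ x).hom.tgt_eq, hV.right_aux, assoc, V.ident_tgt, comp_id]

theorem right_hom (hV : V.IsStrict) (x : Fam V.toIntCat W) :
    (ρ_ x).hom = (Fam.eqIso (hV.right_eq x)).hom := Fam.hom_ext (hV.right_aux x)

theorem lift_lift_eq {X : E} (f g : W ⟶ X) (h : f ≫ toUnit X = g ≫ toUnit X) :
    pullback.lift f g h ≫ lift (pullback.fst (toUnit X) (toUnit X)) (pullback.snd _ _) =
      lift f g := by
  rw [comp_lift, pullback.lift_fst, pullback.lift_snd]

/-- The internal category on the graph `1 ⇇ V₀` given by the tensor product and the unit of a strict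
monoidal category `V`. -/
noncomputable def oneObj (hV : V.IsStrict) : IntCat E where
  toIntGraph := bouquet V.vert
  ident := V.unit
  comp := lift (pullback.fst (toUnit V.vert) (toUnit V.vert)) (pullback.snd _ _) ≫ V.tObj
  ident_src := toUnit_unique _ _
  ident_tgt := toUnit_unique _ _
  comp_src := toUnit_unique _ _
  comp_tgt := toUnit_unique _ _
  ident_comp {W} f h := by
    refine (assoc _ _ _).symm.trans ((congrArg (· ≫ V.tObj) (lift_lift_eq _ _ h)).trans ?_)
    have : f ≫ toUnit V.vert ≫ V.unit = toUnit W ≫ V.unit := by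
      rw [← assoc, toUnit_unique (f ≫ toUnit _) (toUnit W)]
    refine (congrArg (fun x => lift x f ≫ V.tObj) this).trans ?_
    exact hV.left_eq ⟨f⟩
  comp_ident {W} f h := by
    refine (assoc _ _ _).symm.trans ((congrArg (· ≫ V.tObj) (lift_lift_eq _ _ h)).trans ?_)
    have : f ≫ toUnit V.vert ≫ V.unit = toUnit W ≫ V.unit := by
      rw [← assoc, toUnit_unique (f ≫ toUnit _) (toUnit W)]
    refine (congrArg (fun x => lift f x ≫ V.tObj) this).trans ?_
    exact hV.right_eq ⟨f⟩
  comp_assoc k g f hkg hgf h₁ h₂ := by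
    refine (assoc _ _ _).symm.trans ((congrArg (· ≫ V.tObj) (lift_lift_eq _ _ h₁)).trans ?_)
    refine Eq.trans ?_ ((assoc _ _ _).symm.trans (congrArg (· ≫ V.tObj) (lift_lift_eq _ _ h₂))).symm
    have e₁ := (assoc _ _ _).symm.trans (congrArg (· ≫ V.tObj) (lift_lift_eq k g hkg))
    have e₂ := (assoc _ _ _).symm.trans (congrArg (· ≫ V.tObj) (lift_lift_eq g f hgf))
    refine (congrArg (fun x => lift x f ≫ V.tObj) e₁).trans ?_
    refine Eq.trans ?_ (congrArg (fun x => lift k x ≫ V.tObj) e₂).symm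
    exact (hV.assoc_eq ⟨k⟩ ⟨g⟩ ⟨f⟩).symm

theorem oneObj_compAt (hV : V.IsStrict) (g f : W ⟶ V.vert) (h) :
    hV.oneObj.compAt g f h = lift g f ≫ V.tObj :=
  (assoc _ _ _).symm.trans (congrArg (· ≫ V.tObj) (lift_lift_eq _ _ h))

variable {Fr : IntGraph E ⥤ IntCat E} (adj : Fr ⊣ IntCat.forget E)

/-- The functor from the free category to `1 ⇇ V₀` that extends the identity. -/
noncomputable def tenFunctor (hV : V.IsStrict) : listCat V adj ⟶ hV.oneObj :=
  (adj.homEquiv (bouquet V.vert) hV.oneObj).symm (𝟙 (bouquet V.vert))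

/-- The morphism of graphs underlying `tenFunctor`. -/
noncomputable def tenMap (hV : V.IsStrict) : (listCat V adj).toIntGraph ⟶ bouquet V.vert :=
  (IntCat.forget E).map (hV.tenFunctor adj)

theorem single_tenMap (hV : V.IsStrict) : single V adj ≫ hV.tenMap adj = 𝟙 _ := by
  have := (adj.homEquiv (bouquet V.vert) hV.oneObj).apply_symm_apply (𝟙 (bouquet V.vert))
  rwa [adj.homEquiv_unit] at this

theorem tenMap_comp (hV : V.IsStrict) (l m : W ⟶ (listCat V adj).edge)
    (h : l ≫ (listCat V adj).src = m ≫ (listCat V adj).tgt) :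
    (V.tenAt (hV.tenMap adj) l ⊗ V.tenAt (hV.tenMap adj) m).val =
      (listCat V adj).compAt l m h ≫ (hV.tenMap adj).e := by
  have h' : (l ≫ (hV.tenFunctor adj).e) ≫ toUnit V.vert =
      (m ≫ (hV.tenFunctor adj).e) ≫ toUnit V.vert := toUnit_unique _ _
  exact (((hV.tenFunctor adj).map_comp l m h h').trans (hV.oneObj_compAt _ _ h')).symm

theorem tenMap_comp_generic (hV : V.IsStrict) :
    (V.tenAt (hV.tenMap adj) (pullback.fst (listCat V adj).src (listCat V adj).tgt) ⊗
      V.tenAt (hV.tenMap adj) (pullback.snd (listCat V adj).src (listCat V adj).tgt)).val =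
    (V.tenAt (hV.tenMap adj) (listCat V adj).comp).val := by
  rw [hV.tenMap_comp adj _ _ pullback.condition, IntMonCat.tenAt_val, IntCat.compAt,
    pullback.lift_fst_snd, id_comp]

theorem mulAt_eq (hV : V.IsStrict) (l m n : W ⟶ (listCat V adj).edge)
    (h : l ≫ (listCat V adj).src = m ≫ (listCat V adj).tgt)
    (hn : (listCat V adj).compAt l m h = n)
    (e : (V.tenAt (hV.tenMap adj) l ⊗ V.tenAt (hV.tenMap adj) m).val =
      (V.tenAt (hV.tenMap adj) n).val) :
    (V.mulAt (hV.tenMap adj) (Fam.eqIso (hV.tenMap_comp_generic adj)) l m n h hn).hom =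
      (Fam.eqIso e).hom := by
  apply Fam.hom_ext
  have := (V.mulAt (hV.tenMap adj) (Fam.eqIso (hV.tenMap_comp_generic adj)) l m n h hn).hom.src_eq
  change pullback.lift l m h ≫ _ ≫ V.ident = _ ≫ V.ident
  rw [← assoc]
  congr 1
  rw [← this]
  refine Eq.trans ?_ (assoc _ _ _).symm
  exact congrArg (pullback.lift l m h ≫ ·) (Fam.eqIso (hV.tenMap_comp_generic adj)).hom.src_eq.symm

/-- For strict `V`, the iterated tensor product given by the functor from the free category to
`1 ⇇ V₀` that extends the identity; all the coherence isomorphisms are identities. -/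
noncomputable def iteratedTensor (hV : V.IsStrict) :
    IteratedTensor V (listCat V adj) (single V adj) where
  ten := hV.tenMap adj
  ten_single := hV.single_tenMap adj
  ten_ident := (hV.tenFunctor adj).map_ident.trans
    (congrArg (· ≫ V.unit) (toUnit_unique (hV.tenFunctor adj).v (toUnit _)))
  mul := Fam.eqIso (hV.tenMap_comp_generic adj)
  mul_assoc l m n lm mn lmn h₁ h₂ h₃ h₄ e₁ e₂ e₃ e₄ := by
    have k : ∀ {W : E} (l m n : W ⟶ (listCat V adj).edge)
        (h : l ≫ (listCat V adj).src = m ≫ (listCat V adj).tgt)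
        (_ : (listCat V adj).compAt l m h = n),
        (V.tenAt (hV.tenMap adj) l ⊗ V.tenAt (hV.tenMap adj) m).val =
          (V.tenAt (hV.tenMap adj) n).val := by
      intro W l m n h hn
      rw [hV.tenMap_comp adj l m h, hn, IntMonCat.tenAt_val]
    rw [hV.mulAt_eq adj l m lm h₁ e₁ (k _ _ _ h₁ e₁), hV.mulAt_eq adj _ _ _ h₂ e₂ (k _ _ _ h₂ e₂),
      hV.mulAt_eq adj _ _ _ h₃ e₃ (k _ _ _ h₃ e₃), hV.mulAt_eq adj _ _ _ h₄ e₄ (k _ _ _ h₄ e₄),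
      V.eqIso_whiskerRight, V.whiskerLeft_eqIso, hV.assoc_hom, V.eqIso_trans, V.eqIso_trans,
      V.eqIso_trans]
  ident_mul i l h e hi h' := by
    have k : (V.tenAt (hV.tenMap adj) i ⊗ V.tenAt (hV.tenMap adj) l).val =
        (V.tenAt (hV.tenMap adj) l).val := by
      rw [hV.tenMap_comp adj i l h, e, IntMonCat.tenAt_val]
    rw [hV.mulAt_eq adj _ _ _ h e k, V.eqIso_whiskerRight, V.eqIso_trans, hV.left_hom]
  mul_ident l i h e hi h' := by
    have k : (V.tenAt (hV.tenMap adj) l ⊗ V.tenAt (hV.tenMap adj) i).val =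
        (V.tenAt (hV.tenMap adj) l).val := by
      rw [hV.tenMap_comp adj l i h, e, IntMonCat.tenAt_val]
    rw [hV.mulAt_eq adj _ _ _ h e k, V.whiskerLeft_eqIso, V.eqIso_trans, hV.right_hom]

end IntMonCat.IsStrict

end Strict

/-! ### Lax tensor structures on internal categories -/

section Lax

variable {E : Type u} [Category.{v} E] [CartesianMonoidalCategory E] [HasPullbacks E]

/-! The two sides of the equivalence are an unbiased and a biased presentation of the same
structure. Let `D` be an internal category. A functor of multicategories from the lists of
composable arrows of `D` to the multicategory of `V` (`AlgOps`) gives, for every path `d₁, ..., dₙ`,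
an arrow `⊗ (ten d₁, ..., ten dₙ) ⟶ ten (d₁ ∘ ... ∘ dₙ)`, compatibly with the concatenation of
paths. A lax tensor structure (`LaxTensor`) keeps only the arrows for `n = 2` and `n = 0`, subject
to associativity and unit laws. For `D = Ind(X)` the second notion is a small `Ext(V)`-category with
hom object `ten`, and the first is an enriched multicategory.

Lists in `E` have no elements on which to do induction. Its substitute is the universal property of
the free category: two internal functors out of `Fr.obj G` that agree on `G` are equal (`free_ext`).
To use it, the arrows `f : ⊗ l ⟶ ten d` of `V` are made into the arrows of an internal category
`overCat`. It composes lists by concatenation, arrows of `D` by their composition, and arrows of `V`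
by `conv`, that is, `f ⊗ g` followed by the multiplication of the lax structure and preceded by the
inverse of the coherence isomorphism for the iterated tensor product. The category axioms of
`overCat` come from the coherence of the iterated tensor products together with the axioms of the
lax structure.

From the binary to the unbiased side: the assignment of the identity of `ten d` to `d` extends to an
internal functor `overFree` on the free category, and this defines the operation of every path.
Compatibility with concatenation is an equality of two internal functors out of the free category on
the lists (`mul_freeMap`). One of them is a vertical composite in `V`, which is a functor by the
interchange law `over_interchange`; they agree on generators because composing with an identity
changes nothing.

From the unbiased to the binary side: evaluate at lists with two entries and at empty lists. The
main lemma is `mulAt_at'`: up to the coherence isomorphism, the operation of a concatenation is the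
tensor product of the two operations followed by the binary multiplication. Associativity follows
since both bracketings of three arrows give one and the same path, and the unit laws follow since
concatenation with an empty path changes nothing.

Morphisms on both sides consist of a map on objects and one arrow of `V` for each arrow of `D`.
Naturality at lists with two and with no entries is compatibility with multiplication and unit
(`Hom.map_mul`, `Hom.map_one`). Conversely, naturality at all paths is again an equality of internal
functors out of a free category (`overVert_laxOps`); here `mulAt_at'` serves once more, to see a
given functor of multicategories as an internal functor to `overCat`.

Hence `toSmallCat` is full and faithful. It is surjective on objects because a lax structure is
recovered from the operations that it generates (`ofLax_mul`, `ofLax_one`). The other round trip is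
not needed, as a full, faithful and essentially surjective functor is an equivalence. -/

/-- A family of objects of `V` indexed by the arrows of an internal category `D`, with coherent
arrows `ten l ⊗ ten m ⟶ ten (l ∘ m)` and `I ⟶ ten 1`, given for generalized elements. -/
structure LaxTensor (V : IntMonCat E) (D : IntCat E) where
  ten : D.toIntGraph ⟶ bouquet V.vert
  -- The composite `n` is a variable with an equation, so that equal composites written in different
  -- ways need no transport between hom types. The same device is used for the identity `i` in
  -- `one`.
  mul : ∀ {W : E} (l m n : W ⟶ D.edge) (h : l ≫ D.src = m ≫ D.tgt) (_ : D.compAt l m h = n),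
    V.tenAt ten l ⊗ V.tenAt ten m ⟶ V.tenAt ten n
  one : ∀ {W : E} (p : W ⟶ D.vert) (i : W ⟶ D.edge) (_ : p ≫ D.ident = i),
    𝟙_ (Fam V.toIntCat W) ⟶ V.tenAt ten i
  -- Stability under reindexing: by the Yoneda lemma the family is determined by its value at the
  -- generic composable pair.
  mul_re : ∀ {W W' : E} (r : W' ⟶ W) (l m n : W ⟶ D.edge) (h : l ≫ D.src = m ≫ D.tgt)
    (hn : D.compAt l m h = n) (l' m' n' : W' ⟶ D.edge) (h' : l' ≫ D.src = m' ≫ D.tgt)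
    (hn' : D.compAt l' m' h' = n') (_ : r ≫ l = l') (_ : r ≫ m = m'),
    r ≫ (mul l m n h hn).val = (mul l' m' n' h' hn').val
  one_re : ∀ {W W' : E} (r : W' ⟶ W) (p : W ⟶ D.vert) (i : W ⟶ D.edge) (hi : p ≫ D.ident = i)
    (p' : W' ⟶ D.vert) (i' : W' ⟶ D.edge) (hi' : p' ≫ D.ident = i') (_ : r ≫ p = p'),
    r ≫ (one p i hi).val = (one p' i' hi').val
  mul_assoc : ∀ {W : E} (l m n lm mn lmn : W ⟶ D.edge) (h₁ : l ≫ D.src = m ≫ D.tgt)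
    (h₂ : m ≫ D.src = n ≫ D.tgt) (h₃ : lm ≫ D.src = n ≫ D.tgt) (h₄ : l ≫ D.src = mn ≫ D.tgt)
    (e₁ : D.compAt l m h₁ = lm) (e₂ : D.compAt m n h₂ = mn) (e₃ : D.compAt lm n h₃ = lmn)
    (e₄ : D.compAt l mn h₄ = lmn),
    (mul l m lm h₁ e₁ ▷ V.tenAt ten n) ≫ mul lm n lmn h₃ e₃ =
      (α_ _ _ _).hom ≫ (V.tenAt ten l ◁ mul m n mn h₂ e₂) ≫ mul l mn lmn h₄ e₄
  one_mul : ∀ {W : E} (i l : W ⟶ D.edge) (h : i ≫ D.src = l ≫ D.tgt) (e : D.compAt i l h = l)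
    (hi : (l ≫ D.tgt) ≫ D.ident = i),
    (one _ i hi ▷ V.tenAt ten l) ≫ mul i l l h e = (λ_ _).hom
  mul_one : ∀ {W : E} (l i : W ⟶ D.edge) (h : l ≫ D.src = i ≫ D.tgt) (e : D.compAt l i h = l)
    (hi : (l ≫ D.src) ≫ D.ident = i),
    (V.tenAt ten l ◁ one _ i hi) ≫ mul l i l h e = (ρ_ _).hom

end Lax

/-! ### Tensor products of arrows into a lax tensor structure -/

section Over

variable {E : Type u} [Category.{v} E] [CartesianMonoidalCategory E] [HasPullbacks E]
  {V : IntMonCat E} {A D : IntCat E} {W W' : E}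

namespace LaxTensor

variable (L : LaxTensor V D)

theorem one_val_congr {p p' : W ⟶ D.vert} {i i' : W ⟶ D.edge} (hi : p ≫ D.ident = i)
    (hi' : p' ≫ D.ident = i') (hp : p = p') : (L.one p i hi).val = (L.one p' i' hi').val := by
  subst hp hi hi'
  rfl

end LaxTensor

namespace IteratedTensor

variable {η : bouquet V.vert ⟶ A.toIntGraph} (I : IteratedTensor V A η) (L : LaxTensor V D)

/-- The tensor product of arrows from iterated tensor products to values of a lax tensor
structure. -/
noncomputable def conv {l m n : W ⟶ A.edge} {a b c : W ⟶ D.edge} (h : l ≫ A.src = m ≫ A.tgt)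
    (hn : A.compAt l m h = n) (h' : a ≫ D.src = b ≫ D.tgt) (hn' : D.compAt a b h' = c)
    (f : V.tenAt I.ten l ⟶ V.tenAt L.ten a) (g : V.tenAt I.ten m ⟶ V.tenAt L.ten b) :
    V.tenAt I.ten n ⟶ V.tenAt L.ten c :=
  (I.mulAt l m n h hn).inv ≫ (f ⊗ₘ g) ≫ L.mul a b c h' hn'

theorem conv_re (r : W' ⟶ W) {l m n : W ⟶ A.edge} {a b c : W ⟶ D.edge}
    (h : l ≫ A.src = m ≫ A.tgt) (hn : A.compAt l m h = n) (h' : a ≫ D.src = b ≫ D.tgt)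
    (hn' : D.compAt a b h' = c) {l' m' n' : W' ⟶ A.edge} {a' b' c' : W' ⟶ D.edge}
    (t : l' ≫ A.src = m' ≫ A.tgt) (tn : A.compAt l' m' t = n') (t' : a' ≫ D.src = b' ≫ D.tgt)
    (tn' : D.compAt a' b' t' = c')
    (f : V.tenAt I.ten l ⟶ V.tenAt L.ten a) (g : V.tenAt I.ten m ⟶ V.tenAt L.ten b)
    (f' : V.tenAt I.ten l' ⟶ V.tenAt L.ten a') (g' : V.tenAt I.ten m' ⟶ V.tenAt L.ten b')
    (hl : r ≫ l = l') (hm : r ≫ m = m') (ha : r ≫ a = a') (hb : r ≫ b = b')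
    (hf : r ≫ f.val = f'.val) (hg : r ≫ g.val = g'.val) :
    r ≫ (I.conv L h hn h' hn' f g).val = (I.conv L t tn t' tn' f' g').val := by
  rw [← Fam.re_map_val, conv, conv, Functor.map_comp, Functor.map_comp]
  refine Fam.comp_val_congr ?_ (Fam.comp_val_congr ?_ ?_)
  · rw [Fam.re_map_val, mulAt_inv_val, mulAt_inv_val, ← assoc]
    congr 1
    apply pullback.hom_ext <;> simp [hl, hm]
  · rw [Fam.re_map_val, IntMonCat.tensorHom_val, IntMonCat.tensorHom_val, comp_lift_assoc, hf, hg]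
  · rw [Fam.re_map_val]
    exact L.mul_re r a b c h' hn' a' b' c' t' tn' ha hb

/-- The comparison is made between underlying arrows of `E`, since the two sides have hom types that
are only propositionally equal. -/
theorem conv_val_congr {l m n : W ⟶ A.edge} {a b c : W ⟶ D.edge}
    (h : l ≫ A.src = m ≫ A.tgt) (hn : A.compAt l m h = n) (h' : a ≫ D.src = b ≫ D.tgt)
    (hn' : D.compAt a b h' = c) {l' m' n' : W ⟶ A.edge} {a' b' c' : W ⟶ D.edge}
    (t : l' ≫ A.src = m' ≫ A.tgt) (tn : A.compAt l' m' t = n') (t' : a' ≫ D.src = b' ≫ D.tgt)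
    (tn' : D.compAt a' b' t' = c')
    {f : V.tenAt I.ten l ⟶ V.tenAt L.ten a} {g : V.tenAt I.ten m ⟶ V.tenAt L.ten b}
    {f' : V.tenAt I.ten l' ⟶ V.tenAt L.ten a'} {g' : V.tenAt I.ten m' ⟶ V.tenAt L.ten b'}
    (hl : l = l') (hm : m = m') (ha : a = a') (hb : b = b')
    (hf : f.val = f'.val) (hg : g.val = g'.val) :
    (I.conv L h hn h' hn' f g).val = (I.conv L t tn t' tn' f' g').val := by
  subst hl hm ha hb hn tn hn' tn'
  obtain rfl := Fam.hom_ext hf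
  obtain rfl := Fam.hom_ext hg
  rfl

/-- The associativity of the lax structure handles the codomains, the inverted associativity of the
iterated tensor product handles the domains, and naturality of the associator joins the two. -/
theorem conv_assoc {l m n lm mn lmn : W ⟶ A.edge} {l' m' n' lm' mn' lmn' : W ⟶ D.edge}
    (h₁ : l ≫ A.src = m ≫ A.tgt)
    (h₂ : m ≫ A.src = n ≫ A.tgt) (h₃ : lm ≫ A.src = n ≫ A.tgt) (h₄ : l ≫ A.src = mn ≫ A.tgt)
    (e₁ : A.compAt l m h₁ = lm) (e₂ : A.compAt m n h₂ = mn) (e₃ : A.compAt lm n h₃ = lmn)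
    (e₄ : A.compAt l mn h₄ = lmn) (h₁' : l' ≫ D.src = m' ≫ D.tgt)
    (h₂' : m' ≫ D.src = n' ≫ D.tgt) (h₃' : lm' ≫ D.src = n' ≫ D.tgt)
    (h₄' : l' ≫ D.src = mn' ≫ D.tgt)
    (e₁' : D.compAt l' m' h₁' = lm') (e₂' : D.compAt m' n' h₂' = mn')
    (e₃' : D.compAt lm' n' h₃' = lmn') (e₄' : D.compAt l' mn' h₄' = lmn')
    (f : V.tenAt I.ten l ⟶ V.tenAt L.ten l') (g : V.tenAt I.ten m ⟶ V.tenAt L.ten m')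
    (k : V.tenAt I.ten n ⟶ V.tenAt L.ten n') :
    I.conv L h₃ e₃ h₃' e₃' (I.conv L h₁ e₁ h₁' e₁' f g) k =
      I.conv L h₄ e₄ h₄' e₄' f (I.conv L h₂ e₂ h₂' e₂' g k) := by
  have a := I.mul_assoc l m n lm mn lmn h₁ h₂ h₃ h₄ e₁ e₂ e₃ e₄
  have a' := L.mul_assoc l' m' n' lm' mn' lmn' h₁' h₂' h₃' h₄' e₁' e₂' e₃' e₄'
  have b : (I.mulAt lm n lmn h₃ e₃).inv ≫ ((I.mulAt l m lm h₁ e₁).inv ▷ I.at' n) =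
      (I.mulAt l mn lmn h₄ e₄).inv ≫ (I.at' l ◁ (I.mulAt m n mn h₂ e₂).inv) ≫ (α_ _ _ _).inv := by
    exact mon_aux₀ a
  have c₁ : (I.conv L h₁ e₁ h₁' e₁' f g ⊗ₘ k) = ((I.mulAt l m lm h₁ e₁).inv ▷ I.at' n) ≫
      ((f ⊗ₘ g) ⊗ₘ k) ≫ (L.mul l' m' lm' h₁' e₁' ▷ V.tenAt L.ten n') := by
    exact mon_aux₁ _ _ _ _ _
  have c₂ : (f ⊗ₘ I.conv L h₂ e₂ h₂' e₂' g k) = (I.at' l ◁ (I.mulAt m n mn h₂ e₂).inv) ≫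
      (f ⊗ₘ (g ⊗ₘ k)) ≫ (V.tenAt L.ten l' ◁ L.mul m' n' mn' h₂' e₂') := by
    exact mon_aux₂ _ _ _ _ _
  rw [conv, c₁, conv, c₂]
  simp only [assoc]
  rw [a', reassoc_of% b, associator_naturality_assoc]
  simp

/-- The arrow from the tensor product of an empty list to the value of a lax tensor structure at an
identity. -/
noncomputable def convOne {p : W ⟶ A.vert} {q : W ⟶ D.vert} {i : W ⟶ A.edge} {j : W ⟶ D.edge}
    (hi : p ≫ A.ident = i) (hj : q ≫ D.ident = j) : V.tenAt I.ten i ⟶ V.tenAt L.ten j :=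
  (Fam.eqIso ((I.unit_val p).trans (by rw [hi]))).inv ≫ L.one q j hj

theorem convOne_val {p : W ⟶ A.vert} {q : W ⟶ D.vert} {i : W ⟶ A.edge} {j : W ⟶ D.edge}
    (hi : p ≫ A.ident = i) (hj : q ≫ D.ident = j) :
    (I.convOne L hi hj).val = (L.one q j hj).val :=
  Fam.eqIso_comp_val ((I.unit_val p).trans (by rw [hi])).symm _

/-- When `i` is a copy of the unit through `e`, tensoring with an arrow out of `i` that restricts
along `e` to `e'` does nothing. Neither `e'` nor `b` has to be invertible, as these are the
structure arrows of a lax structure. Cancelling the isomorphism `e.hom ▷ x` reduces the claim to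
naturality of the left unitor. -/
theorem tensor_conj_left {C : Type*} [Category* C] [MonoidalCategory C] {x y i i' : C}
    {a : i ⊗ x ≅ x} {b : i' ⊗ y ⟶ y} {e : 𝟙_ C ≅ i} {e' : 𝟙_ C ⟶ i'}
    (ha : (e.hom ▷ x) ≫ a.hom = (λ_ x).hom) (hb : (e' ▷ y) ≫ b = (λ_ y).hom) (f : x ⟶ y)
    (j : i ⟶ i') (hj : e.hom ≫ j = e') : a.inv ≫ (j ⊗ₘ f) ≫ b = f := by
  rw [Iso.inv_comp_eq, ← cancel_epi (e.hom ▷ x), reassoc_of% ha, MonoidalCategory.tensorHom_def,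
    assoc, ← comp_whiskerRight_assoc, hj, ← whisker_exchange_assoc, hb, leftUnitor_naturality]

theorem tensor_conj_right {C : Type*} [Category* C] [MonoidalCategory C] {x y i i' : C}
    {a : x ⊗ i ≅ x} {b : y ⊗ i' ⟶ y} {e : 𝟙_ C ≅ i} {e' : 𝟙_ C ⟶ i'}
    (ha : (x ◁ e.hom) ≫ a.hom = (ρ_ x).hom) (hb : (y ◁ e') ≫ b = (ρ_ y).hom) (f : x ⟶ y)
    (j : i ⟶ i') (hj : e.hom ≫ j = e') : a.inv ≫ (f ⊗ₘ j) ≫ b = f := by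
  rw [Iso.inv_comp_eq, ← cancel_epi (x ◁ e.hom), reassoc_of% ha, MonoidalCategory.tensorHom_def',
    assoc, ← whiskerLeft_comp_assoc, hj, whisker_exchange_assoc, hb, rightUnitor_naturality]

/-- This is the source of the left unit law of `overCat`: `i` is an empty list and `j` is the unit
of the lax structure up to the identification of `⊗ ()` with the tensor unit. -/
theorem conv_one_left {i l : W ⟶ A.edge} {i' l' : W ⟶ D.edge} (h : i ≫ A.src = l ≫ A.tgt)
    (e : A.compAt i l h = l) (h' : i' ≫ D.src = l' ≫ D.tgt) (e' : D.compAt i' l' h' = l')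
    (hi : i = l ≫ A.tgt ≫ A.ident) (hi' : (l' ≫ D.tgt) ≫ D.ident = i')
    (f : V.tenAt I.ten l ⟶ V.tenAt L.ten l') (j : V.tenAt I.ten i ⟶ V.tenAt L.ten i')
    (hj : j.val = (L.one _ i' hi').val) : I.conv L h e h' e' j f = f := by
  have hk : (𝟙_ (Fam V.toIntCat W)).val = (V.tenAt I.ten i).val := by
    rw [hi, ← assoc]; exact I.unit_val _
  exact tensor_conj_left (I.ident_mul i l h e hk hi) (L.one_mul i' l' h' e' hi') f j
    (Fam.hom_ext ((Fam.eqIso_comp_val hk j).trans hj))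

theorem conv_one_right {i l : W ⟶ A.edge} {i' l' : W ⟶ D.edge} (h : l ≫ A.src = i ≫ A.tgt)
    (e : A.compAt l i h = l) (h' : l' ≫ D.src = i' ≫ D.tgt) (e' : D.compAt l' i' h' = l')
    (hi : i = l ≫ A.src ≫ A.ident) (hi' : (l' ≫ D.src) ≫ D.ident = i')
    (f : V.tenAt I.ten l ⟶ V.tenAt L.ten l') (j : V.tenAt I.ten i ⟶ V.tenAt L.ten i')
    (hj : j.val = (L.one _ i' hi').val) : I.conv L h e h' e' f j = f := by
  have hk : (𝟙_ (Fam V.toIntCat W)).val = (V.tenAt I.ten i).val := by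
    rw [hi, ← assoc]; exact I.unit_val _
  exact tensor_conj_right (I.mul_ident l i h e hk hi) (L.mul_one l' i' h' e' hi') f j
    (Fam.hom_ext ((Fam.eqIso_comp_val hk j).trans hj))

/-- The tensor product of composites. -/
theorem mulHom_conv {l m n l' m' n' : W ⟶ A.edge} {a b c : W ⟶ D.edge}
    (h : l ≫ A.src = m ≫ A.tgt) (hn : A.compAt l m h = n) (h' : l' ≫ A.src = m' ≫ A.tgt)
    (hn' : A.compAt l' m' h' = n') (k : a ≫ D.src = b ≫ D.tgt) (kn : D.compAt a b k = c)
    (f : V.tenAt I.ten l ⟶ V.tenAt I.ten l') (g : V.tenAt I.ten m ⟶ V.tenAt I.ten m')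
    (f' : V.tenAt I.ten l' ⟶ V.tenAt L.ten a) (g' : V.tenAt I.ten m' ⟶ V.tenAt L.ten b) :
    I.mulHom h hn h' hn' f g ≫ I.conv L h' hn' k kn f' g' =
      I.conv L h hn k kn (f ≫ f') (g ≫ g') := by
  simp only [mulHom, conv, assoc, Iso.hom_inv_id_assoc]
  rw [← tensorHom_comp_tensorHom_assoc]

end IteratedTensor

end Over

/-! ### The internal category of arrows from lists to a lax tensor structure -/

section Over

variable {E : Type u} [Category.{v} E] [CartesianMonoidalCategory E] [HasPullbacks E]
  {V : IntMonCat E} {A D : IntCat E} {W W' : E}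

namespace IteratedTensor

variable {η : bouquet V.vert ⟶ A.toIntGraph} (I : IteratedTensor V A η) (L : LaxTensor V D)

/-- The graph whose edges are the triples of a list `l`, an arrow `d` of `D` and an arrow
`⊗ l ⟶ ten d` of `V`. -/
noncomputable def overGraph : IntGraph E := IntGraph.pb I.opsTgt L.ten

/-- The operation underlying an edge. -/
noncomputable def overOps : I.overGraph L ⟶ I.ops := IntGraph.pbFst _ _

/-- The list that is the domain. -/
noncomputable def overDom : I.overGraph L ⟶ A.toIntGraph := I.overOps L ≫ I.opsSrc

/-- The arrow of `D` that is the codomain. -/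
noncomputable def overCod : I.overGraph L ⟶ D.toIntGraph := IntGraph.pbSnd _ _

/-- The underlying arrow of `V`. -/
noncomputable def overArr : (I.overGraph L).edge ⟶ V.edge := (I.overOps L).e ≫ I.opsArr

theorem overArr_src : I.overArr L ≫ V.src = (I.overDom L).e ≫ I.ten.e :=
  (assoc _ _ _).trans ((congrArg (_ ≫ ·) I.opsArr_src).trans (assoc _ _ _).symm)

theorem overArr_tgt : I.overArr L ≫ V.tgt = (I.overCod L).e ≫ L.ten.e :=
  (assoc _ _ _).trans (congrArg IntGraph.Hom.e (IntGraph.pb_condition I.opsTgt L.ten))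

/-- The graphs that are glued have a terminal object of vertices in the middle, so a vertex is just
a pair of a vertex of `A` and a vertex of `D`. -/
theorem over_vert_ext {a b : W ⟶ (I.overGraph L).vert}
    (h : a ≫ (I.overDom L).v = b ≫ (I.overDom L).v)
    (h' : a ≫ (I.overCod L).v = b ≫ (I.overCod L).v) : a = b := by
  refine pullback.hom_ext ?_ h'
  refine pullback.hom_ext ?_ (toUnit_unique _ _)
  exact (assoc _ _ _).trans (h.trans (assoc _ _ _).symm)

theorem over_edge_ext {a b : W ⟶ (I.overGraph L).edge}
    (h : a ≫ (I.overDom L).e = b ≫ (I.overDom L).e)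
    (h' : a ≫ (I.overCod L).e = b ≫ (I.overCod L).e)
    (h'' : a ≫ I.overArr L = b ≫ I.overArr L) : a = b := by
  refine pullback.hom_ext ?_ h'
  refine pullback.hom_ext ?_ ?_
  · exact (assoc _ _ _).trans (h.trans (assoc _ _ _).symm)
  · exact (assoc _ _ _).trans (h''.trans (assoc _ _ _).symm)

theorem over_hom_ext {G : IntGraph E} {a b : G ⟶ I.overGraph L}
    (h : a ≫ I.overDom L = b ≫ I.overDom L) (h' : a ≫ I.overCod L = b ≫ I.overCod L)
    (h'' : a.e ≫ I.overArr L = b.e ≫ I.overArr L) : a = b :=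
  IntGraph.hom_ext
    (I.over_vert_ext L (congrArg IntGraph.Hom.v h) (congrArg IntGraph.Hom.v h'))
    (I.over_edge_ext L (congrArg IntGraph.Hom.e h) (congrArg IntGraph.Hom.e h') h'')

/-- The family of edges given by families of lists `l`, of arrows `d` and of arrows
`⊗ l ⟶ ten d`. -/
noncomputable def overMk (l : W ⟶ A.edge) (d : W ⟶ D.edge)
    (f : V.tenAt I.ten l ⟶ V.tenAt L.ten d) : W ⟶ (I.overGraph L).edge :=
  pullback.lift (f := I.opsTgt.e) (g := L.ten.e)
    (pullback.lift (f := I.ten.e) (g := V.src) l f.val f.src_eq.symm) d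
    (((assoc _ _ _).symm.trans (congrArg (· ≫ V.tgt) (pullback.lift_snd _ _ _))).trans f.tgt_eq)

section

variable (l : W ⟶ A.edge) (d : W ⟶ D.edge) (f : V.tenAt I.ten l ⟶ V.tenAt L.ten d)

theorem overMk_dom : I.overMk L l d f ≫ (I.overDom L).e = l :=
  ((assoc _ _ _).symm.trans (congrArg (· ≫ _) (pullback.lift_fst _ _ _))).trans
    (pullback.lift_fst _ _ _)

theorem overMk_cod : I.overMk L l d f ≫ (I.overCod L).e = d := pullback.lift_snd _ _ _

theorem overMk_arr : I.overMk L l d f ≫ I.overArr L = f.val :=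
  ((assoc _ _ _).symm.trans (congrArg (· ≫ _) (pullback.lift_fst _ _ _))).trans
    (pullback.lift_snd _ _ _)

end

/-- The family of arrows `⊗ l ⟶ ten d` underlying a family of edges. -/
noncomputable def overHom (a : W ⟶ (I.overGraph L).edge) :
    V.tenAt I.ten (a ≫ (I.overDom L).e) ⟶ V.tenAt L.ten (a ≫ (I.overCod L).e) :=
  ⟨a ≫ I.overArr L, by rw [assoc, overArr_src, IntMonCat.tenAt_val, assoc],
    by rw [assoc, overArr_tgt, IntMonCat.tenAt_val, assoc]⟩

theorem composable_map {G H : IntGraph E} (φ : G ⟶ H) {a b : W ⟶ G.edge}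
    (h : a ≫ G.src = b ≫ G.tgt) : (a ≫ φ.e) ≫ H.src = (b ≫ φ.e) ≫ H.tgt := by
  rw [assoc, assoc, φ.src_comm, φ.tgt_comm, ← assoc, h, assoc]

/-- The composite of two families of edges, induced by the composition of lists and of arrows of
`D` and by the lax tensor structure. -/
noncomputable def overComp (a b : W ⟶ (I.overGraph L).edge)
    (h : a ≫ (I.overGraph L).src = b ≫ (I.overGraph L).tgt) : W ⟶ (I.overGraph L).edge :=
  I.overMk L (A.compAt _ _ (composable_map (I.overDom L) h))
    (D.compAt _ _ (composable_map (I.overCod L) h))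
    (I.conv L (composable_map (I.overDom L) h) rfl (composable_map (I.overCod L) h) rfl
      (I.overHom L a) (I.overHom L b))

section

variable (a b : W ⟶ (I.overGraph L).edge) (h : a ≫ (I.overGraph L).src = b ≫ (I.overGraph L).tgt)

theorem overComp_dom : I.overComp L a b h ≫ (I.overDom L).e =
    A.compAt _ _ (composable_map (I.overDom L) h) := I.overMk_dom L _ _ _

theorem overComp_cod : I.overComp L a b h ≫ (I.overCod L).e =
    D.compAt _ _ (composable_map (I.overCod L) h) := I.overMk_cod L _ _ _

theorem overComp_arr : I.overComp L a b h ≫ I.overArr L =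
    (I.conv L (composable_map (I.overDom L) h) rfl (composable_map (I.overCod L) h) rfl
      (I.overHom L a) (I.overHom L b)).val := I.overMk_arr L _ _ _

end

/-- The arrow component rests on `conv_re`, hence on the stability of the lax structure under
reindexing. -/
theorem pre_overComp (r : W' ⟶ W) (a b : W ⟶ (I.overGraph L).edge)
    (h : a ≫ (I.overGraph L).src = b ≫ (I.overGraph L).tgt)
    (h' : (r ≫ a) ≫ (I.overGraph L).src = (r ≫ b) ≫ (I.overGraph L).tgt) :
    r ≫ I.overComp L a b h = I.overComp L (r ≫ a) (r ≫ b) h' := by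
  apply over_edge_ext
  · rw [assoc, overComp_dom, A.pre_compAt, overComp_dom]
    exact A.compAt_congr (assoc _ _ _).symm (assoc _ _ _).symm _
  · rw [assoc, overComp_cod, D.pre_compAt, overComp_cod]
    exact D.compAt_congr (assoc _ _ _).symm (assoc _ _ _).symm _
  · rw [assoc, overComp_arr, overComp_arr]
    exact I.conv_re L r _ _ _ _ _ _ _ _ _ _ _ _ (assoc _ _ _).symm (assoc _ _ _).symm
      (assoc _ _ _).symm (assoc _ _ _).symm (assoc _ _ _).symm (assoc _ _ _).symm

theorem overComp_congr {a b a' b' : W ⟶ (I.overGraph L).edge} (ha : a = a') (hb : b = b')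
    (h : a ≫ (I.overGraph L).src = b ≫ (I.overGraph L).tgt)
    (h' : a' ≫ (I.overGraph L).src = b' ≫ (I.overGraph L).tgt) :
    I.overComp L a b h = I.overComp L a' b' h' := by
  subst ha hb; rfl

theorem overMk_src_eq {l : W ⟶ A.edge} {d : W ⟶ D.edge}
    (f : V.tenAt I.ten l ⟶ V.tenAt L.ten d) (a : W ⟶ (I.overGraph L).vert)
    (hl : l ≫ A.src = a ≫ (I.overDom L).v) (hm : d ≫ D.src = a ≫ (I.overCod L).v) :
    I.overMk L l d f ≫ (I.overGraph L).src = a := by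
  apply over_vert_ext
  · rw [assoc, ← (I.overDom L).src_comm, ← assoc, overMk_dom, hl]
  · rw [assoc, ← (I.overCod L).src_comm, ← assoc, overMk_cod, hm]

theorem overMk_tgt_eq {l : W ⟶ A.edge} {d : W ⟶ D.edge}
    (f : V.tenAt I.ten l ⟶ V.tenAt L.ten d) (a : W ⟶ (I.overGraph L).vert)
    (hl : l ≫ A.tgt = a ≫ (I.overDom L).v) (hm : d ≫ D.tgt = a ≫ (I.overCod L).v) :
    I.overMk L l d f ≫ (I.overGraph L).tgt = a := by
  apply over_vert_ext
  · rw [assoc, ← (I.overDom L).tgt_comm, ← assoc, overMk_dom, hl]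
  · rw [assoc, ← (I.overCod L).tgt_comm, ← assoc, overMk_cod, hm]

/-- The family of identity edges. -/
noncomputable def overIdent : (I.overGraph L).vert ⟶ (I.overGraph L).edge :=
  I.overMk L ((I.overDom L).v ≫ A.ident) ((I.overCod L).v ≫ D.ident) (I.convOne L rfl rfl)

theorem overIdent_dom (a : W ⟶ (I.overGraph L).vert) :
    (a ≫ I.overIdent L) ≫ (I.overDom L).e = (a ≫ (I.overDom L).v) ≫ A.ident := by
  rw [assoc, overIdent, overMk_dom, assoc]

theorem overIdent_cod (a : W ⟶ (I.overGraph L).vert) :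
    (a ≫ I.overIdent L) ≫ (I.overCod L).e = (a ≫ (I.overCod L).v) ≫ D.ident := by
  rw [assoc, overIdent, overMk_cod, assoc]

theorem overIdent_arr (a : W ⟶ (I.overGraph L).vert) :
    (a ≫ I.overIdent L) ≫ I.overArr L = (L.one (a ≫ (I.overCod L).v) _ rfl).val := by
  rw [assoc, overIdent, overMk_arr, convOne_val]
  exact L.one_re _ _ _ _ _ _ _ rfl

/-- The composition of `overCat` is given at the generic composable pair. This identifies its values
at all other pairs, so that the axioms can be checked on generalized elements. -/
theorem lift_overComp (a b : W ⟶ (I.overGraph L).edge)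
    (h : a ≫ (I.overGraph L).src = b ≫ (I.overGraph L).tgt) :
    pullback.lift a b h ≫ I.overComp L (pullback.fst (I.overGraph L).src (I.overGraph L).tgt)
      (pullback.snd (I.overGraph L).src (I.overGraph L).tgt) pullback.condition =
      I.overComp L a b h := by
  rw [I.pre_overComp _ _ _ _ _ (by rw [pullback.lift_fst, pullback.lift_snd, h])]
  exact I.overComp_congr _ (pullback.lift_fst _ _ _) (pullback.lift_snd _ _ _) _ _

theorem overComp_ident_left (a b : W ⟶ (I.overGraph L).edge)
    (hb : b = a ≫ (I.overGraph L).tgt ≫ I.overIdent L)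
    (h : b ≫ (I.overGraph L).src = a ≫ (I.overGraph L).tgt) : I.overComp L b a h = a := by
  have h₁ : b ≫ (I.overDom L).e = (a ≫ (I.overDom L).e) ≫ A.tgt ≫ A.ident := by
    rw [hb, ← assoc, overIdent_dom, assoc a, ← (I.overDom L).tgt_comm]
    simp only [assoc]
  have h₂ : b ≫ (I.overCod L).e = (a ≫ (I.overCod L).e) ≫ D.tgt ≫ D.ident := by
    rw [hb, ← assoc, overIdent_cod, assoc a, ← (I.overCod L).tgt_comm]
    simp only [assoc]
  have k₁ : A.compAt _ _ (composable_map (I.overDom L) h) = a ≫ (I.overDom L).e :=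
    (A.compAt_congr h₁ rfl _).trans (A.compAt_ident_left _)
  have k₂ : D.compAt _ _ (composable_map (I.overCod L) h) = a ≫ (I.overCod L).e :=
    (D.compAt_congr h₂ rfl _).trans (D.compAt_ident_left _)
  apply over_edge_ext
  · rw [overComp_dom, k₁]
  · rw [overComp_cod, k₂]
  · rw [overComp_arr]
    -- Only the names of the composite list and of the composite in `D` change here: by `k₁` and
    -- `k₂` they are those of `a` itself, as `conv_one_left` requires.
    refine (I.conv_val_congr L _ rfl _ rfl _ k₁ _ k₂ rfl rfl rfl rfl rfl rfl).trans ?_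
    refine congrArg Fam.Hom.val (I.conv_one_left L _ k₁ _ k₂ h₁
      ((assoc _ _ _).trans h₂.symm) (I.overHom L a) (I.overHom L b) ?_)
    refine (congrArg (· ≫ I.overArr L) (hb.trans (assoc _ _ _).symm)).trans
      ((I.overIdent_arr L _).trans ?_)
    -- The unit is taken at the codomain of the target vertex of `a`, while the unit law speaks of
    -- the target of the codomain of `a`.
    exact L.one_val_congr _ _ (by rw [assoc, assoc, ← (I.overCod L).tgt_comm])

theorem overComp_ident_right (a b : W ⟶ (I.overGraph L).edge)
    (hb : b = a ≫ (I.overGraph L).src ≫ I.overIdent L)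
    (h : a ≫ (I.overGraph L).src = b ≫ (I.overGraph L).tgt) : I.overComp L a b h = a := by
  have h₁ : b ≫ (I.overDom L).e = (a ≫ (I.overDom L).e) ≫ A.src ≫ A.ident := by
    rw [hb, ← assoc, overIdent_dom, assoc a, ← (I.overDom L).src_comm]
    simp only [assoc]
  have h₂ : b ≫ (I.overCod L).e = (a ≫ (I.overCod L).e) ≫ D.src ≫ D.ident := by
    rw [hb, ← assoc, overIdent_cod, assoc a, ← (I.overCod L).src_comm]
    simp only [assoc]
  have k₁ : A.compAt _ _ (composable_map (I.overDom L) h) = a ≫ (I.overDom L).e :=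
    (A.compAt_congr rfl h₁ _).trans (A.compAt_ident_right _)
  have k₂ : D.compAt _ _ (composable_map (I.overCod L) h) = a ≫ (I.overCod L).e :=
    (D.compAt_congr rfl h₂ _).trans (D.compAt_ident_right _)
  apply over_edge_ext
  · rw [overComp_dom, k₁]
  · rw [overComp_cod, k₂]
  · rw [overComp_arr]
    refine (I.conv_val_congr L _ rfl _ rfl _ k₁ _ k₂ rfl rfl rfl rfl rfl rfl).trans ?_
    refine congrArg Fam.Hom.val (I.conv_one_right L _ k₁ _ k₂ h₁
      ((assoc _ _ _).trans h₂.symm) (I.overHom L a) (I.overHom L b) ?_)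
    refine (congrArg (· ≫ I.overArr L) (hb.trans (assoc _ _ _).symm)).trans
      ((I.overIdent_arr L _).trans ?_)
    exact L.one_val_congr _ _ (by rw [assoc, assoc, ← (I.overCod L).src_comm])

theorem overComp_assoc (a b c : W ⟶ (I.overGraph L).edge)
    (h : a ≫ (I.overGraph L).src = b ≫ (I.overGraph L).tgt)
    (h' : b ≫ (I.overGraph L).src = c ≫ (I.overGraph L).tgt)
    (k : I.overComp L a b h ≫ (I.overGraph L).src = c ≫ (I.overGraph L).tgt)
    (k' : a ≫ (I.overGraph L).src = I.overComp L b c h' ≫ (I.overGraph L).tgt) :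
    I.overComp L (I.overComp L a b h) c k = I.overComp L a (I.overComp L b c h') k' := by
  have e₁ := I.overComp_dom L a b h
  have e₂ := I.overComp_dom L b c h'
  have e₁' := I.overComp_cod L a b h
  have e₂' := I.overComp_cod L b c h'
  have e₃ : A.compAt _ _ (composable_map (I.overDom L) k) =
      A.compAt _ _ (composable_map (I.overDom L) k') :=
    ((A.compAt_congr e₁ rfl _).trans (A.compAt_assoc _ _ _ (composable_map (I.overDom L) h)
      (composable_map (I.overDom L) h'))).trans (A.compAt_congr rfl e₂ _).symm
  have e₃' : D.compAt _ _ (composable_map (I.overCod L) k) =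
      D.compAt _ _ (composable_map (I.overCod L) k') :=
    ((D.compAt_congr e₁' rfl _).trans (D.compAt_assoc _ _ _ (composable_map (I.overCod L) h)
      (composable_map (I.overCod L) h'))).trans (D.compAt_congr rfl e₂' _).symm
  apply over_edge_ext
  · exact (I.overComp_dom L _ _ _).trans (e₃.trans (I.overComp_dom L _ _ _).symm)
  · exact (I.overComp_cod L _ _ _).trans (e₃'.trans (I.overComp_cod L _ _ _).symm)
  · rw [overComp_arr, overComp_arr]
    have key := congrArg Fam.Hom.val (I.conv_assoc L (composable_map (I.overDom L) h)
      (composable_map (I.overDom L) h') (composable_map (I.overDom L) k)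
      (composable_map (I.overDom L) k') e₁.symm e₂.symm e₃ rfl
      (composable_map (I.overCod L) h) (composable_map (I.overCod L) h')
      (composable_map (I.overCod L) k) (composable_map (I.overCod L) k') e₁'.symm e₂'.symm e₃' rfl
      (I.overHom L a) (I.overHom L b) (I.overHom L c))
    -- In `key` the inner factors are tensor products formed by `conv`, whereas the goal has the
    -- arrows of the composite edges. They have the same underlying arrow of `E`, which is what the
    -- two remaining goals use.
    refine Eq.trans ?_ (key.trans ?_)
    · exact I.conv_val_congr L _ rfl _ rfl _ _ _ _ rfl rfl rfl rfl
        ((I.overComp_arr L a b h).trans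
          (I.conv_val_congr L _ rfl _ rfl _ _ _ _ rfl rfl rfl rfl rfl rfl)) rfl
    · exact (I.conv_val_congr L _ rfl _ rfl _ _ _ _ rfl rfl rfl rfl rfl
        ((I.overComp_arr L b c h').trans
          (I.conv_val_congr L _ rfl _ rfl _ _ _ _ rfl rfl rfl rfl rfl rfl))).symm

/-- The internal category whose arrows are the triples of a list `l`, an arrow `d` of `D` and an
arrow `⊗ l ⟶ ten d` of `V`. -/
noncomputable def overCat : IntCat E where
  toIntGraph := I.overGraph L
  ident := I.overIdent L
  comp := I.overComp L (pullback.fst _ _) (pullback.snd _ _) pullback.condition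
  ident_src := I.overMk_src_eq L _ _ (by rw [assoc, A.ident_src, comp_id, id_comp])
    (by rw [assoc, D.ident_src, comp_id, id_comp])
  ident_tgt := I.overMk_tgt_eq L _ _ (by rw [assoc, A.ident_tgt, comp_id, id_comp])
    (by rw [assoc, D.ident_tgt, comp_id, id_comp])
  comp_src := I.overMk_src_eq L _ _
    (by rw [A.compAt_src, assoc, assoc, (I.overDom L).src_comm])
    (by rw [D.compAt_src, assoc, assoc, (I.overCod L).src_comm])
  comp_tgt := I.overMk_tgt_eq L _ _
    (by rw [A.compAt_tgt, assoc, assoc, (I.overDom L).tgt_comm])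
    (by rw [D.compAt_tgt, assoc, assoc, (I.overCod L).tgt_comm])
  ident_comp f h := by
    rw [lift_overComp]
    exact I.overComp_ident_left L _ _ rfl h
  comp_ident f h := by
    rw [lift_overComp]
    exact I.overComp_ident_right L _ _ rfl h
  comp_assoc k g f hkg hgf h₁ h₂ := by
    have e₁ := I.lift_overComp L k g hkg
    have e₂ := I.lift_overComp L g f hgf
    refine (I.lift_overComp L _ _ h₁).trans (Eq.trans ?_ (I.lift_overComp L _ _ h₂).symm)
    refine (I.overComp_congr L e₁ rfl h₁ (by rw [← e₁, h₁])).trans (Eq.trans ?_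
      (I.overComp_congr L rfl e₂ h₂ (by rw [← e₂, h₂])).symm)
    exact I.overComp_assoc L _ _ _ _ _ _ _

theorem overCat_compAt (a b : W ⟶ (I.overGraph L).edge)
    (h : a ≫ (I.overGraph L).src = b ≫ (I.overGraph L).tgt) :
    (I.overCat L).compAt a b h = I.overComp L a b h := I.lift_overComp L a b h

/-- The internal functor that sends an arrow of `overCat` to its list. -/
noncomputable def overDomFunctor : I.overCat L ⟶ A where
  toHom := I.overDom L
  map_ident := I.overMk_dom L _ _ _
  map_comp g f h _ := (congrArg (· ≫ _) (I.overCat_compAt L g f h)).trans (I.overComp_dom L g f h)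

/-- The internal functor that sends an arrow of `overCat` to its arrow of `D`. -/
noncomputable def overCodFunctor : I.overCat L ⟶ D where
  toHom := I.overCod L
  map_ident := I.overMk_cod L _ _ _
  map_comp g f h _ := (congrArg (· ≫ _) (I.overCat_compAt L g f h)).trans (I.overComp_cod L g f h)

/-- The morphism of graphs given by a list of objects, an arrow of `D` and an arrow of `V`. -/
noncomputable def overLift {G : IntGraph E} (φ : G ⟶ I.ops) (d : G ⟶ D.toIntGraph)
    (h : (φ.e ≫ I.opsArr) ≫ V.tgt = d.e ≫ L.ten.e) : G ⟶ I.overGraph L :=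
  IntGraph.pbLift φ d (bouquet_hom_ext ((assoc _ _ _).symm.trans h))

section

variable {G : IntGraph E} (φ : G ⟶ I.ops) (d : G ⟶ D.toIntGraph)
    (h : (φ.e ≫ I.opsArr) ≫ V.tgt = d.e ≫ L.ten.e)

theorem overLift_ops : I.overLift L φ d h ≫ I.overOps L = φ := IntGraph.pbLift_fst _ _ _

theorem overLift_dom : I.overLift L φ d h ≫ I.overDom L = φ ≫ I.opsSrc :=
  (assoc _ _ _).symm.trans (congrArg (· ≫ I.opsSrc) (I.overLift_ops L φ d h))

theorem overLift_cod : I.overLift L φ d h ≫ I.overCod L = d := IntGraph.pbLift_snd _ _ _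

theorem overLift_arr : (I.overLift L φ d h).e ≫ I.overArr L = φ.e ≫ I.opsArr :=
  (assoc _ _ _).symm.trans (congrArg (· ≫ I.opsArr)
    (congrArg IntGraph.Hom.e (I.overLift_ops L φ d h)))

end

/-- Internal functors to `overCat`. -/
noncomputable def overFunctor {B : IntCat E} (φ : B.toIntGraph ⟶ I.overGraph L) (l : B ⟶ A)
    (d : B ⟶ D) (hl : φ ≫ I.overDom L = l.toHom) (hd : φ ≫ I.overCod L = d.toHom)
    (hi : B.ident ≫ φ.e ≫ I.overArr L = (L.one d.v _ rfl).val)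
    (hc : ∀ {W : E} (g f : W ⟶ B.edge) (h : g ≫ B.src = f ≫ B.tgt)
      (h' : (g ≫ φ.e) ≫ (I.overGraph L).src = (f ≫ φ.e) ≫ (I.overGraph L).tgt),
      B.compAt g f h ≫ φ.e ≫ I.overArr L =
        I.overComp L (g ≫ φ.e) (f ≫ φ.e) h' ≫ I.overArr L) :
    B ⟶ I.overCat L where
  toHom := φ
  map_ident := by
    have hle := congrArg IntGraph.Hom.e hl
    have hme := congrArg IntGraph.Hom.e hd
    have hlv := congrArg IntGraph.Hom.v hl
    have hmv := congrArg IntGraph.Hom.v hd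
    -- Domain and codomain are compatible because `l` and `d` are functors; only the arrow of `V`
    -- gives a condition.
    refine I.over_edge_ext L ?_ ?_ ?_
    · refine Eq.trans ?_ (I.overIdent_dom L φ.v).symm
      refine ((assoc _ _ _).trans (congrArg (_ ≫ ·) hle)).trans (l.map_ident.trans ?_)
      exact congrArg (· ≫ _) hlv.symm
    · refine Eq.trans ?_ (I.overIdent_cod L φ.v).symm
      refine ((assoc _ _ _).trans (congrArg (_ ≫ ·) hme)).trans (d.map_ident.trans ?_)
      exact congrArg (· ≫ _) hmv.symm
    · exact (assoc _ _ _).trans (hi.trans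
        ((L.one_val_congr _ _ hmv.symm).trans (I.overIdent_arr L φ.v).symm))
  map_comp g f h h' := by
    have hle : φ.e ≫ (I.overDom L).e = l.e := congrArg IntGraph.Hom.e hl
    have hme : φ.e ≫ (I.overCod L).e = d.e := congrArg IntGraph.Hom.e hd
    have conv : ∀ {C : IntCat E} (n : B ⟶ C), (g ≫ n.e) ≫ C.src = (f ≫ n.e) ≫ C.tgt := by
      intro C n
      rw [assoc, assoc, n.src_comm, n.tgt_comm, ← assoc, h, assoc]
    refine Eq.trans ?_ (I.overCat_compAt L _ _ h').symm
    refine I.over_edge_ext L ?_ ?_ ?_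
    · refine Eq.trans ?_ (I.overComp_dom L _ _ h').symm
      refine ((assoc _ _ _).trans (congrArg (_ ≫ ·) hle)).trans
        ((l.map_comp g f h (conv l)).trans (A.compAt_congr ?_ ?_ _))
      · exact (congrArg (g ≫ ·) hle.symm).trans (assoc _ _ _).symm
      · exact (congrArg (f ≫ ·) hle.symm).trans (assoc _ _ _).symm
    · refine Eq.trans ?_ (I.overComp_cod L _ _ h').symm
      refine ((assoc _ _ _).trans (congrArg (_ ≫ ·) hme)).trans
        ((d.map_comp g f h (conv d)).trans (D.compAt_congr ?_ ?_ _))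
      · exact (congrArg (g ≫ ·) hme.symm).trans (assoc _ _ _).symm
      · exact (congrArg (f ≫ ·) hme.symm).trans (assoc _ _ _).symm
    · exact (assoc _ _ _).trans (hc g f h h')

end IteratedTensor

end Over

/-! ### Vertical composition, interchange, and change of lax structure -/

section Over

variable {E : Type u} [Category.{v} E] [CartesianMonoidalCategory E] [HasPullbacks E]
  {V : IntMonCat E} {A D D' : IntCat E} {W W' : E}

namespace IteratedTensor

variable {η : bouquet V.vert ⟶ A.toIntGraph} (I : IteratedTensor V A η) (L : LaxTensor V D)

/-- The morphism of graphs underlying an internal functor to `overCat`. -/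
noncomputable def overMap {B : IntCat E} (F : B ⟶ I.overCat L) :
    B.toIntGraph ⟶ I.overGraph L := (IntCat.forget E).map F

theorem overMap_ident {B : IntCat E} (F : B ⟶ I.overCat L) :
    B.ident ≫ (I.overMap L F).e ≫ I.overArr L =
      (L.one ((I.overMap L F).v ≫ (I.overCod L).v) _ rfl).val :=
  (assoc _ _ _).symm.trans ((congrArg (· ≫ I.overArr L) F.map_ident).trans
    (I.overIdent_arr L F.v))

theorem overMap_comp {B : IntCat E} (F : B ⟶ I.overCat L) (g f : W ⟶ B.edge)
    (h : g ≫ B.src = f ≫ B.tgt)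
    (h' : (g ≫ (I.overMap L F).e) ≫ (I.overGraph L).src =
      (f ≫ (I.overMap L F).e) ≫ (I.overGraph L).tgt) :
    B.compAt g f h ≫ (I.overMap L F).e ≫ I.overArr L = I.overComp L _ _ h' ≫ I.overArr L :=
  (assoc _ _ _).symm.trans ((congrArg (· ≫ I.overArr L) (F.map_comp g f h h')).trans
    (congrArg (· ≫ I.overArr L) (I.overCat_compAt L _ _ _)))

section

variable {G : IntGraph E} {φ : G ⟶ I.overGraph L} {ψ : G ⟶ I.stGraph}

theorem overVert_composable (h : φ ≫ I.overDom L = ψ ≫ I.stCod) :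
    (φ.e ≫ I.overArr L) ≫ V.src = (ψ.e ≫ I.stArr) ≫ V.tgt := by
  have he : φ.e ≫ (I.overDom L).e = ψ.e ≫ I.stCod.e := congrArg IntGraph.Hom.e h
  rw [assoc, assoc, overArr_src, stArr_tgt, ← assoc, ← assoc, he]

variable (φ ψ) (h : φ ≫ I.overDom L = ψ ≫ I.stCod)

/-- The composite of a morphism to `overGraph` with a morphism to the graph of lists, by composition
in `V`. -/
noncomputable def overVert : G ⟶ I.overGraph L :=
  I.overLift L (I.opsLift (ψ ≫ I.stDom)
    (V.compAt (φ.e ≫ I.overArr L) (ψ.e ≫ I.stArr) (I.overVert_composable L h))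
    (by rw [V.compAt_src, assoc, stArr_src, IntGraph.comp_e, assoc])) (φ ≫ I.overCod L)
    (by rw [opsLift_arr, V.compAt_tgt, assoc, overArr_tgt, IntGraph.comp_e, assoc])

theorem overVert_dom : I.overVert L φ ψ h ≫ I.overDom L = ψ ≫ I.stDom :=
  (I.overLift_dom L _ _ _).trans (I.opsLift_src _ _ _)

theorem overVert_cod : I.overVert L φ ψ h ≫ I.overCod L = φ ≫ I.overCod L :=
  I.overLift_cod L _ _ _

theorem overVert_arr : (I.overVert L φ ψ h).e ≫ I.overArr L =
    V.compAt (φ.e ≫ I.overArr L) (ψ.e ≫ I.stArr) (I.overVert_composable L h) :=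
  (I.overLift_arr L _ _ _).trans (I.opsLift_arr _ _ _)

end

/-- The interchange law, for families of composable edges. -/
theorem over_interchange {a b c d : W ⟶ (I.overGraph L).edge} {a' b' : W ⟶ I.stGraph.edge}
    (h : a ≫ (I.overGraph L).src = b ≫ (I.overGraph L).tgt)
    (h' : a' ≫ I.stGraph.src = b' ≫ I.stGraph.tgt)
    (hc : c ≫ (I.overGraph L).src = d ≫ (I.overGraph L).tgt)
    (ka : a ≫ (I.overDom L).e = a' ≫ I.stCod.e) (kb : b ≫ (I.overDom L).e = b' ≫ I.stCod.e)
    (c₁ : c ≫ (I.overDom L).e = a' ≫ I.stDom.e)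
    (c₂ : c ≫ (I.overCod L).e = a ≫ (I.overCod L).e)
    (d₁ : d ≫ (I.overDom L).e = b' ≫ I.stDom.e)
    (d₂ : d ≫ (I.overCod L).e = b ≫ (I.overCod L).e)
    (qa : (a ≫ I.overArr L) ≫ V.src = (a' ≫ I.stArr) ≫ V.tgt)
    (qb : (b ≫ I.overArr L) ≫ V.src = (b' ≫ I.stArr) ≫ V.tgt)
    (q : (I.overComp L a b h ≫ I.overArr L) ≫ V.src = (I.stComp a' b' h' ≫ I.stArr) ≫ V.tgt)
    (hca : c ≫ I.overArr L = V.compAt _ _ qa) (hdb : d ≫ I.overArr L = V.compAt _ _ qb) :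
    V.compAt (I.overComp L a b h ≫ I.overArr L) (I.stComp a' b' h' ≫ I.stArr) q =
      I.overComp L c d hc ≫ I.overArr L := by
  -- `f` and `g` are the arrows of `a` and `b` with their domains rewritten as the codomains of `a'`
  -- and `b'`, so that they can be composed with those of `a'` and `b'` in the category of families.
  let f : V.tenAt I.ten (a' ≫ I.stCod.e) ⟶ V.tenAt L.ten (a ≫ (I.overCod L).e) :=
    ⟨a ≫ I.overArr L, (I.overHom L a).src_eq.trans (congrArg (· ≫ I.ten.e) ka),
      (I.overHom L a).tgt_eq⟩
  let g : V.tenAt I.ten (b' ≫ I.stCod.e) ⟶ V.tenAt L.ten (b ≫ (I.overCod L).e) :=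
    ⟨b ≫ I.overArr L, (I.overHom L b).src_eq.trans (congrArg (· ≫ I.ten.e) kb),
      (I.overHom L b).tgt_eq⟩
  have e₁ : I.overComp L a b h ≫ I.overArr L = (I.conv L (I.st_cod_composable h') rfl
      (composable_map (I.overCod L) h) rfl f g).val :=
    (I.overComp_arr L a b h).trans (I.conv_val_congr L _ _ _ _ _ _ _ _ ka kb rfl rfl rfl rfl)
  have e₂ := I.stComp_arr a' b' h'
  refine (V.compAt_congr e₁ e₂ q).trans ?_
  refine Eq.trans ?_ (I.overComp_arr L c d hc).symm
  have key := congrArg Fam.Hom.val (I.mulHom_conv L (I.st_dom_composable h') rfl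
    (I.st_cod_composable h') rfl (composable_map (I.overCod L) h) rfl (I.stHom a') (I.stHom b') f g)
  refine Eq.trans ?_ (key.trans ?_)
  · rfl
  · exact I.conv_val_congr L _ _ _ _ _ _ _ _ c₁.symm d₁.symm c₂.symm d₂.symm hca.symm hdb.symm

/-- The composite of an internal functor to `overCat` with an internal functor to the category of
lists. -/
noncomputable def overVertFunctor {B : IntCat E} (F : B ⟶ I.overCat L) (G : B ⟶ I.stCat)
    (h₀ : I.overMap L F ≫ I.overDom L = I.stMap G ≫ I.stCod) : B ⟶ I.overCat L :=
  I.overFunctor L (I.overVert L (I.overMap L F) (I.stMap G) h₀)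
    (G ≫ I.stDomFunctor) (F ≫ I.overCodFunctor L) (I.overVert_dom L _ _ _)
    (I.overVert_cod L _ _ _)
    (by
      rw [overVert_arr, V.pre_compAt, V.compAt_congr (I.overMap_ident L F) (I.stMap_ident G)]
      -- Over an identity, `G` gives the identity of the tensor unit and `F` gives the unit of the
      -- lax structure, so the composite is the latter.
      have := V.compAt_ident_right (L.one ((I.overMap L F).v ≫ (I.overCod L).v) _ rfl).val
      refine (V.compAt_congr rfl ?_ _).trans this
      rw [← assoc _ V.src, Fam.Hom.src_eq, IntMonCat.tensorUnit_val, assoc])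
    (fun g f k k' => by
      have hF := composable_map (I.overMap L F) k
      have hG := composable_map (I.stMap G) k
      have he := congrArg IntGraph.Hom.e h₀
      have hd := congrArg IntGraph.Hom.e (I.overVert_dom L _ _ h₀)
      have hc := congrArg IntGraph.Hom.e (I.overVert_cod L _ _ h₀)
      have ha := I.overVert_arr L _ _ h₀
      simp only [IntGraph.comp_e] at he hd hc
      rw [overVert_arr, V.pre_compAt, V.compAt_congr (I.overMap_comp L F g f k hF)
        (I.stMap_comp G g f k hG)]
      have q : ∀ {Y : E} (x : Y ⟶ B.edge), ((x ≫ (I.overMap L F).e) ≫ I.overArr L) ≫ V.src =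
          ((x ≫ (I.stMap G).e) ≫ I.stArr) ≫ V.tgt := by
        intro Y x
        have := I.overVert_composable L h₀
        simp only [assoc] at this ⊢
        rw [this]
      refine I.over_interchange L hF hG k' ?_ ?_ ?_ ?_ ?_ ?_ (q g) (q f) _ ?_ ?_
      · rw [assoc, assoc, he]
      · rw [assoc, assoc, he]
      · rw [assoc, assoc, hd]
      · rw [assoc, assoc, hc]
      · rw [assoc, assoc, hd]
      · rw [assoc, assoc, hc]
      · rw [assoc, ha, V.pre_compAt]
        exact V.compAt_congr (assoc _ _ _).symm (assoc _ _ _).symm _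
      · rw [assoc, ha, V.pre_compAt]
        exact V.compAt_congr (assoc _ _ _).symm (assoc _ _ _).symm _)

end IteratedTensor

/-- Morphisms of lax tensor structures over an internal functor `f : D ⟶ D'`, given for generalized
elements. -/
structure LaxTensor.Hom (L : LaxTensor V D) (L' : LaxTensor V D') (f : D ⟶ D') where
  app : D.edge ⟶ V.edge
  app_src : app ≫ V.src = L.ten.e
  app_tgt : app ≫ V.tgt = f.e ≫ L'.ten.e
  map_mul : ∀ {W : E} (l m n : W ⟶ D.edge) (h : l ≫ D.src = m ≫ D.tgt) (hn : D.compAt l m h = n)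
    (l' m' n' : W ⟶ D'.edge) (h' : l' ≫ D'.src = m' ≫ D'.tgt) (hn' : D'.compAt l' m' h' = n')
    (_ : l ≫ f.e = l') (_ : m ≫ f.e = m')
    -- The components are arguments pinned down by their underlying arrows. They can thus be
    -- supplied in whatever form they arise, for instance as reindexed morphisms of `Ext(V)`.
    (φ : V.tenAt L.ten l ⟶ V.tenAt L'.ten l') (ψ : V.tenAt L.ten m ⟶ V.tenAt L'.ten m')
    (χ : V.tenAt L.ten n ⟶ V.tenAt L'.ten n')
    (_ : φ.val = l ≫ app) (_ : ψ.val = m ≫ app) (_ : χ.val = n ≫ app),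
    L.mul l m n h hn ≫ χ = (φ ⊗ₘ ψ) ≫ L'.mul l' m' n' h' hn'
  map_one : ∀ {W : E} (p : W ⟶ D.vert) (i : W ⟶ D.edge) (hi : p ≫ D.ident = i)
    (p' : W ⟶ D'.vert) (i' : W ⟶ D'.edge) (hi' : p' ≫ D'.ident = i') (_ : p ≫ f.v = p')
    (χ : V.tenAt L.ten i ⟶ V.tenAt L'.ten i') (_ : χ.val = i ≫ app),
    L.one p i hi ≫ χ = L'.one p' i' hi'

namespace IteratedTensor

variable {η : bouquet V.vert ⟶ A.toIntGraph} (I : IteratedTensor V A η) {L : LaxTensor V D}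
  {L' : LaxTensor V D'} {f : D ⟶ D'} (φ : L.Hom L' f)

theorem overPush_composable :
    ((I.overCod L).e ≫ φ.app) ≫ V.src = I.overArr L ≫ V.tgt := by
  rw [assoc, φ.app_src, overArr_tgt]

/-- The morphism of graphs induced by a morphism of lax tensor structures. -/
noncomputable def overPush : I.overGraph L ⟶ I.overGraph L' :=
  I.overLift L' (I.opsLift (I.overDom L)
    (V.compAt ((I.overCod L).e ≫ φ.app) (I.overArr L) (I.overPush_composable φ))
    (by rw [V.compAt_src, overArr_src])) (I.overCod L ≫ f.toHom)
    (by
      rw [opsLift_arr, V.compAt_tgt, assoc, φ.app_tgt]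
      exact (assoc _ _ _).symm)

theorem overPush_dom : I.overPush φ ≫ I.overDom L' = I.overDom L :=
  (I.overLift_dom L' _ _ _).trans (I.opsLift_src _ _ _)

theorem overPush_cod : I.overPush φ ≫ I.overCod L' = I.overCod L ≫ f.toHom :=
  I.overLift_cod L' _ _ _

theorem overPush_arr : (I.overPush φ).e ≫ I.overArr L' =
    V.compAt ((I.overCod L).e ≫ φ.app) (I.overArr L) (I.overPush_composable φ) :=
  (I.overLift_arr L' _ _ _).trans (I.opsLift_arr _ _ _)

/-- Compatibility of `φ` with multiplication, preceded by a tensor product of arrows: this is what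
makes `overPush` preserve composition. -/
theorem conv_app {l m n : W ⟶ A.edge} {a b c : W ⟶ D.edge} {a' b' c' : W ⟶ D'.edge}
    (h : l ≫ A.src = m ≫ A.tgt) (hn : A.compAt l m h = n) (k : a ≫ D.src = b ≫ D.tgt)
    (kn : D.compAt a b k = c) (k' : a' ≫ D'.src = b' ≫ D'.tgt) (kn' : D'.compAt a' b' k' = c')
    (ha : a ≫ f.e = a') (hb : b ≫ f.e = b')
    (p : V.tenAt I.ten l ⟶ V.tenAt L.ten a) (q : V.tenAt I.ten m ⟶ V.tenAt L.ten b)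
    (α : V.tenAt L.ten a ⟶ V.tenAt L'.ten a') (β : V.tenAt L.ten b ⟶ V.tenAt L'.ten b')
    (χ : V.tenAt L.ten c ⟶ V.tenAt L'.ten c')
    (hα : α.val = a ≫ φ.app) (hβ : β.val = b ≫ φ.app) (hχ : χ.val = c ≫ φ.app) :
    I.conv L h hn k kn p q ≫ χ = I.conv L' h hn k' kn' (p ≫ α) (q ≫ β) := by
  simp only [conv, assoc]
  rw [φ.map_mul a b c k kn a' b' c' k' kn' ha hb α β χ hα hβ hχ, tensorHom_comp_tensorHom_assoc]

/-- The family of arrows of `V` at a family of arrows of `D`. -/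
def _root_.LaxTensor.Hom.at (a : W ⟶ D.edge) (a' : W ⟶ D'.edge) (h : a ≫ f.e = a') :
    V.tenAt L.ten a ⟶ V.tenAt L'.ten a' :=
  ⟨a ≫ φ.app, by rw [assoc, φ.app_src]; rfl, by rw [assoc, φ.app_tgt, ← assoc, h]; rfl⟩

/-- The arrow of an identity edge is the unit of `L`, and `φ` carries it to the unit of `L'`. -/
theorem overPush_ident : I.overIdent L ≫ (I.overPush φ).e ≫ I.overArr L' =
    (L'.one ((I.overCod L).v ≫ f.v) _ rfl).val := by
  rw [overPush_arr, V.pre_compAt]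
  refine Eq.trans ?_ (congrArg Fam.Hom.val
    (φ.map_one ((I.overCod L).v) _ rfl ((I.overCod L).v ≫ f.v) _ rfl rfl
      (φ.at _ _ (by rw [assoc, f.map_ident, assoc])) rfl))
  rw [Fam.comp_val]
  refine V.compAt_congr ?_ ?_ _
  · exact (assoc _ _ _).symm.trans (congrArg (· ≫ φ.app) (I.overMk_cod L _ _ _))
  · exact (I.overMk_arr L _ _ _).trans (I.convOne_val L _ _)

theorem overPush_comp (g k : W ⟶ (I.overGraph L).edge)
    (h : g ≫ (I.overGraph L).src = k ≫ (I.overGraph L).tgt)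
    (h' : (g ≫ (I.overPush φ).e) ≫ (I.overGraph L').src =
      (k ≫ (I.overPush φ).e) ≫ (I.overGraph L').tgt) :
    I.overComp L g k h ≫ (I.overPush φ).e ≫ I.overArr L' =
      I.overComp L' (g ≫ (I.overPush φ).e) (k ≫ (I.overPush φ).e) h' ≫ I.overArr L' := by
  have hd := congrArg IntGraph.Hom.e (I.overPush_dom φ)
  have hc : (I.overPush φ).e ≫ (I.overCod L').e = (I.overCod L).e ≫ f.e :=
    congrArg IntGraph.Hom.e (I.overPush_cod φ)
  simp only [IntGraph.comp_e] at hd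
  have hd' : ∀ x : W ⟶ (I.overGraph L).edge,
      x ≫ (I.overDom L).e = (x ≫ (I.overPush φ).e) ≫ (I.overDom L').e := by
    intro x
    rw [assoc, hd]
  have hc' : ∀ x : W ⟶ (I.overGraph L).edge,
      (x ≫ (I.overCod L).e) ≫ f.e = (x ≫ (I.overPush φ).e) ≫ (I.overCod L').e := by
    intro x
    rw [assoc, assoc, hc]
  have ha : ∀ (x : W ⟶ (I.overGraph L).edge)
      (t : (x ≫ (I.overCod L).e) ≫ f.e = (x ≫ (I.overPush φ).e) ≫ (I.overCod L').e),
      (I.overHom L x ≫ φ.at _ _ t).val = (I.overHom L' (x ≫ (I.overPush φ).e)).val := by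
    intro x t
    refine Eq.trans ?_ (((assoc _ _ _).trans (congrArg (x ≫ ·) (I.overPush_arr φ))).trans
      (V.pre_compAt _ _ _ _)).symm
    exact V.compAt_congr (assoc _ _ _) rfl _
  have kc := composable_map (I.overCod L) h
  have kc' : ((g ≫ (I.overCod L).e) ≫ f.e) ≫ D'.src = ((k ≫ (I.overCod L).e) ≫ f.e) ≫ D'.tgt :=
    composable_map f.toHom kc
  have kd' := composable_map (I.overCod L') h'
  rw [overPush_arr, V.pre_compAt]
  -- The component of `φ` at the composite arrow of `D` ends at the composite in `D'` of the images,
  -- because `f` preserves composition; `conv_app` then moves it inside the tensor product.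
  refine Eq.trans ?_ (Eq.trans ((congrArg Fam.Hom.val (I.conv_app φ (composable_map (I.overDom L) h) rfl kc
    rfl kd' rfl (hc' g) (hc' k) (I.overHom L g) (I.overHom L k) (φ.at _ _ (hc' g))
    (φ.at _ _ (hc' k)) (φ.at _ _ ((f.map_comp _ _ kc kc').trans
      (D'.compAt_congr (hc' g) (hc' k) kc'))) rfl rfl rfl)).trans ?_)
    (I.overComp_arr L' _ _ h').symm)
  · rw [Fam.comp_val]
    refine V.compAt_congr ?_ (I.overComp_arr L _ _ _) _
    exact (assoc _ _ _).symm.trans (congrArg (· ≫ φ.app) (I.overComp_cod L _ _ _))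
  · exact I.conv_val_congr L' _ _ _ _ _ _ _ _ (hd' g) (hd' k) rfl rfl (ha g _) (ha k _)

/-- The internal functor induced by a morphism of lax tensor structures. -/
noncomputable def overPushFunctor : I.overCat L ⟶ I.overCat L' :=
  I.overFunctor L' (I.overPush φ) (I.overDomFunctor L) (I.overCodFunctor L ≫ f)
    (I.overPush_dom φ) (I.overPush_cod φ) (I.overPush_ident φ)
    (fun g k h h' => (congrArg (· ≫ _) (I.overCat_compAt L g k h)).trans
      (I.overPush_comp φ g k h h'))

end IteratedTensor

end Over

/-! ### From lax tensor structures to operations of all arities -/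

section AlgebraOperations

variable {E : Type u} [Category.{v} E] [CartesianMonoidalCategory E] [HasPullbacks E]
  {V : IntMonCat E} {D : IntCat E} {Fr : IntGraph E ⥤ IntCat E}

/-- The composition of lists of composable arrows of an internal category. -/
def listComp (adj : Fr ⊣ IntCat.forget E) (D : IntCat E) :
    adj.toMonad.obj D.toIntGraph ⟶ D.toIntGraph := (IntCat.forget E).map (adj.counit.app D)

theorem unit_listComp (adj : Fr ⊣ IntCat.forget E) (D : IntCat E) :
    adj.toMonad.η.app D.toIntGraph ≫ listComp adj D = 𝟙 _ := adj.right_triangle_components D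

variable {adj : Fr ⊣ IntCat.forget E}

namespace IteratedTensor

variable (I : IteratedTensor V (listCat V adj) (single V adj))

/-- For a path of paths, the operation at the path of composites takes as inputs the outputs of the
operations at the inner paths. This makes the right-hand side of `mul_ops` meaningful. -/
theorem listComp_composable {t : D.toIntGraph ⟶ bouquet V.vert}
    {m : adj.toMonad.obj D.toIntGraph ⟶ I.ops} (hs : m ≫ I.mSrc = adj.toMonad.map t)
    (ht : m ≫ I.opsTgt = listComp adj D ≫ t) :
    (adj.toMonad.map (listComp adj D) ≫ m) ≫ I.mSrc =
      adj.toMonad.map m ≫ adj.toMonad.map I.opsTgt := by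
  rw [assoc, hs, ← adj.toMonad.map_comp, ← adj.toMonad.map_comp, ht]

/-- A functor to the multicategory induced by `V` from the multicategory of lists of composable
arrows of an internal category `D`. -/
structure AlgOps (D : IntCat E) where
  ten : D.toIntGraph ⟶ bouquet V.vert
  ops : adj.toMonad.obj D.toIntGraph ⟶ I.ops
  ops_src : ops ≫ I.mSrc = adj.toMonad.map ten
  ops_tgt : ops ≫ I.opsTgt = listComp adj D ≫ ten
  unit_ops : adj.toMonad.η.app D.toIntGraph ≫ ops = ten ≫ I.opsIdent
  -- In the multicategory of an algebra a composable pair is determined by its second member, so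
  -- preservation of all composites amounts to this one equation, indexed by the paths of paths.
  mul_ops : adj.toMonad.μ.app D.toIntGraph ≫ ops =
    I.opsComp (adj.toMonad.map (listComp adj D) ≫ ops) (adj.toMonad.map ops)
      (I.listComp_composable ops_src ops_tgt)

/-! #### The functor of multicategories given by a lax tensor structure -/

section

variable (L : LaxTensor V D)

/-- The morphism of graphs that sends an arrow `d` of `D` to the identity of `ten d`, seen as an
arrow `⊗ (ten d) ⟶ ten d`. -/
noncomputable def overGen : D.toIntGraph ⟶ I.overGraph L :=
  I.overLift L (L.ten ≫ I.opsIdent) (𝟙 _) (by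
    rw [IntGraph.comp_e, assoc L.ten.e, opsIdent_arr, assoc, V.ident_tgt, comp_id, IntGraph.id_e, id_comp])

theorem overGen_ops : I.overGen L ≫ I.overOps L = L.ten ≫ I.opsIdent := I.overLift_ops L _ _ _

theorem overGen_dom : I.overGen L ≫ I.overDom L = L.ten ≫ single V adj :=
  (I.overLift_dom L _ _ _).trans ((assoc _ _ _).trans (congrArg (L.ten ≫ ·) I.opsIdent_src))

theorem overGen_cod : I.overGen L ≫ I.overCod L = 𝟙 _ := I.overLift_cod L _ _ _

theorem overGen_arr : (I.overGen L).e ≫ I.overArr L = L.ten.e ≫ V.ident :=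
  (I.overLift_arr L _ _ _).trans ((assoc _ _ _).trans (congrArg (L.ten.e ≫ ·) I.opsIdent_arr))

/-- The internal functor from the free category that sends a list of composable arrows `dᵢ` of `D`
to the arrow from the tensor product of the list of the `ten dᵢ` that is induced by the lax tensor
structure. -/
noncomputable def overFree : Fr.obj D.toIntGraph ⟶ I.overCat L :=
  (adj.homEquiv D.toIntGraph (I.overCat L)).symm (I.overGen L)

/-- The morphism of graphs underlying `overFree`. -/
noncomputable def freeMap : adj.toMonad.obj D.toIntGraph ⟶ I.overGraph L :=
  I.overMap L (I.overFree L)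

theorem unit_freeMap : adj.toMonad.η.app D.toIntGraph ≫ I.freeMap L = I.overGen L := by
  have := (adj.homEquiv D.toIntGraph (I.overCat L)).apply_symm_apply (I.overGen L)
  rwa [adj.homEquiv_unit] at this

/-- Both sides underlie internal functors out of the free category, and both send a generator `d` to
the list with the entry `ten d`. The codomain is treated in the same way, with the composition of
paths as the second functor. -/
theorem freeMap_dom : I.freeMap L ≫ I.overDom L = adj.toMonad.map L.ten := by
  have : I.overFree L ≫ I.overDomFunctor L = Fr.map L.ten := by
    apply free_ext adj
    exact ((assoc _ _ _).symm.trans (congrArg (· ≫ I.overDom L) (I.unit_freeMap L))).trans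
      ((I.overGen_dom L).trans (adj.unit.naturality L.ten))
  exact congrArg (IntCat.forget E).map this

theorem freeMap_cod : I.freeMap L ≫ I.overCod L = listComp adj D := by
  have : I.overFree L ≫ I.overCodFunctor L = adj.counit.app D := by
    apply free_ext adj
    exact ((assoc _ _ _).symm.trans (congrArg (· ≫ I.overCod L) (I.unit_freeMap L))).trans
      ((I.overGen_cod L).trans (unit_listComp adj D).symm)
  exact congrArg (IntCat.forget E).map this

/-- The operations given by the lists of composable arrows of `D`. -/
noncomputable def freeOps : adj.toMonad.obj D.toIntGraph ⟶ I.ops := I.freeMap L ≫ I.overOps L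

theorem freeOps_arr : (I.freeOps L).e ≫ I.opsArr = (I.freeMap L).e ≫ I.overArr L := assoc _ _ _

theorem freeOps_src : I.freeOps L ≫ I.mSrc = adj.toMonad.map L.ten :=
  (assoc _ _ _).trans (I.freeMap_dom L)

theorem freeOps_tgt : I.freeOps L ≫ I.opsTgt = listComp adj D ≫ L.ten := by
  refine ((assoc _ _ _).trans (congrArg (I.freeMap L ≫ ·)
    (IntGraph.pb_condition I.opsTgt L.ten))).trans ((assoc _ _ _).symm.trans ?_)
  exact congrArg (· ≫ L.ten) (I.freeMap_cod L)

theorem unit_freeOps : adj.toMonad.η.app D.toIntGraph ≫ I.freeOps L = L.ten ≫ I.opsIdent :=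
  (assoc _ _ _).symm.trans ((congrArg (· ≫ I.overOps L) (I.unit_freeMap L)).trans
    (I.overGen_ops L))

theorem unit_map_freeMap {Y : IntGraph E} (k : Y ⟶ D.toIntGraph) :
    adj.toMonad.η.app Y ≫ adj.toMonad.map k ≫ I.freeMap L = k ≫ I.overGen L := by
  have n := adj.toMonad.η.naturality k
  simp only [Functor.id_map] at n
  rw [← assoc, ← n, assoc, unit_freeMap]

theorem free_vert_composable :
    (adj.toMonad.map (listComp adj D) ≫ I.freeMap L) ≫ I.overDom L =
      (adj.toMonad.map (I.freeOps L) ≫ I.ten₁) ≫ I.stCod := by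
  refine (assoc _ _ _).trans ((congrArg (_ ≫ ·) (I.freeMap_dom L)).trans ?_)
  refine Eq.trans ?_ ((congrArg (_ ≫ ·) I.ten₁_cod.symm).trans (assoc _ _ _).symm)
  exact (adj.toMonad.map_comp _ _).symm.trans
    ((congrArg adj.toMonad.map (I.freeOps_tgt L).symm).trans (adj.toMonad.map_comp _ _))

/-- Both sides are internal functors out of the free category on the lists: concatenation followed
by `overFree`, and a vertical composite, which is a functor by interchange. A generator is a single
path. There the first gives the operation of the path, and the second gives the same operation
followed by the identity of its output. -/
theorem mul_freeMap : adj.toMonad.μ.app D.toIntGraph ≫ I.freeMap L =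
    I.overVert L (adj.toMonad.map (listComp adj D) ≫ I.freeMap L)
      (adj.toMonad.map (I.freeOps L) ≫ I.ten₁) (I.free_vert_composable L) := by
  have key : adj.counit.app (Fr.obj D.toIntGraph) ≫ I.overFree L =
      I.overVertFunctor L (Fr.map (listComp adj D) ≫ I.overFree L)
        (Fr.map (I.freeOps L) ≫ I.tenArrow) (I.free_vert_composable L) := by
    apply free_ext adj
    -- The equality of restrictions to generators, written with the monad: its multiplication is the
    -- underlying morphism of graphs of the counit.
    change adj.toMonad.η.app (adj.toMonad.obj D.toIntGraph) ≫
        adj.toMonad.μ.app D.toIntGraph ≫ I.freeMap L =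
      adj.toMonad.η.app (adj.toMonad.obj D.toIntGraph) ≫
        I.overVert L (adj.toMonad.map (listComp adj D) ≫ I.freeMap L)
          (adj.toMonad.map (I.freeOps L) ≫ I.ten₁) (I.free_vert_composable L)
    have hl := adj.toMonad.left_unit D.toIntGraph
    have e₀ : adj.toMonad.η.app (adj.toMonad.obj D.toIntGraph) ≫
        adj.toMonad.μ.app D.toIntGraph ≫ I.freeMap L = I.freeMap L :=
      (assoc _ _ _).symm.trans ((congrArg (· ≫ I.freeMap L) hl).trans (id_comp _))
    have e₁ := I.unit_map_freeMap L (listComp adj D)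
    have e₂ := I.unit_map_ten₁ (I.freeOps L)
    refine e₀.trans (I.over_hom_ext L ?_ ?_ ?_)
    · rw [assoc, overVert_dom, ← assoc, e₂, assoc, stGen, stLift_dom]
      exact (assoc _ _ _).symm
    · rw [assoc, overVert_cod, ← assoc, e₁, assoc, overGen_cod, comp_id, freeMap_cod]
    · have e₁' := congrArg IntGraph.Hom.e e₁
      have e₂' := congrArg IntGraph.Hom.e e₂
      simp only [IntGraph.comp_e] at e₁' e₂'
      rw [IntGraph.comp_e, assoc, overVert_arr, V.pre_compAt]
      -- On a generator the outer factor is the identity of `ten` of the composite of the path, that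
      -- is, of the target of the inner factor.
      refine ((V.compAt_congr (f' := (I.freeMap L).e ≫ I.overArr L)
        (g' := ((I.freeMap L).e ≫ I.overArr L) ≫ V.tgt ≫ V.ident) ?_ ?_ _).trans
        (V.compAt_ident_left _)).symm
      · rw [IntGraph.comp_e, ← assoc, e₁', assoc, overGen_arr, assoc, ← assoc _ V.tgt,
          overArr_tgt, ← I.freeMap_cod L]
        simp only [IntGraph.comp_e, assoc]
      · rw [IntGraph.comp_e, ← assoc, e₂', assoc, stGen, stLift_arr, freeOps_arr]
  exact congrArg (IntCat.forget E).map key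

/-- The lists of inputs agree by naturality of the monad multiplication, and the arrows of `V` agree
by `mul_freeMap`. -/
theorem mul_freeOps : adj.toMonad.μ.app D.toIntGraph ≫ I.freeOps L =
    I.opsComp (adj.toMonad.map (listComp adj D) ≫ I.freeOps L) (adj.toMonad.map (I.freeOps L))
      (I.listComp_composable (I.freeOps_src L) (I.freeOps_tgt L)) := by
  apply I.mops_ext
  · have n := adj.toMonad.μ.naturality L.ten
    rw [assoc, freeOps_src, opsComp_src, ← assoc, ← adj.toMonad.map_comp, freeOps_src]
    exact n.symm
  · have e := congrArg (fun x => IntGraph.Hom.e x ≫ I.overArr L) (I.mul_freeMap L)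
    rw [opsComp_arr]
    refine Eq.trans ?_ (e.trans ((I.overVert_arr L _ _ _).trans (V.compAt_congr ?_ ?_ _)))
    · rw [IntGraph.comp_e, IntGraph.comp_e, assoc, assoc, freeOps_arr]
    · rw [IntGraph.comp_e, IntGraph.comp_e, assoc, assoc, freeOps_arr]
    · exact assoc _ _ _

/-- The functor of multicategories given by a lax tensor structure. -/
noncomputable def ofLax : I.AlgOps D where
  ten := L.ten
  ops := I.freeOps L
  ops_src := I.freeOps_src L
  ops_tgt := I.freeOps_tgt L
  unit_ops := I.unit_freeOps L
  mul_ops := I.mul_freeOps L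

end

end IteratedTensor

end AlgebraOperations

/-! ### Operations at lists with two entries and at empty lists -/

section AlgebraOperations

variable {E : Type u} [Category.{v} E] [CartesianMonoidalCategory E] [HasPullbacks E]
  {V : IntMonCat E} {D : IntCat E} {Fr : IntGraph E ⥤ IntCat E} {W W' : E}

theorem IntCat.map_compAt {B C : IntCat E} (F : B ⟶ C) {g f n : W ⟶ B.edge}
    (h : g ≫ B.src = f ≫ B.tgt) (hn : B.compAt g f h = n) {g' f' : W ⟶ C.edge}
    (hg : g ≫ F.e = g') (hf : f ≫ F.e = f') (h' : g' ≫ C.src = f' ≫ C.tgt) :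
    n ≫ F.e = C.compAt g' f' h' := by
  subst hg hf hn
  exact F.map_comp g f h h'

/-- The list with two entries given by two composable arrows of a graph. -/
noncomputable def listPair (adj : Fr ⊣ IntCat.forget E) {G : IntGraph E} (l m : W ⟶ G.edge)
    (h : l ≫ G.src = m ≫ G.tgt) : W ⟶ (Fr.obj G).edge :=
  (Fr.obj G).compAt (l ≫ (adj.toMonad.η.app G).e) (m ≫ (adj.toMonad.η.app G).e)
    (IteratedTensor.composable_map (adj.toMonad.η.app G) h)

theorem pre_listPair (adj : Fr ⊣ IntCat.forget E) {G : IntGraph E} (r : W' ⟶ W)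
    (l m : W ⟶ G.edge) (h : l ≫ G.src = m ≫ G.tgt) (l' m' : W' ⟶ G.edge)
    (h' : l' ≫ G.src = m' ≫ G.tgt) (hl : r ≫ l = l') (hm : r ≫ m = m') :
    r ≫ listPair adj l m h = listPair adj l' m' h' := by
  subst hl hm
  exact ((Fr.obj G).pre_compAt _ _ _ _).trans
    ((Fr.obj G).compAt_congr (assoc _ _ _).symm (assoc _ _ _).symm _)

/-- A list with two entries is the composite of two generators, and `F` preserves it. The facts
about lists with two entries below are instances, for various functors out of free categories. -/
theorem listPair_map (adj : Fr ⊣ IntCat.forget E) {G : IntGraph E} {B : IntCat E}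
    (F : Fr.obj G ⟶ B) (φ : G ⟶ B.toIntGraph)
    (hF : adj.toMonad.η.app G ≫ (IntCat.forget E).map F = φ) (l m : W ⟶ G.edge)
    (h : l ≫ G.src = m ≫ G.tgt) :
    listPair adj l m h ≫ F.e =
      B.compAt (l ≫ φ.e) (m ≫ φ.e) (IteratedTensor.composable_map φ h) := by
  have e := congrArg IntGraph.Hom.e hF
  exact IntCat.map_compAt F _ rfl ((assoc _ _ _).trans (congrArg (l ≫ ·) e))
    ((assoc _ _ _).trans (congrArg (m ≫ ·) e)) _

variable {adj : Fr ⊣ IntCat.forget E}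

/-- The list with no entries. -/
noncomputable def listNil (adj : Fr ⊣ IntCat.forget E) {G : IntGraph E} (p : W ⟶ G.vert) :
    W ⟶ (Fr.obj G).edge := (p ≫ (adj.toMonad.η.app G).v) ≫ (Fr.obj G).ident

theorem listNil_map (adj : Fr ⊣ IntCat.forget E) {G : IntGraph E} {B : IntCat E}
    (F : Fr.obj G ⟶ B) (φ : G ⟶ B.toIntGraph)
    (hF : adj.toMonad.η.app G ≫ (IntCat.forget E).map F = φ) (p : W ⟶ G.vert) :
    listNil adj p ≫ F.e = (p ≫ φ.v) ≫ B.ident := by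
  have e := congrArg IntGraph.Hom.v hF
  refine (assoc _ _ _).trans ((congrArg (_ ≫ ·) F.map_ident).trans ((assoc _ _ _).symm.trans ?_))
  exact congrArg (· ≫ B.ident) ((assoc _ _ _).trans (congrArg (p ≫ ·) e))

namespace IteratedTensor.AlgOps

variable {I : IteratedTensor V (listCat V adj) (single V adj)} (O : I.AlgOps D)

/-- The arrow of `V` underlying the operation given by a list of composable arrows of `D`. -/
noncomputable def arr : (adj.toMonad.obj D.toIntGraph).edge ⟶ V.edge := O.ops.e ≫ I.opsArr

theorem arr_src : O.arr ≫ V.src = (adj.toMonad.map O.ten).e ≫ I.mTen := by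
  rw [arr, assoc, I.opsArr_mSrc, ← assoc, ← IntGraph.comp_e, O.ops_src]

theorem arr_tgt : O.arr ≫ V.tgt = (listComp adj D).e ≫ O.ten.e :=
  (assoc _ _ _).trans (congrArg IntGraph.Hom.e O.ops_tgt)

theorem unit_arr : (adj.toMonad.η.app D.toIntGraph).e ≫ O.arr = O.ten.e ≫ V.ident :=
  (assoc _ _ _).symm.trans ((congrArg (· ≫ I.opsArr) (congrArg IntGraph.Hom.e O.unit_ops)).trans
    ((assoc _ _ _).trans (congrArg (O.ten.e ≫ ·) I.opsIdent_arr)))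

theorem arr_composable :
    ((adj.toMonad.map (listComp adj D)).e ≫ O.arr) ≫ V.src =
      ((adj.toMonad.map O.ops).e ≫ I.tenArr) ≫ V.tgt :=
  (congrArg (· ≫ V.src) (assoc _ _ _).symm).trans
    (I.opsComp_composable _ _ (I.listComp_composable O.ops_src O.ops_tgt))

theorem mul_arr : (adj.toMonad.μ.app D.toIntGraph).e ≫ O.arr =
    V.compAt ((adj.toMonad.map (listComp adj D)).e ≫ O.arr)
      ((adj.toMonad.map O.ops).e ≫ I.tenArr) O.arr_composable := by
  have e := congrArg (fun x => IntGraph.Hom.e x ≫ I.opsArr) O.mul_ops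
  exact (assoc _ _ _).symm.trans (e.trans ((I.opsComp_arr _ _ _).trans
    (V.compAt_congr (assoc _ _ _) rfl _)))

/-- The family of arrows of `V` given by a family of lists of composable arrows of `D`. -/
noncomputable def at' (p : W ⟶ (Fr.obj D.toIntGraph).edge) (l : W ⟶ (listCat V adj).edge)
    (a : W ⟶ D.edge) (hl : p ≫ (adj.toMonad.map O.ten).e = l) (ha : p ≫ (listComp adj D).e = a) :
    V.tenAt I.ten l ⟶ V.tenAt O.ten a where
  val := p ≫ O.arr
  src_eq := (assoc _ _ _).trans ((congrArg (p ≫ ·) O.arr_src).trans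
    ((assoc _ _ _).symm.trans (congrArg (· ≫ I.ten.e) hl)))
  tgt_eq := (assoc _ _ _).trans ((congrArg (p ≫ ·) O.arr_tgt).trans
    ((assoc _ _ _).symm.trans (congrArg (· ≫ O.ten.e) ha)))

/-- The list with the entry `ten a`. -/
noncomputable def sg (a : W ⟶ D.edge) : W ⟶ (listCat V adj).edge := a ≫ O.ten.e ≫ (single V adj).e

theorem sg_composable {a b : W ⟶ D.edge} (h : a ≫ D.src = b ≫ D.tgt) :
    O.sg a ≫ (listCat V adj).src = O.sg b ≫ (listCat V adj).tgt :=
  composable_map (O.ten ≫ single V adj) h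

/-- This is the normalization that the tensor product of a list with one entry is the entry. It is
an equality of families of objects and not of terms, whence the isomorphism `sgIso`. -/
theorem sg_val (a : W ⟶ D.edge) : (V.tenAt O.ten a).val = (V.tenAt I.ten (O.sg a)).val := by
  rw [IntMonCat.tenAt_val, IntMonCat.tenAt_val, sg, assoc, assoc, I.single_ten, comp_id]

/-- The tensor product of a list with one entry. -/
noncomputable def sgIso (a : W ⟶ D.edge) : V.tenAt O.ten a ≅ V.tenAt I.ten (O.sg a) :=
  Fam.eqIso (O.sg_val a)

theorem comp_sgIso_val (a : W ⟶ D.edge) {x : Fam V.toIntCat W} (f : x ⟶ V.tenAt O.ten a) :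
    (f ≫ (O.sgIso a).hom).val = f.val := Fam.comp_eqIso_val f (O.sg_val a)

theorem unit_map_ten : adj.toMonad.η.app D.toIntGraph ≫ adj.toMonad.map O.ten =
    O.ten ≫ single V adj := (adj.toMonad.η.naturality O.ten).symm

theorem unit_map_ten_e (a : W ⟶ D.edge) :
    (a ≫ (adj.toMonad.η.app D.toIntGraph).e) ≫ (adj.toMonad.map O.ten).e = O.sg a :=
  (assoc _ _ _).trans (congrArg (a ≫ ·) (congrArg IntGraph.Hom.e O.unit_map_ten))

variable (adj) in
theorem unit_listComp_e (a : W ⟶ D.edge) :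
    (a ≫ (adj.toMonad.η.app D.toIntGraph).e) ≫ (listComp adj D).e = a :=
  ((assoc _ _ _).trans (congrArg (a ≫ ·) (congrArg IntGraph.Hom.e (unit_listComp adj D)))).trans
    (comp_id a)

/-- Preservation of identities by `O`: a path with one arrow acts as an identity. Through this lemma
the general statement `mulAt_at'` can be applied to single arrows of `D`. -/
theorem at'_unit (a : W ⟶ D.edge) :
    O.at' (a ≫ (adj.toMonad.η.app D.toIntGraph).e) (O.sg a) a (O.unit_map_ten_e a)
      (unit_listComp_e adj a) = (O.sgIso a).inv := by
  apply Fam.hom_ext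
  exact (assoc _ _ _).trans ((congrArg (a ≫ ·) O.unit_arr).trans
    ((assoc _ _ _).symm.trans (congrArg (· ≫ V.ident) (O.sg_val a))))

theorem listPair_ten (a b : W ⟶ D.edge) (h : a ≫ D.src = b ≫ D.tgt) :
    listPair adj a b h ≫ (adj.toMonad.map O.ten).e =
      (listCat V adj).compAt (O.sg a) (O.sg b) (O.sg_composable h) :=
  listPair_map adj (Fr.map O.ten) (O.ten ≫ single V adj) O.unit_map_ten a b h

variable (adj) in
theorem listPair_listComp (a b : W ⟶ D.edge) (h : a ≫ D.src = b ≫ D.tgt) :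
    listPair adj a b h ≫ (listComp adj D).e = D.compAt a b h :=
  (listPair_map adj (adj.counit.app D) (𝟙 _) (unit_listComp adj D) a b h).trans
    (D.compAt_congr (comp_id a) (comp_id b) _)

/-- The composition induced by the lists with two entries. -/
noncomputable def mul (a b c : W ⟶ D.edge) (h : a ≫ D.src = b ≫ D.tgt)
    (hc : D.compAt a b h = c) :
    V.tenAt O.ten a ⊗ V.tenAt O.ten b ⟶ V.tenAt O.ten c :=
  ((O.sgIso a).hom ⊗ₘ (O.sgIso b).hom) ≫
    (I.mulAt (O.sg a) (O.sg b) _ (O.sg_composable h) rfl).hom ≫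
    O.at' (listPair adj a b h) _ c (O.listPair_ten a b h)
      ((listPair_listComp adj a b h).trans hc)

/-- The unit induced by the empty lists. -/
noncomputable def one (p : W ⟶ D.vert) (i : W ⟶ D.edge) (hi : p ≫ D.ident = i) :
    𝟙_ (Fam V.toIntCat W) ⟶ V.tenAt O.ten i :=
  (Fam.eqIso (I.unit_val (p ≫ (O.ten ≫ single V adj).v))).hom ≫
    O.at' (listNil adj p) _ i (listNil_map adj (Fr.map O.ten) _ O.unit_map_ten p)
      ((listNil_map adj (adj.counit.app D) (𝟙 _) (unit_listComp adj D) p).trans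
        ((congrArg (· ≫ D.ident) (comp_id p)).trans hi))

theorem one_val (p : W ⟶ D.vert) (i : W ⟶ D.edge) (hi : p ≫ D.ident = i) :
    (O.one p i hi).val = listNil adj p ≫ O.arr := Fam.eqIso_comp_val _ _

theorem mul_val (a b c : W ⟶ D.edge) (h : a ≫ D.src = b ≫ D.tgt)
    (hc : D.compAt a b h = c) (k) : (O.mul a b c h hc).val =
    V.compAt (listPair adj a b h ≫ O.arr)
      (pullback.lift (O.sg a) (O.sg b) (O.sg_composable h) ≫ I.mul.hom.val) k := by
  have e : ((O.sgIso a).hom ⊗ₘ (O.sgIso b).hom) =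
      (Fam.eqIso (V.tensor_val_congr (O.sg_val a) (O.sg_val b))).hom := V.eqIso_tensor _ _
  rw [mul, e, Fam.eqIso_comp_val]
  rfl

variable (adj) in
-- The monad multiplication is the counit at the free category, which composes a list of arrows
-- there; composing the two arrows `p` and `q` is concatenating them.
theorem listPair_mul (p q r : W ⟶ (Fr.obj D.toIntGraph).edge)
    (h : p ≫ (Fr.obj D.toIntGraph).src = q ≫ (Fr.obj D.toIntGraph).tgt)
    (hr : (Fr.obj D.toIntGraph).compAt p q h = r) : listPair adj p q h ≫ (adj.toMonad.μ.app D.toIntGraph).e = r := by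
  have e := listPair_map adj (adj.counit.app (Fr.obj D.toIntGraph)) (𝟙 _)
    (adj.toMonad.left_unit D.toIntGraph) p q h
  exact e.trans (((Fr.obj D.toIntGraph).compAt_congr (comp_id p) (comp_id q) _).trans hr)

section

variable (p q : W ⟶ (Fr.obj D.toIntGraph).edge)
  (h : p ≫ (Fr.obj D.toIntGraph).src = q ≫ (Fr.obj D.toIntGraph).tgt)

variable (adj) in
theorem listPair_map_listComp {a b : W ⟶ D.edge} (ha : p ≫ (listComp adj D).e = a)
    (hb : q ≫ (listComp adj D).e = b) (hab : a ≫ D.src = b ≫ D.tgt) :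
    listPair adj p q h ≫ (adj.toMonad.map (listComp adj D)).e = listPair adj a b hab := by
  have n : adj.toMonad.η.app (adj.toMonad.obj D.toIntGraph) ≫ adj.toMonad.map (listComp adj D) =
    listComp adj D ≫ adj.toMonad.η.app D.toIntGraph :=
    (adj.toMonad.η.naturality (listComp adj D)).symm
  subst ha hb
  refine (listPair_map adj (Fr.map (listComp adj D)) _ n p q h).trans ?_
  exact (Fr.obj D.toIntGraph).compAt_congr (assoc _ _ _).symm (assoc _ _ _).symm _

variable (I) in
-- The tensor product of lists of operations comes from the internal functor `tenArrow`, so on two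
-- entries it is the composition of the category of lists of objects.
theorem listPair_tenArr {Y : IntGraph E} (k : Y ⟶ I.ops) (p q : W ⟶ Y.edge)
    (h : p ≫ Y.src = q ≫ Y.tgt) :
    listPair adj p q h ≫ (adj.toMonad.map k).e ≫ I.tenArr =
    I.stComp (p ≫ (k ≫ I.stGen).e) (q ≫ (k ≫ I.stGen).e)
      (composable_map (k ≫ I.stGen) h) ≫ I.stArr := by
  have e := listPair_map adj (Fr.map k ≫ I.tenArrow) _ (I.unit_map_ten₁ k) p q h
  refine Eq.trans ?_ ((congrArg (· ≫ I.stArr) e).trans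
    (congrArg (· ≫ I.stArr) (I.stCat_compAt _ _ _)))
  exact (congrArg (_ ≫ ·) (assoc _ _ _).symm).trans (assoc _ _ _).symm

end

theorem gen_dom (p : W ⟶ (Fr.obj D.toIntGraph).edge) (l : W ⟶ (listCat V adj).edge)
    (hl : p ≫ (adj.toMonad.map O.ten).e = l) :
    (p ≫ (O.ops ≫ I.stGen).e) ≫ I.stDom.e = l := by
  have e : (O.ops ≫ I.stGen) ≫ I.stDom = adj.toMonad.map O.ten :=
    ((assoc _ _ _).trans (congrArg (O.ops ≫ ·) (I.stLift_dom _ _ _ _ _))).trans O.ops_src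
  exact ((assoc _ _ _).trans (congrArg (p ≫ ·) (congrArg IntGraph.Hom.e e))).trans hl

theorem gen_cod (p : W ⟶ (Fr.obj D.toIntGraph).edge) (a : W ⟶ D.edge)
    (ha : p ≫ (listComp adj D).e = a) :
    (p ≫ (O.ops ≫ I.stGen).e) ≫ I.stCod.e = O.sg a := by
  have e : (O.ops ≫ I.stGen) ≫ I.stCod = listComp adj D ≫ O.ten ≫ single V adj :=
    ((assoc _ _ _).trans (congrArg (O.ops ≫ ·) (I.stLift_cod _ _ _ _ _))).trans
      ((assoc _ _ _).symm.trans ((congrArg (· ≫ single V adj) O.ops_tgt).trans (assoc _ _ _)))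
  refine ((assoc _ _ _).trans (congrArg (p ≫ ·) (congrArg IntGraph.Hom.e e))).trans ?_
  rw [sg, ← ha]
  exact (assoc _ _ _).symm

theorem gen_arr (p : W ⟶ (Fr.obj D.toIntGraph).edge) :
    (p ≫ (O.ops ≫ I.stGen).e) ≫ I.stArr = p ≫ O.arr :=
  (assoc _ _ _).trans (congrArg (p ≫ ·) ((assoc _ _ _).trans
    (congrArg (O.ops.e ≫ ·) (I.stLift_arr _ _ _ _ _))))

/-- The operations given by lists of composable arrows of `D` are compatible with the composition
of lists. -/
theorem mulAt_at' (p q r : W ⟶ (Fr.obj D.toIntGraph).edge) (l m n : W ⟶ (listCat V adj).edge)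
    (a b c : W ⟶ D.edge) (h : p ≫ (Fr.obj D.toIntGraph).src = q ≫ (Fr.obj D.toIntGraph).tgt)
    (hr : (Fr.obj D.toIntGraph).compAt p q h = r)
    (hl : p ≫ (adj.toMonad.map O.ten).e = l) (hm : q ≫ (adj.toMonad.map O.ten).e = m)
    (hn : r ≫ (adj.toMonad.map O.ten).e = n) (ha : p ≫ (listComp adj D).e = a)
    (hb : q ≫ (listComp adj D).e = b) (hc : r ≫ (listComp adj D).e = c)
    (k : l ≫ (listCat V adj).src = m ≫ (listCat V adj).tgt)
    (kn : (listCat V adj).compAt l m k = n)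
    (k' : a ≫ D.src = b ≫ D.tgt) (kc : D.compAt a b k' = c) :
    (I.mulAt l m n k kn).hom ≫ O.at' r n c hn hc =
      (O.at' p l a hl ha ⊗ₘ O.at' q m b hm hb) ≫ O.mul a b c k' kc := by
  -- The path `r` is the concatenation of the list of paths with the two entries `p` and `q`.
  -- Multiplicativity of `O` is used at this list only.
  have hd := listPair_mul adj p q r h hr
  have key : O.at' r n c hn hc =
      I.mulHom k kn (O.sg_composable k') rfl (O.at' p l a hl ha ≫ (O.sgIso a).hom)
        (O.at' q m b hm hb ≫ (O.sgIso b).hom) ≫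
      O.at' (listPair adj a b k') _ c (O.listPair_ten a b k')
        ((listPair_listComp adj a b k').trans kc) := by
    apply Fam.hom_ext
    -- The outer operation is that of the path `(a, b)` of composites, which defines `mul`. The
    -- inner list of operations contributes the tensor product of the operations at `p` and `q`,
    -- with targets read as lists with one entry.
    refine (congrArg (· ≫ O.arr) hd.symm).trans ((assoc _ _ _).trans
      ((congrArg (_ ≫ ·) O.mul_arr).trans ((V.pre_compAt _ _ _ _).trans (V.compAt_congr ?_ ?_ _))))
    · exact (assoc _ _ _).symm.trans
        (congrArg (· ≫ O.arr) (listPair_map_listComp adj p q h ha hb k'))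
    · refine (listPair_tenArr I O.ops p q h).trans ((I.stComp_arr _ _ _).trans ?_)
      refine I.mulHom_val_congr _ _ _ _ _ _ _ _ (O.gen_dom p l hl) (O.gen_cod p a ha)
        (O.gen_dom q m hm) (O.gen_cod q b hb) ?_ ?_
      · exact (O.gen_arr p).trans (O.comp_sgIso_val a (O.at' p l a hl ha)).symm
      · exact (O.gen_arr q).trans (O.comp_sgIso_val b (O.at' q m b hm hb)).symm
  rw [key, mulHom, mul, ← tensorHom_comp_tensorHom]
  simp only [assoc, Iso.hom_inv_id_assoc]

end IteratedTensor.AlgOps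

end AlgebraOperations

/-! ### The axioms of the lax structure of a functor of multicategories -/

section AlgebraOperations

variable {E : Type u} [Category.{v} E] [CartesianMonoidalCategory E] [HasPullbacks E]
  {V : IntMonCat E} {D : IntCat E} {Fr : IntGraph E ⥤ IntCat E} {W W' : E}
  {adj : Fr ⊣ IntCat.forget E}

/-- Transport of the right unit law from `μ`, a coherence isomorphism between tensor products of
lists, to `m`. The arrow `g` is the operation of an empty path, so it is not assumed invertible; it
suffices to cancel `s.inv ▷ 𝟙_ C`. -/
theorem tensor_unit_right_of_conj {C : Type*} [Category* C] [MonoidalCategory C] {x x' i i' : C}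
    (s : x ≅ x') {b : 𝟙_ C ⟶ i'} {g : i' ⟶ i} {μ : x' ⊗ i' ⟶ x'} {m : x ⊗ i ⟶ x}
    (h : μ ≫ s.inv = (s.inv ⊗ₘ g) ≫ m) (hμ : (x' ◁ b) ≫ μ = (ρ_ x').hom) :
    (x ◁ (b ≫ g)) ≫ m = (ρ_ x).hom := by
  rw [← cancel_epi (s.inv ▷ 𝟙_ C), rightUnitor_naturality, ← hμ, assoc, h,
    MonoidalCategory.tensorHom_def', MonoidalCategory.whiskerLeft_comp]
  simp only [assoc]
  rw [whisker_exchange_assoc, whisker_exchange_assoc]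

theorem tensor_unit_left_of_conj {C : Type*} [Category* C] [MonoidalCategory C] {x x' i i' : C}
    (s : x ≅ x') {b : 𝟙_ C ⟶ i'} {g : i' ⟶ i} {μ : i' ⊗ x' ⟶ x'} {m : i ⊗ x ⟶ x}
    (h : μ ≫ s.inv = (g ⊗ₘ s.inv) ≫ m) (hμ : (b ▷ x') ≫ μ = (λ_ x').hom) :
    ((b ≫ g) ▷ x) ≫ m = (λ_ x).hom := by
  rw [← cancel_epi (𝟙_ C ◁ s.inv), leftUnitor_naturality, ← hμ, assoc, h,
    MonoidalCategory.tensorHom_def, comp_whiskerRight]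
  simp only [assoc]
  rw [← whisker_exchange_assoc, ← whisker_exchange_assoc]

/-- Transport of associativity from the coherence arrows `αᵢ` to the multiplications `βᵢ`. Only the
comparisons of the three factors are invertible; `f`, `g` and `e` are operations of longer paths.
Both sides are compared after precomposition with the isomorphism formed by the inverses of `s`, `t`
and `k`, where each becomes a bracketing of the `αᵢ` followed by the same `e`. -/
theorem tensor_assoc_of_conj {C : Type*} [Category* C] [MonoidalCategory C]
    {x y z x' y' z' p q r p' q' r' : C} (s : x ≅ x') (t : y ≅ y') (k : z ≅ z')
    {α₁ : x' ⊗ y' ⟶ p'} {α₂ : p' ⊗ z' ⟶ r'} {α₃ : y' ⊗ z' ⟶ q'} {α₄ : x' ⊗ q' ⟶ r'}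
    {β₁ : x ⊗ y ⟶ p} {β₂ : p ⊗ z ⟶ r} {β₃ : y ⊗ z ⟶ q} {β₄ : x ⊗ q ⟶ r}
    {f : p' ⟶ p} {g : q' ⟶ q} {e : r' ⟶ r}
    (h₁ : α₁ ≫ f = (s.inv ⊗ₘ t.inv) ≫ β₁) (h₂ : α₂ ≫ e = (f ⊗ₘ k.inv) ≫ β₂)
    (h₃ : α₃ ≫ g = (t.inv ⊗ₘ k.inv) ≫ β₃) (h₄ : α₄ ≫ e = (s.inv ⊗ₘ g) ≫ β₄)
    (hα : (α₁ ▷ z') ≫ α₂ = (α_ _ _ _).hom ≫ (x' ◁ α₃) ≫ α₄) :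
    (β₁ ▷ z) ≫ β₂ = (α_ _ _ _).hom ≫ (x ◁ β₃) ≫ β₄ := by
  have e₁ : ((s.inv ⊗ₘ t.inv) ⊗ₘ k.inv) ≫ (β₁ ▷ z) ≫ β₂ = (α₁ ▷ z') ≫ α₂ ≫ e := by
    rw [h₂, ← tensorHom_id, ← tensorHom_id, tensorHom_comp_tensorHom_assoc, ← h₁,
      tensorHom_comp_tensorHom_assoc]
    simp
  have e₂ : (s.inv ⊗ₘ (t.inv ⊗ₘ k.inv)) ≫ (x ◁ β₃) ≫ β₄ = (x' ◁ α₃) ≫ α₄ ≫ e := by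
    rw [h₄, ← id_tensorHom, ← id_tensorHom, tensorHom_comp_tensorHom_assoc, ← h₃,
      tensorHom_comp_tensorHom_assoc]
    simp
  rw [← cancel_epi ((s.inv ⊗ₘ t.inv) ⊗ₘ k.inv), e₁, associator_naturality_assoc, e₂,
    reassoc_of% hα]

namespace IteratedTensor.AlgOps

variable {I : IteratedTensor V (listCat V adj) (single V adj)} (O : I.AlgOps D)

theorem pre_sg (r : W' ⟶ W) (a : W ⟶ D.edge) (a' : W' ⟶ D.edge) (h : r ≫ a = a') :
    r ≫ O.sg a = O.sg a' := by
  rw [sg, sg, ← h, assoc]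

theorem mul_re (r : W' ⟶ W) (l m n : W ⟶ D.edge) (h : l ≫ D.src = m ≫ D.tgt)
    (hn : D.compAt l m h = n) (l' m' n' : W' ⟶ D.edge) (h' : l' ≫ D.src = m' ≫ D.tgt)
    (hn' : D.compAt l' m' h' = n') (hl : r ≫ l = l') (hm : r ≫ m = m') :
    r ≫ (O.mul l m n h hn).val = (O.mul l' m' n' h' hn').val := by
  have k : ∀ {W : E} (l m n : W ⟶ D.edge) (h : l ≫ D.src = m ≫ D.tgt) (hn : D.compAt l m h = n),
      (listPair adj l m h ≫ O.arr) ≫ V.src =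
        (pullback.lift (O.sg l) (O.sg m) (O.sg_composable h) ≫ I.mul.hom.val) ≫ V.tgt := by
    intro W l m n h hn
    refine (O.at' (listPair adj l m h) _ n (O.listPair_ten l m h)
      ((listPair_listComp adj l m h).trans hn)).src_eq.trans ?_
    exact (I.mulAt (O.sg l) (O.sg m) _ (O.sg_composable h) rfl).hom.tgt_eq.symm
  rw [O.mul_val l m n h hn (k l m n h hn), O.mul_val l' m' n' h' hn' (k l' m' n' h' hn'),
    V.pre_compAt]
  refine V.compAt_congr ?_ ?_ _
  · exact (assoc _ _ _).symm.trans (congrArg (· ≫ O.arr) (pre_listPair adj r l m h l' m' h' hl hm))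
  · rw [← assoc]
    congr 1
    apply pullback.hom_ext
    · simp [O.pre_sg r l l' hl]
    · simp [O.pre_sg r m m' hm]

/-- The value of `one` is a fixed arrow of `E` precomposed with the empty list at `p`, and forming
the empty list commutes with reindexing. -/
theorem one_re (r : W' ⟶ W) (p : W ⟶ D.vert) (i : W ⟶ D.edge) (hi : p ≫ D.ident = i)
    (p' : W' ⟶ D.vert) (i' : W' ⟶ D.edge) (hi' : p' ≫ D.ident = i') (hp : r ≫ p = p') :
    r ≫ (O.one p i hi).val = (O.one p' i' hi').val := by
  subst hp
  have e : r ≫ listNil adj p = listNil adj (r ≫ p) :=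
    (assoc _ _ _).symm.trans (congrArg (· ≫ _) (assoc _ _ _).symm)
  rw [one_val, one_val]
  exact (assoc _ _ _).symm.trans (congrArg (· ≫ O.arr) e)

/-- The insertion of arrows of `D` as lists with one entry. -/
noncomputable abbrev sing (adj : Fr ⊣ IntCat.forget E) (a : W ⟶ D.edge) :
    W ⟶ (Fr.obj D.toIntGraph).edge := a ≫ (adj.toMonad.η.app D.toIntGraph).e

/-- The operation of the path `l, m, n` can be computed from either bracketing by `mulAt_at'`. The
four squares required by `tensor_assoc_of_conj` are instances of that lemma, and the law upstairs is
the associativity of the iterated tensor products. -/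
theorem mul_assoc (l m n lm mn lmn : W ⟶ D.edge) (h₁ : l ≫ D.src = m ≫ D.tgt)
    (h₂ : m ≫ D.src = n ≫ D.tgt) (h₃ : lm ≫ D.src = n ≫ D.tgt) (h₄ : l ≫ D.src = mn ≫ D.tgt)
    (e₁ : D.compAt l m h₁ = lm) (e₂ : D.compAt m n h₂ = mn) (e₃ : D.compAt lm n h₃ = lmn)
    (e₄ : D.compAt l mn h₄ = lmn) :
    (O.mul l m lm h₁ e₁ ▷ V.tenAt O.ten n) ≫ O.mul lm n lmn h₃ e₃ =
      (α_ _ _ _).hom ≫ (V.tenAt O.ten l ◁ O.mul m n mn h₂ e₂) ≫ O.mul l mn lmn h₄ e₄ := by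
  let B := Fr.obj D.toIntGraph
  let t : B ⟶ listCat V adj := Fr.map O.ten
  let d : B ⟶ D := adj.counit.app D
  have c₁ : sing adj l ≫ B.src = sing adj m ≫ B.tgt :=
    composable_map (adj.toMonad.η.app D.toIntGraph) h₁
  have c₂ : sing adj m ≫ B.src = sing adj n ≫ B.tgt :=
    composable_map (adj.toMonad.η.app D.toIntGraph) h₂
  have c₃ : listPair adj l m h₁ ≫ B.src = sing adj n ≫ B.tgt := (B.compAt_src _ _ _).trans c₂
  have c₄ : sing adj l ≫ B.src = listPair adj m n h₂ ≫ B.tgt :=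
    c₁.trans (B.compAt_tgt _ _ _).symm
  -- The two bracketings are the same path with three entries, by associativity in the free
  -- category. This is why a single arrow `e` occurs in both relevant squares.
  have a : B.compAt (listPair adj l m h₁) (sing adj n) c₃ =
    B.compAt (sing adj l) (listPair adj m n h₂) c₄ := B.compAt_assoc _ _ _ _ _
  have dl := unit_listComp_e adj l
  have dm := unit_listComp_e adj m
  have dn := unit_listComp_e adj n
  have dlm := (listPair_listComp adj l m h₁).trans e₁
  have dmn := (listPair_listComp adj m n h₂).trans e₂
  have k₁ := O.sg_composable h₁
  have k₂ := O.sg_composable h₂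
  have tlm := O.listPair_ten l m h₁
  have tmn := O.listPair_ten m n h₂
  have k₃ : (listCat V adj).compAt _ _ k₁ ≫ (listCat V adj).src =
    O.sg n ≫ (listCat V adj).tgt := ((listCat V adj).compAt_src _ _ _).trans k₂
  have k₄ : O.sg l ≫ (listCat V adj).src =
    (listCat V adj).compAt _ _ k₂ ≫ (listCat V adj).tgt :=
    k₁.trans ((listCat V adj).compAt_tgt _ _ _).symm
  have tlmn := IntCat.map_compAt t c₃ rfl tlm (O.unit_map_ten_e n) k₃
  have dlmn := (IntCat.map_compAt d c₃ rfl dlm dn h₃).trans e₃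
  refine tensor_assoc_of_conj (O.sgIso l) (O.sgIso m) (O.sgIso n)
    (α₁ := (I.mulAt (O.sg l) (O.sg m) _ k₁ rfl).hom) (α₃ := (I.mulAt (O.sg m) (O.sg n) _ k₂ rfl).hom)
    (α₂ := (I.mulAt _ (O.sg n) _ k₃ rfl).hom)
    (α₄ := (I.mulAt (O.sg l) _ _ k₄ ((listCat V adj).compAt_assoc _ _ _ k₁ k₂).symm).hom)
    (f := O.at' (listPair adj l m h₁) _ lm tlm dlm) (g := O.at' (listPair adj m n h₂) _ mn tmn dmn)
    (e := O.at' (B.compAt (listPair adj l m h₁) (sing adj n) c₃) _ lmn tlmn dlmn) ?_ ?_ ?_ ?_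
    (I.mul_assoc _ _ _ _ _ _ k₁ k₂ k₃ k₄ rfl rfl rfl _)
  · rw [← O.at'_unit l, ← O.at'_unit m]
    exact O.mulAt_at' _ _ _ _ _ _ _ _ _ c₁ rfl _ _ _ _ _ _ _ _ _ _
  · rw [← O.at'_unit n]
    exact O.mulAt_at' _ _ _ _ _ _ _ _ _ c₃ rfl _ _ _ _ _ _ _ _ _ _
  · rw [← O.at'_unit m, ← O.at'_unit n]
    exact O.mulAt_at' _ _ _ _ _ _ _ _ _ c₂ rfl _ _ _ _ _ _ _ _ _ _
  · rw [← O.at'_unit l]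
    exact O.mulAt_at' _ _ _ _ _ _ _ _ _ c₄ a.symm _ _ _ _ _ _ _ _ _ _

/-- The concatenation of the empty path with `l` is the path `l`, so `mulAt_at'` relates `mul` with
the unit coherence of the iterated tensor products. The law `mul_one` is dual. -/
theorem one_mul (i l : W ⟶ D.edge) (h : i ≫ D.src = l ≫ D.tgt) (e : D.compAt i l h = l)
    (hi : (l ≫ D.tgt) ≫ D.ident = i) :
    (O.one _ i hi ▷ V.tenAt O.ten l) ≫ O.mul i l l h e = (λ_ _).hom := by
  let B := Fr.obj D.toIntGraph
  have t₀ := O.unit_map_ten_e l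
  -- The empty list at the target of `l` is the identity of the free category at the target of the
  -- list `(l)`, since the unit is a morphism of graphs. The equality `et` is its image among the
  -- lists of objects of `V`.
  have en : listNil adj (l ≫ D.tgt) = sing adj l ≫ B.tgt ≫ B.ident := by
    rw [listNil, ← assoc]
    refine congrArg (· ≫ B.ident) ?_
    exact (assoc _ _ _).trans ((congrArg (l ≫ ·)
      (adj.toMonad.η.app D.toIntGraph).tgt_comm.symm).trans (assoc _ _ _).symm)
  have c : listNil adj (l ≫ D.tgt) ≫ B.src = sing adj l ≫ B.tgt := by
    rw [en, assoc, assoc, B.ident_src, comp_id]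
  have cr : B.compAt _ _ c = sing adj l := (B.compAt_congr en rfl c).trans (B.compAt_ident_left _)
  have tn := listNil_map adj (Fr.map O.ten) _ O.unit_map_ten (l ≫ D.tgt)
  have et : ((l ≫ D.tgt) ≫ (O.ten ≫ single V adj).v) ≫ (listCat V adj).ident =
      O.sg l ≫ (listCat V adj).tgt ≫ (listCat V adj).ident := by
    rw [← assoc (O.sg l)]
    refine congrArg (· ≫ (listCat V adj).ident) ?_
    exact (assoc _ _ _).trans ((congrArg (l ≫ ·)
      (O.ten ≫ single V adj).tgt_comm.symm).trans (assoc _ _ _).symm)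
  have k : (((l ≫ D.tgt) ≫ (O.ten ≫ single V adj).v) ≫ (listCat V adj).ident) ≫
      (listCat V adj).src = O.sg l ≫ (listCat V adj).tgt := by
    rw [et, assoc, assoc, (listCat V adj).ident_src, comp_id]
  have kr : (listCat V adj).compAt _ _ k = O.sg l :=
    ((listCat V adj).compAt_congr et rfl k).trans ((listCat V adj).compAt_ident_left _)
  refine tensor_unit_left_of_conj (O.sgIso l) (μ := (I.mulAt _ _ _ k kr).hom) ?_
    (I.ident_mul _ _ k kr (I.unit_val _) et)
  rw [← O.at'_unit l]
  exact O.mulAt_at' _ _ _ _ _ _ _ _ _ c cr _ _ _ _ _ _ _ _ _ _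

theorem mul_one (l i : W ⟶ D.edge) (h : l ≫ D.src = i ≫ D.tgt) (e : D.compAt l i h = l)
    (hi : (l ≫ D.src) ≫ D.ident = i) :
    (V.tenAt O.ten l ◁ O.one _ i hi) ≫ O.mul l i l h e = (ρ_ _).hom := by
  let B := Fr.obj D.toIntGraph
  have en : listNil adj (l ≫ D.src) = sing adj l ≫ B.src ≫ B.ident := by
    rw [listNil, ← assoc]
    refine congrArg (· ≫ B.ident) ?_
    exact (assoc _ _ _).trans ((congrArg (l ≫ ·)
      (adj.toMonad.η.app D.toIntGraph).src_comm.symm).trans (assoc _ _ _).symm)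
  have c : sing adj l ≫ B.src = listNil adj (l ≫ D.src) ≫ B.tgt := by
    rw [en, assoc, assoc, B.ident_tgt, comp_id]
  have cr : B.compAt _ _ c = sing adj l := (B.compAt_congr rfl en c).trans (B.compAt_ident_right _)
  have et : ((l ≫ D.src) ≫ (O.ten ≫ single V adj).v) ≫ (listCat V adj).ident =
      O.sg l ≫ (listCat V adj).src ≫ (listCat V adj).ident := by
    rw [← assoc (O.sg l)]
    refine congrArg (· ≫ (listCat V adj).ident) ?_
    exact (assoc _ _ _).trans ((congrArg (l ≫ ·)
      (O.ten ≫ single V adj).src_comm.symm).trans (assoc _ _ _).symm)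
  have k : O.sg l ≫ (listCat V adj).src =
      (((l ≫ D.src) ≫ (O.ten ≫ single V adj).v) ≫ (listCat V adj).ident) ≫
        (listCat V adj).tgt := by
    rw [et, assoc, assoc, (listCat V adj).ident_tgt, comp_id]
  have kr : (listCat V adj).compAt _ _ k = O.sg l :=
    ((listCat V adj).compAt_congr rfl et k).trans ((listCat V adj).compAt_ident_right _)
  refine tensor_unit_right_of_conj (O.sgIso l) (μ := (I.mulAt _ _ _ k kr).hom) ?_
    (I.mul_ident _ _ k kr (I.unit_val _) et)
  rw [← O.at'_unit l]
  exact O.mulAt_at' _ _ _ _ _ _ _ _ _ c cr _ _ _ _ _ _ _ _ _ _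

/-- The lax tensor structure given by the lists with two entries and by the empty lists. -/
noncomputable def toLax : LaxTensor V D where
  ten := O.ten
  mul := O.mul
  one := O.one
  mul_re := O.mul_re
  one_re := O.one_re
  mul_assoc := O.mul_assoc
  one_mul := O.one_mul
  mul_one := O.mul_one

end IteratedTensor.AlgOps

end AlgebraOperations

/-! ### Functors of multicategories as internal functors, and the round trip -/

section AlgebraOperations

variable {E : Type u} [Category.{v} E] [CartesianMonoidalCategory E] [HasPullbacks E]
  {V : IntMonCat E} {D D' : IntCat E} {Fr : IntGraph E ⥤ IntCat E} {W W' : E}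
  {adj : Fr ⊣ IntCat.forget E} {I : IteratedTensor V (listCat V adj) (single V adj)}

theorem comp_lift_comp_fst {A B Y : E} (a : W ⟶ A) (s t : A ⟶ B) (x : B ⟶ Y) :
    (a ≫ lift (s ≫ x) (t ≫ x)) ≫ fst Y Y = (a ≫ s) ≫ x := by simp

theorem comp_lift_comp_snd {A B Y : E} (a : W ⟶ A) (s t : A ⟶ B) (x : B ⟶ Y) :
    (a ≫ lift (s ≫ x) (t ≫ x)) ≫ snd Y Y = (a ≫ t) ≫ x := by simp

/-- The internal functor to the indiscrete category given by a map on objects. -/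
noncomputable def IntCat.toInd {B : IntCat E} {Y : E} (x : B.vert ⟶ Y) : B ⟶ IntCat.ind Y where
  v := x
  e := lift (B.src ≫ x) (B.tgt ≫ x)
  src_comm := lift_fst _ _
  tgt_comm := lift_snd _ _
  map_ident := by
    have hx : x ≫ lift (𝟙 Y) (𝟙 Y) = lift x x := by simp
    refine Eq.trans ?_ hx.symm
    refine CartesianMonoidalCategory.hom_ext _ _ ?_ ?_
    · refine (comp_lift_comp_fst _ _ _ _).trans (Eq.trans ?_ (lift_fst x x).symm)
      rw [B.ident_src, id_comp]
    · refine (comp_lift_comp_snd _ _ _ _).trans (Eq.trans ?_ (lift_snd x x).symm)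
      rw [B.ident_tgt, id_comp]
  map_comp g f h h' := by
    have h₁ := (IntCat.ind Y).compAt_src _ _ h'
    have h₂ := (IntCat.ind Y).compAt_tgt _ _ h'
    refine CartesianMonoidalCategory.hom_ext _ _ (Eq.trans ?_ h₁.symm) (Eq.trans ?_ h₂.symm)
    · refine (comp_lift_comp_fst _ _ _ _).trans (Eq.trans ?_ (comp_lift_comp_fst _ _ _ _).symm)
      rw [B.compAt_src]
    · refine (comp_lift_comp_snd _ _ _ _).trans (Eq.trans ?_ (comp_lift_comp_snd _ _ _ _).symm)
      rw [B.compAt_tgt]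

/-- The unit of the free category monad is an epimorphism on objects. -/
theorem free_vert_ext (adj : Fr ⊣ IntCat.forget E) {G : IntGraph E} {Y : E}
    {x y : (adj.toMonad.obj G).vert ⟶ Y}
    (h : (adj.toMonad.η.app G).v ≫ x = (adj.toMonad.η.app G).v ≫ y) : x = y := by
  -- A map from objects to `Y` is the same as an internal functor to `Ind(Y)`, so freeness applies
  -- to the two given maps. On edges such a functor is determined by the sources and targets, and
  -- the agreement on the vertices of `G` suffices.
  have key : IntCat.toInd (B := Fr.obj G) x = IntCat.toInd (B := Fr.obj G) y := by
    apply free_ext adj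
    refine IntGraph.hom_ext h ?_
    have hs := (adj.unit.app G).src_comm
    have ht := (adj.unit.app G).tgt_comm
    refine CartesianMonoidalCategory.hom_ext _ _ ?_ ?_
    · refine ((assoc _ _ _).trans (congrArg (_ ≫ ·) (lift_fst _ _))).trans
        (Eq.trans ?_ ((assoc _ _ _).trans (congrArg (_ ≫ ·) (lift_fst _ _))).symm)
      refine (assoc _ _ _).symm.trans (Eq.trans ?_ (assoc _ _ _))
      refine (congrArg (· ≫ x) hs).trans (Eq.trans ?_ (congrArg (· ≫ y) hs).symm)
      exact (assoc _ _ _).trans ((congrArg (G.src ≫ ·) h).trans (assoc _ _ _).symm)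
    · refine ((assoc _ _ _).trans (congrArg (_ ≫ ·) (lift_snd _ _))).trans
        (Eq.trans ?_ ((assoc _ _ _).trans (congrArg (_ ≫ ·) (lift_snd _ _))).symm)
      refine (assoc _ _ _).symm.trans (Eq.trans ?_ (assoc _ _ _))
      refine (congrArg (· ≫ x) ht).trans (Eq.trans ?_ (congrArg (· ≫ y) ht).symm)
      exact (assoc _ _ _).trans ((congrArg (G.tgt ≫ ·) h).trans (assoc _ _ _).symm)
  exact congrArg (fun F : Fr.obj G ⟶ IntCat.ind Y => F.v) key

/-- The triangle identity gives the composite in the other order, and `free_vert_ext` cancels the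
unit. Hence the free category on `D` has the objects of `D` up to isomorphism. -/
theorem listComp_unit_vert (adj : Fr ⊣ IntCat.forget E) (D : IntCat E) :
    (listComp adj D).v ≫ (adj.toMonad.η.app D.toIntGraph).v = 𝟙 _ := by
  have e := congrArg IntGraph.Hom.v (unit_listComp adj D)
  apply free_vert_ext adj
  refine (assoc _ _ _).symm.trans ((congrArg (· ≫ _) e).trans ?_)
  exact (id_comp _).trans (comp_id _).symm

namespace IteratedTensor

namespace AlgOps

variable (O : I.AlgOps D)

/-- The morphism of graphs underlying the internal functor given by lists of composable arrows
of `D`. -/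
noncomputable def toOver : adj.toMonad.obj D.toIntGraph ⟶ I.overGraph O.toLax :=
  I.overLift O.toLax O.ops (listComp adj D) O.arr_tgt

theorem toOver_dom : O.toOver ≫ I.overDom O.toLax = adj.toMonad.map O.ten :=
  (I.overLift_dom _ _ _ _).trans O.ops_src

theorem toOver_cod : O.toOver ≫ I.overCod O.toLax = listComp adj D := I.overLift_cod _ _ _ _

theorem toOver_arr : O.toOver.e ≫ I.overArr O.toLax = O.arr := I.overLift_arr _ _ _ _

theorem toOver_dom_e (p : W ⟶ (Fr.obj D.toIntGraph).edge) :
    p ≫ (adj.toMonad.map O.ten).e = (p ≫ O.toOver.e) ≫ (I.overDom O.toLax).e :=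
  (congrArg (p ≫ ·) (congrArg IntGraph.Hom.e O.toOver_dom).symm).trans (assoc _ _ _).symm

theorem toOver_cod_e (p : W ⟶ (Fr.obj D.toIntGraph).edge) :
    p ≫ (listComp adj D).e = (p ≫ O.toOver.e) ≫ (I.overCod O.toLax).e :=
  (congrArg (p ≫ ·) (congrArg IntGraph.Hom.e O.toOver_cod).symm).trans (assoc _ _ _).symm

/-- The unit `one` was defined with empty lists at vertices of `D`, whereas identities of the free
category live at its own vertices. By `listComp_unit_vert` these are the same empty lists. -/
theorem toOver_ident : (Fr.obj D.toIntGraph).ident ≫ O.arr =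
    (O.one ((listComp adj D).v) _ rfl).val := by
  have hv := listComp_unit_vert adj D
  rw [one_val]
  refine congrArg (· ≫ O.arr) ?_
  exact (id_comp _).symm.trans (congrArg (· ≫ (Fr.obj D.toIntGraph).ident) hv.symm)

/-- This is `mulAt_at'` with the coherence isomorphism moved to the other side: the operation of a
concatenation is then, by definition, the `conv` of the two operations. -/
theorem toOver_comp (g f : W ⟶ (Fr.obj D.toIntGraph).edge)
    (h : g ≫ (Fr.obj D.toIntGraph).src = f ≫ (Fr.obj D.toIntGraph).tgt)
    (h' : (g ≫ O.toOver.e) ≫ (I.overGraph O.toLax).src =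
      (f ≫ O.toOver.e) ≫ (I.overGraph O.toLax).tgt) :
    (Fr.obj D.toIntGraph).compAt g f h ≫ O.arr =
      I.overComp O.toLax (g ≫ O.toOver.e) (f ≫ O.toOver.e) h' ≫ I.overArr O.toLax := by
  have kd := composable_map (I.overDom O.toLax) h'
  have kc := composable_map (I.overCod O.toLax) h'
  have t : (Fr.obj D.toIntGraph).compAt g f h ≫ (adj.toMonad.map O.ten).e =
      (listCat V adj).compAt _ _ kd := IntCat.map_compAt (Fr.map O.ten) h rfl (O.toOver_dom_e g) (O.toOver_dom_e f) kd
  have d : (Fr.obj D.toIntGraph).compAt g f h ≫ (listComp adj D).e = D.compAt _ _ kc :=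
    IntCat.map_compAt (adj.counit.app D) h rfl (O.toOver_cod_e g) (O.toOver_cod_e f) kc
  have key := O.mulAt_at' g f _ _ _ _ _ _ _ h rfl (O.toOver_dom_e g) (O.toOver_dom_e f) t
    (O.toOver_cod_e g) (O.toOver_cod_e f) d kd rfl kc rfl
  -- The inverse of the coherence isomorphism is the first factor of `conv`.
  rw [← Iso.eq_inv_comp] at key
  refine (congrArg Fam.Hom.val key).trans (Eq.trans ?_ (I.overComp_arr O.toLax _ _ h').symm)
  refine I.conv_val_congr O.toLax kd rfl kc rfl kd rfl kc rfl rfl rfl rfl rfl ?_ ?_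
  · exact ((assoc _ _ _).trans (congrArg (g ≫ ·) O.toOver_arr)).symm
  · exact ((assoc _ _ _).trans (congrArg (f ≫ ·) O.toOver_arr)).symm

/-- The internal functor from the free category on the graph underlying `D` that is given by lists
of composable arrows of `D`. -/
noncomputable def functor : Fr.obj D.toIntGraph ⟶ I.overCat O.toLax :=
  I.overFunctor O.toLax O.toOver (Fr.map O.ten) (adj.counit.app D) O.toOver_dom O.toOver_cod
    ((congrArg ((Fr.obj D.toIntGraph).ident ≫ ·) O.toOver_arr).trans O.toOver_ident)
    (fun g f h h' => (congrArg (_ ≫ ·) O.toOver_arr).trans (O.toOver_comp g f h h'))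

/-- The unit law of `O` fixes the value at generators, so `O` and the operations generated by
`O.toLax` have the same restriction to lists with one entry. -/
theorem unit_toOver : adj.toMonad.η.app D.toIntGraph ≫ O.toOver = I.overGen O.toLax := by
  refine I.over_hom_ext _ ?_ ?_ ?_
  · exact ((assoc _ _ _).trans (congrArg (_ ≫ ·) O.toOver_dom)).trans
      (O.unit_map_ten.trans (I.overGen_dom O.toLax).symm)
  · exact ((assoc _ _ _).trans (congrArg (_ ≫ ·) O.toOver_cod)).trans
      ((unit_listComp adj D).trans (I.overGen_cod O.toLax).symm)
  · exact ((assoc _ _ _).trans (congrArg (_ ≫ ·) O.toOver_arr)).trans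
      (O.unit_arr.trans (I.overGen_arr O.toLax).symm)

end AlgOps

theorem tensor_conj_cancel {C : Type*} [Category* C] [MonoidalCategory C] {x y x' y' z t : C}
    (a : x ≅ x') (b : y ≅ y') (m : x' ⊗ y' ≅ z) (k : x ⊗ y ⟶ t) :
    (a.hom ⊗ₘ b.hom) ≫ m.hom ≫ m.inv ≫ (a.inv ⊗ₘ b.inv) ≫ k = k := by
  rw [Iso.hom_inv_id_assoc, ← assoc, tensorHom_comp_tensorHom, Iso.hom_inv_id, Iso.hom_inv_id,
    id_tensorHom_id, id_comp]

section RoundTrip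

variable (L : LaxTensor V D)

theorem ofLax_arr : (I.ofLax L).arr = (I.freeMap L).e ≫ I.overArr L := I.freeOps_arr L

/-- The functor `overFree` sends the empty list to an identity of `overCat`, and the arrow of `V` in
such an identity is the unit of `L`. -/
theorem ofLax_one (p : W ⟶ D.vert) (i : W ⟶ D.edge) (hi : p ≫ D.ident = i) :
    (I.ofLax L).one p i hi = L.one p i hi := by
  apply Fam.hom_ext
  rw [AlgOps.one_val, ofLax_arr]
  have e := listNil_map adj (I.overFree L) (I.overGen L) (I.unit_freeMap L) p
  have hv : (p ≫ (I.overGen L).v) ≫ (I.overCod L).v = p :=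
    (assoc _ _ _).trans ((congrArg (p ≫ ·) (congrArg IntGraph.Hom.v (I.overGen_cod L))).trans
      (comp_id p))
  refine (assoc _ _ _).symm.trans ((congrArg (· ≫ I.overArr L) e).trans ?_)
  exact (I.overIdent_arr L _).trans (L.one_val_congr _ _ hv)

/-- The functor `overFree` sends the list `(a, b)` to the composite of two generators, whose arrow
is the multiplication of `L` preceded by identifications of lists with one entry. These cancel
against the ones in the definition of `AlgOps.mul`. -/
theorem ofLax_mul (a b c : W ⟶ D.edge) (h : a ≫ D.src = b ≫ D.tgt) (hc : D.compAt a b h = c) :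
    (I.ofLax L).mul a b c h hc = L.mul a b c h hc := by
  let O := I.ofLax L
  have kg := composable_map (I.overGen L) h
  have hd : ∀ x : W ⟶ D.edge, (x ≫ (I.overGen L).e) ≫ (I.overDom L).e = O.sg x := fun x =>
    (assoc _ _ _).trans (congrArg (x ≫ ·) (congrArg IntGraph.Hom.e (I.overGen_dom L)))
  have hco : ∀ x : W ⟶ D.edge, (x ≫ (I.overGen L).e) ≫ (I.overCod L).e = x := fun x =>
    (assoc _ _ _).trans ((congrArg (x ≫ ·) (congrArg IntGraph.Hom.e (I.overGen_cod L))).trans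
      (comp_id x))
  have ha : ∀ x : W ⟶ D.edge, (I.overHom L (x ≫ (I.overGen L).e)).val = (O.sgIso x).inv.val :=
    fun x => ((assoc _ _ _).trans (congrArg (x ≫ ·) (I.overGen_arr L))).trans
      ((assoc _ _ _).symm.trans (congrArg (· ≫ V.ident) (O.sg_val x)))
  -- The generators carry identity arrows, which are the inverses of the isomorphisms `sgIso`.
  have key : O.at' (listPair adj a b h) _ c (O.listPair_ten a b h)
      ((AlgOps.listPair_listComp adj a b h).trans hc) =
      I.conv L (O.sg_composable h) rfl h hc (O.sgIso a).inv (O.sgIso b).inv := by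
    apply Fam.hom_ext
    have e := listPair_map adj (I.overFree L) (I.overGen L) (I.unit_freeMap L) a b h
    refine (congrArg (_ ≫ ·) (I.ofLax_arr L)).trans ((assoc _ _ _).symm.trans
      ((congrArg (· ≫ I.overArr L) (e.trans (I.overCat_compAt L _ _ kg))).trans
      ((I.overComp_arr L _ _ kg).trans ?_)))
    exact I.conv_val_congr L _ _ _ _ _ _ _ _ (hd a) (hd b) (hco a) (hco b) (ha a) (ha b)
  refine (congrArg (fun x => _ ≫ _ ≫ x) key).trans ?_
  exact tensor_conj_cancel _ _ _ _

end RoundTrip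

end IteratedTensor

end AlgebraOperations

/-! ### Transformations and morphisms of lax tensor structures -/

section AlgebraOperationsMorphisms

variable {E : Type u} [Category.{v} E] [CartesianMonoidalCategory E] [HasPullbacks E]
  {V : IntMonCat E} {D D' : IntCat E} {Fr : IntGraph E ⥤ IntCat E} {W W' : E}
  {adj : Fr ⊣ IntCat.forget E} {I : IteratedTensor V (listCat V adj) (single V adj)}

/-- The morphism of graphs underlying an internal functor. -/
def IntCat.graphMap (f : D ⟶ D') : D.toIntGraph ⟶ D'.toIntGraph := (IntCat.forget E).map f

namespace IteratedTensor.AlgOps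

theorem hom_composable_left {O' : I.AlgOps D'} {f : D ⟶ D'} {φ : D.toIntGraph ⟶ I.ops}
    (ht : φ ≫ I.opsTgt = IntCat.graphMap f ≫ O'.ten) :
    (adj.toMonad.map (IntCat.graphMap f) ≫ O'.ops) ≫ I.mSrc =
      adj.toMonad.map φ ≫ adj.toMonad.map I.opsTgt := by
  rw [assoc, O'.ops_src, ← adj.toMonad.map_comp, ← adj.toMonad.map_comp, ht]

theorem hom_composable_right {O : I.AlgOps D} {φ : D.toIntGraph ⟶ I.ops}
    (hs : φ ≫ I.mSrc = O.ten ≫ adj.toMonad.η.app (bouquet V.vert)) :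
    (listComp adj D ≫ φ) ≫ I.mSrc =
      (O.ops ≫ adj.toMonad.η.app I.ops) ≫ adj.toMonad.map I.opsTgt := by
  have n := adj.toMonad.η.naturality I.opsTgt
  simp only [Functor.id_map] at n
  rw [assoc, hs, assoc, ← n, ← assoc, ← assoc, O.ops_tgt]

/-- Transformations between functors to the multicategory induced by `V`. -/
structure Hom (O : I.AlgOps D) (O' : I.AlgOps D') (f : D ⟶ D') where
  ops : D.toIntGraph ⟶ I.ops
  ops_src : ops ≫ I.mSrc = O.ten ≫ adj.toMonad.η.app (bouquet V.vert)
  ops_tgt : ops ≫ I.opsTgt = IntCat.graphMap f ≫ O'.ten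
  natural : I.opsComp (adj.toMonad.map (IntCat.graphMap f) ≫ O'.ops) (adj.toMonad.map ops)
      (hom_composable_left ops_tgt) =
    I.opsComp (listComp adj D ≫ ops) (O.ops ≫ adj.toMonad.η.app I.ops)
      (hom_composable_right ops_src)

section

variable (O : I.AlgOps D) (O' : I.AlgOps D') {f : D ⟶ D'} {φ : D.toIntGraph ⟶ I.ops}

theorem ops_arr_src (hs : φ ≫ I.mSrc = O.ten ≫ adj.toMonad.η.app (bouquet V.vert)) :
    (φ.e ≫ I.opsArr) ≫ V.src = O.ten.e := by
  have h : φ.e ≫ I.mSrc.e = O.ten.e ≫ (single V adj).e := congrArg IntGraph.Hom.e hs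
  rw [assoc, I.opsArr_mSrc, ← assoc, h]
  exact (assoc _ _ _).trans ((congrArg (O.ten.e ≫ ·) I.single_ten).trans (comp_id _))

theorem ops_arr_tgt (ht : φ ≫ I.opsTgt = IntCat.graphMap f ≫ O'.ten) :
    (φ.e ≫ I.opsArr) ≫ V.tgt = f.e ≫ O'.ten.e :=
  (assoc _ _ _).trans (congrArg IntGraph.Hom.e ht)

theorem natural_left_arr (ht : φ ≫ I.opsTgt = IntCat.graphMap f ≫ O'.ten) (k) :
    (I.opsComp (adj.toMonad.map (IntCat.graphMap f) ≫ O'.ops) (adj.toMonad.map φ)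
      (hom_composable_left ht)).e ≫ I.opsArr =
    V.compAt ((adj.toMonad.map (IntCat.graphMap f)).e ≫ O'.arr)
      ((adj.toMonad.map φ).e ≫ I.tenArr) k :=
  (I.opsComp_arr _ _ _).trans (V.compAt_congr (assoc _ _ _) rfl _)

/-- The inner list of operations has one entry, so its tensor product is the operation itself and
the composite is a composite in `V`. -/
theorem natural_right_arr (hs : φ ≫ I.mSrc = O.ten ≫ adj.toMonad.η.app (bouquet V.vert)) (k) :
    (I.opsComp (listComp adj D ≫ φ) (O.ops ≫ adj.toMonad.η.app I.ops)
      (hom_composable_right hs)).e ≫ I.opsArr =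
    V.compAt ((listComp adj D).e ≫ φ.e ≫ I.opsArr) O.arr k :=
  (I.opsComp_arr _ _ _).trans (V.compAt_congr (assoc _ _ _)
    ((assoc _ _ _).trans (congrArg (O.ops.e ≫ ·) I.unit_tenArr)) _)

theorem natural_left_composable (ht : φ ≫ I.opsTgt = IntCat.graphMap f ≫ O'.ten) :
    ((adj.toMonad.map (IntCat.graphMap f)).e ≫ O'.arr) ≫ V.src =
      ((adj.toMonad.map φ).e ≫ I.tenArr) ≫ V.tgt :=
  (congrArg (· ≫ V.src) (assoc _ _ _).symm).trans
    (I.opsComp_composable _ _ (hom_composable_left ht))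

theorem natural_right_composable
    (hs : φ ≫ I.mSrc = O.ten ≫ adj.toMonad.η.app (bouquet V.vert)) :
    ((listComp adj D).e ≫ φ.e ≫ I.opsArr) ≫ V.src = O.arr ≫ V.tgt := by
  rw [assoc, O.ops_arr_src hs, O.arr_tgt]

variable (adj) in
theorem listPair_map_map {G H : IntGraph E} (k : G ⟶ H) (a b : W ⟶ G.edge)
    (h : a ≫ G.src = b ≫ G.tgt) {a' b' : W ⟶ H.edge} (ha : a ≫ k.e = a') (hb : b ≫ k.e = b')
    (h' : a' ≫ H.src = b' ≫ H.tgt) :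
    listPair adj a b h ≫ (adj.toMonad.map k).e = listPair adj a' b' h' := by
  subst ha hb
  have n : adj.toMonad.η.app G ≫ adj.toMonad.map k = k ≫ adj.toMonad.η.app H :=
    (adj.toMonad.η.naturality k).symm
  refine (listPair_map adj (Fr.map k) _ n a b h).trans ?_
  exact (Fr.obj H).compAt_congr (assoc _ _ _).symm (assoc _ _ _).symm _

variable (adj) in
theorem listNil_map_map {G H : IntGraph E} (k : G ⟶ H) (p : W ⟶ G.vert) {p' : W ⟶ H.vert}
    (hp : p ≫ k.v = p') : listNil adj p ≫ (adj.toMonad.map k).e = listNil adj p' := by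
  subst hp
  have n : adj.toMonad.η.app G ≫ adj.toMonad.map k = k ≫ adj.toMonad.η.app H :=
    (adj.toMonad.η.naturality k).symm
  refine (listNil_map adj (Fr.map k) _ n p).trans ?_
  exact congrArg (· ≫ (Fr.obj H).ident) (assoc _ _ _).symm

variable (I) in
theorem listNil_tenArr {Y : IntGraph E} (k : Y ⟶ I.ops) (p : W ⟶ Y.vert) :
    listNil adj p ≫ (adj.toMonad.map k).e ≫ I.tenArr = toUnit W ≫ V.unit ≫ V.ident := by
  have e := listNil_map adj (Fr.map k ≫ I.tenArrow) _ (I.unit_map_ten₁ k) p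
  refine Eq.trans ?_ ((congrArg (· ≫ I.stArr) e).trans (I.stIdent_arr _))
  exact (congrArg (_ ≫ ·) (assoc _ _ _).symm).trans (assoc _ _ _).symm

theorem ops_gen_dom (hs : φ ≫ I.mSrc = O.ten ≫ adj.toMonad.η.app (bouquet V.vert))
    (a : W ⟶ D.edge) : (a ≫ (φ ≫ I.stGen).e) ≫ I.stDom.e = O.sg a := by
  have e : (φ ≫ I.stGen) ≫ I.stDom = O.ten ≫ single V adj :=
    ((assoc _ _ _).trans (congrArg (φ ≫ ·) (I.stLift_dom _ _ _ _ _))).trans hs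
  exact (assoc _ _ _).trans (congrArg (a ≫ ·) (congrArg IntGraph.Hom.e e))

theorem ops_gen_cod (ht : φ ≫ I.opsTgt = IntCat.graphMap f ≫ O'.ten) (a : W ⟶ D.edge)
    {a' : W ⟶ D'.edge} (ha : a ≫ f.e = a') : (a ≫ (φ ≫ I.stGen).e) ≫ I.stCod.e = O'.sg a' := by
  subst ha
  have e : (φ ≫ I.stGen) ≫ I.stCod = IntCat.graphMap f ≫ O'.ten ≫ single V adj :=
    ((assoc _ _ _).trans (congrArg (φ ≫ ·) (I.stLift_cod _ _ _ _ _))).trans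
      ((assoc _ _ _).symm.trans ((congrArg (· ≫ single V adj) ht).trans (assoc _ _ _)))
  exact ((assoc _ _ _).trans (congrArg (a ≫ ·) (congrArg IntGraph.Hom.e e))).trans
    (assoc _ _ _).symm

variable (I) in
theorem ops_gen_arr {Y : IntGraph E} (k : Y ⟶ I.ops) (a : W ⟶ Y.edge) :
    (a ≫ (k ≫ I.stGen).e) ≫ I.stArr = a ≫ k.e ≫ I.opsArr :=
  (assoc _ _ _).trans (congrArg (a ≫ ·) ((assoc _ _ _).trans
    (congrArg (k.e ≫ ·) (I.stLift_arr _ _ _ _ _))))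

end

section

variable {O : I.AlgOps D} {O' : I.AlgOps D'} {f : D ⟶ D'} (F : Hom O O' f)

theorem Hom.natural_arr :
    V.compAt ((adj.toMonad.map (IntCat.graphMap f)).e ≫ O'.arr)
      ((adj.toMonad.map F.ops).e ≫ I.tenArr) (natural_left_composable O' F.ops_tgt) =
    V.compAt ((listComp adj D).e ≫ F.ops.e ≫ I.opsArr) O.arr
      (natural_right_composable O F.ops_src) :=
  (natural_left_arr O' F.ops_tgt _).symm.trans
    ((congrArg (fun x => IntGraph.Hom.e x ≫ I.opsArr) F.natural).trans
      (natural_right_arr O F.ops_src _))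

/-- Naturality of the transformation at the path `(l, m)`. One side is the operation of `O` followed
by the component at the composite; the other is the tensor product of the two components followed by
the operation of `O'`. -/
theorem Hom.map_mul (l m n : W ⟶ D.edge) (h : l ≫ D.src = m ≫ D.tgt) (hn : D.compAt l m h = n)
    (l' m' n' : W ⟶ D'.edge) (h' : l' ≫ D'.src = m' ≫ D'.tgt) (hn' : D'.compAt l' m' h' = n')
    (hl : l ≫ f.e = l') (hm : m ≫ f.e = m')
    (φ : V.tenAt O.ten l ⟶ V.tenAt O'.ten l') (ψ : V.tenAt O.ten m ⟶ V.tenAt O'.ten m')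
    (χ : V.tenAt O.ten n ⟶ V.tenAt O'.ten n')
    (hφ : φ.val = l ≫ F.ops.e ≫ I.opsArr) (hψ : ψ.val = m ≫ F.ops.e ≫ I.opsArr)
    (hχ : χ.val = n ≫ F.ops.e ≫ I.opsArr) :
    O.mul l m n h hn ≫ χ = (φ ⊗ₘ ψ) ≫ O'.mul l' m' n' h' hn' := by
  -- The components at `l` and `m` are conjugated by `sgIso`, because tensor products of lists of
  -- operations go between tensor products of lists with one entry. The conjugation disappears in
  -- the final simplification.
  have key : O.at' (listPair adj l m h) _ n (O.listPair_ten l m h)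
        ((listPair_listComp adj l m h).trans hn) ≫ χ =
      I.mulHom (O.sg_composable h) rfl (O'.sg_composable h') rfl
        ((O.sgIso l).inv ≫ φ ≫ (O'.sgIso l').hom) ((O.sgIso m).inv ≫ ψ ≫ (O'.sgIso m').hom) ≫
      O'.at' (listPair adj l' m' h') _ n' (O'.listPair_ten l' m' h')
        ((listPair_listComp adj l' m' h').trans hn') := by
    apply Fam.hom_ext
    have e := congrArg (listPair adj l m h ≫ ·) F.natural_arr
    refine Eq.trans ?_ (e.symm.trans ((V.pre_compAt _ _ _ _).trans (V.compAt_congr ?_ ?_ _)))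
    · refine Eq.trans ?_ (V.pre_compAt _ _ _ _).symm
      refine V.compAt_congr (hχ.trans ?_) rfl _
      exact (congrArg (· ≫ _) ((listPair_listComp adj l m h).trans hn).symm).trans (assoc _ _ _)
    · exact (assoc _ _ _).symm.trans
        (congrArg (· ≫ O'.arr) (listPair_map_map adj (IntCat.graphMap f) l m h hl hm h'))
    · refine (listPair_tenArr I F.ops l m h).trans ((I.stComp_arr _ _ _).trans ?_)
      refine I.mulHom_val_congr _ _ _ _ _ _ _ _ (O.ops_gen_dom F.ops_src l)
        (O'.ops_gen_cod F.ops_tgt l hl) (O.ops_gen_dom F.ops_src m)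
        (O'.ops_gen_cod F.ops_tgt m hm) ?_ ?_
      · exact (ops_gen_arr I F.ops l).trans (hφ.symm.trans
          ((O'.comp_sgIso_val l' φ).symm.trans (Fam.eqIso_comp_val (O.sg_val l).symm _).symm))
      · exact (ops_gen_arr I F.ops m).trans (hψ.symm.trans
          ((O'.comp_sgIso_val m' ψ).symm.trans (Fam.eqIso_comp_val (O.sg_val m).symm _).symm))
  rw [mul, mul, assoc, assoc, key, mulHom]
  simp only [assoc, Iso.hom_inv_id_assoc, tensorHom_comp_tensorHom_assoc]

/-- Naturality of the transformation at the empty path, where there are no components to tensor. -/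
theorem Hom.map_one (p : W ⟶ D.vert) (i : W ⟶ D.edge) (hi : p ≫ D.ident = i)
    (p' : W ⟶ D'.vert) (i' : W ⟶ D'.edge) (hi' : p' ≫ D'.ident = i') (hp : p ≫ f.v = p')
    (χ : V.tenAt O.ten i ⟶ V.tenAt O'.ten i') (hχ : χ.val = i ≫ F.ops.e ≫ I.opsArr) :
    O.one p i hi ≫ χ = O'.one p' i' hi' := by
  have e := congrArg (listNil adj p ≫ ·) F.natural_arr
  have eo := O'.one_val p' i' hi'
  have hn : listNil adj p ≫ (listComp adj D).e = i :=
    (listNil_map adj (adj.counit.app D) (𝟙 _) (unit_listComp adj D) p).trans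
        ((congrArg (· ≫ D.ident) (comp_id p)).trans hi)
  apply Fam.hom_ext
  -- The tensor product of the empty list of operations is the identity of the tensor unit. It is
  -- rewritten as the identity of the source of `O'.one`, so that the right unit law of `V` removes
  -- it.
  have e' := e.symm.trans ((V.pre_compAt _ _ _ _).trans (V.compAt_congr
    (g' := (O'.one p' i' hi').val)
    (f' := (O'.one p' i' hi').val ≫ V.src ≫ V.ident) ?_ ?_ _))
  · refine Eq.trans ?_ (e'.trans (V.compAt_ident_right _))
    refine Eq.trans ?_ (V.pre_compAt _ _ _ _).symm
    refine V.compAt_congr (hχ.trans ?_) (O.one_val p i hi) _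
    exact (congrArg (· ≫ _) hn.symm).trans (assoc _ _ _)
  · refine ((assoc _ _ _).symm.trans (congrArg (· ≫ O'.arr) ?_)).trans eo.symm
    exact listNil_map_map adj (IntCat.graphMap f) p hp
  · refine (listNil_tenArr I F.ops p).trans ?_
    refine Eq.trans ?_ (assoc _ _ _)
    rw [(O'.one p' i' hi').src_eq]
    exact (assoc _ _ _).symm

/-- The morphism of lax tensor structures given by a transformation. -/
noncomputable def Hom.toLax : LaxTensor.Hom O.toLax O'.toLax f where
  app := F.ops.e ≫ I.opsArr
  app_src := O.ops_arr_src F.ops_src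
  app_tgt := O'.ops_arr_tgt F.ops_tgt
  map_mul := F.map_mul
  map_one := F.map_one

end

section

variable {O : I.AlgOps D} {O' : I.AlgOps D'} {f : D ⟶ D'} (Φ : LaxTensor.Hom O.toLax O'.toLax f)

/-- The operations given by a morphism of lax tensor structures. -/
noncomputable def laxOps : D.toIntGraph ⟶ I.ops :=
  I.mLift (O.ten ≫ adj.toMonad.η.app (bouquet V.vert)) Φ.app (by
    refine Eq.trans ?_ Φ.app_src.symm
    exact (assoc _ _ _).trans ((congrArg (O.ten.e ≫ ·) I.single_ten).trans (comp_id _)))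

theorem laxOps_src : laxOps Φ ≫ I.mSrc = O.ten ≫ adj.toMonad.η.app (bouquet V.vert) :=
  I.mLift_src _ _ _

theorem laxOps_arr : (laxOps Φ).e ≫ I.opsArr = Φ.app := I.mLift_arr _ _ _

theorem laxOps_tgt : laxOps Φ ≫ I.opsTgt = IntCat.graphMap f ≫ O'.ten := by
  apply bouquet_hom_ext
  exact (assoc _ _ _).symm.trans ((congrArg (· ≫ V.tgt) (laxOps_arr Φ)).trans Φ.app_tgt)

theorem laxOps_vert_composable :
    (adj.toMonad.map (IntCat.graphMap f) ≫ O'.toOver) ≫ I.overDom O'.toLax =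
      (adj.toMonad.map (laxOps Φ) ≫ I.ten₁) ≫ I.stCod := by
  refine (assoc _ _ _).trans ((congrArg (_ ≫ ·) O'.toOver_dom).trans ?_)
  refine Eq.trans ?_ ((congrArg (_ ≫ ·) I.ten₁_cod.symm).trans (assoc _ _ _).symm)
  exact (adj.toMonad.map_comp _ _).symm.trans
    ((congrArg adj.toMonad.map (laxOps_tgt Φ).symm).trans (adj.toMonad.map_comp _ _))

/-- This equality contains naturality at all paths. Both sides underlie internal functors from the
free category on `D` to `overCat` for `O'`: apply the components and then the operation of `O'`, or
the operation of `O` and then the component at the composite. On generators both give the component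
of `Φ`. -/
theorem overVert_laxOps :
    I.overVert O'.toLax (adj.toMonad.map (IntCat.graphMap f) ≫ O'.toOver)
      (adj.toMonad.map (laxOps Φ) ≫ I.ten₁) (laxOps_vert_composable Φ) =
    O.toOver ≫ I.overPush Φ := by
  have key : I.overVertFunctor O'.toLax (Fr.map (IntCat.graphMap f) ≫ O'.functor)
        (Fr.map (laxOps Φ) ≫ I.tenArrow) (laxOps_vert_composable Φ) =
      O.functor ≫ I.overPushFunctor Φ := by
    apply free_ext adj
    change adj.toMonad.η.app D.toIntGraph ≫
        I.overVert O'.toLax (adj.toMonad.map (IntCat.graphMap f) ≫ O'.toOver)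
          (adj.toMonad.map (laxOps Φ) ≫ I.ten₁) (laxOps_vert_composable Φ) =
      adj.toMonad.η.app D.toIntGraph ≫ O.toOver ≫ I.overPush Φ
    have e₀ : adj.toMonad.η.app D.toIntGraph ≫ O.toOver ≫ I.overPush Φ =
        I.overGen O.toLax ≫ I.overPush Φ :=
      (assoc _ _ _).symm.trans (congrArg (· ≫ I.overPush Φ) O.unit_toOver)
    have e₁ : adj.toMonad.η.app D.toIntGraph ≫
        adj.toMonad.map (IntCat.graphMap f) ≫ O'.toOver =
        IntCat.graphMap f ≫ I.overGen O'.toLax := by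
      have n := adj.toMonad.η.naturality (IntCat.graphMap f)
      refine (assoc _ _ _).symm.trans ((congrArg (· ≫ O'.toOver) n.symm).trans ?_)
      exact (assoc _ _ _).trans (congrArg (_ ≫ ·) O'.unit_toOver)
    have e₂ := I.unit_map_ten₁ (laxOps Φ)
    refine Eq.trans ?_ e₀.symm
    refine I.over_hom_ext O'.toLax ?_ ?_ ?_
    · rw [assoc, overVert_dom, ← assoc, e₂, assoc, stGen, stLift_dom, assoc, overPush_dom,
        overGen_dom]
      exact laxOps_src Φ
    · rw [assoc, overVert_cod, ← assoc, e₁, assoc, overGen_cod, assoc, overPush_cod, ← assoc,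
        overGen_cod]
      exact (comp_id _).trans (id_comp _).symm
    · have e₁' := congrArg IntGraph.Hom.e e₁
      have e₂' := congrArg IntGraph.Hom.e e₂
      have hc := congrArg IntGraph.Hom.e (I.overGen_cod O.toLax)
      have hg : (IntCat.graphMap f).e ≫ (I.overGen O'.toLax).e ≫ I.overArr O'.toLax =
        (Φ.app ≫ V.tgt) ≫ V.ident := by
        rw [overGen_arr, Φ.app_tgt]
        exact (assoc _ _ _).symm
      simp only [IntGraph.comp_e] at e₁' e₂'
      refine (((assoc _ _ _).trans (congrArg (_ ≫ ·) (I.overVert_arr _ _ _ _))).trans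
        (V.pre_compAt _ _ _ _)).trans ?_
      refine Eq.trans ?_ (((assoc _ _ _).trans (congrArg (_ ≫ ·) (I.overPush_arr Φ))).trans
        (V.pre_compAt _ _ _ _)).symm
      -- At a generator the left side is the component followed by the identity of its target, the
      -- right side the identity of its source followed by the component.
      refine (V.compAt_congr (f' := Φ.app) (g' := Φ.app ≫ V.tgt ≫ V.ident) ?_ ?_ _).trans
        ((V.compAt_ident_left _).trans ((V.compAt_ident_right _).symm.trans
        (V.compAt_congr (g := Φ.app) (f := Φ.app ≫ V.src ≫ V.ident) ?_ ?_ _)))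
      · refine (assoc _ _ _).symm.trans ((congrArg (· ≫ I.overArr O'.toLax) e₁').trans ?_)
        exact (assoc _ _ _).trans (hg.trans (assoc _ _ _))
      · refine (assoc _ _ _).symm.trans ((congrArg (· ≫ I.stArr) e₂').trans ?_)
        exact (assoc _ _ _).trans ((congrArg (_ ≫ ·) (I.stLift_arr _ _ _ _ _)).trans (laxOps_arr Φ))
      · exact ((assoc _ _ _).symm.trans ((congrArg (· ≫ Φ.app) hc).trans (id_comp _))).symm
      · rw [overGen_arr, ← assoc, Φ.app_src]
  exact congrArg (IntCat.forget E).map key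

/-- The transformation given by a morphism of lax tensor structures. -/
noncomputable def ofLaxHom : Hom O O' f where
  ops := laxOps Φ
  ops_src := laxOps_src Φ
  ops_tgt := laxOps_tgt Φ
  natural := by
    apply I.mops_ext
    · have n : adj.toMonad.η.app I.ops ≫ adj.toMonad.map I.mSrc =
        I.mSrc ≫ adj.toMonad.η.app _ := (adj.toMonad.η.naturality I.mSrc).symm
      have r := adj.toMonad.right_unit (bouquet V.vert)
      have l := adj.toMonad.left_unit (bouquet V.vert)
      rw [opsComp_src, opsComp_src, ← assoc, ← adj.toMonad.map_comp, laxOps_src,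
        adj.toMonad.map_comp]
      refine ((assoc _ _ _).trans ((congrArg (_ ≫ ·) r).trans (comp_id _))).trans ?_
      refine O.ops_src.symm.trans (Eq.trans ?_ (assoc _ _ _).symm)
      refine congrArg (O.ops ≫ ·) (Eq.symm ?_)
      exact (assoc _ _ _).symm.trans ((congrArg (· ≫ _) n).trans ((assoc _ _ _).trans
        ((congrArg (I.mSrc ≫ ·) l).trans (comp_id _))))
    · have e := congrArg (fun x => IntGraph.Hom.e x ≫ I.overArr O'.toLax) (overVert_laxOps Φ)
      refine (natural_left_arr O' (laxOps_tgt Φ) (natural_left_composable O' (laxOps_tgt Φ))).trans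
        (Eq.trans ?_ (natural_right_arr O (laxOps_src Φ)
          (natural_right_composable O (laxOps_src Φ))).symm)
      refine Eq.trans ?_ (((I.overVert_arr _ _ _ _).symm.trans e).trans (((assoc _ _ _).trans
        (congrArg (O.toOver.e ≫ ·) (I.overPush_arr Φ))).trans ((V.pre_compAt _ _ _ _).trans
        (V.compAt_congr ?_ O.toOver_arr _))))
      · refine V.compAt_congr ?_ ?_ _
        · exact ((assoc _ _ _).trans (congrArg (_ ≫ ·) O'.toOver_arr)).symm
        · exact (assoc _ _ _).symm
      · refine (assoc _ _ _).symm.trans (Eq.trans ?_ (congrArg (_ ≫ ·) (laxOps_arr Φ).symm))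
        exact congrArg (· ≫ Φ.app) (congrArg IntGraph.Hom.e O.toOver_cod)

end

end IteratedTensor.AlgOps

end AlgebraOperationsMorphisms

/-! ### Lax structures on indiscrete categories as small categories -/

section Externalization

variable {E : Type u} [Category.{v} E] [CartesianMonoidalCategory E] [HasPullbacks E]
  {V : IntMonCat E} {W W' : E}

namespace IntMonCat

/-- Reindexing in `Ext(V)` is precomposition, so the coherence isomorphisms are families of
identities and do not affect underlying arrows of `E`. -/
theorem ext_reObj_hom {X Y Z : E} (r : X ⟶ Y) (f : Y ⟶ Z) (g : X ⟶ Z) (h : r ≫ f = g)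
    (A : Fam V.toIntCat Z) (e : ((Fam.re V.toIntCat r).obj ((Fam.re V.toIntCat f).obj A)).val =
      ((Fam.re V.toIntCat g).obj A).val) :
    (V.Ext.reObj r f g h A).hom = (Fam.eqIso e).hom := by
  subst h
  exact comp_id (Fam.eqIso (V.re_comp_val r f A)).inv

theorem ext_reObj_inv {X Y Z : E} (r : X ⟶ Y) (f : Y ⟶ Z) (g : X ⟶ Z) (h : r ≫ f = g)
    (A : Fam V.toIntCat Z) (e : ((Fam.re V.toIntCat g).obj A).val =
      ((Fam.re V.toIntCat r).obj ((Fam.re V.toIntCat f).obj A)).val) :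
    (V.Ext.reObj r f g h A).inv = (Fam.eqIso e).hom := by
  subst h
  exact id_comp (Fam.eqIso (V.re_comp_val r f A)).hom

theorem re_re_val {X Y Z : E} {r : X ⟶ Y} {f : Y ⟶ Z} {g : X ⟶ Z} (h : r ≫ f = g)
    (A : Fam V.toIntCat Z) : ((Fam.re V.toIntCat r).obj ((Fam.re V.toIntCat f).obj A)).val =
      ((Fam.re V.toIntCat g).obj A).val := by
  subst h
  exact (V.re_comp_val r f A).symm

theorem eqIso_conj_val {x y z t : Fam V.toIntCat W} (h : x.val = y.val) (f : y ⟶ z)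
    (h' : z.val = t.val) : ((Fam.eqIso h).hom ≫ f ≫ (Fam.eqIso h').hom).val = f.val := by
  rw [Fam.eqIso_comp_val, Fam.comp_eqIso_val]

theorem comp_comp_eqIso_val {x y z t : Fam V.toIntCat W} (f : x ⟶ y) (g : y ⟶ z)
    (h : z.val = t.val) : (f ≫ g ≫ (Fam.eqIso h).hom).val = (f ≫ g).val := by
  rw [← assoc, Fam.comp_eqIso_val]

theorem eqIso_tensor_conj_val {x x' y y' p q r : Fam V.toIntCat W} (h : x.val = y.val)
    (h' : x'.val = y'.val) (k : (y ⊗ y').val = p.val) (f : p ⟶ q) (k' : q.val = r.val) :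
    (((Fam.eqIso h).hom ⊗ₘ (Fam.eqIso h').hom) ≫ (Fam.eqIso k).hom ≫ f ≫
      (Fam.eqIso k').hom).val = f.val := by
  rw [V.eqIso_tensor, Fam.eqIso_comp_val, eqIso_conj_val]

/-- The comparison arrows in the definition of `idAt` are identities of families, so only the
precomposition with `x` remains. The next two lemmas hold for the same reason. -/
theorem ext_idAt_val {X Z : E} {H : Fam V.toIntCat (X ⊗ X)}
    (i : 𝟙_ (Fam V.toIntCat X) ⟶ (Fam.re V.toIntCat (lift (𝟙 X) (𝟙 X))).obj H) (x : Z ⟶ X) :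
    Fam.Hom.val (V.Ext.idAt (H := H) i x) = x ≫ i.val := by
  have h : x ≫ lift (𝟙 X) (𝟙 X) = lift x x := by simp [comp_lift]
  have e := ext_reObj_hom x _ _ h H (re_re_val h H)
  refine (congrArg (fun k => Fam.Hom.val ((Fam.eqIso (V.re_unit_val x)).hom ≫
    (Fam.re V.toIntCat x).map i ≫ k)) e).trans ?_
  exact eqIso_conj_val _ _ _

theorem ext_compAt_val {X Z : E} {H : Fam V.toIntCat (X ⊗ X)}
    (c : (Fam.re V.toIntCat (snd X (X ⊗ X))).obj H ⊗
        (Fam.re V.toIntCat (lift (fst X (X ⊗ X)) (snd X (X ⊗ X) ≫ fst X X))).obj H ⟶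
      (Fam.re V.toIntCat (lift (fst X (X ⊗ X)) (snd X (X ⊗ X) ≫ snd X X))).obj H)
    (x₀ x₁ x₂ : Z ⟶ X) :
    Fam.Hom.val (V.Ext.compAt (H := H) c x₀ x₁ x₂) = lift x₀ (lift x₁ x₂) ≫ c.val := by
  have h₁ : lift x₀ (lift x₁ x₂) ≫ snd X (X ⊗ X) = lift x₁ x₂ := by simp
  have h₂ : lift x₀ (lift x₁ x₂) ≫ lift (fst X (X ⊗ X)) (snd X (X ⊗ X) ≫ fst X X) =
    lift x₀ x₁ := by simp [comp_lift]
  have h₃ : lift x₀ (lift x₁ x₂) ≫ lift (fst X (X ⊗ X)) (snd X (X ⊗ X) ≫ snd X X) =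
    lift x₀ x₂ := by simp [comp_lift]
  have e₁ := ext_reObj_inv _ _ _ h₁ H (re_re_val h₁ H).symm
  have e₂ := ext_reObj_inv _ _ _ h₂ H (re_re_val h₂ H).symm
  have e₃ := ext_reObj_hom _ _ _ h₃ H (re_re_val h₃ H)
  refine (congrArg (fun k => Fam.Hom.val (k ≫ (Fam.eqIso (V.re_tensor_val _ _ _)).hom ≫
    (Fam.re V.toIntCat (lift x₀ (lift x₁ x₂))).map c ≫
    (V.Ext.reObj _ _ _ h₃ H).hom)) (congrArg₂ (· ⊗ₘ ·) e₁ e₂)).trans ?_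
  refine (congrArg (fun k => Fam.Hom.val (_ ≫ (Fam.eqIso (V.re_tensor_val _ _ _)).hom ≫
    (Fam.re V.toIntCat (lift x₀ (lift x₁ x₂))).map c ≫ k)) e₃).trans ?_
  exact eqIso_tensor_conj_val _ _ _ _ _

theorem ext_mapAt_val {A B : SmallCat V.Ext} {f : A.X ⟶ B.X}
    (m : A.hom ⟶ (V.Ext.re (f ⊗ₘ f)).obj B.hom) {Z : E}
    {x₀ x₁ : Z ⟶ A.X} {y₀ y₁ : Z ⟶ B.X} (h₀ : x₀ ≫ f = y₀) (h₁ : x₁ ≫ f = y₁) :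
    Fam.Hom.val (SmallCat.mapAt m h₀ h₁) = lift x₀ x₁ ≫ Fam.Hom.val m := by
  have h : lift x₀ x₁ ≫ (f ⊗ₘ f) = lift y₀ y₁ := by simp [h₀, h₁]
  have e := ext_reObj_hom _ _ _ h B.hom (re_re_val h B.hom)
  refine (congrArg (fun k => Fam.Hom.val ((Fam.re V.toIntCat (lift x₀ x₁)).map m ≫ k)) e).trans ?_
  exact Fam.comp_eqIso_val _ _

end IntMonCat

/-- The object of arrows of an indiscrete category, with pairs as generalized elements. -/
theorem IntCat.ind_compAt {X : E} (x₀ x₁ x₂ : W ⟶ X) (h) :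
    (IntCat.ind X).compAt (lift x₁ x₂) (lift x₀ x₁) h = lift x₀ x₂ := by
  refine CartesianMonoidalCategory.hom_ext _ _ ?_ ?_
  · exact ((IntCat.ind X).compAt_src _ _ h).trans ((lift_fst _ _).trans (lift_fst _ _).symm)
  · exact ((IntCat.ind X).compAt_tgt _ _ h).trans ((lift_snd _ _).trans (lift_snd _ _).symm)

theorem IntCat.ind_compAt_generic {X : E} (h) :
    (IntCat.ind X).compAt (snd X (X ⊗ X)) (lift (fst X (X ⊗ X)) (snd X (X ⊗ X) ≫ fst X X)) h =
      lift (fst X (X ⊗ X)) (snd X (X ⊗ X) ≫ snd X X) := by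
  have e : lift (snd X (X ⊗ X) ≫ fst X X) (snd X (X ⊗ X) ≫ snd X X) = snd X (X ⊗ X) := by
    rw [← comp_lift, lift_fst_snd, comp_id]
  refine ((IntCat.ind X).compAt_congr e.symm rfl _).trans ?_
  exact IntCat.ind_compAt _ _ _ _

theorem IntCat.ind_composable {X : E} (x₀ x₁ x₂ : W ⟶ X) :
    lift x₁ x₂ ≫ (IntCat.ind X).src = lift x₀ x₁ ≫ (IntCat.ind X).tgt :=
  (lift_fst _ _).trans (lift_snd _ _).symm

theorem comp_ind_ident {X : E} (x : W ⟶ X) : x ≫ (IntCat.ind X).ident = lift x x := by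
  refine (comp_lift _ _ _).trans ?_
  rw [comp_id]

theorem lift_generic {X : E} (x₀ x₁ x₂ : W ⟶ X) :
    lift x₀ (lift x₁ x₂) ≫ lift (fst X (X ⊗ X)) (snd X (X ⊗ X) ≫ fst X X) = lift x₀ x₁ := by
  simp [comp_lift]

namespace LaxTensor

variable {X : E} (L : LaxTensor V (IntCat.ind X))

/-- The unit of a lax tensor structure on an indiscrete category. -/
noncomputable def indOne : 𝟙_ (Fam V.toIntCat X) ⟶ V.tenAt L.ten (lift (𝟙 X) (𝟙 X)) :=
  L.one (𝟙 X) (lift (𝟙 X) (𝟙 X)) (id_comp _)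

/-- The multiplication of a lax tensor structure on an indiscrete category. -/
noncomputable def indMul : V.tenAt L.ten (snd X (X ⊗ X)) ⊗
      V.tenAt L.ten (lift (fst X (X ⊗ X)) (snd X (X ⊗ X) ≫ fst X X)) ⟶
    V.tenAt L.ten (lift (fst X (X ⊗ X)) (snd X (X ⊗ X) ≫ snd X X)) :=
  L.mul _ _ _ (lift_snd _ _).symm (IntCat.ind_compAt_generic _)

/-- The component of the multiplication at generalized elements. -/
noncomputable def mulAt₃ (x₀ x₁ x₂ : W ⟶ X) :
    V.tenAt L.ten (lift x₁ x₂) ⊗ V.tenAt L.ten (lift x₀ x₁) ⟶ V.tenAt L.ten (lift x₀ x₂) :=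
  L.mul _ _ _ (IntCat.ind_composable x₀ x₁ x₂) (IntCat.ind_compAt _ _ _ _)

/-- Reindexing the generic unit along `x` gives the unit at `x` because the lax structure is stable
under reindexing. -/
theorem ext_idAt (x : W ⟶ X) :
    V.Ext.idAt (H := (⟨L.ten.e⟩ : Fam V.toIntCat (X ⊗ X))) L.indOne x =
      L.one x (lift x x) (comp_ind_ident x) := by
  apply Fam.hom_ext
  refine (IntMonCat.ext_idAt_val (H := (⟨L.ten.e⟩ : Fam V.toIntCat (X ⊗ X))) L.indOne x).trans ?_
  exact L.one_re _ _ _ _ _ _ _ (comp_id x)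

/-- The triple classifies the composable pair `(x₁, x₂)`, `(x₀, x₁)`, and stability under reindexing
recovers the multiplication there from the generic one. -/
theorem ext_compAt (x₀ x₁ x₂ : W ⟶ X) :
    V.Ext.compAt (H := (⟨L.ten.e⟩ : Fam V.toIntCat (X ⊗ X))) L.indMul x₀ x₁ x₂ =
      L.mulAt₃ x₀ x₁ x₂ := by
  apply Fam.hom_ext
  refine (IntMonCat.ext_compAt_val (H := (⟨L.ten.e⟩ : Fam V.toIntCat (X ⊗ X))) L.indMul
    x₀ x₁ x₂).trans ?_
  exact L.mul_re _ _ _ _ _ _ _ _ _ _ _ (lift_snd _ _) (lift_generic x₀ x₁ x₂)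

/-- The small category given by a lax tensor structure on an indiscrete category. -/
noncomputable def smallCat : SmallCat V.Ext where
  X := X
  hom := (⟨L.ten.e⟩ : Fam V.toIntCat (X ⊗ X))
  ident := L.indOne
  comp := L.indMul
  ident_comp {Z} x₀ x₁ := by
    have e := L.one_mul (lift x₁ x₁) (lift x₀ x₁) (IntCat.ind_composable _ _ _)
      (IntCat.ind_compAt _ _ _ _) ((congrArg (· ≫ (IntCat.ind X).ident)
        (lift_snd x₀ x₁)).trans (comp_ind_ident x₁))
    -- The unit law is stated at the target of the arrow `(x₀, x₁)`, the axiom of the small category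
    -- at the point `x₁`.
    have e₁ : L.one (lift x₀ x₁ ≫ (IntCat.ind X).tgt) (lift x₁ x₁) ((congrArg (· ≫ (IntCat.ind X).ident)
        (lift_snd x₀ x₁)).trans (comp_ind_ident x₁)) = L.one x₁ (lift x₁ x₁) (comp_ind_ident x₁) :=
      Fam.hom_ext (L.one_val_congr _ _ (lift_snd x₀ x₁))
    refine Eq.trans ?_ ((congrArg (fun t => (t ▷ V.tenAt L.ten (lift x₀ x₁)) ≫ L.mulAt₃ x₀ x₁ x₁) e₁.symm).trans e)
    exact congrArg₂ (fun a b => (a ▷ V.tenAt L.ten (lift x₀ x₁)) ≫ b) (L.ext_idAt x₁)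
      (L.ext_compAt x₀ x₁ x₁)
  comp_ident {Z} x₀ x₁ := by
    have e := L.mul_one (lift x₀ x₁) (lift x₀ x₀) (IntCat.ind_composable _ _ _)
      (IntCat.ind_compAt _ _ _ _) ((congrArg (· ≫ (IntCat.ind X).ident)
        (lift_fst x₀ x₁)).trans (comp_ind_ident x₀))
    have e₁ : L.one (lift x₀ x₁ ≫ (IntCat.ind X).src) (lift x₀ x₀) ((congrArg (· ≫ (IntCat.ind X).ident)
        (lift_fst x₀ x₁)).trans (comp_ind_ident x₀)) = L.one x₀ (lift x₀ x₀) (comp_ind_ident x₀) :=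
      Fam.hom_ext (L.one_val_congr _ _ (lift_fst x₀ x₁))
    refine Eq.trans ?_ ((congrArg (fun t => (V.tenAt L.ten (lift x₀ x₁) ◁ t) ≫ L.mulAt₃ x₀ x₀ x₁) e₁.symm).trans e)
    exact congrArg₂ (fun a b => (V.tenAt L.ten (lift x₀ x₁) ◁ a) ≫ b) (L.ext_idAt x₀)
      (L.ext_compAt x₀ x₀ x₁)
  comp_assoc {Z} x₀ x₁ x₂ x₃ := by
    -- Composition is written in the order of `g ∘ f`, so the first factor is the last arrow of the
    -- path.
    have e := L.mul_assoc (lift x₂ x₃) (lift x₁ x₂) (lift x₀ x₁) (lift x₁ x₃) (lift x₀ x₂)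
      (lift x₀ x₃) (IntCat.ind_composable _ _ _) (IntCat.ind_composable _ _ _)
      (IntCat.ind_composable _ _ _) (IntCat.ind_composable _ _ _) (IntCat.ind_compAt _ _ _ _)
      (IntCat.ind_compAt _ _ _ _) (IntCat.ind_compAt _ _ _ _) (IntCat.ind_compAt _ _ _ _)
    refine Eq.trans ?_ (e.trans ?_)
    · exact congrArg₂ (fun a b => (a ▷ V.tenAt L.ten (lift x₀ x₁)) ≫ b) (L.ext_compAt x₁ x₂ x₃)
        (L.ext_compAt x₀ x₁ x₃)
    · exact congrArg₂ (fun a b => (α_ _ _ _).hom ≫ (V.tenAt L.ten (lift x₂ x₃) ◁ a) ≫ b)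
        (L.ext_compAt x₀ x₁ x₂).symm (L.ext_compAt x₀ x₂ x₃).symm

end LaxTensor

end Externalization

/-! ### Lax structures and their morphisms from small categories and functors -/

section Externalization

variable {E : Type u} [Category.{v} E] [CartesianMonoidalCategory E] [HasPullbacks E]
  {V : IntMonCat E} {W W' : E}

theorem IntCat.ind_exists_lift {X : E} (l : W ⟶ (IntCat.ind X).edge) :
    ∃ x₀ x₁ : W ⟶ X, l = lift x₀ x₁ :=
  ⟨l ≫ fst X X, l ≫ snd X X, CartesianMonoidalCategory.hom_ext _ _ (lift_fst _ _).symm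
    (lift_snd _ _).symm⟩

theorem IntCat.ind_middle_eq {X : E} {x₀ x₁ y₀ y₁ : W ⟶ X}
    (h : lift y₀ y₁ ≫ (IntCat.ind X).src = lift x₀ x₁ ≫ (IntCat.ind X).tgt) : y₀ = x₁ :=
  (lift_fst y₀ y₁).symm.trans (h.trans (lift_snd x₀ x₁))

theorem IntCat.lift_indMap {X Y : E} (f : X ⟶ Y) (x₀ x₁ : W ⟶ X) :
    lift x₀ x₁ ≫ (IntCat.indMap f).e = lift (x₀ ≫ f) (x₁ ≫ f) :=
  lift_map x₀ x₁ f f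

namespace SmallCat

variable (C : SmallCat V.Ext)

/-- The family of hom objects, as a morphism of graphs. -/
noncomputable def indTen : (IntCat.ind C.X).toIntGraph ⟶ bouquet V.vert :=
  bouquetLift (Fam.val (A := V.toIntCat) C.hom)

/-- The composition at generalized elements. -/
noncomputable def mulAt₃ (x₀ x₁ x₂ : W ⟶ C.X) :
    V.tenAt C.indTen (lift x₁ x₂) ⊗ V.tenAt C.indTen (lift x₀ x₁) ⟶
      V.tenAt C.indTen (lift x₀ x₂) :=
  V.Ext.compAt C.comp x₀ x₁ x₂

/-- The identities at generalized elements. -/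
noncomputable def oneAt (x : W ⟶ C.X) :
    𝟙_ (Fam V.toIntCat W) ⟶ V.tenAt C.indTen (lift x x) := V.Ext.idAt C.ident x

theorem mulAt₃_val (x₀ x₁ x₂ : W ⟶ C.X) :
    (C.mulAt₃ x₀ x₁ x₂).val = lift x₀ (lift x₁ x₂) ≫ Fam.Hom.val C.comp :=
  IntMonCat.ext_compAt_val (H := C.hom) C.comp x₀ x₁ x₂

theorem oneAt_val (x : W ⟶ C.X) : (C.oneAt x).val = x ≫ Fam.Hom.val C.ident :=
  IntMonCat.ext_idAt_val (H := C.hom) C.ident x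

/-- Arrows of an indiscrete category are pairs of points, and composability identifies the two
middle points. -/
theorem exists_mulAt₃ (l m n : W ⟶ (IntCat.ind C.X).edge)
    (h : l ≫ (IntCat.ind C.X).src = m ≫ (IntCat.ind C.X).tgt)
    (hn : (IntCat.ind C.X).compAt l m h = n) :
    ∃ x₀ x₁ x₂ : W ⟶ C.X, l = lift x₁ x₂ ∧ m = lift x₀ x₁ ∧ n = lift x₀ x₂ := by
  obtain ⟨x₀, x₁, rfl⟩ := IntCat.ind_exists_lift m
  obtain ⟨y, x₂, rfl⟩ := IntCat.ind_exists_lift l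
  obtain rfl := IntCat.ind_middle_eq h
  exact ⟨x₀, _, x₂, rfl, rfl, hn.symm.trans (IntCat.ind_compAt _ _ _ _)⟩

/-- The composition for composable arrows of the indiscrete category. -/
noncomputable def laxMul (l m n : W ⟶ (IntCat.ind C.X).edge)
    (h : l ≫ (IntCat.ind C.X).src = m ≫ (IntCat.ind C.X).tgt)
    (hn : (IntCat.ind C.X).compAt l m h = n) :
    V.tenAt C.indTen l ⊗ V.tenAt C.indTen m ⟶ V.tenAt C.indTen n where
  -- The formula extracts the triple from `m` and `l` without choosing points: the source of `m` is
  -- `x₀`, and `l` is `(x₁, x₂)`. The points are used only to check source and target.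
  val := lift (m ≫ fst C.X C.X) l ≫ Fam.Hom.val C.comp
  src_eq := by
    obtain ⟨x₀, x₁, x₂, rfl, rfl, rfl⟩ := C.exists_mulAt₃ l m n h hn
    refine Eq.trans ?_ (C.mulAt₃ x₀ x₁ x₂).src_eq
    exact congrArg (· ≫ V.src) ((congrArg (fun t => lift t (lift x₁ x₂) ≫ Fam.Hom.val C.comp)
      (lift_fst x₀ x₁)).trans (C.mulAt₃_val x₀ x₁ x₂).symm)
  tgt_eq := by
    obtain ⟨x₀, x₁, x₂, rfl, rfl, rfl⟩ := C.exists_mulAt₃ l m n h hn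
    refine Eq.trans ?_ (C.mulAt₃ x₀ x₁ x₂).tgt_eq
    exact congrArg (· ≫ V.tgt) ((congrArg (fun t => lift t (lift x₁ x₂) ≫ Fam.Hom.val C.comp)
      (lift_fst x₀ x₁)).trans (C.mulAt₃_val x₀ x₁ x₂).symm)

theorem laxMul_lift (x₀ x₁ x₂ : W ⟶ C.X) (h) (hn) :
    C.laxMul (lift x₁ x₂) (lift x₀ x₁) (lift x₀ x₂) h hn = C.mulAt₃ x₀ x₁ x₂ :=
  Fam.hom_ext ((congrArg (fun t => lift t (lift x₁ x₂) ≫ Fam.Hom.val C.comp)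
      (lift_fst x₀ x₁)).trans (C.mulAt₃_val x₀ x₁ x₂).symm)

/-- The identities for identity arrows of the indiscrete category. -/
noncomputable def laxOne (p : W ⟶ (IntCat.ind C.X).vert) (i : W ⟶ (IntCat.ind C.X).edge)
    (hi : p ≫ (IntCat.ind C.X).ident = i) : 𝟙_ (Fam V.toIntCat W) ⟶ V.tenAt C.indTen i where
  val := p ≫ Fam.Hom.val C.ident
  src_eq := (congrArg (· ≫ V.src) (C.oneAt_val p).symm).trans (C.oneAt p).src_eq
  tgt_eq := by
    obtain rfl := hi.symm.trans (comp_ind_ident p)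
    exact (congrArg (· ≫ V.tgt) (C.oneAt_val p).symm).trans (C.oneAt p).tgt_eq

theorem laxOne_lift (x y : W ⟶ C.X) (h : y = x) (hi) : C.laxOne y (lift x x) hi = C.oneAt x := by
  subst h
  exact Fam.hom_ext (C.oneAt_val y).symm

/-- The lax tensor structure on an indiscrete category given by a small category. -/
noncomputable def lax : LaxTensor V (IntCat.ind C.X) where
  ten := C.indTen
  mul := C.laxMul
  one := C.laxOne
  mul_re r l m n h hn l' m' n' h' hn' hl hm := by
    subst hl hm
    refine (assoc _ _ _).symm.trans (congrArg (· ≫ Fam.Hom.val C.comp) ?_)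
    exact (comp_lift _ _ _).trans (congrArg (fun t => lift t (r ≫ l)) (assoc _ _ _).symm)
  one_re r p i hi p' i' hi' hp := by
    subst hp
    exact (assoc _ _ _).symm
  mul_assoc l m n lm mn lmn h₁ h₂ h₃ h₄ e₁ e₂ e₃ e₄ := by
    -- A path of three arrows is replaced by its four points; `y` and `z` end up as the second and
    -- the third.
    obtain ⟨x₀, x₁, rfl⟩ := IntCat.ind_exists_lift n
    obtain ⟨y, x₂, rfl⟩ := IntCat.ind_exists_lift m
    obtain rfl := IntCat.ind_middle_eq h₂
    obtain ⟨z, x₃, rfl⟩ := IntCat.ind_exists_lift l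
    obtain rfl := IntCat.ind_middle_eq h₁
    obtain rfl := e₁.symm.trans (IntCat.ind_compAt _ _ _ _)
    obtain rfl := e₂.symm.trans (IntCat.ind_compAt _ _ _ _)
    obtain rfl := e₃.symm.trans (IntCat.ind_compAt _ _ _ _)
    have e := C.comp_assoc x₀ y z x₃
    refine Eq.trans ?_ (Eq.trans e ?_)
    · exact congrArg₂ (fun a b => (a ▷ V.tenAt C.indTen (lift x₀ y)) ≫ b)
        (C.laxMul_lift y z x₃ h₁ e₁) (C.laxMul_lift x₀ y x₃ h₃ e₃)
    · exact congrArg₂ (fun a b => (α_ _ _ _).hom ≫ (V.tenAt C.indTen (lift z x₃) ◁ a) ≫ b)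
        (C.laxMul_lift x₀ y z h₂ e₂).symm (C.laxMul_lift x₀ z x₃ h₄ e₄).symm
  one_mul i l h e hi := by
    obtain ⟨x₀, x₁, rfl⟩ := IntCat.ind_exists_lift l
    obtain rfl := hi.symm.trans ((congrArg (· ≫ (IntCat.ind C.X).ident)
        (lift_snd x₀ x₁)).trans (comp_ind_ident x₁))
    refine Eq.trans ?_ (C.ident_comp x₀ x₁)
    exact congrArg₂ (fun a b => (a ▷ V.tenAt C.indTen (lift x₀ x₁)) ≫ b)
        (C.laxOne_lift x₁ _ (lift_snd x₀ x₁) hi) (C.laxMul_lift x₀ x₁ x₁ h e)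
  mul_one l i h e hi := by
    obtain ⟨x₀, x₁, rfl⟩ := IntCat.ind_exists_lift l
    obtain rfl := hi.symm.trans ((congrArg (· ≫ (IntCat.ind C.X).ident)
        (lift_fst x₀ x₁)).trans (comp_ind_ident x₀))
    refine Eq.trans ?_ (C.comp_ident x₀ x₁)
    exact congrArg₂ (fun a b => (V.tenAt C.indTen (lift x₀ x₁) ◁ a) ≫ b)
        (C.laxOne_lift x₀ _ (lift_fst x₀ x₁) hi) (C.laxMul_lift x₀ x₀ x₁ h e)

/-- The types of the unit and the composition depend on the object and the hom family, hence the
heterogeneous equalities; the remaining fields are propositions. -/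
theorem eq_of_ident_comp {X : E} {H : Fam V.toIntCat (X ⊗ X)} {A B : SmallCat V.Ext}
    (hA : A.X = X) (hB : B.X = X) (kA : HEq A.hom H) (kB : HEq B.hom H)
    (hi : HEq A.ident B.ident) (hc : HEq A.comp B.comp) : A = B := by
  obtain ⟨X₁, H₁, i₁, c₁, _, _, _⟩ := A
  obtain ⟨X₂, H₂, i₂, c₂, _, _, _⟩ := B
  dsimp only at hA hB
  subst hA
  obtain rfl : X₂ = X₁ := hB
  obtain rfl := eq_of_heq (kA.trans kB.symm)
  obtain rfl := eq_of_heq hi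
  obtain rfl := eq_of_heq hc
  rfl

/-- Lax tensor structures on indiscrete categories with the multiplication and unit of a small
category give this category. -/
theorem smallCat_eq (L : LaxTensor V (IntCat.ind C.X)) (ht : L.ten.e = C.indTen.e)
    (hi : L.indOne.val = Fam.Hom.val C.ident) (hc : L.indMul.val = Fam.Hom.val C.comp) :
    L.smallCat = C := by
  have hH : (⟨L.ten.e⟩ : Fam V.toIntCat (C.X ⊗ C.X)) = C.hom := Fam.ext ht
  -- The hom families agree by an equality that is not definitional. With both families as variables
  -- it can be eliminated, after which equal underlying arrows give equal morphisms.
  have k : ∀ (H H' : Fam V.toIntCat (C.X ⊗ C.X)) (_ : H = H')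
      (i : 𝟙_ (Fam V.toIntCat C.X) ⟶ (Fam.re V.toIntCat (lift (𝟙 C.X) (𝟙 C.X))).obj H)
      (i' : 𝟙_ (Fam V.toIntCat C.X) ⟶ (Fam.re V.toIntCat (lift (𝟙 C.X) (𝟙 C.X))).obj H')
      (_ : i.val = i'.val), HEq i i' := by
    rintro H _ rfl i i' hi
    exact heq_of_eq (Fam.hom_ext hi)
  have k' : ∀ (H H' : Fam V.toIntCat (C.X ⊗ C.X)) (_ : H = H')
      (c : (Fam.re V.toIntCat (snd C.X (C.X ⊗ C.X))).obj H ⊗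
        (Fam.re V.toIntCat (lift (fst C.X (C.X ⊗ C.X)) (snd C.X (C.X ⊗ C.X) ≫ fst C.X C.X))).obj H
        ⟶ (Fam.re V.toIntCat
          (lift (fst C.X (C.X ⊗ C.X)) (snd C.X (C.X ⊗ C.X) ≫ snd C.X C.X))).obj H)
      (c' : (Fam.re V.toIntCat (snd C.X (C.X ⊗ C.X))).obj H' ⊗
        (Fam.re V.toIntCat (lift (fst C.X (C.X ⊗ C.X)) (snd C.X (C.X ⊗ C.X) ≫ fst C.X C.X))).obj H'
        ⟶ (Fam.re V.toIntCat
          (lift (fst C.X (C.X ⊗ C.X)) (snd C.X (C.X ⊗ C.X) ≫ snd C.X C.X))).obj H')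
      (_ : c.val = c'.val), HEq c c' := by
    rintro H _ rfl c c' hc
    exact heq_of_eq (Fam.hom_ext hc)
  exact eq_of_ident_comp (H := C.hom) rfl rfl (heq_of_eq hH) HEq.rfl
    (k _ C.hom hH _ C.ident hi) (k' _ C.hom hH _ C.comp hc)

theorem hom_eq {A B : SmallCat V.Ext} {F G : A ⟶ B} (h : SmallCat.Hom.obj F = SmallCat.Hom.obj G)
    (h' : Fam.Hom.val (SmallCat.Hom.map F) = Fam.Hom.val (SmallCat.Hom.map G)) : F = G := by
  obtain ⟨f, m, _, _⟩ := F
  obtain ⟨g, n, _, _⟩ := G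
  obtain rfl : f = g := h
  obtain rfl : m = n := Fam.hom_ext h'
  rfl

end SmallCat

namespace LaxTensor

section

variable {X Y : E} {L : LaxTensor V (IntCat.ind X)} {L' : LaxTensor V (IntCat.ind Y)} {f : X ⟶ Y}

/-- The component of a morphism of lax tensor structures at the generic arrow. -/
noncomputable def Hom.generic (Φ : Hom L L' (IntCat.indMap f)) :
    (⟨L.ten.e⟩ : Fam V.toIntCat (X ⊗ X)) ⟶
      (Fam.re V.toIntCat (f ⊗ₘ f)).obj (⟨L'.ten.e⟩ : Fam V.toIntCat (Y ⊗ Y)) :=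
  ⟨Φ.app, Φ.app_src, Φ.app_tgt⟩

/-- The functor of small categories given by a morphism of lax tensor structures. -/
noncomputable def Hom.smallHom (Φ : Hom L L' (IntCat.indMap f)) : L.smallCat ⟶ L'.smallCat where
  obj := f
  map := Φ.generic
  map_ident x := by
    -- The reindexed generic morphism `mapAt` is supplied as the component, its underlying arrow
    -- being the required one.
    have e := Φ.map_one x (lift x x) (comp_ind_ident x) (x ≫ f) (lift (x ≫ f) (x ≫ f))
      (comp_ind_ident _) rfl (SmallCat.mapAt (A := L.smallCat) (B := L'.smallCat) Φ.generic rfl rfl)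
      (IntMonCat.ext_mapAt_val (A := L.smallCat) (B := L'.smallCat) Φ.generic rfl rfl)
    refine (Eq.trans ?_ e).trans (L'.ext_idAt (x ≫ f)).symm
    exact congrArg (· ≫ _) (L.ext_idAt x)
  map_comp x₀ x₁ x₂ := by
    have e := Φ.map_mul (lift x₁ x₂) (lift x₀ x₁) (lift x₀ x₂) (IntCat.ind_composable _ _ _)
      (IntCat.ind_compAt _ _ _ _) (lift (x₁ ≫ f) (x₂ ≫ f)) (lift (x₀ ≫ f) (x₁ ≫ f))
      (lift (x₀ ≫ f) (x₂ ≫ f)) (IntCat.ind_composable _ _ _) (IntCat.ind_compAt _ _ _ _)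
      (IntCat.lift_indMap _ _ _) (IntCat.lift_indMap _ _ _)
      (SmallCat.mapAt (A := L.smallCat) (B := L'.smallCat) Φ.generic rfl rfl)
      (SmallCat.mapAt (A := L.smallCat) (B := L'.smallCat) Φ.generic rfl rfl)
      (SmallCat.mapAt (A := L.smallCat) (B := L'.smallCat) Φ.generic rfl rfl)
      (IntMonCat.ext_mapAt_val (A := L.smallCat) (B := L'.smallCat) Φ.generic rfl rfl)
      (IntMonCat.ext_mapAt_val (A := L.smallCat) (B := L'.smallCat) Φ.generic rfl rfl)
      (IntMonCat.ext_mapAt_val (A := L.smallCat) (B := L'.smallCat) Φ.generic rfl rfl)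
    refine (Eq.trans ?_ e).trans ?_
    · exact congrArg (· ≫ _) (L.ext_compAt x₀ x₁ x₂)
    · exact congrArg (_ ≫ ·) (L'.ext_compAt (x₀ ≫ f) (x₁ ≫ f) (x₂ ≫ f)).symm

end

section

variable {X Y : E} {L : LaxTensor V (IntCat.ind X)} {L' : LaxTensor V (IntCat.ind Y)}
  (F : SmallCat.Hom L.smallCat L'.smallCat)

/-- The components of a functor of small categories. -/
noncomputable def homAt (x₀ x₁ : W ⟶ X) : V.tenAt L.ten (lift x₀ x₁) ⟶
    V.tenAt L'.ten (lift (x₀ ≫ F.obj) (x₁ ≫ F.obj)) :=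
  SmallCat.mapAt (A := L.smallCat) (B := L'.smallCat) F.map rfl rfl

theorem homAt_val (x₀ x₁ : W ⟶ X) : (homAt F x₀ x₁).val = lift x₀ x₁ ≫ Fam.Hom.val F.map :=
  IntMonCat.ext_mapAt_val (A := L.smallCat) (B := L'.smallCat) F.map rfl rfl

/-- The morphism of lax tensor structures given by a functor of small categories. -/
noncomputable def ofSmallHom : Hom L L' (IntCat.indMap F.obj) where
  app := Fam.Hom.val F.map
  app_src := Fam.Hom.src_eq (A := V.toIntCat) F.map
  app_tgt := Fam.Hom.tgt_eq (A := V.toIntCat) F.map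
  map_mul l m n h hn l' m' n' h' hn' hl hm φ ψ χ hφ hψ hχ := by
    obtain ⟨x₀, x₁, rfl⟩ := IntCat.ind_exists_lift m
    obtain ⟨y, x₂, rfl⟩ := IntCat.ind_exists_lift l
    obtain rfl := IntCat.ind_middle_eq h
    obtain rfl := hn.symm.trans (IntCat.ind_compAt _ _ _ _)
    obtain rfl := hl.symm.trans (IntCat.lift_indMap _ _ _)
    obtain rfl := hm.symm.trans (IntCat.lift_indMap _ _ _)
    obtain rfl := hn'.symm.trans (IntCat.ind_compAt _ _ _ _)
    -- The prescribed underlying arrows leave no choice for the components: they are those of `F` at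
    -- the points found above.
    obtain rfl : φ = homAt F y x₂ := Fam.hom_ext (hφ.trans (homAt_val F y x₂).symm)
    obtain rfl : ψ = homAt F x₀ y := Fam.hom_ext (hψ.trans (homAt_val F x₀ y).symm)
    obtain rfl : χ = homAt F x₀ x₂ := Fam.hom_ext (hχ.trans (homAt_val F x₀ x₂).symm)
    refine Eq.trans ?_ ((F.map_comp x₀ y x₂).trans ?_)
    · exact congrArg (· ≫ _) (L.ext_compAt x₀ y x₂).symm
    · exact congrArg (_ ≫ ·) (L'.ext_compAt (x₀ ≫ F.obj) (y ≫ F.obj) (x₂ ≫ F.obj))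
  map_one p i hi p' i' hi' hp χ hχ := by
    obtain rfl := hp
    obtain rfl := hi.symm.trans (comp_ind_ident p)
    obtain rfl := hi'.symm.trans (comp_ind_ident _)
    obtain rfl : χ = homAt F p p := Fam.hom_ext (hχ.trans (homAt_val F p p).symm)
    refine Eq.trans ?_ ((F.map_ident p).trans (L'.ext_idAt _))
    exact congrArg (· ≫ _) (L.ext_idAt p).symm

end

end LaxTensor

end Externalization

/-! ### The equivalence -/

section Equivalence

variable {E : Type u} [Category.{v} E] [CartesianMonoidalCategory E] [HasPullbacks E]
  {V : IntMonCat E} {Fr : IntGraph E ⥤ IntCat E} {adj : Fr ⊣ IntCat.forget E}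

namespace IteratedTensor

theorem multicat_compAt (I : IteratedTensor V (listCat V adj) (single V adj)) {G : IntGraph E}
    (c : G ⟶ I.ops) (d : G ⟶ adj.toMonad.obj I.ops)
    (h : c ≫ I.mSrc = d ≫ adj.toMonad.map I.opsTgt) :
    I.multicat.compAt c d h = I.opsComp c d h := I.lift_opsComp c d h

variable {I : IteratedTensor V (listCat V adj) (single V adj)}

/-- The source map of the multicategory of an algebra is an identity, so the composite is the
concatenation of the second member of the pair. -/
theorem indMulticat_compAt {X : E} {G : IntGraph E}
    (c : G ⟶ (indMulticat adj X).C₁) (d : G ⟶ adj.toMonad.obj (indMulticat adj X).C₁) (h) :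
    (indMulticat adj X).compAt c d h = d ≫ adj.toMonad.μ.app (indAlgebra adj X).A :=
  (assoc _ _ _).symm.trans (congrArg (· ≫ adj.toMonad.μ.app (indAlgebra adj X).A)
    (pullback.lift_snd _ _ _))

/-- The functor of multicategories underlying an enriched multicategory. -/
noncomputable def enrichedOps (A : EnrichedMulticat I.multicat) : I.AlgOps (IntCat.ind A.X) where
  ten := A.map.f₀
  ops := A.map.f₁
  ops_src := A.m₁_src
  ops_tgt := A.m₁_tgt
  unit_ops := A.map.map_ident
  mul_ops := by
    -- The generic composable pair of `Ind⁺(X)`: a path of paths, as second member, together with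
    -- its path of composites. Functoriality at this pair is multiplicativity.
    have h : adj.toMonad.map (indAlgebra adj A.X).a ≫ (indMulticat adj A.X).src =
        𝟙 _ ≫ adj.toMonad.map (indMulticat adj A.X).tgt := (comp_id _).trans (id_comp _).symm
    have hs : A.map.f₁ ≫ I.mSrc = adj.toMonad.map A.map.f₀ := A.m₁_src
    have k := I.listComp_composable (D := IntCat.ind A.X) hs A.m₁_tgt
    have h' : (adj.toMonad.map (indAlgebra adj A.X).a ≫ A.map.f₁) ≫ I.multicat.src =
        (𝟙 _ ≫ adj.toMonad.map A.map.f₁) ≫ adj.toMonad.map I.multicat.tgt :=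
      k.trans (congrArg (· ≫ _) (id_comp _).symm)
    have e := A.map.map_comp (adj.toMonad.map (indAlgebra adj A.X).a) (𝟙 _) h h'
    have e₁ := indMulticat_compAt (adj.toMonad.map (indAlgebra adj A.X).a) (𝟙 _) h
    refine (congrArg (· ≫ A.map.f₁) (e₁.trans (id_comp _)).symm).trans (e.trans ?_)
    exact (I.multicat_compAt _ _ h').trans (I.opsComp_congr rfl (id_comp _) h' k)

/-- The enriched multicategory given by a functor of multicategories. -/
noncomputable def enrichedOfOps {X : E} (O : I.AlgOps (IntCat.ind X)) :
    EnrichedMulticat I.multicat where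
  X := X
  map :=
    { f₀ := O.ten
      f₁ := O.ops
      src_comm := O.ops_src.trans (id_comp _).symm
      tgt_comm := O.ops_tgt
      map_ident := O.unit_ops
      map_comp := fun {W} c d h h' => by
        -- Any composable pair is obtained from the generic one by reindexing along `d`, because its
        -- first member is forced to be the path of composites of `d`.
        have h₀ : c = d ≫ adj.toMonad.map (indAlgebra adj X).a := (comp_id c).symm.trans h
        have e := congrArg (d ≫ ·) O.mul_ops
        have k : (d ≫ adj.toMonad.map (listComp adj (IntCat.ind X)) ≫ O.ops) ≫ I.mSrc =
            (d ≫ adj.toMonad.map O.ops) ≫ adj.toMonad.map I.opsTgt :=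
          (assoc _ _ _).trans ((congrArg (d ≫ ·)
            (I.listComp_composable O.ops_src O.ops_tgt)).trans (assoc _ _ _).symm)
        refine (congrArg (· ≫ O.ops) (indMulticat_compAt c d h)).trans ((assoc _ _ _).trans
          (e.trans ((I.pre_opsComp _ _ _ _ k).trans ?_)))
        refine (I.opsComp_congr ?_ rfl k h').trans (I.multicat_compAt _ _ h').symm
        exact (assoc _ _ _).symm.trans (congrArg (· ≫ O.ops) h₀.symm) }

section

variable {A B : EnrichedMulticat I.multicat}

/-- The transformation underlying a functor of enriched multicategories. -/
noncomputable def enrichedHomOps (F : EnrichedMulticat.Hom A B) :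
    AlgOps.Hom (enrichedOps A) (enrichedOps B) (IntCat.indMap F.f₀) where
  ops := F.f₁
  ops_src := F.src_eq
  ops_tgt := F.tgt_eq
  natural := (I.multicat_compAt _ _ _).symm.trans (F.natural.trans (I.multicat_compAt _ _ _))

/-- The functor of enriched multicategories given by a transformation. -/
noncomputable def enrichedHomOfOps {f : A.X ⟶ B.X}
    (F : AlgOps.Hom (enrichedOps A) (enrichedOps B) (IntCat.indMap f)) :
    EnrichedMulticat.Hom A B where
  f₀ := f
  f₁ := F.ops
  src_eq := F.ops_src
  tgt_eq := F.ops_tgt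
  natural := (I.multicat_compAt _ _ _).trans (F.natural.trans (I.multicat_compAt _ _ _).symm)

end

variable (I) in
/-- The functor that sends an enriched multicategory to the small category with the same hom
objects. -/
noncomputable def toSmallCat : EnrichedMulticat I.multicat ⥤ SmallCat V.Ext where
  obj A := (enrichedOps A).toLax.smallCat
  map F := (enrichedHomOps F).toLax.smallHom
  map_id A := by
    refine SmallCat.hom_eq rfl ?_
    let H : Fam V.toIntCat (A.X ⊗ A.X) := ⟨(enrichedOps A).ten.e⟩
    have e : ((Fam.re V.toIntCat (𝟙 (A.X ⊗ A.X))).obj H) =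
      (Fam.re V.toIntCat (𝟙 A.X ⊗ₘ 𝟙 A.X)).obj H := by rw [id_tensorHom_id]
    -- The identity functor of an enriched multicategory carries the identities of the hom objects.
    -- On the side of small categories the identity carries an isomorphism that also has identities
    -- as underlying arrow.
    refine ((assoc _ _ _).trans (congrArg ((enrichedOps A).ten.e ≫ ·) I.opsIdent_arr)).trans ?_
    refine Eq.trans ?_ (congrArg (fun k => Fam.Hom.val ((Fam.eqIso (V.re_id_val H)).inv ≫ k))
      (V.eqToHom_eq e)).symm
    exact (Fam.comp_eqIso_val (Fam.eqIso (V.re_id_val H)).inv (congrArg Fam.val e)).symm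
  map_comp {A B C} F G := by
    refine SmallCat.hom_eq rfl ?_
    let H : Fam V.toIntCat (C.X ⊗ C.X) := ⟨(enrichedOps C).ten.e⟩
    let m := (enrichedHomOps F).toLax.generic
    let n := (enrichedHomOps G).toLax.generic
    have h : (F.f₀ ⊗ₘ F.f₀) ≫ (G.f₀ ⊗ₘ G.f₀) = (F.f₀ ≫ G.f₀) ⊗ₘ (F.f₀ ≫ G.f₀) := by simp
    have e := IntMonCat.ext_reObj_hom _ _ _ h H (IntMonCat.re_re_val h H)
    refine Eq.trans ?_ (congrArg (fun k => Fam.Hom.val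
      (m ≫ (Fam.re V.toIntCat (F.f₀ ⊗ₘ F.f₀)).map n ≫ k)) e).symm
    refine Eq.trans ?_ (IntMonCat.comp_comp_eqIso_val m _ _).symm
    -- Composing unary operations is composing their arrows in `V`, since the tensor product of a
    -- list with one operation is that operation.
    refine (congrArg (fun x => IntGraph.Hom.e x ≫ I.opsArr) (I.multicat_compAt _ _ _)).trans
      ((I.opsComp_arr _ _ _).trans (V.compAt_congr ?_ ?_ _))
    · exact assoc _ _ _
    · exact (assoc _ _ _).trans (congrArg (F.f₁.e ≫ ·) I.unit_tenArr)

instance : (toSmallCat I).Faithful where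
  map_injective {_ _} F G h := by
    have h₀ : F.f₀ = G.f₀ := congrArg SmallCat.Hom.obj h
    have h₁ : F.f₁.e ≫ I.opsArr = G.f₁.e ≫ I.opsArr := by
      have : ∀ {A B : SmallCat V.Ext} (P Q : A ⟶ B), P = Q →
          Fam.Hom.val P.map = Fam.Hom.val Q.map := by
        rintro _ _ P _ rfl
        rfl
      exact this _ _ h
    -- An operation is a list of inputs with an arrow of `V`. The inputs are the same for both
    -- functors, namely the hom object as a list with one entry, so the arrow of `V` decides.
    exact EnrichedMulticat.Hom.ext h₀ (I.mops_ext (F.src_eq.trans G.src_eq.symm) h₁)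

instance : (toSmallCat I).Full where
  map_surjective {_ _} H :=
    -- The preimage has the components of `H` as unary operations; naturality at paths of every
    -- length is provided by `ofLaxHom`.
    ⟨enrichedHomOfOps (AlgOps.ofLaxHom (LaxTensor.ofSmallHom H)),
      SmallCat.hom_eq rfl (AlgOps.laxOps_arr (LaxTensor.ofSmallHom H))⟩

/-- The unit and the multiplication of the generated operations are those of `C.lax`, and at the
generic points these are the unit and the composition of `C`. The small category is thus recovered
exactly and not only up to isomorphism. -/
theorem toSmallCat_obj_lax (C : SmallCat V.Ext) :
    (toSmallCat I).obj (enrichedOfOps (I.ofLax C.lax)) = C := by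
  refine C.smallCat_eq _ rfl ?_ ?_
  · exact (congrArg Fam.Hom.val (I.ofLax_one C.lax _ _ (id_comp _))).trans (id_comp _)
  · refine (congrArg Fam.Hom.val (I.ofLax_mul C.lax _ _ _ _
      (IntCat.ind_compAt_generic _))).trans ?_
    -- The triple that the generic composable pair defines is the identity of `X × (X × X)`.
    refine (congrArg (· ≫ Fam.Hom.val C.comp) ?_).trans (id_comp _)
    refine CartesianMonoidalCategory.hom_ext _ _ ?_ ?_
    · exact (lift_fst _ _).trans ((lift_fst _ _).trans (id_comp _).symm)
    · exact (lift_snd _ _).trans (id_comp _).symm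

instance : (toSmallCat I).EssSurj where
  mem_essImage C := ⟨enrichedOfOps (I.ofLax C.lax), ⟨eqToIso (toSmallCat_obj_lax C)⟩⟩

instance : (toSmallCat I).IsEquivalence where

end IteratedTensor

end Equivalence

theorem mainTheorem4 {E : Type u} [Category.{v} E] [CartesianMonoidalCategory E] [HasPullbacks E]
    (Fr : IntGraph E ⥤ IntCat E) (adj : Fr ⊣ IntCat.forget E) (V : IntMonCat E)
    (I : IteratedTensor V (listCat V adj) (single V adj)) :
    Nonempty (EnrichedMulticat I.multicat ≌ SmallCat V.Ext) :=
  ⟨(IteratedTensor.toSmallCat I).asEquivalence⟩
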